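/- **Setting.** Let $\Bbbk=\mathbb{C}(q^{1/2})$ with $q^{1/2}$ a formal variable, $[m]=\frac{q^m-q^{-m}}{q-q^{-1}}$. Let $n\ge 4$, $\epsilon=(\epsilon_1,\dots,\epsilon_n)\in\{0,1\}^n$, $q_i=(-1)^{\epsilon_i}q^{(-1)^{\epsilon_i}}$, $P=\bigoplus_{i=1}^n\mathbb{Z}\delta_i$ with $(\delta_i|\delta_j)=(-1)^{\epsilon_i}\delta_{ij}$, and $\mathbf{q}(\mu,\nu)=\prod_i q_i^{\mu_i\nu_i}$ for $\mu,\nu\in P$. Let $X\in\{C,D\}$, $I=\{0,1,\dots,n-1\}$, $\alpha_i=\delta_i-\delta_{i+1}$ for $i\neq 0$, and $\alpha_0=-2\delta_1$ if $X=C$, $\alpha_0=-\delta_1-\delta_2$ if $X=D$. **The algebra $\mathcal{U}_X(\epsilon)$** is the $\Bbbk$-algebra with generators $e_i,f_i$ ($i\in I$), $k_\mu$ ($\mu\in P$); put $k_i=k_{\alpha_i}$, $[u,v]_t=uv-tvu$, $[u,v]=[u,v]_1$. The relations are $k_0=1$ (for $\mu=0\in P$), $k_{\mu+\mu'}=k_\mu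 k_{\mu'}$, $k_\mu e_ik_{-\mu}=\mathbf{q}(\mu,\alpha_i)e_i$, $k_\mu f_ik_{-\mu}=\mathbf{q}(\mu,\alpha_i)^{-1}f_i$, $e_if_j-f_je_i=\delta_{ij}\frac{k_i-k_i^{-1}}{q-q^{-1}}$ (with $q^2-q^{-2}$ as denominator if $X=C$ and $i=j=0$), and the following ones for $x=e$ and for $x=f$: * $x_ix_j=x_jx_i$ if $(\alpha_i|\alpha_j)=0$, and $x_i^2=0$ if $(\alpha_i|\alpha_i)=0$; * $x_i^2x_j-(-1)^{\epsilon_i}[2]x_ix_jx_i+x_jx_i^2=0$ if $i,j\ne0$, $|i-j|=1$, $\epsilon_i=\epsilon_{i+1}$; * $x_ix_{i-1}x_ix_{i+1}-x_ix_{i+1}x_ix_{i-1}+(-1)^{\epsilon_i}[2]x_ix_{i-1}x_{i+1}x_i-x_{i-1}x_ix_{i+1}x_i+x_{i+1}x_ix_{i-1}x_i=0$ if $2\le i\le n-2$, $\epsilon_i\ne\epsilon_{i+1}$; * for $X=D$: $x_0^2x_2-(-1)^{\epsilon_2}[2]x_0x_2x_0+x_2x_0^2=0$ if $\epsilon_1=\epsilon_2$;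 $x_2^2x_0-(-1)^{\epsilon_2}[2]x_2x_0x_2+x_0x_2^2=0$ if $\epsilon_2=\epsilon_3$; $x_0x_1x_2-x_1x_0x_2+(-1)^{\epsilon_2}[2](x_1x_2x_0-x_0x_2x_1)+x_2x_0x_1-x_2x_1x_0=0$ if $\epsilon_1\ne\epsilon_2$; $x_0x_2x_3x_2-x_3x_2x_0x_2+(-1)^{\epsilon_3}[2]x_2x_3x_0x_2-x_2x_0x_2x_3+x_2x_3x_2x_0=0$ if $\epsilon_2\neq\epsilon_3$; * for $X=C$: $x_0^2x_1-(q^2+q^{-2})x_0x_1x_0+x_1x_0^2=0$; $x_1^3x_0-[3]x_1^2x_0x_1+[3]x_1x_0x_1^2-x_0x_1^3=0$ if $\epsilon_1=\epsilon_2$; $[[[[x_2,x_1]_{q_2},x_0]_{q_1^2},[x_2,x_1]_{q_2}],x_1]=0$ if $\epsilon_1\ne\epsilon_2\ne\epsilon_3$; $[[[[[[x_3,x_2]_{q_3},x_1]_{q_2},x_0]_{q_1^2},x_1]_{q_1},x_2]_{q_2},x_1]=0$ if $\epsilon_1\neq\epsilon_2=\epsilon_3$. The comultiplication is $\Delta(k_\mu)=k_\mu\otimes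 k_\mu$, $\Delta(e_i)=e_i\otimes1+k_i\otimes e_i$, $\Delta(f_i)=f_i\otimes k_i^{-1}+1\otimes f_i$. **The modules.** Let $\mathcal{W}=\mathcal{W}_\epsilon$ have the basis $|\mathbf{m}\rangle$, $\mathbf{m}\in\mathbb{Z}_{\ge0}^n$ with $m_i\le1$ whenever $\epsilon_i=1$, and put $|\mathbf{m}\rangle=0$ for all other $\mathbf{m}\in\mathbb{Z}^n$. Let $\mathbf{e}_i$ be the unit vectors. Put $k_\mu|\mathbf{m}\rangle=q^{\frac12\sum_i\mu_i}\,\mathbf{q}(\mathbf{m},\mu)|\mathbf{m}\rangle$, and for $i\neq0$ put $e_i|\mathbf{m}\rangle=[m_{i+1}]|\mathbf{m}+\mathbf{e}_i-\mathbf{e}_{i+1}\rangle$, $f_i|\mathbf{m}\rangle=[m_i]|\mathbf{m}-\mathbf{e}_i+\mathbf{e}_{i+1}\rangle$. * If $(X,\epsilon_1)=(D,1)$, let $\mathcal{U}_X(\epsilon)$ act on $\mathscr{W}=\mathcal{W}$ with, moreover, $e_0|\mathbf{m}\rangle=[m_2]|\mathbf{m}-\mathbf{e}_1-\mathbf{e}_2\rangle$,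 $f_0|\mathbf{m}\rangle=-|\mathbf{m}+\mathbf{e}_1+\mathbf{e}_2\rangle$. If $(X,\epsilon_1)=(C,0)$, let it act on $\mathscr{W}=\mathcal{W}$ with $e_0|\mathbf{m}\rangle=\frac{[m_1][m_1-1]}{[2]^2}|\mathbf{m}-2\mathbf{e}_1\rangle$, $f_0|\mathbf{m}\rangle=-|\mathbf{m}+2\mathbf{e}_1\rangle$. * If $(X,\epsilon_1)=(D,0)$ or $(C,1)$, let $\mathcal{U}_X(\epsilon)$ act on $\mathscr{W}=\mathcal{W}^{\otimes2}$, where $k_\mu$ and, for $i\ne0$, $e_i$, $f_i$ act as $\Delta(k_\mu)$, $\Delta(e_i)$, $\Delta(f_i)$. For $(D,0)$: $e_0$ sends $|\mathbf{m}\rangle\otimes|\mathbf{m}'\rangle$ to $[m_2][m_1']\,|\mathbf{m}-\mathbf{e}_2\rangle\otimes|\mathbf{m}'-\mathbf{e}_1\rangle-q_1^{-m_1'}q_2^{-m_2}q^{-1}[m_1][m_2']\,|\mathbf{m}-\mathbf{e}_1\rangle\otimes|\mathbf{m}'-\mathbf{e}_2\rangle$, and $f_0$ sends it to $-q_1^{m_1}q_2^{m_2'}q\,|\mathbf{m}+\mathbf{e}_2\rangle\otimes|\mathbf{m}'+\mathbf{e}_1\rangle+|\mathbf{m}+\mathbf{e}_1\rangle\otimes|\mathbf{m}'+\mathbf{e}_2\rangle$.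 For $(C,1)$: $e_0$ sends it to $[m_1][m_1']\,|\mathbf{m}-\mathbf{e}_1\rangle\otimes|\mathbf{m}'-\mathbf{e}_1\rangle$, and $f_0$ sends it to $-|\mathbf{m}+\mathbf{e}_1\rangle\otimes|\mathbf{m}'+\mathbf{e}_1\rangle$. In each case $\mathcal{U}_X(\epsilon)$ acts on $\mathscr{W}^{\otimes\ell}$ through $\Delta$. **The $\imath$quantum groups.** Let $\mathbf{U}(\mathfrak{sl}_r)$ be the Drinfeld–Jimbo quantum group over $\Bbbk$ with generators $\mathsf{e}_i,\mathsf{f}_i,\mathsf{k}_i^{\pm1}$ ($1\le i\le r-1$) and a comultiplication by the same formulas as $\Delta$. Let $T_i=T''_{i,1}$ be Lusztig's automorphisms, so that $T_i(\mathsf{e}_j)=\mathsf{e}_i\mathsf{e}_j-q^{-1}\mathsf{e}_j\mathsf{e}_i$ for $|i-j|=1$. * $\mathbf{U}^\imath(\mathfrak{so}_\ell)$ ($\ell\ge2$), with parameters $\varsigma_i,\kappa_i\in\Bbbk$, is the subalgebra of $\mathbf{U}(\mathfrak{sl}_\ell)$ generated by $\mathsf{B}_i=\mathsf{f}_i+\varsigma_i\mathsf{e}_i\mathsf{k}_i^{-1}+\kappa_i\mathsf{k}_i^{-1}$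 ($i\in\mathsf{I}=\{1,\dots,\ell-1\}$). * $\mathbf{U}^\imath(\mathfrak{sp}_{2\ell})$ ($\ell\ge1$), with parameters $\varsigma_i\in\Bbbk$ ($i\in\mathsf{I}_\circ=\{2,4,\dots,2\ell-2\}$), is the subalgebra of $\mathbf{U}(\mathfrak{sl}_{2\ell})$ generated by $\mathsf{B}_i=\mathsf{f}_i+\varsigma_iT_1T_3\cdots T_{2\ell-1}(\mathsf{e}_i)\mathsf{k}_i^{-1}$ ($i\in\mathsf{I}_\circ$) and $\mathsf{e}_j,\mathsf{f}_j,\mathsf{k}_j^{\pm1}$ ($j=1,3,\dots,2\ell-1$). Let $r=\ell$ if $\mathscr{W}=\mathcal{W}$ and $r=2\ell$ if $\mathscr{W}=\mathcal{W}^{\otimes2}$. Identify the basis vector $|\mathbf{m}_1\rangle\otimes\cdots\otimes|\mathbf{m}_r\rangle$ of $\mathscr{W}^{\otimes\ell}=\mathcal{W}^{\otimes r}$, $\mathbf{m}_s=(m_{s1},\dots,m_{sn})$, with $|\mathbf{m}^1\rangle\otimes\cdots\otimes|\mathbf{m}^n\rangle\in\mathcal{W}'_1\otimes\cdots\otimes\mathcal{W}'_n$,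 where $\mathbf{m}^t=(m_{1t},\dots,m_{rt})$ and $\mathcal{W}'_t=\mathcal{W}_{(\epsilon_t,\dots,\epsilon_t)}$ ($r$ entries). Let $\mathbf{U}(\mathfrak{sl}_r)$ act on each $\mathcal{W}'_t$ by $\mathsf{e}_i|\mathbf{m}\rangle=[m_{i+1}]|\mathbf{m}+\mathbf{e}_i-\mathbf{e}_{i+1}\rangle$, $\mathsf{f}_i|\mathbf{m}\rangle=[m_i]|\mathbf{m}-\mathbf{e}_i+\mathbf{e}_{i+1}\rangle$, $\mathsf{k}_i|\mathbf{m}\rangle=q^{m_i-m_{i+1}}|\mathbf{m}\rangle$, and on $\mathscr{W}^{\otimes\ell}$ through the comultiplication. **Proposition.** 1. Suppose $(X,\epsilon_1)\in\{(D,1),(C,0)\}$, so $\mathscr{W}=\mathcal{W}$, and let $\ell\ge2$. For all $\varsigma_i,\kappa_i\in\Bbbk$, the action of $\mathbf{U}^\imath(\mathfrak{so}_\ell)$ on $\mathscr{W}^{\otimes\ell}$ commutes with that of $\mathcal{U}_X(\epsilon)$ if and only if $\varsigma_i=-q^{-1}$ and $\kappa_i=0$ for all $i\in\mathsf{I}$.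 2. Suppose $(X,\epsilon_1)\in\{(D,0),(C,1)\}$, so $\mathscr{W}=\mathcal{W}^{\otimes2}$, and let $\ell\ge1$. For all $\varsigma_i\in\Bbbk$, the action of $\mathbf{U}^\imath(\mathfrak{sp}_{2\ell})$ on $\mathscr{W}^{\otimes\ell}$ commutes with that of $\mathcal{U}_X(\epsilon)$ if and only if $\varsigma_i=-q$ for all $i\in\mathsf{I}_\circ$. -/

import Mathlib

set_option linter.unusedSimpArgs false

open scoped TensorProduct

noncomputable section

namespace FockDuality

/-! ## The ground field -/

/-- The ground field `ℂ(q^{1/2})`, with `q^{1/2}` a formal variable. -/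
def 𝕂 : Type := RatFunc ℂ

instance : Field 𝕂 := inferInstanceAs (Field (RatFunc ℂ))

/-- The formal variable `q^{1/2}`. -/
def qHalf : 𝕂 := (RatFunc.X : RatFunc ℂ)

/-- The element `q` of the ground field. -/
def q : 𝕂 := qHalf ^ 2

/-- The quantum integer `[m] = (q^m - q^{-m}) / (q - q^{-1})`. -/
def qInt (m : ℤ) : 𝕂 := (q ^ m - q ^ (-m)) / (q - q⁻¹)

theorem q_ne_zero : q ≠ 0 :=
  pow_ne_zero 2 (M₀ := RatFunc ℂ) RatFunc.X_ne_zero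

theorem q_sub_inv_ne_zero : q - q⁻¹ ≠ 0 := by
  intro h
  have h1 : qHalf ^ 4 = 1 := by
    have h2 : q = q⁻¹ := sub_eq_zero.mp h
    calc qHalf ^ 4 = q * q := by rw [q]; ring
      _ = q * q⁻¹ := by rw [← h2]
      _ = 1 := mul_inv_cancel₀ q_ne_zero
  have h3 : (algebraMap (Polynomial ℂ) (RatFunc ℂ)) (Polynomial.X ^ 4) =
      algebraMap (Polynomial ℂ) (RatFunc ℂ) 1 := by
    rw [map_pow, map_one, RatFunc.algebraMap_X]
    exact h1
  have h4 := RatFunc.algebraMap_injective ℂ h3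
  have h5 := congrArg Polynomial.natDegree h4
  simp at h5

theorem qInt_zero : qInt 0 = 0 := by simp [qInt]

theorem qInt_one : qInt 1 = 1 := by
  simp [qInt, div_self q_sub_inv_ne_zero]

theorem qInt_two : qInt 2 = q + q⁻¹ := by
  have h0 := q_ne_zero
  rw [qInt, div_eq_iff q_sub_inv_ne_zero, zpow_neg]
  norm_cast
  field_simp
  ring

/-! ## The space `𝒲_ε` and its elementary operators -/

/-- `m ∈ ℤ₊ⁿ(ε)`: all entries are nonnegative, and the entries at the places with `ε_t = 1`
are at most one. -/
def IsState {n : ℕ} (ε : Fin n → Fin 2) (m : Fin n → ℤ) : Prop :=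
  ∀ t, 0 ≤ m t ∧ (ε t = 1 → m t ≤ 1)

/-- The index set `ℤ₊ⁿ(ε)`. -/
abbrev State {n : ℕ} (ε : Fin n → Fin 2) : Type := {m : Fin n → ℤ // IsState ε m}

/-- The space `𝒲_ε` with basis `|m⟩`, `m ∈ ℤ₊ⁿ(ε)`. -/
def Fock {n : ℕ} (ε : Fin n → Fin 2) : Type := State ε →₀ 𝕂

instance {n : ℕ} (ε : Fin n → Fin 2) : AddCommGroup (Fock ε) :=
  inferInstanceAs (AddCommGroup (State ε →₀ 𝕂))

instance {n : ℕ} (ε : Fin n → Fin 2) : Module 𝕂 (Fock ε) :=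
  inferInstanceAs (Module 𝕂 (State ε →₀ 𝕂))

/-- The basis of the vectors `|m⟩`, `m ∈ ℤ₊ⁿ(ε)`. -/
def Fock.basis {n : ℕ} (ε : Fin n → Fin 2) : Module.Basis (State ε) 𝕂 (Fock ε) :=
  .ofRepr (LinearEquiv.refl 𝕂 (State ε →₀ 𝕂))

open Classical in
/-- The vector `|m⟩`, with the convention that it is zero if `m ∉ ℤ₊ⁿ(ε)`. -/
def ket {n : ℕ} (ε : Fin n → Fin 2) (m : Fin n → ℤ) : Fock ε :=
  if h : IsState ε m then Fock.basis ε ⟨m, h⟩ else 0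

/-- The operator `|m⟩ ↦ c(m) |m + v⟩` on `𝒲_ε`. -/
def shiftOp {n : ℕ} (ε : Fin n → Fin 2) (c : (Fin n → ℤ) → 𝕂) (v : Fin n → ℤ) :
    Module.End 𝕂 (Fock ε) :=
  (Fock.basis ε).constr 𝕂 fun m : State ε => c m.1 • ket ε (m.1 + v)

/-- The operator `|m⟩ ↦ [m_b] |m + e_a - e_b⟩` on `𝒲_ε`. -/
def move {n : ℕ} (ε : Fin n → Fin 2) (a b : Fin n) : Module.End 𝕂 (Fock ε) :=
  shiftOp ε (fun m => qInt (m b)) (Pi.single a 1 - Pi.single b 1)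

/-! ## Iterated coproducts

For `Δ(e) = e ⊗ 1 + k ⊗ e`, `Δ(f) = f ⊗ k⁻¹ + 1 ⊗ f`, `Δ(k) = k ⊗ k`, the iterated coproducts are
`∑ₛ k ⊗ ⋯ ⊗ k ⊗ e ⊗ 1 ⊗ ⋯ ⊗ 1`, `∑ₛ 1 ⊗ ⋯ ⊗ 1 ⊗ f ⊗ k⁻¹ ⊗ ⋯ ⊗ k⁻¹` and `k ⊗ ⋯ ⊗ k`. -/

/-- The operator on `⨂ₜ M t` that acts as `x` on the factor `s`, as `A t` on the factors `t < s`
and as `B t` on the factors `t > s`. -/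
def site {n : ℕ} {M : Fin n → Type} [∀ t, AddCommGroup (M t)] [∀ t, Module 𝕂 (M t)]
    (A B : Π t, Module.End 𝕂 (M t)) (s : Fin n) (x : Module.End 𝕂 (M s)) :
    Module.End 𝕂 (⨂[𝕂] t, M t) :=
  PiTensorProduct.map (Function.update (fun t => if t < s then A t else B t) s x)

/-- `∑ₛ k ⊗ ⋯ ⊗ k ⊗ e ⊗ 1 ⊗ ⋯ ⊗ 1`, with `e` in the place `s`. -/
def tensE {n : ℕ} {M : Fin n → Type} [∀ t, AddCommGroup (M t)] [∀ t, Module 𝕂 (M t)]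
    (k e : Π t, Module.End 𝕂 (M t)) : Module.End 𝕂 (⨂[𝕂] t, M t) :=
  ∑ s, site k (fun _ => 1) s (e s)

/-- `∑ₛ 1 ⊗ ⋯ ⊗ 1 ⊗ f ⊗ k' ⊗ ⋯ ⊗ k'`, with `f` in the place `s`; here `k'` is the inverse
of `k`. -/
def tensF {n : ℕ} {M : Fin n → Type} [∀ t, AddCommGroup (M t)] [∀ t, Module 𝕂 (M t)]
    (k' f : Π t, Module.End 𝕂 (M t)) : Module.End 𝕂 (⨂[𝕂] t, M t) :=
  ∑ s, site (fun _ => 1) k' s (f s)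

/-! ## The generalized quantum group `𝒰_X(ε)`

Coordinates and nodes are both indexed by `Fin n`. The coordinate `t : Fin n` is the place `t + 1`
of `{1, …, n}`, and the node `i : Fin n` is the node `i` of `I = {0, 1, …, n - 1}`; so the node
`i ≠ 0` joins the coordinates `i - 1` and `i`. -/

/-- The two types `C` and `D`. -/
inductive CDType
  | C
  | D

/-- The vector `δ_t` of the lattice `P = ℤⁿ`. -/
def delta {n : ℕ} (t : Fin n) : Fin n → ℤ := Pi.single t 1

/-- The simple roots: `δ_i - δ_{i+1}` for `i ≠ 0`, and for `i = 0` the vector `-2δ_1` in type `C`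
and `-δ_1 - δ_2` in type `D`. -/
def alpha {n : ℕ} [NeZero n] (X : CDType) (i : Fin n) : Fin n → ℤ :=
  if i = 0 then
    match X with
    | .C => -(2 • delta 0)
    | .D => -delta 0 - delta 1
  else delta (i - 1) - delta i

/-- The sign `(-1)^{ε_t}`. -/
def sgn {n : ℕ} (ε : Fin n → Fin 2) (t : Fin n) : ℤ := (-1) ^ (ε t).val

/-- The bilinear form `(δ_s | δ_t) = (-1)^{ε_s} δ_{st}`. -/
def form {n : ℕ} (ε : Fin n → Fin 2) (μ ν : Fin n → ℤ) : ℤ := ∑ t, sgn ε t * μ t * ν t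

/-- The scalar `q_t = (-1)^{ε_t} q^{(-1)^{ε_t}}`. -/
def qPar {n : ℕ} (ε : Fin n → Fin 2) (t : Fin n) : 𝕂 := (sgn ε t : 𝕂) * q ^ sgn ε t

/-- The biadditive function `𝐪(μ, ν) = ∏ₜ q_t^{μ_t ν_t}`. -/
def qForm {n : ℕ} (ε : Fin n → Fin 2) (μ ν : Fin n → ℤ) : 𝕂 := ∏ t, qPar ε t ^ (μ t * ν t)

/-- The generators `e_i`, `f_i` (`i ∈ I`) and `k_μ` (`μ ∈ P`). -/
inductive UGen (n : ℕ)
  | e (i : Fin n)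
  | f (i : Fin n)
  | k (μ : Fin n → ℤ)

/-- The bracket `[u, v]_c = u v - c v u`. -/
def qBracket {A : Type*} [Ring A] [Algebra 𝕂 A] (c : 𝕂) (u v : A) : A := u * v - c • (v * u)

/-- The expressions in `x_0, …, x_{n-1}` which vanish in `𝒰_X(ε)` both for `x = e` and for
`x = f`. -/
inductive SerreExpr {n : ℕ} [NeZero n] (X : CDType) (ε : Fin n → Fin 2) {A : Type*} [Ring A]
    [Algebra 𝕂 A] (x : Fin n → A) : A → Prop
  | comm (i j : Fin n) (h : form ε (alpha X i) (alpha X j) = 0) :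
      SerreExpr X ε x (x i * x j - x j * x i)
  | square (i : Fin n) (h : form ε (alpha X i) (alpha X i) = 0) :
      SerreExpr X ε x (x i * x i)
  | cubic (i j : Fin n) (hi : i ≠ 0) (hj : j ≠ 0)
      (hij : i.val + 1 = j.val ∨ j.val + 1 = i.val) (h : ε (i - 1) = ε i) :
      SerreExpr X ε x
        (x i * x i * x j - ((sgn ε i : 𝕂) * qInt 2) • (x i * x j * x i) + x j * x i * x i)
  | quartic (i : Fin n) (h0 : i.val ≠ 0) (h1 : i.val ≠ 1) (hn : i.val ≠ n - 1)
      (h : ε (i - 1) ≠ ε i) :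
      SerreExpr X ε x
        (x i * x (i - 1) * x i * x (i + 1) - x i * x (i + 1) * x i * x (i - 1)
          + ((sgn ε (i - 1) : 𝕂) * qInt 2) • (x i * x (i - 1) * x (i + 1) * x i)
          - x (i - 1) * x i * x (i + 1) * x i + x (i + 1) * x i * x (i - 1) * x i)
  | D_cubic (hX : X = .D) (h : ε 0 = ε 1) :
      SerreExpr X ε x
        (x 0 * x 0 * x 2 - ((sgn ε 1 : 𝕂) * qInt 2) • (x 0 * x 2 * x 0) + x 2 * x 0 * x 0)
  | D_cubic_two (hX : X = .D) (h : ε 1 = ε 2) :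
      SerreExpr X ε x
        (x 2 * x 2 * x 0 - ((sgn ε 1 : 𝕂) * qInt 2) • (x 2 * x 0 * x 2) + x 0 * x 2 * x 2)
  | D_triangle (hX : X = .D) (h : ε 0 ≠ ε 1) :
      SerreExpr X ε x
        (x 0 * x 1 * x 2 - x 1 * x 0 * x 2
          + ((sgn ε 1 : 𝕂) * qInt 2) • (x 1 * x 2 * x 0 - x 0 * x 2 * x 1)
          + x 2 * x 0 * x 1 - x 2 * x 1 * x 0)
  | D_quartic (hX : X = .D) (h : ε 1 ≠ ε 2) :
      SerreExpr X ε x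
        (x 0 * x 2 * x 3 * x 2 - x 3 * x 2 * x 0 * x 2
          + ((sgn ε 2 : 𝕂) * qInt 2) • (x 2 * x 3 * x 0 * x 2)
          - x 2 * x 0 * x 2 * x 3 + x 2 * x 3 * x 2 * x 0)
  | C_cubic (hX : X = .C) :
      SerreExpr X ε x
        (x 0 * x 0 * x 1 - (q ^ 2 + q⁻¹ ^ 2) • (x 0 * x 1 * x 0) + x 1 * x 0 * x 0)
  | C_quartic (hX : X = .C) (h : ε 0 = ε 1) :
      SerreExpr X ε x
        (x 1 * x 1 * x 1 * x 0 - qInt 3 • (x 1 * x 1 * x 0 * x 1)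
          + qInt 3 • (x 1 * x 0 * x 1 * x 1) - x 0 * x 1 * x 1 * x 1)
  | C_sextic (hX : X = .C) (h : ε 0 ≠ ε 1) (h' : ε 1 ≠ ε 2) :
      SerreExpr X ε x
        (qBracket 1 (qBracket 1
          (qBracket (qPar ε 0 ^ 2) (qBracket (qPar ε 1) (x 2) (x 1)) (x 0))
          (qBracket (qPar ε 1) (x 2) (x 1))) (x 1))
  | C_septic (hX : X = .C) (h : ε 0 ≠ ε 1) (h' : ε 1 = ε 2) :
      SerreExpr X ε x
        (qBracket 1 (qBracket (qPar ε 1) (qBracket (qPar ε 0)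
          (qBracket (qPar ε 0 ^ 2) (qBracket (qPar ε 1)
            (qBracket (qPar ε 2) (x 3) (x 2)) (x 1)) (x 0)) (x 1)) (x 2)) (x 1))

/-- The free generator `e_i`. -/
def UGen.E {n : ℕ} (i : Fin n) : FreeAlgebra 𝕂 (UGen n) := FreeAlgebra.ι 𝕂 (.e i)

/-- The free generator `f_i`. -/
def UGen.F {n : ℕ} (i : Fin n) : FreeAlgebra 𝕂 (UGen n) := FreeAlgebra.ι 𝕂 (.f i)

/-- The free generator `k_μ`. -/
def UGen.K {n : ℕ} (μ : Fin n → ℤ) : FreeAlgebra 𝕂 (UGen n) := FreeAlgebra.ι 𝕂 (.k μ)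

/-- The denominator in the relation for `e_i f_i - f_i e_i`. -/
def efDenom {n : ℕ} [NeZero n] (X : CDType) (i : Fin n) : 𝕂 :=
  match X with
  | .C => if i = 0 then q ^ 2 - q⁻¹ ^ 2 else q - q⁻¹
  | .D => q - q⁻¹

open UGen in
/-- The defining relations of `𝒰_X(ε)`. -/
inductive URel {n : ℕ} [NeZero n] (X : CDType) (ε : Fin n → Fin 2) :
    FreeAlgebra 𝕂 (UGen n) → FreeAlgebra 𝕂 (UGen n) → Prop
  | k_zero : URel X ε (K 0) 1
  | k_add (μ ν : Fin n → ℤ) : URel X ε (K (μ + ν)) (K μ * K ν)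
  | k_e (μ : Fin n → ℤ) (i : Fin n) :
      URel X ε (K μ * E i * K (-μ)) (qForm ε μ (alpha X i) • E i)
  | k_f (μ : Fin n → ℤ) (i : Fin n) :
      URel X ε (K μ * F i * K (-μ)) ((qForm ε μ (alpha X i))⁻¹ • F i)
  | e_f (i j : Fin n) :
      URel X ε (E i * F j - F j * E i)
        (if i = j then (efDenom X i)⁻¹ • (K (alpha X i) - K (-alpha X i)) else 0)
  | e_serre (y : FreeAlgebra 𝕂 (UGen n)) (h : SerreExpr X ε E y) : URel X ε y 0
  | f_serre (y : FreeAlgebra 𝕂 (UGen n)) (h : SerreExpr X ε F y) : URel X ε y 0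

/-- The generalized quantum group `𝒰_X(ε)`. -/
abbrev UX {n : ℕ} [NeZero n] (X : CDType) (ε : Fin n → Fin 2) : Type := RingQuot (URel X ε)

/-- `𝒰_X(ε)` acts on `W` through operators attached to its generators, given as an algebra map
`act` on the free algebra. `ActsAs X ε act u T` says that the element `u` of `𝒰_X(ε)` acts on `W`
as the operator `T`: some polynomial in the generators represents `u`, and evaluates to `T`. -/
def ActsAs {n : ℕ} [NeZero n] (X : CDType) (ε : Fin n → Fin 2) {W : Type} [AddCommGroup W]
    [Module 𝕂 W] (act : FreeAlgebra 𝕂 (UGen n) →ₐ[𝕂] Module.End 𝕂 W) (u : UX X ε)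
    (T : Module.End 𝕂 W) : Prop :=
  ∃ y, RingQuot.mkAlgHom 𝕂 (URel X ε) y = u ∧ act y = T

/-- If the generators `e_i`, `f_i`, `k_μ` of `𝒰_X(ε)` act on `V` by the given operators, these are
the operators by which they act on `V^{⊗ℓ}` through the comultiplication
`Δ(e_i) = e_i ⊗ 1 + k_i ⊗ e_i`, `Δ(f_i) = f_i ⊗ k_i⁻¹ + 1 ⊗ f_i`, `Δ(k_μ) = k_μ ⊗ k_μ`,
where `k_i = k_{α_i}`. -/
def tensorPowerAct {n : ℕ} [NeZero n] (X : CDType) {V : Type} [AddCommGroup V] [Module 𝕂 V]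
    (e f : Fin n → Module.End 𝕂 V) (k : (Fin n → ℤ) → Module.End 𝕂 V) (ℓ : ℕ) :
    FreeAlgebra 𝕂 (UGen n) →ₐ[𝕂] Module.End 𝕂 (⨂[𝕂] _ : Fin ℓ, V) :=
  FreeAlgebra.lift 𝕂 fun g =>
    match g with
    | .e i => tensE (fun _ => k (alpha X i)) (fun _ => e i)
    | .f i => tensF (fun _ => k (-alpha X i)) (fun _ => f i)
    | .k μ => PiTensorProduct.map fun _ => k μ

/-! ## The `q`-oscillator module `𝒲` -/

/-- `k_μ |m⟩ = q^{(Λ|μ)/2} 𝐪(m, μ) |m⟩` with `Λ = ∑ₜ (-1)^{ε_t} δ_t`, so `(Λ|μ) = ∑ₜ μ_t`. In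
particular `k_i |m⟩ = q_i^{m_i} q_{i+1}^{-m_{i+1}} |m⟩` for `i ≠ 0`, while
`k_0 |m⟩ = q^{-1} q_1^{-2 m_1} |m⟩` in type `C` and `k_0 |m⟩ = q^{-1} q_1^{-m_1} q_2^{-m_2} |m⟩`
in type `D`. -/
def oscK {n : ℕ} (ε : Fin n → Fin 2) (μ : Fin n → ℤ) : Module.End 𝕂 (Fock ε) :=
  shiftOp ε (fun m => qHalf ^ (∑ t, μ t) * qForm ε m μ) 0

/-- The action of `e_i` on `𝒲`. -/
def oscE {n : ℕ} [NeZero n] (X : CDType) (ε : Fin n → Fin 2) (i : Fin n) :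
    Module.End 𝕂 (Fock ε) :=
  if i = 0 then
    match X with
    | .C => shiftOp ε (fun m => qInt (m 0) * qInt (m 0 - 1) / qInt 2 ^ 2) (-(2 • delta 0))
    | .D => shiftOp ε (fun m => qInt (m 1)) (-delta 0 - delta 1)
  else move ε (i - 1) i

/-- The action of `f_i` on `𝒲`. In type `D` this is the action twisted by the sign change of `f_0`
and `k_0`. -/
def oscF {n : ℕ} [NeZero n] (X : CDType) (ε : Fin n → Fin 2) (i : Fin n) :
    Module.End 𝕂 (Fock ε) :=
  if i = 0 then
    match X with
    | .C => -shiftOp ε (fun _ => 1) (2 • delta 0)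
    | .D => -shiftOp ε (fun _ => 1) (delta 0 + delta 1)
  else move ε i (i - 1)

/-! ## The `q`-oscillator module `𝒲 ⊗ 𝒲` -/

/-- The action of `k_μ` on `𝒲 ⊗ 𝒲`. -/
def oscTwoK {n : ℕ} (ε : Fin n → Fin 2) (μ : Fin n → ℤ) :
    Module.End 𝕂 (Fock ε ⊗[𝕂] Fock ε) :=
  TensorProduct.map (oscK ε μ) (oscK ε μ)

/-- The action of `e_i` on `𝒲 ⊗ 𝒲`. For `i ≠ 0` it is `e_i ⊗ 1 + k_i ⊗ e_i`; for `i = 0` it sends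
`|m⟩ ⊗ |m'⟩` to `[m_1] [m'_1] |m - e_1⟩ ⊗ |m' - e_1⟩` in type `C` and to
`[m_2] [m'_1] |m - e_2⟩ ⊗ |m' - e_1⟩
  - q_1^{-m'_1} q_2^{-m_2} q^{-1} [m_1] [m'_2] |m - e_1⟩ ⊗ |m' - e_2⟩` in type `D`. -/
def oscTwoE {n : ℕ} [NeZero n] (X : CDType) (ε : Fin n → Fin 2) (i : Fin n) :
    Module.End 𝕂 (Fock ε ⊗[𝕂] Fock ε) :=
  if i = 0 then
    match X with
    | .C => TensorProduct.map (shiftOp ε (fun m => qInt (m 0)) (-delta 0))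
        (shiftOp ε (fun m => qInt (m 0)) (-delta 0))
    | .D => TensorProduct.map (shiftOp ε (fun m => qInt (m 1)) (-delta 1))
          (shiftOp ε (fun m => qInt (m 0)) (-delta 0))
        - q⁻¹ • TensorProduct.map
          (shiftOp ε (fun m => qPar ε 1 ^ (-m 1) * qInt (m 0)) (-delta 0))
          (shiftOp ε (fun m => qPar ε 0 ^ (-m 0) * qInt (m 1)) (-delta 1))
  else TensorProduct.map (move ε (i - 1) i) 1
    + TensorProduct.map (oscK ε (alpha X i)) (move ε (i - 1) i)

/-- The action of `f_i` on `𝒲 ⊗ 𝒲`. For `i ≠ 0` it is `f_i ⊗ k_i⁻¹ + 1 ⊗ f_i`; for `i = 0` it sends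
`|m⟩ ⊗ |m'⟩` to `- |m + e_1⟩ ⊗ |m' + e_1⟩` in type `C` and to
`- q_1^{m_1} q_2^{m'_2} q |m + e_2⟩ ⊗ |m' + e_1⟩ + |m + e_1⟩ ⊗ |m' + e_2⟩` in type `D`. -/
def oscTwoF {n : ℕ} [NeZero n] (X : CDType) (ε : Fin n → Fin 2) (i : Fin n) :
    Module.End 𝕂 (Fock ε ⊗[𝕂] Fock ε) :=
  if i = 0 then
    match X with
    | .C => -TensorProduct.map (shiftOp ε (fun _ => 1) (delta 0))
        (shiftOp ε (fun _ => 1) (delta 0))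
    | .D => -(q • TensorProduct.map (shiftOp ε (fun m => qPar ε 0 ^ m 0) (delta 1))
          (shiftOp ε (fun m => qPar ε 1 ^ m 1) (delta 0)))
        + TensorProduct.map (shiftOp ε (fun _ => 1) (delta 0)) (shiftOp ε (fun _ => 1) (delta 1))
  else TensorProduct.map (move ε i (i - 1)) (oscK ε (-alpha X i))
    + TensorProduct.map 1 (move ε i (i - 1))

/-! ## The quantum group `𝐔(𝔰𝔩_r)`

The node `i : Fin (r - 1)` is the node `i + 1` of `{1, …, r - 1}`; it joins the coordinates `lo i`
and `hi i` of `Fin r`. -/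

/-- The first of the two coordinates joined by the node `i`. -/
def lo {r : ℕ} (i : Fin (r - 1)) : Fin r := ⟨i.val, by omega⟩

/-- The second of the two coordinates joined by the node `i`. -/
def hi {r : ℕ} (i : Fin (r - 1)) : Fin r := ⟨i.val + 1, by omega⟩

/-- The Cartan matrix of `𝔰𝔩_r`. -/
def cartan {r : ℕ} (i j : Fin (r - 1)) : ℤ :=
  if i = j then 2 else if i.val + 1 = j.val ∨ j.val + 1 = i.val then -1 else 0

/-- The generators `e_i`, `f_i`, `k_i`, `k_i⁻¹` of `𝐔(𝔰𝔩_r)`. -/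
inductive SlGen (r : ℕ)
  | e (i : Fin (r - 1))
  | f (i : Fin (r - 1))
  | k (i : Fin (r - 1))
  | kInv (i : Fin (r - 1))

/-- The free generator `e_i`. -/
def SlGen.E {r : ℕ} (i : Fin (r - 1)) : FreeAlgebra 𝕂 (SlGen r) := FreeAlgebra.ι 𝕂 (.e i)

/-- The free generator `f_i`. -/
def SlGen.F {r : ℕ} (i : Fin (r - 1)) : FreeAlgebra 𝕂 (SlGen r) := FreeAlgebra.ι 𝕂 (.f i)

/-- The free generator `k_i`. -/
def SlGen.K {r : ℕ} (i : Fin (r - 1)) : FreeAlgebra 𝕂 (SlGen r) := FreeAlgebra.ι 𝕂 (.k i)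

/-- The free generator `k_i⁻¹`. -/
def SlGen.K' {r : ℕ} (i : Fin (r - 1)) : FreeAlgebra 𝕂 (SlGen r) := FreeAlgebra.ι 𝕂 (.kInv i)

open SlGen in
/-- The defining relations of `𝐔(𝔰𝔩_r)`. -/
inductive SlRel (r : ℕ) : FreeAlgebra 𝕂 (SlGen r) → FreeAlgebra 𝕂 (SlGen r) → Prop
  | k_inv (i) : SlRel r (K i * K' i) 1
  | inv_k (i) : SlRel r (K' i * K i) 1
  | k_k (i j) : SlRel r (K i * K j) (K j * K i)
  | k_e (i j) : SlRel r (K i * E j * K' i) (q ^ cartan i j • E j)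
  | k_f (i j) : SlRel r (K i * F j * K' i) (q ^ (-cartan i j) • F j)
  | e_f (i j) :
      SlRel r (E i * F j - F j * E i) (if i = j then (q - q⁻¹)⁻¹ • (K i - K' i) else 0)
  | e_e (i j) (h : cartan i j = 0) : SlRel r (E i * E j) (E j * E i)
  | f_f (i j) (h : cartan i j = 0) : SlRel r (F i * F j) (F j * F i)
  | e_serre (i j) (h : cartan i j = -1) :
      SlRel r (E i * E i * E j - qInt 2 • (E i * E j * E i) + E j * E i * E i) 0
  | f_serre (i j) (h : cartan i j = -1) :
      SlRel r (F i * F i * F j - qInt 2 • (F i * F j * F i) + F j * F i * F i) 0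

/-- The quantum group `𝐔(𝔰𝔩_r)`. -/
abbrev Usl (r : ℕ) : Type := RingQuot (SlRel r)

/-- The projection from the free algebra on the generators to `𝐔(𝔰𝔩_r)`. -/
def Usl.mk (r : ℕ) : FreeAlgebra 𝕂 (SlGen r) →ₐ[𝕂] Usl r := RingQuot.mkAlgHom 𝕂 (SlRel r)

open SlGen in
/-- Lusztig's braid group operator `T_i = T''_{i,1}`, on polynomials in the generators of
`𝐔(𝔰𝔩_r)`. -/
def lusztigT {r : ℕ} (i : Fin (r - 1)) :
    FreeAlgebra 𝕂 (SlGen r) →ₐ[𝕂] FreeAlgebra 𝕂 (SlGen r) :=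
  FreeAlgebra.lift 𝕂 fun g =>
    match g with
    | .e j => if i = j then -(F i * K i)
        else if cartan i j = -1 then E i * E j - q⁻¹ • (E j * E i) else E j
    | .f j => if i = j then -(K' i * E i)
        else if cartan i j = -1 then F j * F i - q • (F i * F j) else F j
    | .k j => if i = j then K' i else if cartan i j = -1 then K j * K i else K j
    | .kInv j => if i = j then K i else if cartan i j = -1 then K' j * K' i else K' j

/-- `T_{w_•} = T_1 T_3 T_5 ⋯`, the product over the odd nodes of `{1, …, r - 1}`. -/
def lusztigTBlack (r : ℕ) : FreeAlgebra 𝕂 (SlGen r) →ₐ[𝕂] FreeAlgebra 𝕂 (SlGen r) :=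
  ((List.finRange (r - 1)).filter fun i => i.val % 2 = 0).foldr
    (fun i T => (lusztigT i).comp T) (AlgHom.id 𝕂 _)

open SlGen in
/-- The `ı`quantum group `𝐔^ı(𝔰𝔬_ℓ)` with parameters `ς_i`, `κ_i`: the subalgebra of `𝐔(𝔰𝔩_ℓ)`
generated by `B_i = f_i + ς_i e_i k_i⁻¹ + κ_i k_i⁻¹`. -/
def iQuantumSo (ℓ : ℕ) (ς κ : Fin (ℓ - 1) → 𝕂) : Subalgebra 𝕂 (Usl ℓ) :=
  Algebra.adjoin 𝕂
    (Set.range fun i => Usl.mk ℓ (F i + ς i • (E i * K' i) + κ i • K' i))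

open SlGen in
/-- The `ı`quantum group `𝐔^ı(𝔰𝔭_{2ℓ})` with parameters `ς_i`: the subalgebra of `𝐔(𝔰𝔩_{2ℓ})`
generated by `B_i = f_i + ς_i T_{w_•}(e_i) k_i⁻¹` for the even nodes `i` and by
`e_j`, `f_j`, `k_j`, `k_j⁻¹` for the odd nodes `j` of `{1, …, 2ℓ - 1}`. -/
def iQuantumSp (ℓ : ℕ) (ς : Fin (2 * ℓ - 1) → 𝕂) : Subalgebra 𝕂 (Usl (2 * ℓ)) :=
  Algebra.adjoin 𝕂
    ({b | ∃ i : Fin (2 * ℓ - 1), i.val % 2 = 1 ∧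
        b = Usl.mk (2 * ℓ) (F i + ς i • (lusztigTBlack (2 * ℓ) (E i) * K' i))} ∪
      {b | ∃ j : Fin (2 * ℓ - 1), j.val % 2 = 0 ∧
        (b = Usl.mk (2 * ℓ) (E j) ∨ b = Usl.mk (2 * ℓ) (F j) ∨
          b = Usl.mk (2 * ℓ) (K j) ∨ b = Usl.mk (2 * ℓ) (K' j))})

/-- The action of `k_i^s` on `𝒲` for `ε = (0^r)`, also used on the spaces with `ε = (1^r)`:
`|m⟩ ↦ q^{s (m_a - m_b)} |m⟩` where the node `i` joins `a` and `b`. -/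
def kCol (p : Fin 2) {r : ℕ} (a b : Fin r) (s : ℤ) :
    Module.End 𝕂 (Fock (fun _ : Fin r => p)) :=
  shiftOp _ (fun m => q ^ (s * (m a - m b))) 0

/-! ## The action of `𝐔(𝔰𝔩_r)` is well defined

The following facts verify the defining relations, first on one space `𝒲_{(p^r)}` and then on a
tensor product of such spaces. -/

/-- The defining relations of `𝐔(𝔰𝔩_r)`, for a family of elements of an algebra. -/
structure SlRels {r : ℕ} {A : Type*} [Ring A] [Algebra 𝕂 A] (e f k k' : Fin (r - 1) → A) :
    Prop where
  k_inv (i) : k i * k' i = 1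
  inv_k (i) : k' i * k i = 1
  k_k (i j) : k i * k j = k j * k i
  k_e (i j) : k i * e j * k' i = q ^ cartan i j • e j
  k_f (i j) : k i * f j * k' i = q ^ (-cartan i j) • f j
  e_f (i j) : e i * f j - f j * e i = if i = j then (q - q⁻¹)⁻¹ • (k i - k' i) else 0
  e_e (i j) (h : cartan i j = 0) : e i * e j = e j * e i
  f_f (i j) (h : cartan i j = 0) : f i * f j = f j * f i
  e_serre (i j) (h : cartan i j = -1) :
    e i * e i * e j - qInt 2 • (e i * e j * e i) + e j * e i * e i = 0
  f_serre (i j) (h : cartan i j = -1) :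
    f i * f i * f j - qInt 2 • (f i * f j * f i) + f j * f i * f i = 0

theorem ket_of_not {n : ℕ} {ε : Fin n → Fin 2} {m : Fin n → ℤ} (h : ¬ IsState ε m) :
    ket ε m = 0 := by
  rw [ket, dif_neg h]

open Classical in
theorem shiftOp_ket {n : ℕ} (ε : Fin n → Fin 2) (c : (Fin n → ℤ) → 𝕂) (v m : Fin n → ℤ) :
    shiftOp ε c v (ket ε m) = (if IsState ε m then c m else 0) • ket ε (m + v) := by
  by_cases h : IsState ε m
  · rw [if_pos h, ket, dif_pos h]
    rw [shiftOp, Module.Basis.constr_basis]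
  · rw [if_neg h, ket_of_not h]
    simp

theorem end_ext {n : ℕ} {ε : Fin n → Fin 2} {S T : Module.End 𝕂 (Fock ε)}
    (h : ∀ m, IsState ε m → S (ket ε m) = T (ket ε m)) : S = T := by
  refine (Fock.basis ε).ext fun m => ?_
  have := h m.1 m.2
  rw [ket, dif_pos m.2] at this
  exact this

section column
variable {r : ℕ} (p : Fin 2)

/-- The condition on one entry of a state. -/
def Ok (p : Fin 2) (x : ℤ) : Prop := 0 ≤ x ∧ (p = 1 → x ≤ 1)

theorem isState_iff3 {m w : Fin r → ℤ} (hm : IsState (fun _ => p) m) (a b c : Fin r)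
    (h : ∀ t, t ≠ a → t ≠ b → t ≠ c → w t = m t) :
    IsState (fun _ => p) w ↔ Ok p (w a) ∧ Ok p (w b) ∧ Ok p (w c) := by
  constructor
  · intro hw; exact ⟨hw a, hw b, hw c⟩
  · rintro ⟨ha, hb, hc⟩ t
    by_cases h1 : t = a
    · subst h1; exact ha
    by_cases h2 : t = b
    · subst h2; exact hb
    by_cases h3 : t = c
    · subst h3; exact hc
    rw [h t h1 h2 h3]; exact hm t

theorem isState_iff4 {m w : Fin r → ℤ} (hm : IsState (fun _ => p) m) (a b c d : Fin r)
    (h : ∀ t, t ≠ a → t ≠ b → t ≠ c → t ≠ d → w t = m t) :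
    IsState (fun _ => p) w ↔ Ok p (w a) ∧ Ok p (w b) ∧ Ok p (w c) ∧ Ok p (w d) := by
  constructor
  · intro hw; exact ⟨hw a, hw b, hw c, hw d⟩
  · rintro ⟨ha, hb, hc, hd⟩ t
    by_cases h1 : t = a
    · subst h1; exact ha
    by_cases h2 : t = b
    · subst h2; exact hb
    by_cases h3 : t = c
    · subst h3; exact hc
    by_cases h4 : t = d
    · subst h4; exact hd
    rw [h t h1 h2 h3 h4]; exact hm t

theorem two_cases (p : Fin 2) : p = 0 ∨ p = 1 := by omega

theorem move_far {a b c d : Fin r} (hab : a ≠ b) (hac : a ≠ c) (had : a ≠ d) (hbc : b ≠ c)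
    (hbd : b ≠ d) (hcd : c ≠ d) : move (fun _ : Fin r => p) a b * move (fun _ : Fin r => p) c d = move (fun _ : Fin r => p) c d * move (fun _ : Fin r => p) a b := by
  classical
  refine end_ext fun m hm => ?_
  simp only [Module.End.mul_apply, move, shiftOp_ket, map_smul, smul_smul, if_pos hm]
  have hv : m + (Pi.single c 1 - Pi.single d 1) + (Pi.single a 1 - Pi.single b 1) =
    m + (Pi.single a 1 - Pi.single b 1) + (Pi.single c 1 - Pi.single d 1) := by abel
  rw [hv]
  by_cases hf : IsState (fun _ => p) (m + (Pi.single a 1 - Pi.single b 1) +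
      (Pi.single c 1 - Pi.single d 1))
  swap
  · rw [ket_of_not hf]; simp
  congr 1
  rw [isState_iff4 p hm a b c d (by intro t h1 h2 h3 h4; simp [h1, h2, h3, h4])] at hf
  rw [isState_iff4 p hm a b c d (by intro t h1 h2 h3 h4; simp [h1, h2, h3, h4]),
    isState_iff4 p hm a b c d (by intro t h1 h2 h3 h4; simp [h1, h2, h3, h4])]
  have hma := hm a; have hmb := hm b; have hmc := hm c; have hmd := hm d
  simp [hab, hac, had, hbc, hbd, hcd, hab.symm, hac.symm, had.symm, hbc.symm,
    hbd.symm, hcd.symm, Ok] at *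
  rw [if_pos (by grind), if_pos (by grind)]
  ring

theorem move_src {a b c : Fin r} (hab : a ≠ b) (hac : a ≠ c) (hbc : b ≠ c) :
    move (fun _ : Fin r => p) a b * move (fun _ : Fin r => p) c b = move (fun _ : Fin r => p) c b * move (fun _ : Fin r => p) a b := by
  classical
  refine end_ext fun m hm => ?_
  simp only [Module.End.mul_apply, move, shiftOp_ket, map_smul, smul_smul, if_pos hm]
  have hv : m + (Pi.single c 1 - Pi.single b 1) + (Pi.single a 1 - Pi.single b 1) =
    m + (Pi.single a 1 - Pi.single b 1) + (Pi.single c 1 - Pi.single b 1) := by abel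
  rw [hv]
  by_cases hf : IsState (fun _ => p) (m + (Pi.single a 1 - Pi.single b 1) +
      (Pi.single c 1 - Pi.single b 1))
  swap
  · rw [ket_of_not hf]; simp
  congr 1
  rw [isState_iff3 p hm a b c (by intro t h1 h2 h3; simp [h1, h2, h3])] at hf
  rw [isState_iff3 p hm a b c (by intro t h1 h2 h3; simp [h1, h2, h3]),
    isState_iff3 p hm a b c (by intro t h1 h2 h3; simp [h1, h2, h3])]
  have hma := hm a; have hmb := hm b; have hmc := hm c
  simp [hab, hac, hbc, hab.symm, hac.symm, hbc.symm, Ok] at *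
  rw [if_pos (by grind), if_pos (by grind)]

theorem move_tgt {a b c : Fin r} (hab : a ≠ b) (hac : a ≠ c) (hbc : b ≠ c) :
    move (fun _ : Fin r => p) a b * move (fun _ : Fin r => p) a c = move (fun _ : Fin r => p) a c * move (fun _ : Fin r => p) a b := by
  classical
  refine end_ext fun m hm => ?_
  simp only [Module.End.mul_apply, move, shiftOp_ket, map_smul, smul_smul, if_pos hm]
  have hv : m + (Pi.single a 1 - Pi.single c 1) + (Pi.single a 1 - Pi.single b 1) =
    m + (Pi.single a 1 - Pi.single b 1) + (Pi.single a 1 - Pi.single c 1) := by abel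
  rw [hv]
  by_cases hf : IsState (fun _ => p) (m + (Pi.single a 1 - Pi.single b 1) +
      (Pi.single a 1 - Pi.single c 1))
  swap
  · rw [ket_of_not hf]; simp
  congr 1
  rw [isState_iff3 p hm a b c (by intro t h1 h2 h3; simp [h1, h2, h3])] at hf
  rw [isState_iff3 p hm a b c (by intro t h1 h2 h3; simp [h1, h2, h3]),
    isState_iff3 p hm a b c (by intro t h1 h2 h3; simp [h1, h2, h3])]
  have hma := hm a; have hmb := hm b; have hmc := hm c
  simp [hab, hac, hbc, hab.symm, hac.symm, hbc.symm, Ok] at *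
  rw [if_pos (by grind), if_pos (by grind)]
  ring

theorem qInt_ident1 (x y : ℤ) : qInt x * qInt (y + 1) - qInt y * qInt (x + 1) =
    (q - q⁻¹)⁻¹ * (q ^ (x - y) - q ^ (y - x)) := by
  have h0 := q_ne_zero
  have h1 := q_sub_inv_ne_zero
  have hx : q ^ x ≠ 0 := zpow_ne_zero _ h0
  have hy : q ^ y ≠ 0 := zpow_ne_zero _ h0
  simp only [qInt, neg_add, zpow_add₀ h0, zpow_neg, zpow_sub₀ h0, zpow_one]
  have h2 : q ^ 2 - 1 ≠ 0 := by
    intro h; apply h1; field_simp; simpa using h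
  field_simp
  ring

theorem qInt_ident2 (x : ℤ) : qInt (x + 1) + qInt (x - 1) = qInt 2 * qInt x := by
  have h0 := q_ne_zero
  have hx : q ^ x ≠ 0 := zpow_ne_zero _ h0
  rw [qInt_two, qInt, qInt, qInt]
  rw [← add_div, ← mul_div_assoc]
  congr 1
  simp only [neg_add, neg_sub, zpow_add₀ h0, zpow_neg, zpow_sub₀ h0, zpow_one]
  field_simp
  ring

theorem move_self {a b : Fin r} (hab : a ≠ b) :
    move (fun _ : Fin r => p) a b * move (fun _ : Fin r => p) b a - move (fun _ : Fin r => p) b a * move (fun _ : Fin r => p) a b =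
      (q - q⁻¹)⁻¹ • (kCol p a b 1 - kCol p a b (-1)) := by
  classical
  refine end_ext fun m hm => ?_
  simp only [LinearMap.sub_apply, LinearMap.smul_apply, Module.End.mul_apply, move, kCol,
    shiftOp_ket, map_smul, smul_smul, if_pos hm]
  have hv : m + (Pi.single a 1 - Pi.single b 1) + (Pi.single b 1 - Pi.single a 1) = m := by abel
  have hv' : m + (Pi.single b 1 - Pi.single a 1) + (Pi.single a 1 - Pi.single b 1) = m := by abel
  rw [hv, hv', add_zero, ← sub_smul, ← sub_smul, smul_smul]
  congr 1
  rw [isState_iff3 p hm a b b (by intro t h1 h2 h3; simp [h1, h2]),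
    isState_iff3 p hm a b b (by intro t h1 h2 h3; simp [h1, h2])]
  have hma := hm a; have hmb := hm b
  have key := qInt_ident1 (m a) (m b)
  have e1 : (1 : ℤ) * (m a - m b) = m a - m b := by ring
  have e2 : (-1 : ℤ) * (m a - m b) = m b - m a := by ring
  rw [e1, e2, ← key]
  simp [hab, hab.symm, Ok] at *
  generalize m a = x at *
  generalize m b = y at *
  rcases two_cases p with rfl | rfl
  · simp at *
    by_cases hx : x = 0
    · by_cases hy : y = 0
      · simp [hx, hy, qInt_zero]
      · rw [if_neg (by omega), if_pos (by omega), hx, qInt_zero]; ring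
    · by_cases hy : y = 0
      · rw [hy, qInt_zero]; simp; omega
      · rw [if_pos (by omega), if_pos (by omega)]
  · simp at *
    obtain ⟨hx0, hx1⟩ := hma
    obtain ⟨hy0, hy1⟩ := hmb
    interval_cases x <;> interval_cases y <;> simp [qInt_zero, qInt_one]

theorem move_serre1 {a b c : Fin r} (hab : a ≠ b) (hac : a ≠ c) (hbc : b ≠ c) :
    move (fun _ : Fin r => p) a b * move (fun _ : Fin r => p) a b * move (fun _ : Fin r => p) b c - qInt 2 • (move (fun _ : Fin r => p) a b * move (fun _ : Fin r => p) b c * move (fun _ : Fin r => p) a b)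
      + move (fun _ : Fin r => p) b c * move (fun _ : Fin r => p) a b * move (fun _ : Fin r => p) a b = 0 := by
  classical
  refine end_ext fun m hm => ?_
  simp only [LinearMap.sub_apply, LinearMap.add_apply, LinearMap.smul_apply, Module.End.mul_apply,
    move, shiftOp_ket, map_smul, smul_smul, if_pos hm, LinearMap.zero_apply]
  have hv : m + (Pi.single b 1 - Pi.single c 1) + (Pi.single a 1 - Pi.single b 1) +
    (Pi.single a 1 - Pi.single b 1) = m + (Pi.single a 1 - Pi.single b 1) +
      (Pi.single a 1 - Pi.single b 1) + (Pi.single b 1 - Pi.single c 1) := by abel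
  have hv' : m + (Pi.single a 1 - Pi.single b 1) + (Pi.single b 1 - Pi.single c 1) +
    (Pi.single a 1 - Pi.single b 1) = m + (Pi.single a 1 - Pi.single b 1) +
      (Pi.single a 1 - Pi.single b 1) + (Pi.single b 1 - Pi.single c 1) := by abel
  rw [hv, hv', ← sub_smul, ← add_smul]
  by_cases hf : IsState (fun _ => p) (m + (Pi.single a 1 - Pi.single b 1) +
      (Pi.single a 1 - Pi.single b 1) + (Pi.single b 1 - Pi.single c 1))
  swap
  · rw [ket_of_not hf]; simp
  have hz : ∀ x : 𝕂, x = 0 → x • ket (fun _ => p) (m + (Pi.single a 1 - Pi.single b 1) +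
      (Pi.single a 1 - Pi.single b 1) + (Pi.single b 1 - Pi.single c 1)) = 0 := by
    rintro x rfl; simp
  apply hz
  clear hz
  rw [isState_iff3 p hm a b c (by intro t h1 h2 h3; simp [h1, h2, h3])] at hf
  rw [isState_iff3 p hm a b c (by intro t h1 h2 h3; simp [h1, h2, h3]),
    isState_iff3 p hm a b c (by intro t h1 h2 h3; simp [h1, h2, h3]),
    isState_iff3 p hm a b c (by intro t h1 h2 h3; simp [h1, h2, h3]),
    isState_iff3 p hm a b c (by intro t h1 h2 h3; simp [h1, h2, h3]),
    isState_iff3 p hm a b c (by intro t h1 h2 h3; simp [h1, h2, h3])]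
  have hma := hm a; have hmb := hm b; have hmc := hm c
  have key := qInt_ident2 (m b)
  simp [hab, hac, hbc, hab.symm, hac.symm, hbc.symm, Ok] at *
  generalize m a = x at *
  generalize m b = y at *
  generalize m c = z at *
  rcases two_cases p with rfl | rfl
  · simp at *
    have e : y - 1 = y + -1 := by ring
    by_cases hy : y = 0
    · subst hy; simp [qInt_zero]
    · have hz : 1 ≤ z := by omega
      have hz0 : 0 ≤ z := by omega
      have hy1 : 1 ≤ y := by omega
      have e1 : (0 : ℤ) ≤ x + 1 := by omega
      have e2 : (0 : ℤ) ≤ x + 1 + 1 := by omega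
      have e3 : (0 : ℤ) ≤ y + 1 := by omega
      rw [e] at key
      simp only [e1, e2, e3, hz, hz0, hy1, hma, hmb, true_and, and_true, and_self, if_true]
      by_cases h2 : 2 ≤ y
      · simp only [h2, if_true]
        linear_combination qInt z * qInt y * key
      · have hy2 : y = 1 := by omega
        subst hy2
        simp [qInt_zero, qInt_one] at *
        ring
  · simp at *
    omega

theorem move_serre2 {a b c : Fin r} (hab : a ≠ b) (hac : a ≠ c) (hbc : b ≠ c) :
    move (fun _ : Fin r => p) b c * move (fun _ : Fin r => p) b c * move (fun _ : Fin r => p) a b - qInt 2 • (move (fun _ : Fin r => p) b c * move (fun _ : Fin r => p) a b * move (fun _ : Fin r => p) b c)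
      + move (fun _ : Fin r => p) a b * move (fun _ : Fin r => p) b c * move (fun _ : Fin r => p) b c = 0 := by
  classical
  refine end_ext fun m hm => ?_
  simp only [LinearMap.sub_apply, LinearMap.add_apply, LinearMap.smul_apply, Module.End.mul_apply,
    move, shiftOp_ket, map_smul, smul_smul, if_pos hm, LinearMap.zero_apply]
  have hv : m + (Pi.single b 1 - Pi.single c 1) + (Pi.single b 1 - Pi.single c 1) +
    (Pi.single a 1 - Pi.single b 1) = m + (Pi.single a 1 - Pi.single b 1) +
      (Pi.single b 1 - Pi.single c 1) + (Pi.single b 1 - Pi.single c 1) := by abel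
  have hv' : m + (Pi.single b 1 - Pi.single c 1) + (Pi.single a 1 - Pi.single b 1) +
    (Pi.single b 1 - Pi.single c 1) = m + (Pi.single a 1 - Pi.single b 1) +
      (Pi.single b 1 - Pi.single c 1) + (Pi.single b 1 - Pi.single c 1) := by abel
  rw [hv, hv', ← sub_smul, ← add_smul]
  by_cases hf : IsState (fun _ => p) (m + (Pi.single a 1 - Pi.single b 1) +
      (Pi.single b 1 - Pi.single c 1) + (Pi.single b 1 - Pi.single c 1))
  swap
  · rw [ket_of_not hf]; simp
  have hz : ∀ x : 𝕂, x = 0 → x • ket (fun _ => p) (m + (Pi.single a 1 - Pi.single b 1) +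
      (Pi.single b 1 - Pi.single c 1) + (Pi.single b 1 - Pi.single c 1)) = 0 := by
    rintro x rfl; simp
  apply hz
  clear hz
  rw [isState_iff3 p hm a b c (by intro t h1 h2 h3; simp [h1, h2, h3])] at hf
  rw [isState_iff3 p hm a b c (by intro t h1 h2 h3; simp [h1, h2, h3]),
    isState_iff3 p hm a b c (by intro t h1 h2 h3; simp [h1, h2, h3]),
    isState_iff3 p hm a b c (by intro t h1 h2 h3; simp [h1, h2, h3]),
    isState_iff3 p hm a b c (by intro t h1 h2 h3; simp [h1, h2, h3]),
    isState_iff3 p hm a b c (by intro t h1 h2 h3; simp [h1, h2, h3])]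
  have hma := hm a; have hmb := hm b; have hmc := hm c
  have key := qInt_ident2 (m b + 1)
  simp [hab, hac, hbc, hab.symm, hac.symm, hbc.symm, Ok] at *
  generalize m a = x at *
  generalize m b = y at *
  generalize m c = z at *
  rcases two_cases p with rfl | rfl
  · simp at *
    have e1 : (0 : ℤ) ≤ x + 1 := by omega
    have e3 : (0 : ℤ) ≤ y + 1 := by omega
    have e4 : (0 : ℤ) ≤ y + 1 + 1 := by omega
    have hz2 : 2 ≤ z := by omega
    have hz1 : 1 ≤ z := by omega
    simp only [e1, e3, e4, hz2, hz1, hma, hmb, hmc, true_and, and_true, and_self, if_true]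
    by_cases h2 : 1 ≤ y
    · simp only [h2, if_true]
      linear_combination qInt z * qInt (z + -1) * key
    · have hy2 : y = 0 := by omega
      subst hy2
      simp [qInt_zero, qInt_one] at *
      ring
  · simp at *
    omega

end column

theorem cartan_cases {r : ℕ} (i j : Fin (r - 1)) (P : Prop) (h1 : i = j → P)
    (h2 : i.val + 1 = j.val → P) (h3 : j.val + 1 = i.val → P)
    (h4 : i ≠ j → i.val + 1 ≠ j.val → j.val + 1 ≠ i.val → P) : P := by
  by_cases a : i = j
  · exact h1 a
  by_cases b : i.val + 1 = j.val
  · exact h2 b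
  by_cases c : j.val + 1 = i.val
  · exact h3 c
  exact h4 a b c

theorem diag_mul {n : ℕ} (ε : Fin n → Fin 2) (c d : (Fin n → ℤ) → 𝕂) :
    shiftOp ε c 0 * shiftOp ε d 0 = shiftOp ε (fun m => c m * d m) 0 := by
  refine end_ext fun m hm => ?_
  simp [shiftOp_ket, hm, smul_smul, mul_comm]

theorem kCol_mul (p : Fin 2) {r : ℕ} (a b : Fin r) (v : Fin r → ℤ) (c : (Fin r → ℤ) → 𝕂) (s : ℤ) :
    kCol p a b s * shiftOp _ c v * kCol p a b (-s) =
      q ^ (s * (v a - v b)) • shiftOp _ c v := by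
  refine end_ext fun m hm => ?_
  simp only [Module.End.mul_apply, kCol, shiftOp_ket, map_smul, smul_smul, if_pos hm, add_zero,
    LinearMap.smul_apply]
  by_cases h : IsState (fun _ => p) (m + v)
  · rw [if_pos h]
    congr 1
    have h0 := q_ne_zero
    have : q ^ (s * (v a - v b)) = q ^ (-s * (m a - m b)) * q ^ (s * ((m + v) a - (m + v) b)) := by
      rw [← zpow_add₀ h0]; congr 1; simp; ring
    rw [this]; ring
  · rw [ket_of_not h]; simp

theorem column_rels (p : Fin 2) (r : ℕ) :
    SlRels (r := r) (fun i => move (fun _ : Fin r => p) (lo i) (hi i)) (fun i => move (fun _ : Fin r => p) (hi i) (lo i))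
      (fun i => kCol p (lo i) (hi i) 1) (fun i => kCol p (lo i) (hi i) (-1)) where
  k_inv i := by
    rw [kCol, kCol, diag_mul]
    refine end_ext fun m hm => ?_
    simp [shiftOp_ket, hm, ← zpow_add₀ q_ne_zero]
  inv_k i := by
    rw [kCol, kCol, diag_mul]
    refine end_ext fun m hm => ?_
    simp [shiftOp_ket, hm, ← zpow_add₀ q_ne_zero]
  k_k i j := by
    rw [kCol, kCol, diag_mul, diag_mul]
    simp_rw [mul_comm]
  k_e i j := by
    rw [move, kCol_mul]
    congr 2
    refine cartan_cases i j _ ?_ ?_ ?_ ?_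
    · rintro rfl; simp [cartan, lo, hi, Pi.single_apply]
    · intro h; simp [cartan, lo, hi, Pi.single_apply, Fin.ext_iff]; grind
    · intro h; simp [cartan, lo, hi, Pi.single_apply, Fin.ext_iff]; grind
    · intro h1 h2 h3; simp [cartan, lo, hi, Pi.single_apply, Fin.ext_iff]; grind
  k_f i j := by
    rw [move, kCol_mul]
    congr 2
    refine cartan_cases i j _ ?_ ?_ ?_ ?_
    · rintro rfl; simp [cartan, lo, hi, Pi.single_apply]
    · intro h; simp [cartan, lo, hi, Pi.single_apply, Fin.ext_iff]; grind
    · intro h; simp [cartan, lo, hi, Pi.single_apply, Fin.ext_iff]; grind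
    · intro h1 h2 h3; simp [cartan, lo, hi, Pi.single_apply, Fin.ext_iff]; grind
  e_f i j := by
    refine cartan_cases i j _ ?_ ?_ ?_ ?_
    · rintro rfl
      rw [if_pos rfl]
      exact move_self p (by simp [lo, hi])
    · intro h
      rw [if_neg (by rintro rfl; omega), sub_eq_zero]
      have : lo j = hi i := by simp [lo, hi, h]
      rw [this]
      exact move_src p (by simp [lo, hi]) (by simp [lo, hi]; omega) (by simp [hi]; omega)
    · intro h
      rw [if_neg (by rintro rfl; omega), sub_eq_zero]
      have : hi j = lo i := by simp [lo, hi, h]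
      rw [this]
      exact move_tgt p (by simp [lo, hi]) (by simp [lo]; omega) (by simp [lo, hi]; omega)
    · intro h1 h2 h3
      rw [if_neg h1, sub_eq_zero]
      have h4 : i.val ≠ j.val := fun h => h1 (Fin.ext h)
      apply move_far <;> simp [lo, hi] <;> omega
  e_e i j h := by
    have h1 : i ≠ j := by rintro rfl; simp [cartan] at h
    have h2 : ¬ (i.val + 1 = j.val ∨ j.val + 1 = i.val) := by
      intro h'; simp [cartan, h1, h'] at h
    have h4 : i.val ≠ j.val := fun h => h1 (Fin.ext h)
    apply move_far <;> simp [lo, hi] <;> omega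
  f_f i j h := by
    have h1 : i ≠ j := by rintro rfl; simp [cartan] at h
    have h2 : ¬ (i.val + 1 = j.val ∨ j.val + 1 = i.val) := by
      intro h'; simp [cartan, h1, h'] at h
    have h4 : i.val ≠ j.val := fun h => h1 (Fin.ext h)
    apply move_far <;> simp [lo, hi] <;> omega
  e_serre i j h := by
    have h2 : i.val + 1 = j.val ∨ j.val + 1 = i.val := by
      by_contra h'; simp only [cartan, h', if_false] at h; split_ifs at h
    rcases h2 with h2 | h2
    · have : lo j = hi i := by simp [lo, hi, h2]
      rw [this]
      exact move_serre1 p (by simp [lo, hi]) (by simp [lo, hi]; omega) (by simp [hi]; omega)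
    · have : hi j = lo i := by simp [lo, hi, h2]
      rw [this]
      exact move_serre2 p (by simp [lo]; omega) (by simp [lo, hi]; omega) (by simp [lo, hi])
  f_serre i j h := by
    have h2 : i.val + 1 = j.val ∨ j.val + 1 = i.val := by
      by_contra h'; simp only [cartan, h', if_false] at h; split_ifs at h
    rcases h2 with h2 | h2
    · have : lo j = hi i := by simp [lo, hi, h2]
      rw [this]
      exact move_serre2 p (by simp [hi]; omega) (by simp [lo, hi]; omega) (by simp [lo, hi])
    · have : hi j = lo i := by simp [lo, hi, h2]
      rw [this]
      exact move_serre1 p (by simp [lo, hi]) (by simp [lo, hi]; omega) (by simp [lo]; omega)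

section tensor

theorem serre_add {A : Type*} [Ring A] [Algebra 𝕂 A] {a b c d : A}
    (hca : c * a = q ^ (2 : ℤ) • (a * c)) (hcb : c * b = q ^ (-1 : ℤ) • (b * c))
    (hda : d * a = q ^ (-1 : ℤ) • (a * d))
    (h1 : a * a * b - qInt 2 • (a * b * a) + b * a * a = 0)
    (h2 : c * c * d - qInt 2 • (c * d * c) + d * c * c = 0) :
    (a + c) * (a + c) * (b + d) - qInt 2 • ((a + c) * (b + d) * (a + c))
      + (b + d) * (a + c) * (a + c) = 0 := by
  have h0 := q_ne_zero
  have t1 : a * a * d - qInt 2 • (a * d * a) + d * a * a = 0 := by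
    have e1 : a * d * a = q ^ (-1 : ℤ) • (a * a * d) := by
      rw [mul_assoc, hda, mul_smul_comm, mul_assoc]
    have e2 : d * a * a = (q ^ (-1 : ℤ) * q ^ (-1 : ℤ)) • (a * a * d) := by
      rw [hda, smul_mul_assoc, e1, smul_smul]
    rw [e1, e2, qInt_two, smul_smul]
    have : (1 : 𝕂) - (q + q⁻¹) * q ^ (-1 : ℤ) + q ^ (-1 : ℤ) * q ^ (-1 : ℤ) = 0 := by
      rw [zpow_neg_one]; field_simp; ring
    calc _ = ((1 : 𝕂) - (q + q⁻¹) * q ^ (-1 : ℤ) + q ^ (-1 : ℤ) * q ^ (-1 : ℤ)) • (a * a * d) := by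
          module
      _ = 0 := by rw [this, zero_smul]
  have t2 : c * c * b - qInt 2 • (c * b * c) + b * c * c = 0 := by
    have e1 : c * b * c = q ^ (-1 : ℤ) • (b * c * c) := by
      rw [hcb, smul_mul_assoc]
    have e2 : c * c * b = (q ^ (-1 : ℤ) * q ^ (-1 : ℤ)) • (b * c * c) := by
      rw [mul_assoc, hcb, mul_smul_comm, ← mul_assoc, e1, smul_smul]
    rw [e1, e2, qInt_two, smul_smul]
    have : (1 : 𝕂) - (q + q⁻¹) * q ^ (-1 : ℤ) + q ^ (-1 : ℤ) * q ^ (-1 : ℤ) = 0 := by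
      rw [zpow_neg_one]; field_simp; ring
    calc _ = ((1 : 𝕂) - (q + q⁻¹) * q ^ (-1 : ℤ) + q ^ (-1 : ℤ) * q ^ (-1 : ℤ)) • (b * c * c) := by
          module
      _ = 0 := by rw [this, zero_smul]
  have t3 : a * c * b + c * a * b - qInt 2 • (a * b * c + c * b * a) + b * a * c + b * c * a
      = 0 := by
    have e1 : a * c * b = q ^ (-1 : ℤ) • (a * b * c) := by
      rw [mul_assoc, hcb, mul_smul_comm, mul_assoc]
    have e2 : c * a * b = (q ^ (2 : ℤ) * q ^ (-1 : ℤ)) • (a * b * c) := by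
      rw [hca, smul_mul_assoc, e1, smul_smul]
    have e3 : b * c * a = q ^ (2 : ℤ) • (b * a * c) := by
      rw [mul_assoc, hca, mul_smul_comm, mul_assoc]
    have e4 : c * b * a = (q ^ (-1 : ℤ) * q ^ (2 : ℤ)) • (b * a * c) := by
      rw [hcb, smul_mul_assoc, e3, smul_smul]
    rw [e1, e2, e4, e3, qInt_two]
    have i1 : q ^ (-1 : ℤ) + q ^ (2 : ℤ) * q ^ (-1 : ℤ) - (q + q⁻¹) = 0 := by
      rw [zpow_neg_one]; norm_cast; field_simp; ring
    have i2 : 1 + q ^ (2 : ℤ) - (q + q⁻¹) * (q ^ (-1 : ℤ) * q ^ (2 : ℤ)) = 0 := by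
      rw [zpow_neg_one]; norm_cast; field_simp; ring
    calc _ = (q ^ (-1 : ℤ) + q ^ (2 : ℤ) * q ^ (-1 : ℤ) - (q + q⁻¹)) • (a * b * c) +
          (1 + q ^ (2 : ℤ) - (q + q⁻¹) * (q ^ (-1 : ℤ) * q ^ (2 : ℤ))) • (b * a * c) := by
          module
      _ = 0 := by rw [i1, i2, zero_smul, zero_smul, add_zero]
  have t4 : a * c * d + c * a * d - qInt 2 • (a * d * c + c * d * a) + d * a * c + d * c * a
      = 0 := by
    have e1 : c * a * d = q ^ (2 : ℤ) • (a * c * d) := by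
      rw [hca, smul_mul_assoc]
    have e2 : d * a * c = q ^ (-1 : ℤ) • (a * d * c) := by
      rw [hda, smul_mul_assoc]
    have e3 : c * d * a = (q ^ (-1 : ℤ) * q ^ (2 : ℤ)) • (a * c * d) := by
      rw [mul_assoc, hda, mul_smul_comm, ← mul_assoc, e1, smul_smul]
    have e4 : d * c * a = (q ^ (2 : ℤ) * q ^ (-1 : ℤ)) • (a * d * c) := by
      rw [mul_assoc, hca, mul_smul_comm, ← mul_assoc, e2, smul_smul]
    rw [e1, e2, e3, e4, qInt_two]
    have i1 : q ^ (-1 : ℤ) + q ^ (2 : ℤ) * q ^ (-1 : ℤ) - (q + q⁻¹) = 0 := by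
      rw [zpow_neg_one]; norm_cast; field_simp; ring
    have i2 : 1 + q ^ (2 : ℤ) - (q + q⁻¹) * (q ^ (-1 : ℤ) * q ^ (2 : ℤ)) = 0 := by
      rw [zpow_neg_one]; norm_cast; field_simp; ring
    calc _ = (q ^ (-1 : ℤ) + q ^ (2 : ℤ) * q ^ (-1 : ℤ) - (q + q⁻¹)) • (a * d * c) +
          (1 + q ^ (2 : ℤ) - (q + q⁻¹) * (q ^ (-1 : ℤ) * q ^ (2 : ℤ))) • (a * c * d) := by
          module
      _ = 0 := by rw [i1, i2, zero_smul, zero_smul, add_zero]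
  have : (a + c) * (a + c) * (b + d) - qInt 2 • ((a + c) * (b + d) * (a + c))
      + (b + d) * (a + c) * (a + c) =
      (a * a * b - qInt 2 • (a * b * a) + b * a * a) +
      (c * c * d - qInt 2 • (c * d * c) + d * c * c) +
      (a * a * d - qInt 2 • (a * d * a) + d * a * a) +
      (c * c * b - qInt 2 • (c * b * c) + b * c * c) +
      (a * c * b + c * a * b - qInt 2 • (a * b * c + c * b * a) + b * a * c + b * c * a) +
      (a * c * d + c * a * d - qInt 2 • (a * d * c + c * d * a) + d * a * c + d * c * a) := by
    simp only [add_mul, mul_add, smul_add]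
    abel
  rw [this, h1, h2, t1, t2, t3, t4]
  simp

theorem serre_sum {A : Type*} [Ring A] [Algebra 𝕂 A] {n : ℕ} {X Y : Fin n → A}
    (hXX : ∀ s s', s < s' → X s' * X s = q ^ (2 : ℤ) • (X s * X s'))
    (hXY : ∀ s s', s < s' → X s' * Y s = q ^ (-1 : ℤ) • (Y s * X s'))
    (hYX : ∀ s s', s < s' → Y s' * X s = q ^ (-1 : ℤ) • (X s * Y s'))
    (h : ∀ s, X s * X s * Y s - qInt 2 • (X s * Y s * X s) + Y s * X s * X s = 0)
    (S : Finset (Fin n)) :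
    (∑ s ∈ S, X s) * (∑ s ∈ S, X s) * (∑ s ∈ S, Y s)
      - qInt 2 • ((∑ s ∈ S, X s) * (∑ s ∈ S, Y s) * (∑ s ∈ S, X s))
      + (∑ s ∈ S, Y s) * (∑ s ∈ S, X s) * (∑ s ∈ S, X s) = 0 := by
  induction S using Finset.induction_on_max with
  | empty => simp
  | insert s S hs ih =>
    have hn : s ∉ S := fun h' => lt_irrefl _ (hs s h')
    rw [Finset.sum_insert hn, Finset.sum_insert hn, add_comm (X s), add_comm (Y s)]
    refine serre_add ?_ ?_ ?_ ih (h s)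
    · rw [Finset.mul_sum, Finset.sum_mul, Finset.smul_sum]
      exact Finset.sum_congr rfl fun t ht => hXX t s (hs t ht)
    · rw [Finset.mul_sum, Finset.sum_mul, Finset.smul_sum]
      exact Finset.sum_congr rfl fun t ht => hXY t s (hs t ht)
    · rw [Finset.mul_sum, Finset.sum_mul, Finset.smul_sum]
      exact Finset.sum_congr rfl fun t ht => hYX t s (hs t ht)

theorem serre_sum' {A : Type*} [Ring A] [Algebra 𝕂 A] {n : ℕ} {X Y : Fin n → A}
    (hXX : ∀ s s', s < s' → X s * X s' = q ^ (2 : ℤ) • (X s' * X s))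
    (hXY : ∀ s s', s < s' → X s * Y s' = q ^ (-1 : ℤ) • (Y s' * X s))
    (hYX : ∀ s s', s < s' → Y s * X s' = q ^ (-1 : ℤ) • (X s' * Y s))
    (h : ∀ s, X s * X s * Y s - qInt 2 • (X s * Y s * X s) + Y s * X s * X s = 0)
    (S : Finset (Fin n)) :
    (∑ s ∈ S, X s) * (∑ s ∈ S, X s) * (∑ s ∈ S, Y s)
      - qInt 2 • ((∑ s ∈ S, X s) * (∑ s ∈ S, Y s) * (∑ s ∈ S, X s))
      + (∑ s ∈ S, Y s) * (∑ s ∈ S, X s) * (∑ s ∈ S, X s) = 0 := by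
  induction S using Finset.induction_on_max with
  | empty => simp
  | insert s S hs ih =>
    have hn : s ∉ S := fun h' => lt_irrefl _ (hs s h')
    rw [Finset.sum_insert hn, Finset.sum_insert hn]
    refine serre_add ?_ ?_ ?_ (h s) ih
    · rw [Finset.mul_sum, Finset.sum_mul, Finset.smul_sum]
      exact Finset.sum_congr rfl fun t ht => hXX t s (hs t ht)
    · rw [Finset.mul_sum, Finset.sum_mul, Finset.smul_sum]
      exact Finset.sum_congr rfl fun t ht => hXY t s (hs t ht)
    · rw [Finset.mul_sum, Finset.sum_mul, Finset.smul_sum]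
      exact Finset.sum_congr rfl fun t ht => hYX t s (hs t ht)

variable {n : ℕ} {M : Fin n → Type} [∀ t, AddCommGroup (M t)] [∀ t, Module 𝕂 (M t)]

theorem map_scalar {F G : Π t, Module.End 𝕂 (M t)} (s : Fin n) (c : 𝕂)
    (h : ∀ t, t ≠ s → F t = G t) (hs : F s = c • G s) :
    PiTensorProduct.map F = c • PiTensorProduct.map G := by
  have : F = Function.update G s (c • G s) := by
    funext t
    by_cases ht : t = s
    · subst ht; simpa using hs
    · simpa [ht] using h t ht
  rw [this, PiTensorProduct.map_update_smul, Function.update_eq_self]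

theorem site_mul (A B A' B' : Π t, Module.End 𝕂 (M t)) (s : Fin n) (x x' : Module.End 𝕂 (M s)) :
    site A B s x * site A' B' s x' =
      site (fun t => A t * A' t) (fun t => B t * B' t) s (x * x') := by
  rw [site, site, site, ← PiTensorProduct.map_mul]
  congr 1
  funext t
  by_cases ht : t = s
  · subst ht; simp
  · by_cases h : t < s <;> simp [ht, h]

theorem site_add (A B : Π t, Module.End 𝕂 (M t)) (s : Fin n) (x y : Module.End 𝕂 (M s)) :
    site A B s (x + y) = site A B s x + site A B s y :=
  PiTensorProduct.map_update_add _ _ _ _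

theorem site_smul (A B : Π t, Module.End 𝕂 (M t)) (s : Fin n) (c : 𝕂) (x : Module.End 𝕂 (M s)) :
    site A B s (c • x) = c • site A B s x :=
  PiTensorProduct.map_update_smul _ _ _ _

theorem site_sub (A B : Π t, Module.End 𝕂 (M t)) (s : Fin n) (x y : Module.End 𝕂 (M s)) :
    site A B s (x - y) = site A B s x - site A B s y := by
  have h := site_add A B s (x - y) y
  rw [sub_add_cancel] at h
  rw [h, add_sub_cancel_right]

theorem site_zero (A B : Π t, Module.End 𝕂 (M t)) (s : Fin n) : site A B s 0 = 0 := by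
  have h := site_smul A B s 0 0
  simpa using h

theorem site_e_e {k k' e e' : Π t, Module.End 𝕂 (M t)} {c : 𝕂} {s s' : Fin n} (h : s < s')
    (hk : ∀ t, k t * k' t = k' t * k t) (hc : ∀ t, k' t * e t = c • (e t * k' t)) :
    site k' (fun _ => 1) s' (e' s') * site k (fun _ => 1) s (e s) =
      c • (site k (fun _ => 1) s (e s) * site k' (fun _ => 1) s' (e' s')) := by
  rw [site, site, ← PiTensorProduct.map_mul, ← PiTensorProduct.map_mul]
  refine map_scalar s c ?_ ?_
  · intro t ht
    by_cases h1 : t = s'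
    · subst h1; simp [h.ne', h.not_gt]
    · rcases lt_or_gt_of_ne ht with h2 | h2
      · simp [ht, h1, h2, h2.trans h, hk]
      · simp [ht, h1, h2.not_gt]
  · simp [h.ne, h, hc]

theorem site_f_f {k k' f f' : Π t, Module.End 𝕂 (M t)} {c : 𝕂} {s s' : Fin n} (h : s < s')
    (hk : ∀ t, k t * k' t = k' t * k t) (hc : ∀ t, k t * f' t = c • (f' t * k t)) :
    site (fun _ => 1) k s (f s) * site (fun _ => 1) k' s' (f' s') =
      c • (site (fun _ => 1) k' s' (f' s') * site (fun _ => 1) k s (f s)) := by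
  rw [site, site, ← PiTensorProduct.map_mul, ← PiTensorProduct.map_mul]
  refine map_scalar s' c ?_ ?_
  · intro t ht
    by_cases h1 : t = s
    · subst h1; simp [h.ne, h]
    · rcases lt_or_gt_of_ne ht with h2 | h2
      · simp [ht, h1, h2]
      · simp [ht, h1, h2.not_gt, (h.trans h2).not_gt, hk]
  · simp [h.ne', h.not_gt, hc]

theorem site_e_f_lt {k k' e f : Π t, Module.End 𝕂 (M t)} {s s' : Fin n} (h : s < s') :
    site k (fun _ => 1) s (e s) * site (fun _ => 1) k' s' (f s') =
      site (fun _ => 1) k' s' (f s') * site k (fun _ => 1) s (e s) := by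
  rw [site, site, ← PiTensorProduct.map_mul, ← PiTensorProduct.map_mul]
  congr 1
  funext t
  by_cases h1 : t = s
  · subst h1; simp [h.ne, h]
  by_cases h2 : t = s'
  · subst h2; simp [h.ne', h.not_gt]
  by_cases h3 : t < s
  · simp [h1, h2, h3, h3.trans h]
  · simp [h1, h2, h3]

theorem site_e_f_gt {k k' e f : Π t, Module.End 𝕂 (M t)} {c d : 𝕂} {s s' : Fin n} (h : s' < s)
    (hk : ∀ t, k t * k' t = k' t * k t) (hf : ∀ t, k t * f t = c • (f t * k t))
    (he : ∀ t, e t * k' t = d • (k' t * e t)) (hcd : c * d = 1) :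
    site k (fun _ => 1) s (e s) * site (fun _ => 1) k' s' (f s') =
      site (fun _ => 1) k' s' (f s') * site k (fun _ => 1) s (e s) := by
  rw [site, site, ← PiTensorProduct.map_mul, ← PiTensorProduct.map_mul]
  rw [← one_smul 𝕂 (PiTensorProduct.map fun t =>
    Function.update (fun t => if t < s' then 1 else k' t) s' (f s') t *
    Function.update (fun t => if t < s then k t else 1) s (e s) t), ← hcd, mul_smul]
  rw [← map_scalar (F := Function.update (fun t =>
    Function.update (fun t => if t < s' then 1 else k' t) s' (f s') t *
    Function.update (fun t => if t < s then k t else 1) s (e s) t) s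
      (d • (k' s * e s))) s d ?_ ?_]
  · refine map_scalar s' c ?_ ?_
    · intro t ht
      by_cases h1 : t = s
      · subst h1; simp [h.ne', h.not_gt, he]
      · by_cases h2 : t < s
        · by_cases h3 : t < s' <;> simp [h1, ht, h2, h3, hk]
        · simp [h1, ht, h2]
    · simp [h.ne, h, hf]
  · intro t ht
    simp [ht]
  · simp [h.ne', h.not_gt]

theorem telescope (k k' : Π t, Module.End 𝕂 (M t)) :
    ∑ s, (site k k' s (k s) - site k k' s (k' s)) =
      PiTensorProduct.map k - PiTensorProduct.map k' := by
  have key : ∀ s : Fin n, site k k' s (k s) - site k k' s (k' s) =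
      PiTensorProduct.map (fun t => if t.val < s.val + 1 then k t else k' t) -
        PiTensorProduct.map (fun t => if t.val < s.val then k t else k' t) := by
    intro s
    have e1 : Function.update (fun t => if t < s then k t else k' t) s (k s) =
        fun t => if t.val < s.val + 1 then k t else k' t := by
      funext t
      by_cases ht : t = s
      · subst ht; simp
      · have h1 : t.val ≠ s.val := fun h => ht (Fin.ext h)
        have h2 : t.val < s.val + 1 ↔ t < s := by rw [Fin.lt_def]; omega
        simp [ht, h2]
    have e2 : Function.update (fun t => if t < s then k t else k' t) s (k' s) =
        fun t => if t.val < s.val then k t else k' t := by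
      funext t
      by_cases ht : t = s
      · subst ht; simp
      · simp [ht]
    rw [site, site, e1, e2]
  let G : ℕ → Module.End 𝕂 (⨂[𝕂] t, M t) := fun s =>
    PiTensorProduct.map (fun t : Fin n => if t.val < s then k t else k' t)
  have h0 : G 0 = PiTensorProduct.map k' := by simp [G]
  have hn : G n = PiTensorProduct.map k := by simp [G]
  rw [← h0, ← hn, ← Finset.sum_range_sub G n, ← Fin.sum_univ_eq_sum_range (fun s => G (s + 1) - G s)]
  exact Finset.sum_congr rfl fun s _ => key s

theorem SlRels.k_e' {r : ℕ} {A : Type*} [Ring A] [Algebra 𝕂 A] {e f k k' : Fin (r - 1) → A}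
    (h : SlRels e f k k') (i j) : k i * e j = q ^ cartan i j • (e j * k i) := by
  rw [← smul_mul_assoc, ← h.k_e, mul_assoc, h.inv_k, mul_one]

theorem SlRels.k_f' {r : ℕ} {A : Type*} [Ring A] [Algebra 𝕂 A] {e f k k' : Fin (r - 1) → A}
    (h : SlRels e f k k') (i j) : k i * f j = q ^ (-cartan i j) • (f j * k i) := by
  rw [← smul_mul_assoc, ← h.k_f, mul_assoc, h.inv_k, mul_one]

theorem SlRels.e_inv {r : ℕ} {A : Type*} [Ring A] [Algebra 𝕂 A] {e f k k' : Fin (r - 1) → A}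
    (h : SlRels e f k k') (i j) : e j * k' i = q ^ cartan i j • (k' i * e j) := by
  rw [← mul_smul_comm, ← h.k_e, ← mul_assoc, ← mul_assoc, h.inv_k, one_mul]

theorem SlRels.inv_f {r : ℕ} {A : Type*} [Ring A] [Algebra 𝕂 A] {e f k k' : Fin (r - 1) → A}
    (h : SlRels e f k k') (i j) : k' i * f j = q ^ cartan i j • (f j * k' i) := by
  have h1 : f j * k' i = q ^ (-cartan i j) • (k' i * f j) := by
    rw [← mul_smul_comm, ← h.k_f, ← mul_assoc, ← mul_assoc, h.inv_k, one_mul]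
  rw [h1, smul_smul, ← zpow_add₀ q_ne_zero, add_neg_cancel, zpow_zero, one_smul]

theorem SlRels.k_inv_comm {r : ℕ} {A : Type*} [Ring A] [Algebra 𝕂 A] {e f k k' : Fin (r - 1) → A}
    (h : SlRels e f k k') (i j) : k i * k' j = k' j * k i := by
  calc k i * k' j = k' j * k j * (k i * k' j) := by rw [h.inv_k, one_mul]
    _ = k' j * (k j * k i) * k' j := by simp only [mul_assoc]
    _ = k' j * (k i * k j) * k' j := by rw [h.k_k]
    _ = k' j * k i * (k j * k' j) := by simp only [mul_assoc]
    _ = k' j * k i := by rw [h.k_inv, mul_one]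

theorem SlRels.inv_inv {r : ℕ} {A : Type*} [Ring A] [Algebra 𝕂 A] {e f k k' : Fin (r - 1) → A}
    (h : SlRels e f k k') (i j) : k' i * k' j = k' j * k' i := by
  calc k' i * k' j = k' i * k' j * (k i * k' i) := by rw [h.k_inv, mul_one]
    _ = k' i * (k' j * k i) * k' i := by simp only [mul_assoc]
    _ = k' i * (k i * k' j) * k' i := by rw [h.k_inv_comm]
    _ = (k' i * k i) * k' j * k' i := by simp only [mul_assoc]
    _ = k' j * k' i := by rw [h.inv_k, one_mul]

theorem cartan_symm {r : ℕ} (i j : Fin (r - 1)) : cartan i j = cartan j i := by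
  simp only [cartan, eq_comm, or_comm]

theorem tensor_rels {r : ℕ} {e f k k' : Π t, Fin (r - 1) → Module.End 𝕂 (M t)}
    (h : ∀ t, SlRels (e t) (f t) (k t) (k' t)) :
    SlRels (r := r) (fun i => tensE (fun t => k t i) (fun t => e t i))
      (fun i => tensF (fun t => k' t i) (fun t => f t i))
      (fun i => PiTensorProduct.map fun t => k t i)
      (fun i => PiTensorProduct.map fun t => k' t i) where
  k_inv i := by
    rw [← PiTensorProduct.map_mul]
    simp only [(h _).k_inv]
    exact PiTensorProduct.map_one
  inv_k i := by
    rw [← PiTensorProduct.map_mul]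
    simp only [(h _).inv_k]
    exact PiTensorProduct.map_one
  k_k i j := by
    rw [← PiTensorProduct.map_mul, ← PiTensorProduct.map_mul]
    simp only [(h _).k_k i j]
  k_e i j := by
    simp only [tensE]
    rw [Finset.mul_sum, Finset.sum_mul, Finset.smul_sum]
    refine Finset.sum_congr rfl fun s _ => ?_
    rw [site, ← PiTensorProduct.map_mul, ← PiTensorProduct.map_mul]
    refine map_scalar s _ ?_ ?_
    · intro t ht
      by_cases h1 : t < s
      · simp [ht, h1, (h t).k_k i j, mul_assoc, (h t).k_inv]
      · simp [ht, h1, (h t).k_inv]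
    · simp [(h s).k_e]
  k_f i j := by
    simp only [tensF]
    rw [Finset.mul_sum, Finset.sum_mul, Finset.smul_sum]
    refine Finset.sum_congr rfl fun s _ => ?_
    rw [site, ← PiTensorProduct.map_mul, ← PiTensorProduct.map_mul]
    refine map_scalar s _ ?_ ?_
    · intro t ht
      by_cases h1 : t < s
      · simp [ht, h1, (h t).k_inv]
      · simp [ht, h1, (h t).k_inv_comm i j, mul_assoc, (h t).k_inv]
    · simp [(h s).k_f]
  e_f i j := by
    have hd : ∀ s s', s ≠ s' →
        site (fun t => k t i) (fun _ => 1) s (e s i) * site (fun _ => 1) (fun t => k' t j) s' (f s' j) =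
        site (fun _ => 1) (fun t => k' t j) s' (f s' j) * site (fun t => k t i) (fun _ => 1) s (e s i) := by
      intro s s' hs
      rcases lt_or_gt_of_ne hs with h1 | h1
      · exact site_e_f_lt (e := fun t => e t i) (f := fun t => f t j) h1
      · refine site_e_f_gt (e := fun t => e t i) (f := fun t => f t j) h1
          (fun t => (h t).k_inv_comm i j) (fun t => (h t).k_f' i j) (fun t => (h t).e_inv j i) ?_
        rw [cartan_symm j i, ← zpow_add₀ q_ne_zero, neg_add_cancel, zpow_zero]
    have hs : ∀ s, site (fun t => k t i) (fun _ => 1) s (e s i) *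
          site (fun _ => 1) (fun t => k' t j) s (f s j) -
        site (fun _ => 1) (fun t => k' t j) s (f s j) *
          site (fun t => k t i) (fun _ => 1) s (e s i) =
        if i = j then (q - q⁻¹)⁻¹ • (site (fun t => k t i) (fun t => k' t i) s (k s i) -
          site (fun t => k t i) (fun t => k' t i) s (k' s i)) else 0 := by
      intro s
      rw [site_mul, site_mul]
      simp only [mul_one, one_mul]
      rw [← site_sub, (h s).e_f]
      split_ifs with hij
      · subst hij
        rw [site_smul, site_sub]
      · exact site_zero _ _ _
    simp only [tensE, tensF]
    rw [Finset.sum_mul_sum, Finset.sum_mul_sum,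
      Finset.sum_comm (f := fun s s' => site (fun _ => 1) (fun t => k' t j) s (f s j) *
        site (fun t => k t i) (fun _ => 1) s' (e s' i)), ← Finset.sum_sub_distrib]
    have : ∀ s : Fin n, (∑ s', site (fun t => k t i) (fun _ => 1) s (e s i) *
          site (fun _ => 1) (fun t => k' t j) s' (f s' j)) -
        (∑ s', site (fun _ => 1) (fun t => k' t j) s' (f s' j) *
          site (fun t => k t i) (fun _ => 1) s (e s i)) =
        if i = j then (q - q⁻¹)⁻¹ • (site (fun t => k t i) (fun t => k' t i) s (k s i) -
          site (fun t => k t i) (fun t => k' t i) s (k' s i)) else 0 := by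
      intro s
      rw [← Finset.sum_sub_distrib, Finset.sum_eq_single s, hs]
      · intro s' _ hne
        rw [hd s s' hne.symm, sub_self]
      · simp
    rw [Finset.sum_congr rfl fun s _ => this s]
    split_ifs with hij
    · rw [← Finset.smul_sum, telescope (fun t => k t i) (fun t => k' t i)]
    · simp
  e_e i j hij := by
    simp only [tensE]
    rw [Finset.sum_mul_sum, Finset.sum_mul_sum, Finset.sum_comm]
    refine Finset.sum_congr rfl fun s _ => Finset.sum_congr rfl fun s' _ => ?_
    rcases lt_trichotomy s s' with h1 | h1 | h1
    · have := site_e_e (e := fun t => e t j) (e' := fun t => e t i) h1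
        (fun t => (h t).k_k j i) (fun t => (h t).k_e' i j)
      rw [hij, zpow_zero, one_smul] at this
      exact this
    · subst h1
      rw [site_mul, site_mul, (h s).e_e i j hij]
      simp only [(h _).k_k i j]
    · have := site_e_e (e := fun t => e t i) (e' := fun t => e t j) h1
        (fun t => (h t).k_k i j) (fun t => (h t).k_e' j i)
      rw [cartan_symm, hij, zpow_zero, one_smul] at this
      exact this.symm
  f_f i j hij := by
    simp only [tensF]
    rw [Finset.sum_mul_sum, Finset.sum_mul_sum, Finset.sum_comm]
    refine Finset.sum_congr rfl fun s _ => Finset.sum_congr rfl fun s' _ => ?_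
    rcases lt_trichotomy s s' with h1 | h1 | h1
    · have := site_f_f (f := fun t => f t j) (f' := fun t => f t i) h1
        (fun t => (h t).inv_inv j i) (fun t => (h t).inv_f j i)
      rw [cartan_symm, hij, zpow_zero, one_smul] at this
      exact this.symm
    · subst h1
      rw [site_mul, site_mul, (h s).f_f i j hij]
      simp only [(h _).inv_inv i j]
    · have := site_f_f (f := fun t => f t i) (f' := fun t => f t j) h1
        (fun t => (h t).inv_inv i j) (fun t => (h t).inv_f i j)
      rw [hij, zpow_zero, one_smul] at this
      exact this
  e_serre i j hij := by
    have hii : cartan i i = 2 := by simp [cartan]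
    refine serre_sum ?_ ?_ ?_ ?_ _
    · intro s s' hs
      rw [← hii]
      exact site_e_e (e := fun t => e t i) (e' := fun t => e t i) hs
        (fun t => (h t).k_k i i) (fun t => (h t).k_e' i i)
    · intro s s' hs
      rw [← hij]
      exact site_e_e (e := fun t => e t j) (e' := fun t => e t i) hs
        (fun t => (h t).k_k j i) (fun t => (h t).k_e' i j)
    · intro s s' hs
      rw [← hij, cartan_symm]
      exact site_e_e (e := fun t => e t i) (e' := fun t => e t j) hs
        (fun t => (h t).k_k i j) (fun t => (h t).k_e' j i)
    · intro s
      have c1 : (fun t => k t i * k t j * k t i) = fun t => k t i * k t i * k t j := by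
        funext t; rw [mul_assoc, (h t).k_k j i, ← mul_assoc]
      have c2 : (fun t => k t j * k t i * k t i) = fun t => k t i * k t i * k t j := by
        funext t; rw [(h t).k_k j i, mul_assoc, (h t).k_k j i, ← mul_assoc]
      simp only [site_mul]
      rw [c1, c2, ← site_smul, ← site_sub, ← site_add, (h s).e_serre i j hij, site_zero]
  f_serre i j hij := by
    have hii : cartan i i = 2 := by simp [cartan]
    refine serre_sum' ?_ ?_ ?_ ?_ _
    · intro s s' hs
      rw [← hii]
      exact site_f_f (f := fun t => f t i) (f' := fun t => f t i) hs
        (fun t => (h t).inv_inv i i) (fun t => (h t).inv_f i i)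
    · intro s s' hs
      rw [← hij]
      exact site_f_f (f := fun t => f t i) (f' := fun t => f t j) hs
        (fun t => (h t).inv_inv i j) (fun t => (h t).inv_f i j)
    · intro s s' hs
      rw [← hij, cartan_symm]
      exact site_f_f (f := fun t => f t j) (f' := fun t => f t i) hs
        (fun t => (h t).inv_inv j i) (fun t => (h t).inv_f j i)
    · intro s
      have c1 : (fun t => k' t i * k' t j * k' t i) = fun t => k' t i * k' t i * k' t j := by
        funext t; rw [mul_assoc, (h t).inv_inv j i, ← mul_assoc]
      have c2 : (fun t => k' t j * k' t i * k' t i) = fun t => k' t i * k' t i * k' t j := by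
        funext t; rw [(h t).inv_inv j i, mul_assoc, (h t).inv_inv j i, ← mul_assoc]
      simp only [site_mul]
      rw [c1, c2, ← site_smul, ← site_sub, ← site_add, (h s).f_serre i j hij, site_zero]

end tensor

/-! ## The action of `𝐔(𝔰𝔩_r)` on the Fock spaces -/

/-- The operators of the generators of `𝐔(𝔰𝔩_r)` on `𝒲'_1 ⊗ ⋯ ⊗ 𝒲'_n`, `𝒲'_t = 𝒲_{(ε_t^r)}`:
on each `𝒲'_t` one has `e_i |m⟩ = [m_{i+1}] |m + e_i - e_{i+1}⟩`,
`f_i |m⟩ = [m_i] |m - e_i + e_{i+1}⟩`, `k_i |m⟩ = q^{m_i - m_{i+1}} |m⟩`, and the tensor product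
is formed with the comultiplication. -/
def slWords {n : ℕ} (ε : Fin n → Fin 2) (r : ℕ) :
    FreeAlgebra 𝕂 (SlGen r) →ₐ[𝕂]
      Module.End 𝕂 (⨂[𝕂] t : Fin n, Fock (fun _ : Fin r => ε t)) :=
  FreeAlgebra.lift 𝕂 fun g =>
    match g with
    | .e i => tensE (fun t => kCol (ε t) (lo i) (hi i) 1) (fun _ => move _ (lo i) (hi i))
    | .f i => tensF (fun t => kCol (ε t) (lo i) (hi i) (-1)) (fun _ => move _ (hi i) (lo i))
    | .k i => PiTensorProduct.map fun t => kCol (ε t) (lo i) (hi i) 1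
    | .kInv i => PiTensorProduct.map fun t => kCol (ε t) (lo i) (hi i) (-1)

theorem slWords_rel {n : ℕ} (ε : Fin n → Fin 2) (r : ℕ) {x y : FreeAlgebra 𝕂 (SlGen r)}
    (h : SlRel r x y) : slWords ε r x = slWords ε r y := by
  have key := tensor_rels (fun t : Fin n => column_rels (ε t) r)
  have hE : ∀ i, slWords ε r (SlGen.E i) = tensE (fun t => kCol (ε t) (lo i) (hi i) 1)
      (fun _ => move _ (lo i) (hi i)) := fun i => by rw [slWords, SlGen.E, FreeAlgebra.lift_ι_apply]
  have hF : ∀ i, slWords ε r (SlGen.F i) = tensF (fun t => kCol (ε t) (lo i) (hi i) (-1))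
      (fun _ => move _ (hi i) (lo i)) := fun i => by rw [slWords, SlGen.F, FreeAlgebra.lift_ι_apply]
  have hK : ∀ i, slWords ε r (SlGen.K i) = PiTensorProduct.map fun t =>
      kCol (ε t) (lo i) (hi i) 1 := fun i => by rw [slWords, SlGen.K, FreeAlgebra.lift_ι_apply]
  have hK' : ∀ i, slWords ε r (SlGen.K' i) = PiTensorProduct.map fun t =>
      kCol (ε t) (lo i) (hi i) (-1) := fun i => by rw [slWords, SlGen.K', FreeAlgebra.lift_ι_apply]
  cases h with
  | k_inv i => simpa only [map_mul, map_one, hK, hK'] using key.k_inv i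
  | inv_k i => simpa only [map_mul, map_one, hK, hK'] using key.inv_k i
  | k_k i j => simpa only [map_mul, hK] using key.k_k i j
  | k_e i j => simpa only [map_mul, map_smul, hK, hK', hE] using key.k_e i j
  | k_f i j => simpa only [map_mul, map_smul, hK, hK', hF] using key.k_f i j
  | e_f i j =>
    have := key.e_f i j
    split_ifs at this ⊢
    · simpa only [map_mul, map_sub, map_smul, hK, hK', hE, hF] using this
    · simpa only [map_mul, map_sub, map_zero, hE, hF] using this
  | e_e i j h => simpa only [map_mul, hE] using key.e_e i j h
  | f_f i j h => simpa only [map_mul, hF] using key.f_f i j h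
  | e_serre i j h =>
    simpa only [map_mul, map_add, map_sub, map_smul, map_zero, hE] using key.e_serre i j h
  | f_serre i j h =>
    simpa only [map_mul, map_add, map_sub, map_smul, map_zero, hF] using key.f_serre i j h

/-- The representation of `𝐔(𝔰𝔩_r)` on `𝒲'_1 ⊗ ⋯ ⊗ 𝒲'_n`. -/
def slRep {n : ℕ} (ε : Fin n → Fin 2) (r : ℕ) :
    Usl r →ₐ[𝕂] Module.End 𝕂 (⨂[𝕂] t : Fin n, Fock (fun _ : Fin r => ε t)) :=
  RingQuot.liftAlgHom 𝕂 ⟨slWords ε r, fun _ _ h => slWords_rel ε r h⟩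

/-- The basis `|m^1⟩ ⊗ ⋯ ⊗ |m^n⟩` of `𝒲'_1 ⊗ ⋯ ⊗ 𝒲'_n`. -/
def colBasis {n : ℕ} (ε : Fin n → Fin 2) (r : ℕ) :
    Module.Basis (Π t : Fin n, State (fun _ : Fin r => ε t)) 𝕂
      (⨂[𝕂] t : Fin n, Fock (fun _ : Fin r => ε t)) :=
  Basis.piTensorProduct fun _ => Fock.basis _

/-- The basis `|m_1⟩ ⊗ ⋯ ⊗ |m_ℓ⟩` of `𝒲^{⊗ℓ}`. -/
def rowBasis {n : ℕ} (ε : Fin n → Fin 2) (ℓ : ℕ) :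
    Module.Basis (Fin ℓ → State ε) 𝕂 (⨂[𝕂] _ : Fin ℓ, Fock ε) :=
  Basis.piTensorProduct fun _ => Fock.basis _

/-- The basis `(|m_1⟩ ⊗ |m_2⟩) ⊗ ⋯ ⊗ (|m_{2ℓ-1}⟩ ⊗ |m_{2ℓ}⟩)` of `(𝒲 ⊗ 𝒲)^{⊗ℓ}`. -/
def rowBasisTwo {n : ℕ} (ε : Fin n → Fin 2) (ℓ : ℕ) :
    Module.Basis (Fin ℓ → State ε × State ε) 𝕂 (⨂[𝕂] _ : Fin ℓ, Fock ε ⊗[𝕂] Fock ε) :=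
  Basis.piTensorProduct fun _ =>
    (Fock.basis ε).tensorProduct (Fock.basis ε)

/-- The rows of an `ℓ × n` matrix, turned into its columns. -/
def transpose {n : ℕ} (ε : Fin n → Fin 2) (ℓ : ℕ) :
    (Fin ℓ → State ε) ≃ (Π t : Fin n, State (fun _ : Fin ℓ => ε t)) where
  toFun M t := ⟨fun s => (M s).1 t, fun s => (M s).2 t⟩
  invFun N s := ⟨fun t => (N t).1 s, fun t => (N t).2 s⟩
  left_inv _ := rfl
  right_inv _ := rfl

/-- The rows of a `2ℓ × n` matrix, grouped in consecutive pairs, turned into its columns. -/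
def transposeTwo {n : ℕ} (ε : Fin n → Fin 2) (ℓ : ℕ) :
    (Fin ℓ → State ε × State ε) ≃ (Π t : Fin n, State (fun _ : Fin (2 * ℓ) => ε t)) where
  toFun M t :=
    ⟨fun s => if s.val % 2 = 0 then (M ⟨s.val / 2, by omega⟩).1.1 t
        else (M ⟨s.val / 2, by omega⟩).2.1 t, fun s => by
      dsimp only
      split_ifs
      · exact (M _).1.2 t
      · exact (M _).2.2 t⟩
  invFun N s :=
    (⟨fun t => (N t).1 ⟨2 * s.val, by omega⟩, fun t => (N t).2 _⟩,
      ⟨fun t => (N t).1 ⟨2 * s.val + 1, by omega⟩, fun t => (N t).2 _⟩)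
  left_inv M := by
    funext s
    refine Prod.ext (Subtype.ext (funext fun t => ?_)) (Subtype.ext (funext fun t => ?_))
    · have h1 : (⟨2 * s.val / 2, by omega⟩ : Fin ℓ) = s := Fin.ext (by simp)
      simp only [Nat.mul_mod_right, if_true, h1]
    · have h1 : (⟨(2 * s.val + 1) / 2, by omega⟩ : Fin ℓ) = s := Fin.ext (by simp; omega)
      have h2 : (2 * s.val + 1) % 2 ≠ 0 := by omega
      simp only [h2, if_false, h1]
  right_inv N := by
    funext t
    refine Subtype.ext (funext fun s => ?_)
    by_cases h : s.val % 2 = 0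
    · have h1 : (⟨2 * (s.val / 2), by omega⟩ : Fin (2 * ℓ)) = s := Fin.ext (by simp; omega)
      simp only [h, if_true, h1]
    · have h1 : (⟨2 * (s.val / 2) + 1, by omega⟩ : Fin (2 * ℓ)) = s := Fin.ext (by simp; omega)
      simp only [h, if_false, h1]

/-- The isomorphism `𝒲^{⊗ℓ} ≃ 𝒲'_1 ⊗ ⋯ ⊗ 𝒲'_n` which reads a matrix by columns. -/
def transposeIso {n : ℕ} (ε : Fin n → Fin 2) (ℓ : ℕ) :
    (⨂[𝕂] _ : Fin ℓ, Fock ε) ≃ₗ[𝕂] ⨂[𝕂] t : Fin n, Fock (fun _ : Fin ℓ => ε t) :=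
  (rowBasis ε ℓ).equiv (colBasis ε ℓ) (transpose ε ℓ)

/-- The isomorphism `(𝒲 ⊗ 𝒲)^{⊗ℓ} ≃ 𝒲'_1 ⊗ ⋯ ⊗ 𝒲'_n` which reads a matrix by columns. -/
def transposeIsoTwo {n : ℕ} (ε : Fin n → Fin 2) (ℓ : ℕ) :
    (⨂[𝕂] _ : Fin ℓ, Fock ε ⊗[𝕂] Fock ε) ≃ₗ[𝕂]
      ⨂[𝕂] t : Fin n, Fock (fun _ : Fin (2 * ℓ) => ε t) :=
  (rowBasisTwo ε ℓ).equiv (colBasis ε (2 * ℓ)) (transposeTwo ε ℓ)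

/-- The representation of `𝐔(𝔰𝔩_ℓ)` on `𝒲^{⊗ℓ}`. -/
def slRepRow {n : ℕ} (ε : Fin n → Fin 2) (ℓ : ℕ) :
    Usl ℓ →ₐ[𝕂] Module.End 𝕂 (⨂[𝕂] _ : Fin ℓ, Fock ε) :=
  ((transposeIso ε ℓ).symm.conjAlgEquiv 𝕂).toAlgHom.comp (slRep ε ℓ)

/-- The representation of `𝐔(𝔰𝔩_{2ℓ})` on `(𝒲 ⊗ 𝒲)^{⊗ℓ}`. -/
def slRepRowTwo {n : ℕ} (ε : Fin n → Fin 2) (ℓ : ℕ) :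
    Usl (2 * ℓ) →ₐ[𝕂] Module.End 𝕂 (⨂[𝕂] _ : Fin ℓ, Fock ε ⊗[𝕂] Fock ε) :=
  ((transposeIsoTwo ε ℓ).symm.conjAlgEquiv 𝕂).toAlgHom.comp (slRep ε (2 * ℓ))

/-! ## Commuting actions -/

/-- The action of the subalgebra `𝐔^ı(𝔰𝔬_ℓ)` of `𝐔(𝔰𝔩_ℓ)` on `𝒲^{⊗ℓ}` commutes with the action
of `𝒰_X(ε)`. -/
def SoActionCommutes {n : ℕ} [NeZero n] (X : CDType) (ε : Fin n → Fin 2) (ℓ : ℕ)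
    (ς κ : Fin (ℓ - 1) → 𝕂) : Prop :=
  ∀ (u : UX X ε) (T : Module.End 𝕂 (⨂[𝕂] _ : Fin ℓ, Fock ε)),
    ActsAs X ε (tensorPowerAct X (oscE X ε) (oscF X ε) (oscK ε) ℓ) u T →
      ∀ b ∈ iQuantumSo ℓ ς κ, T * slRepRow ε ℓ b = slRepRow ε ℓ b * T

/-- The action of the subalgebra `𝐔^ı(𝔰𝔭_{2ℓ})` of `𝐔(𝔰𝔩_{2ℓ})` on `(𝒲 ⊗ 𝒲)^{⊗ℓ}` commutes with
the action of `𝒰_X(ε)`. -/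
def SpActionCommutes {n : ℕ} [NeZero n] (X : CDType) (ε : Fin n → Fin 2) (ℓ : ℕ)
    (ς : Fin (2 * ℓ - 1) → 𝕂) : Prop :=
  ∀ (u : UX X ε) (T : Module.End 𝕂 (⨂[𝕂] _ : Fin ℓ, Fock ε ⊗[𝕂] Fock ε)),
    ActsAs X ε (tensorPowerAct X (oscTwoE X ε) (oscTwoF X ε) (oscTwoK ε) ℓ) u T →
      ∀ b ∈ iQuantumSp ℓ ς, T * slRepRowTwo ε ℓ b = slRepRowTwo ε ℓ b * T

end FockDuality

end

open FockDuality

/-!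
In the basis of occupation numbers, the space `𝒲^{⊗ r}` has the `r × n` matrices `M` as its basis,
with row `s` the state of the `s`-th factor `𝒲` and column `t` the state of `𝒲'_t`. Both actions
consist of sums of weighted shifts `|M⟩ ↦ c(M) |M + v⟩`: the elements `e_i`, `f_i`, `i ≠ 0`, of
`𝒰_X(ε)` move a unit between two neighbouring columns within a row, `e_0` and `f_0` remove and add
two units within a row (for `𝐔^ı(𝔰𝔬_ℓ)`) or within a pair of rows (for `𝐔^ı(𝔰𝔭_{2ℓ})`), and
`𝐔(𝔰𝔩_r)` moves a unit between two neighbouring rows within a column. By `wshift_mul` the product of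
two such shifts is computed on weights, as long as the weights vanish wherever a configuration stops
being one (`Admissible`).

*Reduction to a window.* The group-like tensor factors in the comultiplication act by multiplicative
characters `chi` of the entries of `M`. The commutator of an operator for the rows `a`, `b` with an
operator of `𝒰_X(ε)` only involves the summands which meet these rows and one or two columns. The
other summands commute with it, since the part in the window preserves the characters which they
involve (`commutesCol_of_far`, `FarScale`, `commutesCol_of_window`, `commute_soB_of_window`), or
they `q`-commute and drop out of the `q`-brackets which define `T_1 T_3 ⋯ (𝖾_i)`
(`commute_spB_of_window`). Finite identities between weights remain.

* For the nodes `i ≠ 0` these form the quantum `(𝔤𝔩, 𝔤𝔩)` duality on `2 × 2` matrices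
  (`rowE_colE_local` and its variants), so that these nodes commute with all of `𝐔(𝔰𝔩_r)`
  (`commutesCol_rowE`, `commutesCol_rowF`).
* For the node `0` and `𝐔^ı(𝔰𝔬_ℓ)` one has a commutation in two rows (`soE_local_typeD`,
  `soE_local_typeC` and their variants), whence `commute_soED_soB` and its variants.
* For the node `0` and `𝐔^ı(𝔰𝔭_{2ℓ})`, the summand of each pair of rows commutes with the Levi part
  `𝖾_j`, `𝖿_j`, `𝗄_j`, `j` odd. For the node `i` between two pairs, the bracket of the summand of
  one pair with `𝖿_i` equals `q` times the iterated `q`-bracket of the summand of the other pair,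
  times `𝗄_i⁻¹` (`lower_bracket_eq`, `raise_bracket_eq` and their variants of type `C`). This
  cancels against the second term of `𝖡_i` exactly if `ς_i = -q` (`commute_sub_bracket`).

The isomorphisms `rowIso`, `rowIsoTwo` and `colIso` transport the statement to matrices, and both
algebras are replaced by generators (`soActionCommutes_iff`, `spActionCommutes_iff`).

*Necessity.* If `𝖡_i` commutes with `f_0` for other parameters, then so does the difference to the
element with the distinguished parameters. This difference is a combination of `𝖾_i 𝗄_i⁻¹` and
`𝗄_i⁻¹`, or a multiple of `T_1 T_3 ⋯ (𝖾_i) 𝗄_i⁻¹`, and is evaluated on the vacuum `|0⟩`. For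
`𝐔^ı(𝔰𝔬_ℓ)` comparing two coefficients suffices (`so_parameters`). For `𝐔^ı(𝔰𝔭_{2ℓ})`, the vector
`f_0|0⟩` is invariant under the Levi part, and on such vectors an element killed by `T_1 T_3 ⋯
(𝖾_i)` is killed by `𝖾_i` (`SlRels.apply_eq_zero`), which is not the case
(`colE_pairGen_vacuum_ne_zero`).
-/

noncomputable section

namespace FockDuality

/-! ### Weighted shift operators on occupation numbers -/

/-- Occupation numbers on a set `σ` of sites: nonnegative, and at most one at the sites of
parity `1`. -/
def IsConf {σ : Type} (η : σ → Fin 2) (M : σ → ℤ) : Prop :=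
  ∀ x, 0 ≤ M x ∧ (η x = 1 → M x ≤ 1)

/-- The space with basis the configurations of occupation numbers on `σ`. -/
def ConfSpace {σ : Type} (η : σ → Fin 2) : Type := {M : σ → ℤ // IsConf η M} →₀ 𝕂

instance {σ : Type} (η : σ → Fin 2) : AddCommGroup (ConfSpace η) :=
  inferInstanceAs (AddCommGroup ({M : σ → ℤ // IsConf η M} →₀ 𝕂))

instance {σ : Type} (η : σ → Fin 2) : Module 𝕂 (ConfSpace η) :=
  inferInstanceAs (Module 𝕂 ({M : σ → ℤ // IsConf η M} →₀ 𝕂))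

/-- The basis of the configurations. -/
def confBasis {σ : Type} (η : σ → Fin 2) :
    Module.Basis {M : σ → ℤ // IsConf η M} 𝕂 (ConfSpace η) :=
  .ofRepr (LinearEquiv.refl 𝕂 ({M : σ → ℤ // IsConf η M} →₀ 𝕂))

section engine
variable {σ : Type} {η : σ → Fin 2}

open Classical in
/-- The basis vector `|M⟩`, with the convention that it is zero if `M` is not a configuration. -/
def cket (η : σ → Fin 2) (M : σ → ℤ) : ConfSpace η :=
  if h : IsConf η M then confBasis η ⟨M, h⟩ else 0

/-- The operator `|M⟩ ↦ c(M) |M + v⟩`. -/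
def wshift (η : σ → Fin 2) (c : (σ → ℤ) → 𝕂) (v : σ → ℤ) : Module.End 𝕂 (ConfSpace η) :=
  (confBasis η).constr 𝕂 fun M : {M : σ → ℤ // IsConf η M} => c M.1 • cket η (M.1 + v)

theorem cket_of_not {M : σ → ℤ} (h : ¬ IsConf η M) : cket η M = 0 := dif_neg h

theorem cket_of {M : σ → ℤ} (h : IsConf η M) : cket η M = confBasis η ⟨M, h⟩ := dif_pos h

theorem wshift_cket (c : (σ → ℤ) → 𝕂) (v : σ → ℤ) {M : σ → ℤ} (h : IsConf η M) :
    wshift η c v (cket η M) = c M • cket η (M + v) := by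
  rw [cket_of h, wshift, Module.Basis.constr_basis]

theorem conf_ext {W : Type*} [AddCommGroup W] [Module 𝕂 W] {S T : ConfSpace η →ₗ[𝕂] W}
    (h : ∀ M, IsConf η M → S (cket η M) = T (cket η M)) : S = T := by
  refine (confBasis η).ext fun M => ?_
  have := h M.1 M.2
  rwa [cket_of M.2] at this

theorem wshift_congr {c c' : (σ → ℤ) → 𝕂} {v : σ → ℤ}
    (h : ∀ M, IsConf η M → IsConf η (M + v) → c M = c' M) : wshift η c v = wshift η c' v := by
  refine conf_ext fun M hM => ?_
  rw [wshift_cket _ _ hM, wshift_cket _ _ hM]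
  by_cases h1 : IsConf η (M + v)
  · rw [h M hM h1]
  · rw [cket_of_not h1, smul_zero, smul_zero]

theorem wshift_add (c c' : (σ → ℤ) → 𝕂) (v : σ → ℤ) :
    wshift η (fun M => c M + c' M) v = wshift η c v + wshift η c' v := by
  refine conf_ext fun M hM => ?_
  simp only [LinearMap.add_apply, wshift_cket _ _ hM, add_smul]

theorem wshift_sub (c c' : (σ → ℤ) → 𝕂) (v : σ → ℤ) :
    wshift η (fun M => c M - c' M) v = wshift η c v - wshift η c' v := by
  refine conf_ext fun M hM => ?_
  simp only [LinearMap.sub_apply, wshift_cket _ _ hM, sub_smul]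

theorem wshift_smul (a : 𝕂) (c : (σ → ℤ) → 𝕂) (v : σ → ℤ) :
    wshift η (fun M => a * c M) v = a • wshift η c v := by
  refine conf_ext fun M hM => ?_
  simp only [LinearMap.smul_apply, wshift_cket _ _ hM, smul_smul]

theorem wshift_zero (v : σ → ℤ) : wshift η (fun _ => 0) v = 0 := by
  refine conf_ext fun M hM => ?_
  simp only [LinearMap.zero_apply, wshift_cket _ _ hM, zero_smul]

theorem wshift_one : wshift η (fun _ => 1) 0 = 1 := by
  refine conf_ext fun M hM => ?_
  rw [wshift_cket _ _ hM, one_smul, add_zero]; rfl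

/-- The weight `c` of a shift by `v` vanishes whenever a nonnegative entry becomes negative, and
whenever an entry greater than one at a site of parity `1` becomes at most one. The product of two
such shifts then never passes through a vector that is zero by convention. -/
structure Admissible (η : σ → Fin 2) (c : (σ → ℤ) → 𝕂) (v : σ → ℤ) : Prop where
  nonneg : ∀ M x, 0 ≤ M x → M x + v x < 0 → c M = 0
  le_one : ∀ M x, η x = 1 → 1 < M x → M x + v x ≤ 1 → c M = 0

/-- The product of two weighted shifts. The vectors which are zero by convention cause no
correction: `d` vanishes on the steps which make an entry negative, and `c` on the steps back from
an entry which is too large. -/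
theorem wshift_mul {c d : (σ → ℤ) → 𝕂} {v w : σ → ℤ} (hc : Admissible η c v)
    (hd : Admissible η d w) :
    wshift η c v * wshift η d w = wshift η (fun M => d M * c (M + w)) (v + w) := by
  refine conf_ext fun M hM => ?_
  rw [Module.End.mul_apply, wshift_cket _ _ hM, wshift_cket _ _ hM, map_smul, mul_smul]
  have e : M + w + v = M + (v + w) := by abel
  by_cases h : IsConf η (M + w)
  · rw [wshift_cket _ _ h, e]
  rw [cket_of_not h, map_zero, smul_zero]
  by_cases h2 : IsConf η (M + (v + w))
  swap
  · rw [cket_of_not h2, smul_zero, smul_zero]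
  have h0 : d M = 0 ∨ c (M + w) = 0 := by
    simp only [IsConf, not_forall, not_and_or, not_le] at h
    obtain ⟨x, hx | ⟨h1, hx⟩⟩ := h
    · exact .inl (hd.nonneg M x (hM x).1 hx)
    · refine .inr (hc.le_one _ x h1 hx ?_)
      have := (h2 x).2 h1
      rwa [← e] at this
  rcases h0 with h0 | h0 <;> simp [h0]

theorem wshift_qcomm {c d g : (σ → ℤ) → 𝕂} {v w u : σ → ℤ} (a : 𝕂) (hc : Admissible η c v)
    (hd : Admissible η d w) (hu : v + w = u)
    (h : ∀ M, IsConf η M → IsConf η (M + u) → d M * c (M + w) - a * (c M * d (M + v)) = g M) :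
    wshift η c v * wshift η d w - a • (wshift η d w * wshift η c v) = wshift η g u := by
  rw [wshift_mul hc hd, wshift_mul hd hc, add_comm w v, hu, ← wshift_smul, ← wshift_sub]
  exact wshift_congr h

theorem wshift_qcommute {c d : (σ → ℤ) → 𝕂} {v w : σ → ℤ} (a : 𝕂) (hc : Admissible η c v)
    (hd : Admissible η d w)
    (h : ∀ M, IsConf η M → IsConf η (M + (v + w)) → d M * c (M + w) = a * (c M * d (M + v))) :
    wshift η c v * wshift η d w = a • (wshift η d w * wshift η c v) := by
  rw [← sub_eq_zero, wshift_qcomm (g := fun _ => 0) a hc hd rfl, wshift_zero]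
  intro M hM hM'
  rw [h M hM hM', sub_self]

/-- The weight `[m]` of the annihilation operator at a site of parity `p`. At parity `1` only the
values at `0` and `1` matter; the value at `2` is put to zero to make the shifts admissible. -/
def dn (p : Fin 2) (m : ℤ) : 𝕂 := if p = 1 ∧ m = 2 then 0 else qInt m

/-- The sum of the unit vectors at the sites in the list. -/
def units [DecidableEq σ] (L : List σ) : σ → ℤ := (L.map fun x => Pi.single x 1).sum

theorem units_apply [DecidableEq σ] (L : List σ) (x : σ) : units L x = L.count x := by
  induction L with
  | nil => simp [units]
  | cons y L ih =>
    rw [units] at ih ⊢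
    rw [List.map_cons, List.sum_cons, Pi.add_apply, ih, List.count_cons, Pi.single_apply]
    by_cases h : y = x
    · simp [h, add_comm]
    · simp [h, Ne.symm h]

end engine

/-- The scalar `(-1)^p q^{(-1)^p}`, so that `qPar ε t = qpar (ε t)`. -/
def qpar (p : Fin 2) : 𝕂 := (((-1) ^ p.val : ℤ) : 𝕂) * q ^ ((-1 : ℤ) ^ p.val)

theorem qpar_zero : qpar 0 = q := by simp [qpar]
theorem qpar_one : qpar 1 = -q⁻¹ := by simp [qpar]
theorem qpar_ne_zero (p : Fin 2) : qpar p ≠ 0 := by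
  rcases two_cases p with rfl | rfl
  · rw [qpar_zero]; exact q_ne_zero
  · rw [qpar_one]; exact neg_ne_zero.mpr (inv_ne_zero q_ne_zero)

theorem dn_zero (m : ℤ) : dn 0 m = qInt m := by simp [dn]

theorem dn_of_le_one (p : Fin 2) {m : ℤ} (h : m ≤ 1) : dn p m = qInt m := by
  rw [dn, if_neg]; omega

theorem qInt_succ (m : ℤ) : qInt (m + 1) = q * qInt m + (q ^ m)⁻¹ := by
  have h0 := q_ne_zero
  have h1 := q_sub_inv_ne_zero
  have hx : q ^ m ≠ 0 := zpow_ne_zero _ h0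
  have h2 : q ^ 2 - 1 ≠ 0 := by
    intro h; apply h1; field_simp; simpa using h
  simp only [qInt, neg_add, zpow_add₀ h0, zpow_neg, zpow_one]
  field_simp
  ring

theorem qInt_succ' (m : ℤ) : qInt (m + 1) = q⁻¹ * qInt m + q ^ m := by
  have h0 := q_ne_zero
  have h1 := q_sub_inv_ne_zero
  have hx : q ^ m ≠ 0 := zpow_ne_zero _ h0
  have h2 : q ^ 2 - 1 ≠ 0 := by
    intro h; apply h1; field_simp; simpa using h
  simp only [qInt, neg_add, zpow_add₀ h0, zpow_neg, zpow_one]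
  field_simp
  ring

theorem dn_succ {p : Fin 2} {m : ℤ} (h : 0 ≤ m ∧ (p = 1 → m ≤ 1)) :
    dn p (m + 1) = q * dn p m + (qpar p ^ m)⁻¹ := by
  rcases two_cases p with rfl | rfl
  · rw [dn_zero, dn_zero, qpar_zero, qInt_succ]
  · have h0 := q_ne_zero
    have : m = 0 ∨ m = 1 := by have := h.2 rfl; omega
    rcases this with rfl | rfl
    · simp [dn, qInt_zero, qInt_one]
    · simp [dn, qInt_one, qpar_one, inv_neg]

theorem dn_succ' {p : Fin 2} {m : ℤ} (h : 0 ≤ m ∧ (p = 1 → m ≤ 1)) :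
    dn p (m + 1) = q⁻¹ * dn p m + qpar p ^ m := by
  rcases two_cases p with rfl | rfl
  · rw [dn_zero, dn_zero, qpar_zero, qInt_succ']
  · have h0 := q_ne_zero
    have : m = 0 ∨ m = 1 := by have := h.2 rfl; omega
    rcases this with rfl | rfl
    · simp [dn, qInt_zero, qInt_one]
    · simp [dn, qInt_one, qpar_one]

/-- Both sides vanish at parity `1`, where a site cannot be lowered twice. -/
theorem dn_mul_dn {p : Fin 2} {m : ℤ} (h : 0 ≤ m ∧ (p = 1 → m ≤ 1)) :
    qpar p * (dn p m * dn p (m - 1)) = q * (dn p m * dn p (m - 1)) := by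
  rcases two_cases p with rfl | rfl
  · rw [qpar_zero]
  · have : m = 0 ∨ m = 1 := by have := h.2 rfl; omega
    rcases this with rfl | rfl <;> simp [dn, qInt_zero]

theorem dn_succ_qpar {p : Fin 2} {m : ℤ} (h : 0 ≤ m ∧ (p = 1 → m ≤ 1)) :
    dn p (m + 1) = qpar p * dn p m + (q ^ m)⁻¹ := by
  rcases two_cases p with rfl | rfl
  · rw [dn_zero, dn_zero, qpar_zero, qInt_succ]
  · have h0 := q_ne_zero
    have : m = 0 ∨ m = 1 := by have := h.2 rfl; omega
    rcases this with rfl | rfl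
    · simp [dn, qInt_zero, qInt_one]
    · simp [dn, qInt_one, qpar_one]

theorem dn_succ_qpar' {p : Fin 2} {m : ℤ} (h : 0 ≤ m ∧ (p = 1 → m ≤ 1)) :
    dn p (m + 1) = (qpar p)⁻¹ * dn p m + q ^ m := by
  rcases two_cases p with rfl | rfl
  · rw [dn_zero, dn_zero, qpar_zero, qInt_succ']
  · have h0 := q_ne_zero
    have : m = 0 ∨ m = 1 := by have := h.2 rfl; omega
    rcases this with rfl | rfl
    · simp [dn, qInt_zero, qInt_one]
    · simp [dn, qInt_one, qpar_one, inv_neg]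

/-- At parity `1` no site can be raised twice. -/
theorem qpar_of_add_two {p : Fin 2} {m : ℤ} (h : 0 ≤ m) (h' : p = 1 → m + 2 ≤ 1) : qpar p = q := by
  rcases two_cases p with rfl | rfl
  · rw [qpar_zero]
  · have := h' rfl
    omega

/-- At a site which can be lowered, the two parametrizations of the weights agree. -/
theorem dn_mul_qpar_zpow {p : Fin 2} {m : ℤ} (h : 0 ≤ m ∧ (p = 1 → m ≤ 1)) :
    dn p m * (qpar p * (qpar p ^ m)⁻¹) = dn p m * (q * (q ^ m)⁻¹) := by
  rcases two_cases p with rfl | rfl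
  · rw [qpar_zero]
  · have : m = 0 ∨ m = 1 := by have := h.2 rfl; omega
    have h0 := q_ne_zero
    rcases this with rfl | rfl
    · simp [dn, qInt_zero]
    · simp [qpar_one, h0]

/-- At a site which can be raised, the two parametrizations of the weights agree. -/
theorem qpar_zpow_of_succ {p : Fin 2} {m : ℤ} (h : 0 ≤ m) (h' : p = 1 → m + 1 ≤ 1) :
    qpar p ^ m = q ^ m := by
  rcases two_cases p with rfl | rfl
  · rw [qpar_zero]
  · have : m = 0 := by have := h' rfl; omega
    rw [this, zpow_zero, zpow_zero]

/-! ### Operators on finitely many sites -/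

section loc
variable {σ τ : Type} {η : σ → Fin 2} {x : τ → σ} {ζ : τ → Fin 2}

/-- The weighted shift that only involves the sites `x y`, with weight and shift given in terms of
the occupation numbers of these sites. -/
def lshift (η : σ → Fin 2) (x : τ → σ) (c : (τ → ℤ) → 𝕂) (v : τ → ℤ) :
    Module.End 𝕂 (ConfSpace η) :=
  wshift η (fun M => c (M ∘ x)) (Function.extend x v 0)

theorem comp_add_extend (hx : Function.Injective x) (M : σ → ℤ) (v : τ → ℤ) :
    (M + Function.extend x v 0) ∘ x = M ∘ x + v := by
  funext y
  simp [hx.extend_apply]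

theorem extend_add_extend (hx : Function.Injective x) (v w : τ → ℤ) :
    Function.extend x v 0 + Function.extend x w 0 = Function.extend x (v + w) (0 : σ → ℤ) := by
  funext z
  by_cases hz : ∃ y, x y = z
  · obtain ⟨y, rfl⟩ := hz
    simp [hx.extend_apply]
  · simp [Function.extend_apply' _ _ _ hz]

theorem Admissible.extend (hx : Function.Injective x) (hζ : ∀ y, η (x y) = ζ y)
    {c : (τ → ℤ) → 𝕂} {v : τ → ℤ} (h : Admissible ζ c v) :
    Admissible η (fun M => c (M ∘ x)) (Function.extend x v 0) := by
  constructor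
  · intro M z h1 h2
    by_cases hz : ∃ y, x y = z
    · obtain ⟨y, rfl⟩ := hz
      rw [hx.extend_apply] at h2
      exact h.nonneg _ y h1 h2
    · rw [Function.extend_apply' _ _ _ hz] at h2
      simp only [Pi.zero_apply] at h2
      omega
  · intro M z h0 h1 h2
    by_cases hz : ∃ y, x y = z
    · obtain ⟨y, rfl⟩ := hz
      rw [hx.extend_apply] at h2
      exact h.le_one _ y (hζ y ▸ h0) h1 h2
    · rw [Function.extend_apply' _ _ _ hz] at h2
      simp only [Pi.zero_apply] at h2
      omega

theorem IsConf.comp (hζ : ∀ y, η (x y) = ζ y) {M : σ → ℤ} (h : IsConf η M) :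
    IsConf ζ (M ∘ x) := fun y => hζ y ▸ h (x y)

/-- The product of two local shifts, in terms of local data. -/
theorem lshift_mul (hx : Function.Injective x) (hζ : ∀ y, η (x y) = ζ y)
    {c d : (τ → ℤ) → 𝕂} {v w : τ → ℤ} (hc : Admissible ζ c v) (hd : Admissible ζ d w) :
    lshift η x c v * lshift η x d w = lshift η x (fun m => d m * c (m + w)) (v + w) := by
  rw [lshift, lshift, wshift_mul (hc.extend hx hζ) (hd.extend hx hζ), extend_add_extend hx]
  simp only [comp_add_extend hx]
  rfl

theorem lshift_qcomm (hx : Function.Injective x) (hζ : ∀ y, η (x y) = ζ y)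
    {c d g : (τ → ℤ) → 𝕂} {v w u : τ → ℤ} (a : 𝕂) (hc : Admissible ζ c v)
    (hd : Admissible ζ d w) (hu : v + w = u)
    (h : ∀ m, IsConf ζ m → IsConf ζ (m + u) → d m * c (m + w) - a * (c m * d (m + v)) = g m) :
    lshift η x c v * lshift η x d w - a • (lshift η x d w * lshift η x c v) = lshift η x g u := by
  have hu' := extend_add_extend hx v w
  rw [hu] at hu'
  refine wshift_qcomm a (hc.extend hx hζ) (hd.extend hx hζ) hu' fun M hM hM' => ?_
  have hM'' := hM'.comp hζ
  rw [comp_add_extend hx] at hM'' ⊢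
  rw [comp_add_extend hx]
  exact h _ (hM.comp hζ) hM''

theorem lshift_add (x : τ → σ) (c c' : (τ → ℤ) → 𝕂) (v : τ → ℤ) :
    lshift η x (fun m => c m + c' m) v = lshift η x c v + lshift η x c' v :=
  wshift_add _ _ _

theorem lshift_smul (x : τ → σ) (a : 𝕂) (c : (τ → ℤ) → 𝕂) (v : τ → ℤ) :
    lshift η x (fun m => a * c m) v = a • lshift η x c v :=
  wshift_smul _ _ _

theorem lshift_zero (x : τ → σ) (v : τ → ℤ) : lshift η x (fun _ => 0) v = 0 :=
  wshift_zero _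

variable [DecidableEq τ]

/-- The weight of a monomial of annihilation operators at the sites `A` and of the diagonal
operator `g`. -/
def monWt (ζ : τ → Fin 2) (g : (τ → ℤ) → 𝕂) (A : List τ) (m : τ → ℤ) : 𝕂 :=
  g m * (A.map fun y => dn (ζ y) (m y)).prod

/-- The normally ordered monomial with creation operators at the sites `C`, annihilation operators
at the sites `A`, and the diagonal operator `g` to their right, for a family of sites `x`. -/
def lmon (η : σ → Fin 2) (x : τ → σ) (g : (τ → ℤ) → 𝕂) (C A : List τ) :
    Module.End 𝕂 (ConfSpace η) :=
  lshift η x (monWt (η ∘ x) g A) (units C - units A)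

theorem monWt_admissible (g : (τ → ℤ) → 𝕂) (C : List τ) {A : List τ} (hA : A.Nodup) :
    Admissible ζ (monWt ζ g A) (units C - units A) := by
  have key : ∀ m x, (units C - units A : τ → ℤ) x < 0 → dn (ζ x) (m x) = 0 →
      monWt ζ g A m = 0 := by
    intro m x hx h0
    have hxA : x ∈ A := by
      by_contra h
      rw [Pi.sub_apply, units_apply, units_apply, List.count_eq_zero_of_not_mem h] at hx
      omega
    rw [monWt, List.prod_eq_zero, mul_zero]
    exact List.mem_map.mpr ⟨x, hxA, h0⟩
  have ge : ∀ x, -1 ≤ (units C - units A : τ → ℤ) x := by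
    intro x
    rw [Pi.sub_apply, units_apply, units_apply]
    have := List.nodup_iff_count_le_one.mp hA x
    omega
  constructor
  · intro m x h1 h2
    have := ge x
    refine key m x (by omega) ?_
    have : m x = 0 := by omega
    simp [dn, this, qInt_zero]
  · intro m x h0 h1 h2
    have := ge x
    refine key m x (by omega) ?_
    have : m x = 2 := by omega
    simp [dn, this, h0]

/-- The `a`-commutator of two monomials. -/
theorem lmon_qcomm (hx : Function.Injective x)
    {g g' h : (τ → ℤ) → 𝕂} {C A C' A' C'' A'' : List τ} (a : 𝕂)
    (hA : A.Nodup ∧ A'.Nodup ∧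
      ∀ y, C.count y + C'.count y + A''.count y = A.count y + A'.count y + C''.count y)
    (hh : ∀ m : τ → ℤ, IsConf (η ∘ x) m → IsConf (η ∘ x) (m + (units C'' - units A'')) →
      monWt (η ∘ x) g' A' m * monWt (η ∘ x) g A (m + (units C' - units A')) -
        a * (monWt (η ∘ x) g A m * monWt (η ∘ x) g' A' (m + (units C - units A))) =
          monWt (η ∘ x) h A'' m) :
    lmon η x g C A * lmon η x g' C' A' - a • (lmon η x g' C' A' * lmon η x g C A) =
      lmon η x h C'' A'' := by
  refine lshift_qcomm (ζ := η ∘ x) hx (fun _ => rfl) a (monWt_admissible _ _ hA.1)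
    (monWt_admissible _ _ hA.2.1) ?_ hh
  funext y
  have := hA.2.2 y
  simp only [Pi.add_apply, Pi.sub_apply, units_apply]
  omega

/-- Two monomials `a`-commute if their weights do. -/
theorem lmon_comm (hx : Function.Injective x)
    {g g' : (τ → ℤ) → 𝕂} {C A C' A' : List τ} (a : 𝕂) (hA : A.Nodup ∧ A'.Nodup)
    (hh : ∀ m : τ → ℤ, IsConf (η ∘ x) m →
      IsConf (η ∘ x) (m + (units C - units A + (units C' - units A'))) →
      monWt (η ∘ x) g' A' m * monWt (η ∘ x) g A (m + (units C' - units A')) =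
        a * (monWt (η ∘ x) g A m * monWt (η ∘ x) g' A' (m + (units C - units A)))) :
    lmon η x g C A * lmon η x g' C' A' - a • (lmon η x g' C' A' * lmon η x g C A) = 0 := by
  rw [lmon, lmon, lshift_qcomm (ζ := η ∘ x) (g := fun _ => 0) hx (fun _ => rfl) a
    (monWt_admissible _ _ hA.1)
    (monWt_admissible _ _ hA.2) rfl fun m hm hm' => sub_eq_zero.mpr (hh m hm hm'), lshift_zero]

theorem lmon_smul (a : 𝕂) (g : (τ → ℤ) → 𝕂) (C A : List τ) :
    lmon η x (fun m => a * g m) C A = a • lmon η x g C A := by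
  rw [lmon, lmon, ← lshift_smul]
  congr 1
  funext m
  simp only [monWt, mul_assoc]

theorem lmon_neg (g : (τ → ℤ) → 𝕂) (C A : List τ) :
    lmon η x (fun m => -g m) C A = -lmon η x g C A := by
  rw [← neg_one_smul 𝕂, ← lmon_smul]
  simp only [neg_one_mul]

theorem lmon_add (g g' : (τ → ℤ) → 𝕂) (C A : List τ) :
    lmon η x (fun m => g m + g' m) C A = lmon η x g C A + lmon η x g' C A := by
  rw [lmon, lmon, lmon, ← lshift_add]
  congr 1
  funext m
  simp only [monWt, add_mul]

theorem lmon_sub (g g' : (τ → ℤ) → 𝕂) (C A : List τ) :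
    lmon η x (fun m => g m - g' m) C A = lmon η x g C A - lmon η x g' C A := by
  simp only [sub_eq_add_neg, lmon_add, lmon_neg]

theorem lmon_mul_diag (hx : Function.Injective x) {g d : (τ → ℤ) → 𝕂} {C A : List τ}
    (hA : A.Nodup) :
    lmon η x g C A * lmon η x d [] [] = lmon η x (fun m => g m * d m) C A := by
  rw [lmon, lmon, lshift_mul (ζ := η ∘ x) hx (fun _ => rfl) (monWt_admissible _ _ hA)
    (monWt_admissible _ _ List.nodup_nil), sub_self, add_zero, lmon]
  congr 1
  funext m
  simp only [monWt, add_zero, List.map_nil, List.prod_nil, mul_one]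
  ring

end loc

/-! ### The `(𝔤𝔩, 𝔤𝔩)` duality in two rows and two columns -/

/-- The form in which all commutations in two rows appear: the diagonal commutators vanish, and the
mixed ones cancel. -/
theorem commute_add_add {A : Type*} [Ring A] [Algebra 𝕂 A] {r s c d h : A}
    (h1 : r * c - (1 : 𝕂) • (c * r) = 0) (h2 : s * d - (1 : 𝕂) • (d * s) = 0)
    (h3 : r * d - (1 : 𝕂) • (d * r) = h) (h4 : s * c - (1 : 𝕂) • (c * s) = -h) :
    Commute (r + s) (c + d) := by
  rw [one_smul] at h1 h2 h3 h4
  rw [Commute, SemiconjBy]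
  linear_combination (norm := noncomm_ring) h1 + h2 + h3 + h4

/-- The parities of two columns of sites. -/
abbrev HasPar {σ τ : Type} (η : σ → Fin 2) (x : τ × Fin 2 → σ) (p p' : Fin 2) : Prop :=
  ∀ y, η (x y) = ![p, p'] y.2

section howe
variable {σ : Type} {η : σ → Fin 2} {x : Fin 2 × Fin 2 → σ} {p p' : Fin 2}

/-- Here and in the next three lemmas, the rows and columns of a `2 × 2` matrix are indexed by `Fin
2 × Fin 2`; the first operator moves a unit between the columns in each of the two rows, the second
one between the rows in each of the two columns. -/
theorem rowE_colE_local (hx : Function.Injective x) (hp : HasPar η x p p') :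
    Commute (lmon η x (fun _ => 1) [(0, 0)] [(0, 1)] +
        lmon η x (fun m => qpar p ^ m (0, 0) * qpar p' ^ (-m (0, 1))) [(1, 0)] [(1, 1)])
      (lmon η x (fun _ => 1) [(0, 0)] [(1, 0)] +
        lmon η x (fun m => q ^ (m (0, 0) - m (1, 0))) [(0, 1)] [(1, 1)]) := by
  have h0 := q_ne_zero
  have hp0 := qpar_ne_zero p
  have hp0' := qpar_ne_zero p'
  refine commute_add_add (lmon_comm hx 1 (by decide) fun m hm hm' => ?_)
    (lmon_comm hx 1 (by decide) fun m hm hm' => ?_)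
    (lmon_qcomm (h := fun m => qpar p ^ m (0, 0) * q ^ (-m (1, 0)) * qpar p' ^ (-m (0, 1)))
      (C'' := [(0, 0)]) (A'' := [(1, 1)]) hx 1 (by decide) fun m hm hm' => ?_)
    ((lmon_qcomm hx 1 (by decide) fun m hm hm' => ?_).trans (lmon_neg _ _ _))
  · simp [monWt, units_apply, mul_comm]
  · have h1 := dn_mul_dn (hm (1, 1))
    simp only [Function.comp_apply, hp] at h1
    simp [monWt, units_apply, zpow_add₀, zpow_sub₀, h0, hp0, hp0', hp] at h1 ⊢
    field_simp
    grind
  · have h1 := dn_succ (hm (0, 1))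
    have h2 := qpar_zpow_of_succ (hm (0, 0)).1 (by simpa [units_apply] using (hm' (0, 0)).2)
    simp [monWt, units_apply, h0, zpow_add₀, zpow_sub₀, hp] at h1 h2 ⊢
    rw [h1, h2]
    field_simp
    ring
  · have h1 := dn_succ_qpar (hm (1, 0))
    simp [monWt, units_apply, h0, zpow_add₀, hp0, hp] at h1 ⊢
    rw [h1]
    field_simp
    ring

theorem rowE_colF_local (hx : Function.Injective x) (hp : HasPar η x p p') :
    Commute (lmon η x (fun _ => 1) [(0, 0)] [(0, 1)] +
        lmon η x (fun m => qpar p ^ m (0, 0) * qpar p' ^ (-m (0, 1))) [(1, 0)] [(1, 1)])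
      (lmon η x (fun _ => 1) [(1, 1)] [(0, 1)] +
        lmon η x (fun m => q ^ (m (1, 1) - m (0, 1))) [(1, 0)] [(0, 0)]) := by
  have h0 := q_ne_zero
  have hp0 := qpar_ne_zero p
  have hp0' := qpar_ne_zero p'
  refine commute_add_add (lmon_comm hx 1 (by decide) fun m hm hm' => ?_)
    (lmon_comm hx 1 (by decide) fun m hm hm' => ?_)
    (lmon_qcomm (h := fun m => -(qpar p ^ m (0, 0) * q * q ^ (m (1, 1) - m (0, 1))))
      (C'' := [(1, 0)]) (A'' := [(0, 1)]) hx 1 (by decide) fun m hm hm' => ?_)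
    ((lmon_qcomm hx 1 (by decide) fun m hm hm' => ?_).trans (lmon_neg _ _ _))
  · simp [monWt, units_apply, mul_comm]
  · have h1 := qpar_of_add_two (hm (1, 0)).1 (by simpa [units_apply] using (hm' (1, 0)).2)
    simp [monWt, units_apply, zpow_add₀, zpow_sub₀, h0, hp0, hp] at h1 ⊢
    rw [h1]
    field_simp
  · have h1 := dn_succ' (hm (0, 0))
    simp [monWt, units_apply, h0, zpow_add₀, zpow_sub₀, hp] at h1 ⊢
    rw [h1]
    field_simp
    ring
  · have h1 := dn_succ_qpar' (hm (1, 1))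
    have h2 := dn_mul_qpar_zpow (hm (0, 1))
    simp only [Function.comp_apply, hp] at h1 h2
    simp [monWt, units_apply, h0, zpow_add₀, zpow_sub₀, hp0', hp] at h1 h2 ⊢
    rw [h1]
    rcases h2 with h2 | h2
    · linear_combination (dn p' (m (0, 1)) * qpar p ^ m (0, 0) * q ^ m (1, 1)) * h2 +
        dn p' (m (0, 1)) * qpar p ^ m (0, 0) * (qpar p' ^ m (0, 1))⁻¹ * dn p' (m (1, 1)) *
          mul_inv_cancel₀ hp0'
    · simp [h2]

theorem rowF_colE_local (hx : Function.Injective x) (hp : HasPar η x p p') :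
    Commute (lmon η x (fun _ => 1) [(1, 1)] [(1, 0)] +
        lmon η x (fun m => qpar p ^ (-m (1, 0)) * qpar p' ^ m (1, 1)) [(0, 1)] [(0, 0)])
      (lmon η x (fun _ => 1) [(0, 0)] [(1, 0)] +
        lmon η x (fun m => q ^ (m (0, 0) - m (1, 0))) [(0, 1)] [(1, 1)]) := by
  have h0 := q_ne_zero
  have hp0 := qpar_ne_zero p
  have hp0' := qpar_ne_zero p'
  refine commute_add_add (lmon_comm hx 1 (by decide) fun m hm hm' => ?_)
    (lmon_comm hx 1 (by decide) fun m hm hm' => ?_)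
    (lmon_qcomm (h := fun m => -(q * q ^ (m (0, 0) - m (1, 0)) * qpar p' ^ m (1, 1)))
      (C'' := [(0, 1)]) (A'' := [(1, 0)]) hx 1 (by decide) fun m hm hm' => ?_)
    ((lmon_qcomm hx 1 (by decide) fun m hm hm' => ?_).trans (lmon_neg _ _ _))
  · simp [monWt, units_apply, mul_comm]
  · have h1 := qpar_of_add_two (hm (0, 1)).1 (by simpa [units_apply] using (hm' (0, 1)).2)
    simp [monWt, units_apply, zpow_add₀, zpow_sub₀, h0, hp0', hp] at h1 ⊢
    rw [h1]
    field_simp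
  · have h1 := dn_succ' (hm (1, 1))
    simp [monWt, units_apply, h0, zpow_add₀, zpow_sub₀, hp] at h1 ⊢
    rw [h1]
    field_simp
    ring
  · have h1 := dn_succ_qpar' (hm (0, 0))
    have h2 := dn_mul_qpar_zpow (hm (1, 0))
    simp only [Function.comp_apply, hp] at h1 h2
    simp [monWt, units_apply, h0, zpow_add₀, zpow_sub₀, hp0, hp] at h1 h2 ⊢
    rw [h1]
    rcases h2 with h2 | h2
    · linear_combination (dn p (m (1, 0)) * qpar p' ^ m (1, 1) * q ^ m (0, 0)) * h2 +
        dn p (m (1, 0)) * qpar p' ^ m (1, 1) * (qpar p ^ m (1, 0))⁻¹ * dn p (m (0, 0)) *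
          mul_inv_cancel₀ hp0
    · simp [h2]

theorem rowF_colF_local (hx : Function.Injective x) (hp : HasPar η x p p') :
    Commute (lmon η x (fun _ => 1) [(1, 1)] [(1, 0)] +
        lmon η x (fun m => qpar p ^ (-m (1, 0)) * qpar p' ^ m (1, 1)) [(0, 1)] [(0, 0)])
      (lmon η x (fun _ => 1) [(1, 1)] [(0, 1)] +
        lmon η x (fun m => q ^ (m (1, 1) - m (0, 1))) [(1, 0)] [(0, 0)]) := by
  have h0 := q_ne_zero
  have hp0 := qpar_ne_zero p
  have hp0' := qpar_ne_zero p'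
  refine commute_add_add (lmon_comm hx 1 (by decide) fun m hm hm' => ?_)
    (lmon_comm hx 1 (by decide) fun m hm hm' => ?_)
    (lmon_qcomm (h := fun m => q ^ (m (1, 1) - m (0, 1)) * qpar p ^ (-m (1, 0)))
      (C'' := [(1, 1)]) (A'' := [(0, 0)]) hx 1 (by decide) fun m hm hm' => ?_)
    ((lmon_qcomm hx 1 (by decide) fun m hm hm' => ?_).trans (lmon_neg _ _ _))
  · simp [monWt, units_apply, mul_comm]
  · have h1 := dn_mul_dn (hm (0, 0))
    simp only [Function.comp_apply, hp] at h1
    simp [monWt, units_apply, zpow_add₀, zpow_sub₀, h0, hp0, hp] at h1 ⊢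
    field_simp
    grind
  · have h1 := dn_succ (hm (1, 0))
    simp [monWt, units_apply, h0, zpow_add₀, zpow_sub₀, hp] at h1 ⊢
    rw [h1]
    field_simp
    ring
  · have h1 := dn_succ_qpar (hm (0, 1))
    have h2 := qpar_zpow_of_succ (hm (1, 1)).1 (by simpa [units_apply] using (hm' (1, 1)).2)
    simp [monWt, units_apply, h0, zpow_add₀, zpow_sub₀, hp0', hp] at h1 h2 ⊢
    rw [h1, h2]
    field_simp
    ring

end howe

/-! ### The node `0` in two rows -/

section so
theorem q_sq_sub_one_ne_zero : q ^ 2 - 1 ≠ 0 := by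
  intro h
  have h0 := q_ne_zero
  apply q_sub_inv_ne_zero
  field_simp
  simpa using h

variable {σ : Type} {η : σ → Fin 2}

section typeC
variable {x : Fin 2 → σ}

/-- At a site of parity `0` the entry is not bounded above, and the weight `[m] [m - 1]` excludes
negative entries. -/
theorem admissible_lower_two {τ : Type} [DecidableEq τ] {ζ : τ → Fin 2} {s : τ} (h : ζ s = 0)
    (g : (τ → ℤ) → 𝕂) :
    Admissible ζ (fun m => g m * (qInt (m s) * qInt (m s - 1))) (units [] - units [s, s]) := by
  have hv : ∀ y, y ≠ s → (units [] - units [s, s] : τ → ℤ) y = 0 := fun y hy => by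
    simp [units_apply, List.count_cons, hy.symm]
  refine ⟨fun m y h1 h2 => ?_, fun m y h0 h1 h2 => ?_⟩ <;> by_cases hy : y = s
  · subst hy
    simp [units_apply] at h2
    have : m y = 0 ∨ m y = 1 := by omega
    rcases this with h | h <;> simp [h, qInt_zero]
  · rw [hv y hy] at h2; omega
  · rw [hy, h] at h0; exact absurd h0 (by decide)
  · rw [hv y hy] at h2; omega

theorem admissible_raise {τ : Type} [DecidableEq τ] {ζ : τ → Fin 2} (g : (τ → ℤ) → 𝕂)
    (C : List τ) : Admissible ζ g (units C - units []) := by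
  refine ⟨fun m y h1 h2 => ?_, fun m y h0 h1 h2 => ?_⟩ <;>
  · simp only [Pi.sub_apply, units_apply, List.count_nil] at h2
    omega

/-- Two units are removed from one of two rows, in one column of parity `0`. The terms of `f` and of
`-q⁻¹ e k⁻¹` lead to opposite multiples of the removal of one unit from each row. -/
theorem soE_local_typeC (hx : Function.Injective x) (h : ∀ y, η (x y) = 0) (b : 𝕂) :
    Commute (lshift η x (fun m => b * (qInt (m 0) * qInt (m 0 - 1))) (units [] - units [0, 0]) +
        lshift η x (fun m => b * q⁻¹ * q ^ (-m 0 - m 0) * (qInt (m 1) * qInt (m 1 - 1)))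
          (units [] - units [1, 1]))
      (lmon η x (fun _ => 1) [1] [0] + lmon η x (fun m => -q⁻¹ * q ^ (m 1 - m 0)) [0] [1]) := by
  have h0 := q_ne_zero
  have h1 := q_sq_sub_one_ne_zero
  have hA : ∀ (g : (Fin 2 → ℤ) → 𝕂) (s : Fin 2),
      Admissible (η ∘ x) (fun m => g m * (qInt (m s) * qInt (m s - 1)))
      (units [] - units [s, s]) := fun g s => admissible_lower_two (ζ := η ∘ x) (h s) g
  have hB : ∀ (g : (Fin 2 → ℤ) → 𝕂) (s t : Fin 2),
      Admissible (η ∘ x) (monWt (η ∘ x) g [t]) (units [s] - units [t]) :=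
    fun g s t => monWt_admissible _ _ (List.nodup_singleton t)
  refine commute_add_add
    ((lshift_qcomm (g := fun _ => 0) hx (fun _ => rfl) 1 (hA _ _) (hB _ _ _) rfl
      fun m hm hm' => ?_).trans (lshift_zero _ _))
    ((lshift_qcomm (g := fun _ => 0) hx (fun _ => rfl) 1 (hA _ _) (hB _ _ _) rfl
      fun m hm hm' => ?_).trans (lshift_zero _ _))
    (lshift_qcomm (g := fun m => -(b * (q + q⁻¹) * qInt (m 1) * qInt (m 0) * q ^ (m 1 - m 0 - m 0)))
      (u := -units [0, 1]) hx (fun _ => rfl) 1 (hA _ _) (hB _ _ _) (by decide) fun m hm hm' => ?_)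
    ((lshift_qcomm (g := fun m => (-1) *
      -(b * (q + q⁻¹) * qInt (m 1) * qInt (m 0) * q ^ (m 1 - m 0 - m 0)))
      (u := -units [0, 1]) hx (fun _ => rfl) 1 (hA _ _) (hB _ _ _) (by decide)
      fun m hm hm' => ?_).trans ((lshift_smul _ _ _ _).trans (neg_one_smul _ _)))
  all_goals
    simp [monWt, units_apply, h, dn_zero, zpow_add₀, zpow_sub₀, qInt, h0]
    try field_simp
    try ring

theorem soF_local_typeC (hx : Function.Injective x) (h : ∀ y, η (x y) = 0) :
    Commute (lshift η x (fun m => q * q ^ (m 1 + m 1)) (units [0, 0] - units []) +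
        lshift η x (fun _ => 1) (units [1, 1] - units []))
      (lmon η x (fun m => -q⁻¹ * q ^ (m 1 - m 0)) [0] [1] + lmon η x (fun _ => 1) [1] [0]) := by
  have h0 := q_ne_zero
  have h1 := q_sq_sub_one_ne_zero
  have hA : ∀ (g : (Fin 2 → ℤ) → 𝕂) C, Admissible (η ∘ x) g (units C - units []) := admissible_raise
  have hB : ∀ (g : (Fin 2 → ℤ) → 𝕂) (s t : Fin 2),
      Admissible (η ∘ x) (monWt (η ∘ x) g [t]) (units [s] - units [t]) :=
    fun g s t => monWt_admissible _ _ (List.nodup_singleton t)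
  refine commute_add_add
    ((lshift_qcomm (g := fun _ => 0) hx (fun _ => rfl) 1 (hA _ _) (hB _ _ _) rfl
      fun m hm hm' => ?_).trans (lshift_zero _ _))
    ((lshift_qcomm (g := fun _ => 0) hx (fun _ => rfl) 1 (hA _ _) (hB _ _ _) rfl
      fun m hm hm' => ?_).trans (lshift_zero _ _))
    (lshift_qcomm (g := fun m => -((q + q⁻¹) * q * q ^ (m 1 + m 1 - m 0)))
      (u := units [0, 1]) hx (fun _ => rfl) 1 (hA _ _) (hB _ _ _) (by decide) fun m hm hm' => ?_)
    ((lshift_qcomm (g := fun m => (-1) * -((q + q⁻¹) * q * q ^ (m 1 + m 1 - m 0)))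
      (u := units [0, 1]) hx (fun _ => rfl) 1 (hA _ _) (hB _ _ _) (by decide)
      fun m hm hm' => ?_).trans ((lshift_smul _ _ _ _).trans (neg_one_smul _ _)))
  all_goals
    simp [monWt, units_apply, h, dn_zero, zpow_add₀, zpow_sub₀, qInt, h0]
    try field_simp
    try ring
end typeC

section typeD
variable {x : Fin 2 × Fin 2 → σ} {p' : Fin 2}

/-- Two units, one in each column, are removed from one of two rows. At parity `1` in the first
column and arbitrary parity in the second one this commutes with `f - q⁻¹ e k⁻¹`, already for the
pairs of terms which move a unit in opposite columns and directions. -/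
theorem soE_local_typeD (hx : Function.Injective x) (hp : HasPar η x 1 p') :
    Commute (lmon η x (fun _ => 1) [] [(0, 0), (0, 1)] +
        lmon η x (fun m => q⁻¹ * qpar 1 ^ (-m (0, 0)) * qpar p' ^ (-m (0, 1))) [] [(1, 0), (1, 1)])
      ((lmon η x (fun m => q ^ (-(m (0, 1) - m (1, 1)))) [(1, 0)] [(0, 0)] +
        lmon η x (fun m => -q⁻¹ * q ^ (-(m (0, 1) - m (1, 1)))) [(0, 1)] [(1, 1)]) +
       (lmon η x (fun _ => 1) [(1, 1)] [(0, 1)] +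
        lmon η x (fun m => -q⁻¹ * q ^ (-(m (0, 0) - m (1, 0)) - (m (0, 1) - m (1, 1))))
          [(0, 0)] [(1, 0)])) := by
  have h0 := q_ne_zero
  have hp1 := qpar_ne_zero 1
  have hp0' := qpar_ne_zero p'
  have d0 : dn 1 0 = 0 := by simp [dn, qInt_zero]
  have d1 : dn 1 1 = 1 := by simp [dn, qInt_one]
  have d2 : dn 1 2 = 0 := by simp [dn]
  refine Commute.add_right
   (commute_add_add (lmon_comm hx 1 (by decide) fun m hm hm' => ?_)
    (lmon_comm hx 1 (by decide) fun m hm hm' => ?_)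
    (lmon_qcomm (h := fun m => -(q⁻¹ * q ^ m (1, 1) * (q ^ m (0, 1))⁻¹ * (qpar p' ^ m (0, 1))⁻¹))
      (C'' := []) (A'' := [(0, 0), (1, 1)]) hx 1 (by decide) fun m hm hm' => ?_)
    ((lmon_qcomm hx 1 (by decide) fun m hm hm' => ?_).trans (lmon_neg _ _ _)))
   (commute_add_add (lmon_comm hx 1 (by decide) fun m hm hm' => ?_)
    (lmon_comm hx 1 (by decide) fun m hm hm' => ?_)
    (lmon_qcomm (h := fun m => -(q ^ m (1, 1) * (q ^ m (0, 1))⁻¹ * (qpar 1 ^ m (0, 0))⁻¹))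
      (C'' := []) (A'' := [(0, 1), (1, 0)]) hx 1 (by decide) fun m hm hm' => ?_)
    ((lmon_qcomm hx 1 (by decide) fun m hm hm' => ?_).trans (lmon_neg _ _ _)))
  · have h3 := hm (0, 0)
    simp [hp] at h3
    obtain h3 | h3 : m (0, 0) = 0 ∨ m (0, 0) = 1 := by omega
    all_goals simp [monWt, units_apply, hp, h3, d0]
  · have h1 := dn_mul_dn (hm (1, 1))
    simp only [Function.comp_apply, hp] at h1
    simp [monWt, units_apply, zpow_add₀, zpow_sub₀, h0, hp1, hp0', hp] at h1 ⊢
    field_simp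
    grind
  · have h1 := dn_succ (hm (0, 1))
    simp [monWt, units_apply, h0, zpow_add₀, zpow_sub₀, hp] at h1 ⊢
    rw [h1]
    field_simp
    ring
  · have h2 := hm (1, 0)
    have h3 := hm (0, 0)
    simp [hp] at h2 h3
    obtain h2 | h2 : m (1, 0) = 0 ∨ m (1, 0) = 1 := by omega
    all_goals
    obtain h3 | h3 : m (0, 0) = 0 ∨ m (0, 0) = 1 := by omega
    all_goals
      simp [monWt, units_apply, h0, zpow_add₀, zpow_sub₀, hp, h2, h3, d0, d1, d2, qpar_one]
      try field_simp
      try ring_nf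
      try simp [d2]
  · simp [monWt, units_apply, hp]
    ring
  · have h3 := hm (1, 0)
    simp [hp] at h3
    obtain h3 | h3 : m (1, 0) = 0 ∨ m (1, 0) = 1 := by omega
    all_goals simp [monWt, units_apply, hp, h3, d0]
  · have h2 := hm (1, 0)
    have h3 := hm (0, 0)
    simp [hp] at h2 h3
    obtain h2 | h2 : m (1, 0) = 0 ∨ m (1, 0) = 1 := by omega
    all_goals
    obtain h3 | h3 : m (0, 0) = 0 ∨ m (0, 0) = 1 := by omega
    all_goals
      simp [monWt, units_apply, h0, zpow_add₀, zpow_sub₀, hp, h2, h3, d0, d1, d2, qpar_one]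
      try field_simp
      try ring_nf
      try simp [d2]
  · have h1 := dn_succ_qpar' (hm (1, 1))
    have h2 := dn_mul_qpar_zpow (hm (0, 1))
    simp only [Function.comp_apply, hp] at h1 h2
    simp [monWt, units_apply, h0, zpow_add₀, zpow_sub₀, hp1, hp0', hp] at h1 h2 ⊢
    rw [h1]
    rcases h2 with h2 | h2
    · have h3 : (qpar p' ^ m (0, 1))⁻¹ = q * (q ^ m (0, 1))⁻¹ * (qpar p')⁻¹ := by
        rw [← h2]; field_simp
      rw [h3]
      field_simp
      ring
    · simp [h2]

theorem soF_local_typeD (hx : Function.Injective x) (hp : HasPar η x 1 p') :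
    Commute (lmon η x (fun m => q * qpar 1 ^ m (1, 0) * qpar p' ^ m (1, 1)) [(0, 0), (0, 1)] [] +
        lmon η x (fun _ => 1) [(1, 0), (1, 1)] [])
      ((lmon η x (fun m => -q⁻¹ * q ^ (-(m (0, 1) - m (1, 1)))) [(0, 1)] [(1, 1)] +
        lmon η x (fun m => q ^ (-(m (0, 1) - m (1, 1)))) [(1, 0)] [(0, 0)]) +
       (lmon η x (fun m => -q⁻¹ * q ^ (-(m (0, 0) - m (1, 0)) - (m (0, 1) - m (1, 1))))
          [(0, 0)] [(1, 0)] + lmon η x (fun _ => 1) [(1, 1)] [(0, 1)])) := by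
  have h0 := q_ne_zero
  have hp1 := qpar_ne_zero 1
  have hp0' := qpar_ne_zero p'
  have d0 : dn 1 0 = 0 := by simp [dn, qInt_zero]
  have d1 : dn 1 1 = 1 := by simp [dn, qInt_one]
  have d2 : dn 1 2 = 0 := by simp [dn]
  refine Commute.add_right
   (commute_add_add (lmon_comm hx 1 (by decide) fun m hm hm' => ?_)
    (lmon_comm hx 1 (by decide) fun m hm hm' => ?_)
    (lmon_qcomm (h := fun m => -(q ^ m (1, 1) * (q ^ m (0, 1))⁻¹ * qpar p' ^ m (1, 1)))
      (C'' := [(1, 0), (0, 1)]) (A'' := []) hx 1 (by decide) fun m hm hm' => ?_)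
    ((lmon_qcomm hx 1 (by decide) fun m hm hm' => ?_).trans (lmon_neg _ _ _)))
   (commute_add_add (lmon_comm hx 1 (by decide) fun m hm hm' => ?_)
    (lmon_comm hx 1 (by decide) fun m hm hm' => ?_)
    (lmon_qcomm (h := fun m => -(q * q ^ m (1, 1) * (q ^ m (0, 1))⁻¹ * qpar 1 ^ m (1, 0)))
      (C'' := [(0, 0), (1, 1)]) (A'' := []) hx 1 (by decide) fun m hm hm' => ?_)
    ((lmon_qcomm hx 1 (by decide) fun m hm hm' => ?_).trans (lmon_neg _ _ _)))
  · have h1 := qpar_of_add_two (hm (0, 1)).1 (by simpa [units_apply] using (hm' (0, 1)).2)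
    simp [monWt, units_apply, zpow_add₀, zpow_sub₀, h0, hp1, hp0', hp] at h1 ⊢
    rw [h1]
    field_simp
  · exfalso
    have h2 := (hm (1, 0)).1
    have h3 := (hm' (1, 0)).2
    simp [hp, units_apply] at h2 h3
    omega
  · have h2 := hm (1, 0)
    have h3 := hm (0, 0)
    have h4 := (hm' (1, 0)).2
    simp [hp, units_apply] at h2 h3 h4
    obtain h2 : m (1, 0) = 0 := by omega
    obtain h3 | h3 : m (0, 0) = 0 ∨ m (0, 0) = 1 := by omega
    all_goals
      simp [monWt, units_apply, h0, zpow_add₀, zpow_sub₀, hp, h2, h3, d0, d1, d2, qpar_one]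
      try field_simp
      try simp [d2]
  · have h1 := dn_succ' (hm (1, 1))
    simp [monWt, units_apply, h0, zpow_add₀, zpow_sub₀, hp] at h1 ⊢
    rw [h1]
    field_simp
    ring
  · exfalso
    have h2 := (hm (0, 0)).1
    have h3 := (hm' (0, 0)).2
    simp [hp, units_apply] at h2 h3
    omega
  · simp [monWt, units_apply]
  · have h1 := dn_succ_qpar (hm (0, 1))
    have h2 := qpar_zpow_of_succ (hm (1, 1)).1 (by simpa [units_apply] using (hm' (1, 1)).2)
    simp [monWt, units_apply, h0, zpow_add₀, zpow_sub₀, hp0', hp] at h1 h2 ⊢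
    rw [h1, h2]
    field_simp
    ring
  · have h2 := hm (1, 0)
    have h3 := (hm (0, 0)).1
    have h4 := (hm' (0, 0)).2
    simp [hp, units_apply] at h2 h3 h4
    obtain h3 : m (0, 0) = 0 := by omega
    obtain h2 | h2 : m (1, 0) = 0 ∨ m (1, 0) = 1 := by omega
    all_goals
      simp [monWt, units_apply, h0, zpow_add₀, zpow_sub₀, hp, h2, h3, d0, d1, d2, qpar_one]
      try field_simp
      try simp [d2]
end typeD
end so

/-! ### The node `0` of type `D` in two and four rows -/

section bracket
variable {A : Type*} [Ring A] [Algebra 𝕂 A]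

theorem qBracket_add_right {a : 𝕂} {u v v' w w' : A} (h : qBracket a u v = w)
    (h' : qBracket a u v' = w') : qBracket a u (v + v') = w + w' := by
  rw [← h, ← h', qBracket, qBracket, qBracket, mul_add, add_mul, smul_add]
  abel

theorem qBracket_add_left {a : 𝕂} {u u' v w w' : A} (h : qBracket a u v = w)
    (h' : qBracket a u' v = w') : qBracket a (u + u') v = w + w' := by
  rw [← h, ← h', qBracket, qBracket, qBracket, mul_add, add_mul, smul_add]
  abel

end bracket

section sp
variable {σ ρ : Type} [DecidableEq ρ] (η : σ → Fin 2) (x : ρ × Fin 2 → σ) (p : Fin 2)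

/-- The part in two columns of the operator of `e` for the rows `i` and `j`. -/
def colPairE (i j : ρ) : Module.End 𝕂 (ConfSpace η) :=
  lmon η x (fun _ => 1) [(i, 0)] [(j, 0)] +
    lmon η x (fun m => q ^ (m (i, 0) - m (j, 0))) [(i, 1)] [(j, 1)]

/-- The part in two columns of the operator of `f` for the rows `i` and `j`. -/
def colPairF (i j : ρ) : Module.End 𝕂 (ConfSpace η) :=
  lmon η x (fun m => q ^ (-(m (i, 1) - m (j, 1)))) [(j, 0)] [(i, 0)] +
    lmon η x (fun _ => 1) [(j, 1)] [(i, 1)]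

/-- The part in two columns of the operator of `k⁻¹` for the rows `i` and `j`. -/
def colPairK (i j : ρ) : Module.End 𝕂 (ConfSpace η) :=
  lmon η x (fun m => q ^ (-(m (i, 0) - m (j, 0)) - (m (i, 1) - m (j, 1)))) [] []

/-- The operator of `e_0` in type `D` for the pair of rows `i` and `j`, with parities `0` and `p`
in the two columns, times a diagonal operator. -/
def lowerPair (g : (ρ × Fin 2 → ℤ) → 𝕂) (i j : ρ) : Module.End 𝕂 (ConfSpace η) :=
  lmon η x (fun m => g m) [] [(i, 1), (j, 0)] +
    lmon η x (fun m => -q⁻¹ * g m * q ^ (-m (j, 0)) * qpar p ^ (-m (i, 1))) [] [(i, 0), (j, 1)]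

/-- The operator of `f_0` in type `D` for the pair of rows `i` and `j`, with parities `0` and `p`
in the two columns, times a diagonal operator. -/
def raisePair (g : (ρ × Fin 2 → ℤ) → 𝕂) (i j : ρ) : Module.End 𝕂 (ConfSpace η) :=
  lmon η x (fun m => -q * g m * q ^ m (i, 0) * qpar p ^ m (j, 1)) [(i, 1), (j, 0)] [] +
    lmon η x (fun m => g m) [(i, 0), (j, 1)] []

end sp

section levi
variable {σ : Type} {η : σ → Fin 2} {x : Fin 2 × Fin 2 → σ} {p : Fin 2}

/-- A pair of units, one in each row and each column, is removed in a way which is invariant under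
moves between the two rows: a `q`-determinant of the annihilation operators. -/
theorem lowerPair_colPairE (hx : Function.Injective x) (hp : HasPar η x 0 p) :
    Commute (lowerPair η x p (fun _ => 1) 0 1) (colPairE η x 0 1) := by
  have h0 := q_ne_zero
  have hp0 := qpar_ne_zero p
  rw [lowerPair, colPairE]
  refine commute_add_add (lmon_comm hx 1 (by decide) fun m hm hm' => ?_)
    (lmon_comm hx 1 (by decide) fun m hm hm' => ?_)
    (lmon_qcomm (h := fun m => q ^ (m (0, 0) - m (1, 0)) * qpar p ^ (-m (0, 1))) (C'' := [])
    (A'' := [(1, 0), (1, 1)]) hx 1 (by decide) fun m hm hm' => ?_)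
    ((lmon_qcomm hx 1 (by decide) fun m hm hm' => ?_).trans (lmon_neg _ _ _))
  · simp [monWt, units_apply, zpow_add₀, zpow_sub₀, h0, hp0, hp, dn_zero, qpar_zero]
    ring
  · have g := dn_mul_dn (hm (1, 1))
    simp only [Function.comp_apply, hp] at g
    simp [monWt, units_apply, zpow_add₀, zpow_sub₀, h0, hp0, hp, dn_zero, qpar_zero] at g ⊢
    field_simp
    grind
  · have g0 := dn_succ (hm (0, 1))
    simp [monWt, units_apply, zpow_add₀, zpow_sub₀, h0, hp0, hp, dn_zero, qpar_zero] at g0 ⊢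
    rw [g0]
    field_simp
    ring
  · have g0 := dn_succ' (hm (0, 0))
    simp [monWt, units_apply, zpow_add₀, zpow_sub₀, h0, hp0, hp, dn_zero, qpar_zero] at g0 ⊢
    rw [g0]
    field_simp
    ring

theorem lowerPair_colPairF (hx : Function.Injective x) (hp : HasPar η x 0 p) :
    Commute (lowerPair η x p (fun _ => 1) 0 1) (colPairF η x 0 1) := by
  have h0 := q_ne_zero
  have hp0 := qpar_ne_zero p
  rw [lowerPair, colPairF, add_comm (lmon η x _ _ _) (lmon η x _ [(1, 1)] _)]
  refine commute_add_add (lmon_comm hx 1 (by decide) fun m hm hm' => ?_)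
    (lmon_comm hx 1 (by decide) fun m hm hm' => ?_)
    (lmon_qcomm (h := fun m => q ^ (m (1, 1) - m (0, 1) - m (1, 0))) (C'' := [])
    (A'' := [(0, 0), (0, 1)]) hx 1 (by decide) fun m hm hm' => ?_)
    ((lmon_qcomm hx 1 (by decide) fun m hm hm' => ?_).trans (lmon_neg _ _ _))
  · simp [monWt, units_apply, zpow_add₀, zpow_sub₀, h0, hp0, hp, dn_zero, qpar_zero]
    ring
  · simp [monWt, units_apply, zpow_add₀, zpow_sub₀, h0, hp0, hp, dn_zero, qpar_zero]
    ring
  · have g0 := dn_succ (hm (1, 0))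
    simp [monWt, units_apply, zpow_add₀, zpow_sub₀, h0, hp0, hp, dn_zero, qpar_zero] at g0 ⊢
    rw [g0]
    field_simp
    ring
  · have g := dn_succ_qpar' (hm (1, 1))
    have h2 := dn_mul_qpar_zpow (hm (0, 1))
    simp only [Function.comp_apply, hp] at h2
    simp [monWt, units_apply, zpow_add₀, zpow_sub₀, h0, hp0, hp, dn_zero, qpar_zero] at g h2 ⊢
    rw [g]
    rcases h2 with h2 | h2
    · have h3 : (qpar p ^ m (0, 1))⁻¹ = q * (q ^ m (0, 1))⁻¹ * (qpar p)⁻¹ := by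
        rw [← h2]
        field_simp
      rw [h3]
      field_simp
      ring
    · simp [h2]

/-- The analogue for creation operators of `lowerPair_colPairE`. -/
theorem raisePair_colPairE (hx : Function.Injective x) (hp : HasPar η x 0 p) :
    Commute (raisePair η x p (fun _ => 1) 0 1) (colPairE η x 0 1) := by
  have h0 := q_ne_zero
  have hp0 := qpar_ne_zero p
  rw [raisePair, colPairE, add_comm (lmon η x _ _ _) (lmon η x _ [(0, 1)] _)]
  refine commute_add_add (lmon_comm hx 1 (by decide) fun m hm hm' => ?_)
    (lmon_comm hx 1 (by decide) fun m hm hm' => ?_)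
    (lmon_qcomm (h := fun m => q * q ^ (m (0, 0) - m (1, 0)) * qpar p ^ m (1, 1))
    (C'' := [(0, 0), (0, 1)]) (A'' := []) hx 1 (by decide) fun m hm hm' => ?_)
    ((lmon_qcomm hx 1 (by decide) fun m hm hm' => ?_).trans (lmon_neg _ _ _))
  · have g := qpar_of_add_two (hm (0, 1)).1 (by simpa [units_apply] using (hm' (0, 1)).2)
    simp [monWt, units_apply, zpow_add₀, zpow_sub₀, h0, hp0, hp, dn_zero, qpar_zero] at g ⊢
    rw [g]
    field_simp
  · simp [monWt, units_apply, zpow_add₀, zpow_sub₀, h0, hp0, hp, dn_zero, qpar_zero]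
  · have g0 := dn_succ (hm (1, 0))
    simp [monWt, units_apply, zpow_add₀, zpow_sub₀, h0, hp0, hp, dn_zero, qpar_zero] at g0 ⊢
    rw [g0]
    field_simp
    ring
  · have g0 := dn_succ' (hm (1, 1))
    simp [monWt, units_apply, zpow_add₀, zpow_sub₀, h0, hp0, hp, dn_zero, qpar_zero] at g0 ⊢
    rw [g0]
    field_simp
    ring

theorem raisePair_colPairF (hx : Function.Injective x) (hp : HasPar η x 0 p) :
    Commute (raisePair η x p (fun _ => 1) 0 1) (colPairF η x 0 1) := by
  have h0 := q_ne_zero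
  have hp0 := qpar_ne_zero p
  rw [raisePair, colPairF]
  refine commute_add_add (lmon_comm hx 1 (by decide) fun m hm hm' => ?_)
    (lmon_comm hx 1 (by decide) fun m hm hm' => ?_)
    (lmon_qcomm (h := fun m => q * q ^ (m (0, 0) - m (0, 1)) * qpar p ^ m (1, 1))
    (C'' := [(1, 0), (1, 1)]) (A'' := []) hx 1 (by decide) fun m hm hm' => ?_)
    ((lmon_qcomm hx 1 (by decide) fun m hm hm' => ?_).trans (lmon_neg _ _ _))
  · simp [monWt, units_apply, zpow_add₀, zpow_sub₀, h0, hp0, hp, dn_zero, qpar_zero]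
    ring
  · simp [monWt, units_apply, zpow_add₀, zpow_sub₀, h0, hp0, hp, dn_zero, qpar_zero]
  · have g0 := dn_succ_qpar (hm (0, 1))
    simp [monWt, units_apply, zpow_add₀, zpow_sub₀, h0, hp0, hp, dn_zero, qpar_zero] at g0 ⊢
    rw [g0]
    field_simp
    ring
  · have g := dn_succ' (hm (0, 0))
    have h2 := qpar_zpow_of_succ (hm (1, 1)).1 (by simpa [units_apply] using (hm' (1, 1)).2)
    simp only [Function.comp_apply, hp] at h2
    simp [monWt, units_apply, zpow_add₀, zpow_sub₀, h0, hp0, hp, dn_zero, qpar_zero] at g h2 ⊢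
    rw [g, h2]
    field_simp
    ring

end levi

section two
variable {σ : Type} {η : σ → Fin 2} {x : Fin 4 × Fin 2 → σ} {p : Fin 2}

theorem lowerPair_colPairF_middle (hx : Function.Injective x) (hp : HasPar η x 0 p) :
    qBracket 1 (lowerPair η x p (fun _ => 1) 0 1) (colPairF η x 1 2) = 0 := by
  have h0 := q_ne_zero
  have hp0 := qpar_ne_zero p
  rw [lowerPair, colPairF]
  refine (qBracket_add_left (qBracket_add_right (lmon_comm hx _ (by decide) fun m hm hm' => ?_)
    (lmon_comm hx _ (by decide) fun m hm hm' => ?_))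
    (qBracket_add_right (lmon_comm hx _ (by decide) fun m hm hm' => ?_)
    (lmon_comm hx _ (by decide) fun m hm hm' => ?_))).trans ?_
  · simp [monWt, units_apply, zpow_add₀, zpow_sub₀, h0, hp0, hp, dn_zero, qpar_zero]
    ring
  · simp [monWt, units_apply, zpow_add₀, zpow_sub₀, h0, hp0, hp, dn_zero, qpar_zero]
    ring
  · simp [monWt, units_apply, zpow_add₀, zpow_sub₀, h0, hp0, hp, dn_zero, qpar_zero]
    field_simp
  · simp [monWt, units_apply, zpow_add₀, zpow_sub₀, h0, hp0, hp, dn_zero, qpar_zero]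
    ring
  · simp

/-- The weight is the one which `e_0` on the rows `2`, `3` inherits from the group-like factor on
the rows `0`, `1`. -/
theorem lowerPair_colPairE_middle (hx : Function.Injective x) (hp : HasPar η x 0 p) :
    qBracket q⁻¹ (lowerPair η x p
      (fun m => q⁻¹ * q⁻¹ * q ^ (-m (0, 0)) * qpar p ^ (-m (0, 1)) * q ^ (-m (1, 0)) *
      qpar p ^ (-m (1, 1))) 2 3) (colPairE η x 1 2) = 0 := by
  have h0 := q_ne_zero
  have hp0 := qpar_ne_zero p
  rw [lowerPair, colPairE]
  refine (qBracket_add_left (qBracket_add_right (lmon_comm hx _ (by decide) fun m hm hm' => ?_)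
    (lmon_comm hx _ (by decide) fun m hm hm' => ?_))
    (qBracket_add_right (lmon_comm hx _ (by decide) fun m hm hm' => ?_)
    (lmon_comm hx _ (by decide) fun m hm hm' => ?_))).trans ?_
  · simp [monWt, units_apply, zpow_add₀, zpow_sub₀, h0, hp0, hp, dn_zero, qpar_zero]
    ring
  · have g := dn_mul_dn (hm (2, 1))
    simp only [Function.comp_apply, hp] at g
    simp [monWt, units_apply, zpow_add₀, zpow_sub₀, h0, hp0, hp, dn_zero, qpar_zero] at g ⊢
    field_simp
    grind
  · simp [monWt, units_apply, zpow_add₀, zpow_sub₀, h0, hp0, hp, dn_zero, qpar_zero]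
    ring
  · simp [monWt, units_apply, zpow_add₀, zpow_sub₀, h0, hp0, hp, dn_zero, qpar_zero]
    field_simp
  · simp

/-- The bracket with `e` for the rows `1` and `2` moves the lowered site from row `1` to row `2`;
the third summand arises from the diagonal factors. -/
theorem lower_bracket_one (hx : Function.Injective x) (hp : HasPar η x 0 p) :
    qBracket q (lowerPair η x p (fun _ => 1) 0 1) (colPairE η x 1 2) =
      lmon η x (fun m => q ^ (-m (1, 0))) [] [(0, 1), (2, 0)] +
      lmon η x (fun m => -q⁻¹ * qpar p ^ (-m (0, 1)) * q ^ (-m (2, 0)) * qpar p ^ (-m (1, 1))) []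
        [(0, 0), (2, 1)] +
      lmon η x (fun m => (1 - q⁻¹ * q⁻¹) * qpar p ^ (-m (0, 1)) * q ^ (-m (1, 0))) [(1, 0)]
        [(0, 0), (1, 1), (2, 0)] := by
  have h0 := q_ne_zero
  have hp0 := qpar_ne_zero p
  rw [lowerPair, colPairE]
  refine (qBracket_add_left (qBracket_add_right
    (lmon_qcomm (h := fun m => q ^ (-m (1, 0))) (C'' := []) (A'' := [(0, 1), (2, 0)]) hx _
    (by decide) fun m hm hm' => ?_) (lmon_comm hx _ (by decide) fun m hm hm' => ?_))
    (qBracket_add_right (lmon_qcomm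
    (h := fun m => (1 - q⁻¹ * q⁻¹) * qpar p ^ (-m (0, 1)) * q ^ (-m (1, 0))) (C'' := [(1, 0)])
    (A'' := [(0, 0), (1, 1), (2, 0)]) hx _ (by decide) fun m hm hm' => ?_)
    (lmon_qcomm (h := fun m => -q⁻¹ * qpar p ^ (-m (0, 1)) * q ^ (-m (2, 0)) * qpar p ^ (-m (1, 1)))
    (C'' := []) (A'' := [(0, 0), (2, 1)]) hx _ (by decide) fun m hm hm' => ?_))).trans ?_
  · have g0 := dn_succ (hm (1, 0))
    simp [monWt, units_apply, zpow_add₀, zpow_sub₀, h0, hp0, hp, dn_zero, qpar_zero] at g0 ⊢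
    rw [g0]
    field_simp
    ring
  · simp [monWt, units_apply, zpow_add₀, zpow_sub₀, h0, hp0, hp, dn_zero, qpar_zero]
    field_simp
  · simp [monWt, units_apply, zpow_add₀, zpow_sub₀, h0, hp0, hp, dn_zero, qpar_zero]
    field_simp
    ring
  · have g0 := dn_succ (hm (1, 1))
    simp [monWt, units_apply, zpow_add₀, zpow_sub₀, h0, hp0, hp, dn_zero, qpar_zero] at g0 ⊢
    rw [g0]
    field_simp
    ring
  · abel

/-- The bracket with `e` for the rows `2` and `3`, applied to the result of `lower_bracket_one`. -/
theorem lower_bracket_two (hx : Function.Injective x) (hp : HasPar η x 0 p) :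
    qBracket q⁻¹ (colPairE η x 2 3)
      (lmon η x (fun m => q ^ (-m (1, 0))) [] [(0, 1), (2, 0)] +
      lmon η x (fun m => -q⁻¹ * qpar p ^ (-m (0, 1)) * q ^ (-m (2, 0)) * qpar p ^ (-m (1, 1))) []
      [(0, 0), (2, 1)] + lmon η x
      (fun m => (1 - q⁻¹ * q⁻¹) * qpar p ^ (-m (0, 1)) * q ^ (-m (1, 0))) [(1, 0)]
      [(0, 0), (1, 1), (2, 0)]) =
      lmon η x (fun m => -q⁻¹ * q ^ (-m (1, 0)) * q ^ (-m (2, 0))) [] [(0, 1), (3, 0)] +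
      lmon η x (fun m => q⁻¹ * q⁻¹ * qpar p ^ (-m (0, 1)) * qpar p ^ (-m (1, 1)) *
        qpar p ^ (-m (2, 1)) * q ^ (-m (3, 0))) [] [(0, 0), (3, 1)] +
      lmon η x (fun m => -q⁻¹ * (1 - q⁻¹ * q⁻¹) * qpar p ^ (-m (0, 1)) * qpar p ^ (-m (1, 1)) *
        q ^ (-m (2, 0))) [(2, 0)] [(0, 0), (2, 1), (3, 0)] +
      lmon η x (fun m => -q⁻¹ * (1 - q⁻¹ * q⁻¹) * qpar p ^ (-m (0, 1)) * q ^ (-m (1, 0)) *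
        q ^ (-m (2, 0))) [(1, 0)] [(0, 0), (1, 1), (3, 0)] := by
  have h0 := q_ne_zero
  have hp0 := qpar_ne_zero p
  rw [colPairE]
  refine (qBracket_add_left (qBracket_add_right
    (qBracket_add_right (lmon_qcomm (h := fun m => -q⁻¹ * q ^ (-m (1, 0)) * q ^ (-m (2, 0)))
    (C'' := []) (A'' := [(0, 1), (3, 0)]) hx _ (by decide) fun m hm hm' => ?_)
    (lmon_qcomm (h := fun m => -q⁻¹ * (1 - q⁻¹ * q⁻¹) * qpar p ^ (-m (0, 1)) *
    qpar p ^ (-m (1, 1)) * q ^ (-m (2, 0))) (C'' := [(2, 0)]) (A'' := [(0, 0), (2, 1), (3, 0)]) hx _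
    (by decide) fun m hm hm' => ?_))
    (lmon_qcomm (h := fun m => -q⁻¹ * (1 - q⁻¹ * q⁻¹) * qpar p ^ (-m (0, 1)) * q ^ (-m (1, 0)) *
    q ^ (-m (2, 0))) (C'' := [(1, 0)]) (A'' := [(0, 0), (1, 1), (3, 0)]) hx _ (by decide)
    fun m hm hm' => ?_)) (qBracket_add_right
    (qBracket_add_right (lmon_comm hx _ (by decide) fun m hm hm' => ?_)
    (lmon_qcomm (h := fun m => q⁻¹ * q⁻¹ * qpar p ^ (-m (0, 1)) * qpar p ^ (-m (1, 1)) *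
    qpar p ^ (-m (2, 1)) * q ^ (-m (3, 0))) (C'' := []) (A'' := [(0, 0), (3, 1)]) hx _ (by decide)
    fun m hm hm' => ?_)) (lmon_comm hx _ (by decide) fun m hm hm' => ?_))).trans ?_
  · have g0 := dn_succ (hm (2, 0))
    simp [monWt, units_apply, zpow_add₀, zpow_sub₀, h0, hp0, hp, dn_zero, qpar_zero] at g0 ⊢
    rw [g0]
    field_simp
    ring
  · simp [monWt, units_apply, zpow_add₀, zpow_sub₀, h0, hp0, hp, dn_zero, qpar_zero]
    ring
  · have g0 := dn_succ (hm (2, 0))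
    simp [monWt, units_apply, zpow_add₀, zpow_sub₀, h0, hp0, hp, dn_zero, qpar_zero] at g0 ⊢
    rw [g0]
    field_simp
    ring
  · simp [monWt, units_apply, zpow_add₀, zpow_sub₀, h0, hp0, hp, dn_zero, qpar_zero]
    ring
  · have g0 := dn_succ (hm (2, 1))
    simp [monWt, units_apply, zpow_add₀, zpow_sub₀, h0, hp0, hp, dn_zero, qpar_zero] at g0 ⊢
    rw [g0]
    field_simp
    ring
  · simp [monWt, units_apply, zpow_add₀, zpow_sub₀, h0, hp0, hp, dn_zero, qpar_zero]
    ring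
  · abel

/-- The bracket with `e` for the rows `0` and `1`, applied to the result of `lower_bracket_two`. -/
theorem lower_bracket_three (hx : Function.Injective x) (hp : HasPar η x 0 p) :
    qBracket q⁻¹ (colPairE η x 0 1)
      (lmon η x (fun m => -q⁻¹ * q ^ (-m (1, 0)) * q ^ (-m (2, 0))) [] [(0, 1), (3, 0)] +
      lmon η x (fun m => q⁻¹ * q⁻¹ * qpar p ^ (-m (0, 1)) * qpar p ^ (-m (1, 1)) *
      qpar p ^ (-m (2, 1)) * q ^ (-m (3, 0))) [] [(0, 0), (3, 1)] +
      lmon η x (fun m => -q⁻¹ * (1 - q⁻¹ * q⁻¹) * qpar p ^ (-m (0, 1)) * qpar p ^ (-m (1, 1)) *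
      q ^ (-m (2, 0))) [(2, 0)] [(0, 0), (2, 1), (3, 0)] +
      lmon η x (fun m => -q⁻¹ * (1 - q⁻¹ * q⁻¹) * qpar p ^ (-m (0, 1)) * q ^ (-m (1, 0)) *
      q ^ (-m (2, 0))) [(1, 0)] [(0, 0), (1, 1), (3, 0)]) =
      lmon η x (fun m => q⁻¹ * q⁻¹ * q ^ (-m (0, 0)) * qpar p ^ (-m (0, 1)) * q ^ (-m (2, 0))) []
        [(1, 1), (3, 0)] +
      lmon η x (fun m => -q⁻¹ * (q⁻¹ * q⁻¹ * q ^ (-m (0, 0)) * qpar p ^ (-m (0, 1))) *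
        qpar p ^ (-m (1, 1)) * q ^ (-m (3, 0)) * qpar p ^ (-m (2, 1))) [] [(1, 0), (3, 1)] +
      lmon η x (fun m => (1 - q⁻¹ * q⁻¹) * (q⁻¹ * q⁻¹ * q ^ (-m (0, 0)) * qpar p ^ (-m (0, 1))) *
        qpar p ^ (-m (1, 1)) * q ^ (-m (2, 0))) [(2, 0)] [(1, 0), (2, 1), (3, 0)] := by
  have h0 := q_ne_zero
  have hp0 := qpar_ne_zero p
  have hq := q_sq_sub_one_ne_zero
  rw [colPairE]
  refine (qBracket_add_left (qBracket_add_right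
    (qBracket_add_right (qBracket_add_right (lmon_comm hx _ (by decide) fun m hm hm' => ?_)
    (lmon_qcomm (h := fun m => -q⁻¹ * (q⁻¹ * q⁻¹ * q ^ (-m (0, 0)) * qpar p ^ (-m (0, 1))) *
    qpar p ^ (-m (1, 1)) * q ^ (-m (3, 0)) * qpar p ^ (-m (2, 1))) (C'' := [])
    (A'' := [(1, 0), (3, 1)]) hx _ (by decide) fun m hm hm' => ?_))
    (lmon_qcomm (h := fun m => (1 - q⁻¹ * q⁻¹) *
    (q⁻¹ * q⁻¹ * q ^ (-m (0, 0)) * qpar p ^ (-m (0, 1))) * qpar p ^ (-m (1, 1)) * q ^ (-m (2, 0)))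
    (C'' := [(2, 0)]) (A'' := [(1, 0), (2, 1), (3, 0)]) hx _ (by decide) fun m hm hm' => ?_))
    (lmon_qcomm (h := fun m => q⁻¹ * q⁻¹ * q ^ (-m (0, 0)) * qpar p ^ (-m (0, 1)) *
    q ^ (-m (2, 0)) - q⁻¹ * q⁻¹ * qpar p ^ (-m (0, 1)) *
    q ^ (m (0, 0) - m (1, 0) - m (1, 0) - m (2, 0))) (C'' := []) (A'' := [(1, 1), (3, 0)]) hx _
    (by decide) fun m hm hm' => ?_))
    (qBracket_add_right (qBracket_add_right
    (qBracket_add_right (lmon_qcomm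
    (h := fun m => q⁻¹ * q⁻¹ * qpar p ^ (-m (0, 1)) *
    q ^ (m (0, 0) - m (1, 0) - m (1, 0) - m (2, 0))) (C'' := []) (A'' := [(1, 1), (3, 0)]) hx _
    (by decide) fun m hm hm' => ?_) (lmon_comm hx _ (by decide) fun m hm hm' => ?_))
    (lmon_comm hx _ (by decide) fun m hm hm' => ?_))
    (lmon_comm hx _ (by decide) fun m hm hm' => ?_))).trans ?_
  · simp [monWt, units_apply, zpow_add₀, zpow_sub₀, h0, hp0, hp, dn_zero, qpar_zero]
    ring
  · have g0 := dn_succ (hm (0, 0))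
    simp [monWt, units_apply, zpow_add₀, zpow_sub₀, h0, hp0, hp, dn_zero, qpar_zero] at g0 ⊢
    rw [g0]
    field_simp
    ring
  · have g0 := dn_succ (hm (0, 0))
    simp [monWt, units_apply, zpow_add₀, zpow_sub₀, h0, hp0, hp, dn_zero, qpar_zero] at g0 ⊢
    rw [g0]
    field_simp
    ring
  · simp [monWt, units_apply, zpow_add₀, zpow_sub₀, h0, hp0, hp, dn_zero, qpar_zero]
    simp only [qInt, zpow_add₀ h0, zpow_sub₀ h0, zpow_neg, zpow_one]
    field_simp
    ring
  · have g0 := dn_succ (hm (0, 1))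
    simp [monWt, units_apply, zpow_add₀, zpow_sub₀, h0, hp0, hp, dn_zero, qpar_zero] at g0 ⊢
    rw [g0]
    field_simp
    ring
  · simp [monWt, units_apply, zpow_add₀, zpow_sub₀, h0, hp0, hp, dn_zero, qpar_zero]
    field_simp
  · simp [monWt, units_apply, zpow_add₀, zpow_sub₀, h0, hp0, hp, dn_zero, qpar_zero]
    field_simp
  · have g := dn_mul_dn (hm (1, 1))
    simp only [Function.comp_apply, hp] at g
    simp [monWt, units_apply, zpow_add₀, zpow_sub₀, h0, hp0, hp, dn_zero, qpar_zero] at g ⊢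
    field_simp
    grind
  · rw [lmon_sub]
    abel

/-- The bracket of the lowering operator of the other pair of rows with `f` for the rows `1` and
`2`: up to `q` and `k⁻¹`, the same monomials as in `lower_bracket_three`. -/
theorem lower_bracket_four (hx : Function.Injective x) (hp : HasPar η x 0 p) :
    qBracket 1 (lowerPair η x p
      (fun m => q⁻¹ * q⁻¹ * q ^ (-m (0, 0)) * qpar p ^ (-m (0, 1)) * q ^ (-m (1, 0)) *
      qpar p ^ (-m (1, 1))) 2 3) (colPairF η x 1 2) =
      lmon η x (fun m => q * (q⁻¹ * q⁻¹ * q ^ (-m (0, 0)) * qpar p ^ (-m (0, 1)) *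
        q ^ (-m (2, 0))) * q ^ (-(m (1, 0) - m (2, 0)) - (m (1, 1) - m (2, 1)))) []
        [(1, 1), (3, 0)] +
      lmon η x (fun m => q * (-q⁻¹ * (q⁻¹ * q⁻¹ * q ^ (-m (0, 0)) * qpar p ^ (-m (0, 1))) *
        qpar p ^ (-m (1, 1)) * q ^ (-m (3, 0)) * qpar p ^ (-m (2, 1))) *
        q ^ (-(m (1, 0) - m (2, 0)) - (m (1, 1) - m (2, 1)))) [] [(1, 0), (3, 1)] +
      lmon η x (fun m => q * ((1 - q⁻¹ * q⁻¹) *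
        (q⁻¹ * q⁻¹ * q ^ (-m (0, 0)) * qpar p ^ (-m (0, 1))) * qpar p ^ (-m (1, 1)) *
        q ^ (-m (2, 0))) * q ^ (-(m (1, 0) - m (2, 0)) - (m (1, 1) - m (2, 1)))) [(2, 0)]
        [(1, 0), (2, 1), (3, 0)] := by
  have h0 := q_ne_zero
  have hp0 := qpar_ne_zero p
  rw [lowerPair, colPairF]
  refine (qBracket_add_left (qBracket_add_right
    (lmon_qcomm (h := fun m => q *
    ((1 - q⁻¹ * q⁻¹) * (q⁻¹ * q⁻¹ * q ^ (-m (0, 0)) * qpar p ^ (-m (0, 1))) * qpar p ^ (-m (1, 1)) *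
    q ^ (-m (2, 0))) * q ^ (-(m (1, 0) - m (2, 0)) - (m (1, 1) - m (2, 1)))) (C'' := [(2, 0)])
    (A'' := [(1, 0), (2, 1), (3, 0)]) hx _ (by decide) fun m hm hm' => ?_)
    (lmon_qcomm (h := fun m => q *
    (q⁻¹ * q⁻¹ * q ^ (-m (0, 0)) * qpar p ^ (-m (0, 1)) * q ^ (-m (2, 0))) *
    q ^ (-(m (1, 0) - m (2, 0)) - (m (1, 1) - m (2, 1)))) (C'' := []) (A'' := [(1, 1), (3, 0)]) hx _
    (by decide) fun m hm hm' => ?_))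
    (qBracket_add_right (lmon_qcomm
    (h := fun m => q * (-q⁻¹ * (q⁻¹ * q⁻¹ * q ^ (-m (0, 0)) * qpar p ^ (-m (0, 1))) *
    qpar p ^ (-m (1, 1)) * q ^ (-m (3, 0)) * qpar p ^ (-m (2, 1))) *
    q ^ (-(m (1, 0) - m (2, 0)) - (m (1, 1) - m (2, 1)))) (C'' := []) (A'' := [(1, 0), (3, 1)]) hx _
    (by decide) fun m hm hm' => ?_) (lmon_comm hx _ (by decide) fun m hm hm' => ?_))).trans ?_
  · simp [monWt, units_apply, zpow_add₀, zpow_sub₀, h0, hp0, hp, dn_zero, qpar_zero]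
    field_simp
  · have g := dn_succ_qpar' (hm (2, 1))
    have h2 := dn_mul_qpar_zpow (hm (1, 1))
    simp only [Function.comp_apply, hp] at h2
    simp [monWt, units_apply, zpow_add₀, zpow_sub₀, h0, hp0, hp, dn_zero, qpar_zero] at g h2 ⊢
    rw [g]
    rcases h2 with h2 | h2
    · have h3 : (qpar p ^ m (1, 1))⁻¹ = q * (q ^ m (1, 1))⁻¹ * (qpar p)⁻¹ := by
        rw [← h2]
        field_simp
      rw [h3]
      field_simp
      ring
    · simp [h2]
  · have g0 := dn_succ' (hm (2, 0))
    simp [monWt, units_apply, zpow_add₀, zpow_sub₀, h0, hp0, hp, dn_zero, qpar_zero] at g0 ⊢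
    rw [g0]
    field_simp
    ring
  · simp [monWt, units_apply, zpow_add₀, zpow_sub₀, h0, hp0, hp, dn_zero, qpar_zero]
    field_simp
  · abel

/-- For the rows `0`, `1` and `2`, `3`, the commutator of the second lowering operator with `f` in
the middle is `q` times the iterated bracket of the first one with the three operators `e`, times
`k⁻¹`. -/
theorem lower_bracket_eq (hx : Function.Injective x) (hp : HasPar η x 0 p) :
    qBracket 1 (lowerPair η x p
      (fun m => q⁻¹ * q⁻¹ * q ^ (-m (0, 0)) * qpar p ^ (-m (0, 1)) * q ^ (-m (1, 0)) *
      qpar p ^ (-m (1, 1))) 2 3) (colPairF η x 1 2) =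
      q • (qBracket q⁻¹ (colPairE η x 0 1)
        (qBracket q⁻¹ (colPairE η x 2 3)
        (qBracket q (lowerPair η x p (fun _ => 1) 0 1) (colPairE η x 1 2))) *
        colPairK η x 1 2) := by
  rw [lower_bracket_one hx hp, lower_bracket_two hx hp, lower_bracket_three hx hp,
    lower_bracket_four hx hp, colPairK, add_mul, add_mul, lmon_mul_diag hx (by decide),
    lmon_mul_diag hx (by decide), lmon_mul_diag hx (by decide), smul_add, smul_add,
    ← lmon_smul, ← lmon_smul, ← lmon_smul]
  simp only [mul_assoc]

theorem raisePair_colPairF_middle (hx : Function.Injective x) (hp : HasPar η x 0 p) :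
    qBracket 1 (raisePair η x p (fun _ => 1) 2 3) (colPairF η x 1 2) = 0 := by
  have h0 := q_ne_zero
  have hp0 := qpar_ne_zero p
  rw [raisePair, colPairF]
  refine (qBracket_add_left (qBracket_add_right (lmon_comm hx _ (by decide) fun m hm hm' => ?_)
    (lmon_comm hx _ (by decide) fun m hm hm' => ?_))
    (qBracket_add_right (lmon_comm hx _ (by decide) fun m hm hm' => ?_)
    (lmon_comm hx _ (by decide) fun m hm hm' => ?_))).trans ?_
  · simp [monWt, units_apply, zpow_add₀, zpow_sub₀, h0, hp0, hp, dn_zero, qpar_zero]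
    ring
  · simp [monWt, units_apply, zpow_add₀, zpow_sub₀, h0, hp0, hp, dn_zero, qpar_zero]
    ring
  · simp [monWt, units_apply, zpow_add₀, zpow_sub₀, h0, hp0, hp, dn_zero, qpar_zero]
  · simp [monWt, units_apply, zpow_add₀, zpow_sub₀, h0, hp0, hp, dn_zero, qpar_zero]
  · simp

/-- The weight is the one which `f_0` on the rows `0`, `1` inherits from the group-like factor on
the rows `2`, `3`. -/
theorem raisePair_colPairE_middle (hx : Function.Injective x) (hp : HasPar η x 0 p) :
    qBracket q⁻¹ (raisePair η x p
      (fun m => q * q * q ^ m (2, 0) * qpar p ^ m (2, 1) * q ^ m (3, 0) * qpar p ^ m (3, 1)) 0 1)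
      (colPairE η x 1 2) = 0 := by
  have h0 := q_ne_zero
  have hp0 := qpar_ne_zero p
  rw [raisePair, colPairE]
  refine (qBracket_add_left (qBracket_add_right (lmon_comm hx _ (by decide) fun m hm hm' => ?_)
    (lmon_comm hx _ (by decide) fun m hm hm' => ?_))
    (qBracket_add_right (lmon_comm hx _ (by decide) fun m hm hm' => ?_)
    (lmon_comm hx _ (by decide) fun m hm hm' => ?_))).trans ?_
  · simp [monWt, units_apply, zpow_add₀, zpow_sub₀, h0, hp0, hp, dn_zero, qpar_zero]
    ring
  · simp [monWt, units_apply, zpow_add₀, zpow_sub₀, h0, hp0, hp, dn_zero, qpar_zero]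
    field_simp
  · simp [monWt, units_apply, zpow_add₀, zpow_sub₀, h0, hp0, hp, dn_zero, qpar_zero]
    ring
  · have g := qpar_of_add_two (hm (1, 1)).1 (by simpa [units_apply] using (hm' (1, 1)).2)
    simp [monWt, units_apply, zpow_add₀, zpow_sub₀, h0, hp0, hp, dn_zero, qpar_zero] at g ⊢
    rw [g]
    field_simp
  · simp

/-- The analogue of `lower_bracket_one` for creation operators, with the two pairs of rows
exchanged. -/
theorem raise_bracket_one (hx : Function.Injective x) (hp : HasPar η x 0 p) :
    qBracket q (raisePair η x p (fun _ => 1) 2 3) (colPairE η x 1 2) =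
      lmon η x (fun m => -q * q ^ m (2, 0)) [(1, 0), (3, 1)] [] +
      lmon η x (fun m => q * q * q ^ m (1, 0) * qpar p ^ m (2, 1) * qpar p ^ m (3, 1))
        [(1, 1), (3, 0)] [] +
      lmon η x (fun m => (q * q - 1) * q ^ m (2, 0) * qpar p ^ m (3, 1)) [(1, 0), (2, 1), (3, 0)]
        [(2, 0)] := by
  have h0 := q_ne_zero
  have hp0 := qpar_ne_zero p
  rw [raisePair, colPairE]
  refine (qBracket_add_left (qBracket_add_right
    (lmon_qcomm (h := fun m => (q * q - 1) * q ^ m (2, 0) * qpar p ^ m (3, 1))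
    (C'' := [(1, 0), (2, 1), (3, 0)]) (A'' := [(2, 0)]) hx _ (by decide) fun m hm hm' => ?_)
    (lmon_qcomm (h := fun m => q * q * q ^ m (1, 0) * qpar p ^ m (2, 1) * qpar p ^ m (3, 1))
    (C'' := [(1, 1), (3, 0)]) (A'' := []) hx _ (by decide) fun m hm hm' => ?_))
    (qBracket_add_right (lmon_qcomm (h := fun m => -q * q ^ m (2, 0)) (C'' := [(1, 0), (3, 1)])
    (A'' := []) hx _ (by decide) fun m hm hm' => ?_)
    (lmon_comm hx _ (by decide) fun m hm hm' => ?_))).trans ?_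
  · simp [monWt, units_apply, zpow_add₀, zpow_sub₀, h0, hp0, hp, dn_zero, qpar_zero]
    field_simp
    ring
  · have g0 := dn_succ' (hm (2, 1))
    simp [monWt, units_apply, zpow_add₀, zpow_sub₀, h0, hp0, hp, dn_zero, qpar_zero] at g0 ⊢
    rw [g0]
    field_simp
    ring
  · have g0 := dn_succ' (hm (2, 0))
    simp [monWt, units_apply, zpow_add₀, zpow_sub₀, h0, hp0, hp, dn_zero, qpar_zero] at g0 ⊢
    rw [g0]
    field_simp
    ring
  · simp [monWt, units_apply, zpow_add₀, zpow_sub₀, h0, hp0, hp, dn_zero, qpar_zero]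
    field_simp
  · abel

theorem raise_bracket_two (hx : Function.Injective x) (hp : HasPar η x 0 p) :
    qBracket q⁻¹ (colPairE η x 2 3)
      (lmon η x (fun m => -q * q ^ m (2, 0)) [(1, 0), (3, 1)] [] +
      lmon η x (fun m => q * q * q ^ m (1, 0) * qpar p ^ m (2, 1) * qpar p ^ m (3, 1))
      [(1, 1), (3, 0)] [] + lmon η x (fun m => (q * q - 1) * q ^ m (2, 0) * qpar p ^ m (3, 1))
      [(1, 0), (2, 1), (3, 0)] [(2, 0)]) =
      lmon η x (fun m => -q * q ^ m (3, 0) * qpar p ^ m (3, 1)) [(1, 0), (2, 1)] [] +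
      lmon η x (fun m => q * q * q ^ m (3, 0) * qpar p ^ m (3, 1) * q ^ m (1, 0) *
        qpar p ^ m (2, 1)) [(1, 1), (2, 0)] [] := by
  have h0 := q_ne_zero
  have hp0 := qpar_ne_zero p
  have hq := q_sq_sub_one_ne_zero
  rw [colPairE]
  refine (qBracket_add_left (qBracket_add_right
    (qBracket_add_right (lmon_comm hx _ (by decide) fun m hm hm' => ?_)
    (lmon_qcomm (h := fun m => q * q * q ^ m (3, 0) * qpar p ^ m (3, 1) * q ^ m (1, 0) *
    qpar p ^ m (2, 1)) (C'' := [(1, 1), (2, 0)]) (A'' := []) hx _ (by decide) fun m hm hm' => ?_))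
    (lmon_qcomm (h := fun m => -q * q ^ m (3, 0) * qpar p ^ m (3, 1) - -q * qpar p ^ m (3, 1) *
    q ^ (m (2, 0) + m (2, 0) - m (3, 0))) (C'' := [(1, 0), (2, 1)]) (A'' := []) hx _ (by decide)
    fun m hm hm' => ?_)) (qBracket_add_right
    (qBracket_add_right (lmon_qcomm
    (h := fun m => -q * qpar p ^ m (3, 1) * q ^ (m (2, 0) + m (2, 0) - m (3, 0)))
    (C'' := [(1, 0), (2, 1)]) (A'' := []) hx _ (by decide) fun m hm hm' => ?_)
    (lmon_comm hx _ (by decide) fun m hm hm' => ?_))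
    (lmon_comm hx _ (by decide) fun m hm hm' => ?_))).trans ?_
  · simp [monWt, units_apply, zpow_add₀, zpow_sub₀, h0, hp0, hp, dn_zero, qpar_zero]
    field_simp
  · have g0 := dn_succ' (hm (3, 0))
    simp [monWt, units_apply, zpow_add₀, zpow_sub₀, h0, hp0, hp, dn_zero, qpar_zero] at g0 ⊢
    rw [g0]
    field_simp
    ring
  · simp [monWt, units_apply, zpow_add₀, zpow_sub₀, h0, hp0, hp, dn_zero, qpar_zero]
    simp only [qInt, zpow_add₀ h0, zpow_sub₀ h0, zpow_neg, zpow_one]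
    field_simp
    ring
  · have g0 := dn_succ' (hm (3, 1))
    simp [monWt, units_apply, zpow_add₀, zpow_sub₀, h0, hp0, hp, dn_zero, qpar_zero] at g0 ⊢
    rw [g0]
    field_simp
    ring
  · simp [monWt, units_apply, zpow_add₀, zpow_sub₀, h0, hp0, hp, dn_zero, qpar_zero]
    field_simp
  · have g := qpar_of_add_two (hm (2, 1)).1 (by simpa [units_apply] using (hm' (2, 1)).2)
    simp [monWt, units_apply, zpow_add₀, zpow_sub₀, h0, hp0, hp, dn_zero, qpar_zero] at g ⊢
    rw [g]
    field_simp
  · rw [lmon_sub]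
    abel

theorem raise_bracket_three (hx : Function.Injective x) (hp : HasPar η x 0 p) :
    qBracket q⁻¹ (colPairE η x 0 1)
      (lmon η x (fun m => -q * q ^ m (3, 0) * qpar p ^ m (3, 1)) [(1, 0), (2, 1)] [] +
      lmon η x (fun m => q * q * q ^ m (3, 0) * qpar p ^ m (3, 1) * q ^ m (1, 0) *
      qpar p ^ m (2, 1)) [(1, 1), (2, 0)] []) =
      lmon η x (fun m => -q * (q ^ m (3, 0) * qpar p ^ m (3, 1)) * q ^ m (1, 0)) [(0, 0), (2, 1)]
        [] +
      lmon η x (fun m => q * q * (q ^ m (3, 0) * qpar p ^ m (3, 1)) * q ^ m (0, 0) *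
        qpar p ^ m (1, 1) * qpar p ^ m (2, 1)) [(0, 1), (2, 0)] [] +
      lmon η x (fun m => (q * q - 1) * (q ^ m (3, 0) * qpar p ^ m (3, 1)) * q ^ m (1, 0) *
        qpar p ^ m (2, 1)) [(0, 0), (1, 1), (2, 0)] [(1, 0)] := by
  have h0 := q_ne_zero
  have hp0 := qpar_ne_zero p
  rw [colPairE]
  refine (qBracket_add_left (qBracket_add_right
    (lmon_qcomm (h := fun m => -q * (q ^ m (3, 0) * qpar p ^ m (3, 1)) * q ^ m (1, 0))
    (C'' := [(0, 0), (2, 1)]) (A'' := []) hx _ (by decide) fun m hm hm' => ?_)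
    (lmon_qcomm (h := fun m => (q * q - 1) * (q ^ m (3, 0) * qpar p ^ m (3, 1)) * q ^ m (1, 0) *
    qpar p ^ m (2, 1)) (C'' := [(0, 0), (1, 1), (2, 0)]) (A'' := [(1, 0)]) hx _ (by decide)
    fun m hm hm' => ?_)) (qBracket_add_right (lmon_comm hx _ (by decide) fun m hm hm' => ?_)
    (lmon_qcomm (h := fun m => q * q * (q ^ m (3, 0) * qpar p ^ m (3, 1)) * q ^ m (0, 0) *
    qpar p ^ m (1, 1) * qpar p ^ m (2, 1)) (C'' := [(0, 1), (2, 0)]) (A'' := []) hx _ (by decide)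
    fun m hm hm' => ?_))).trans ?_
  · have g0 := dn_succ' (hm (1, 0))
    simp [monWt, units_apply, zpow_add₀, zpow_sub₀, h0, hp0, hp, dn_zero, qpar_zero] at g0 ⊢
    rw [g0]
    field_simp
    ring
  · simp [monWt, units_apply, zpow_add₀, zpow_sub₀, h0, hp0, hp, dn_zero, qpar_zero]
    field_simp
  · simp [monWt, units_apply, zpow_add₀, zpow_sub₀, h0, hp0, hp, dn_zero, qpar_zero]
    ring
  · have g0 := dn_succ' (hm (1, 1))
    simp [monWt, units_apply, zpow_add₀, zpow_sub₀, h0, hp0, hp, dn_zero, qpar_zero] at g0 ⊢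
    rw [g0]
    field_simp
    ring
  · abel

theorem raise_bracket_four (hx : Function.Injective x) (hp : HasPar η x 0 p) :
    qBracket 1 (raisePair η x p
      (fun m => q * q * q ^ m (2, 0) * qpar p ^ m (2, 1) * q ^ m (3, 0) * qpar p ^ m (3, 1)) 0 1)
      (colPairF η x 1 2) =
      lmon η x (fun m => q * (-q * (q ^ m (3, 0) * qpar p ^ m (3, 1)) * q ^ m (1, 0)) *
        q ^ (-(m (1, 0) - m (2, 0)) - (m (1, 1) - m (2, 1)))) [(0, 0), (2, 1)] [] +
      lmon η x (fun m => q * (q * q * (q ^ m (3, 0) * qpar p ^ m (3, 1)) * q ^ m (0, 0) *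
        qpar p ^ m (1, 1) * qpar p ^ m (2, 1)) *
        q ^ (-(m (1, 0) - m (2, 0)) - (m (1, 1) - m (2, 1)))) [(0, 1), (2, 0)] [] +
      lmon η x (fun m => q * ((q * q - 1) * (q ^ m (3, 0) * qpar p ^ m (3, 1)) * q ^ m (1, 0) *
        qpar p ^ m (2, 1)) * q ^ (-(m (1, 0) - m (2, 0)) - (m (1, 1) - m (2, 1))))
        [(0, 0), (1, 1), (2, 0)] [(1, 0)] := by
  have h0 := q_ne_zero
  have hp0 := qpar_ne_zero p
  rw [raisePair, colPairF]
  refine (qBracket_add_left (qBracket_add_right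
    (lmon_qcomm (h := fun m => q *
    (q * q * (q ^ m (3, 0) * qpar p ^ m (3, 1)) * q ^ m (0, 0) * qpar p ^ m (1, 1) *
    qpar p ^ m (2, 1)) * q ^ (-(m (1, 0) - m (2, 0)) - (m (1, 1) - m (2, 1))))
    (C'' := [(0, 1), (2, 0)]) (A'' := []) hx _ (by decide) fun m hm hm' => ?_)
    (lmon_comm hx _ (by decide) fun m hm hm' => ?_))
    (qBracket_add_right (lmon_qcomm
    (h := fun m => q * ((q * q - 1) * (q ^ m (3, 0) * qpar p ^ m (3, 1)) * q ^ m (1, 0) *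
    qpar p ^ m (2, 1)) * q ^ (-(m (1, 0) - m (2, 0)) - (m (1, 1) - m (2, 1))))
    (C'' := [(0, 0), (1, 1), (2, 0)]) (A'' := [(1, 0)]) hx _ (by decide) fun m hm hm' => ?_)
    (lmon_qcomm (h := fun m => q * (-q * (q ^ m (3, 0) * qpar p ^ m (3, 1)) * q ^ m (1, 0)) *
    q ^ (-(m (1, 0) - m (2, 0)) - (m (1, 1) - m (2, 1)))) (C'' := [(0, 0), (2, 1)]) (A'' := []) hx _
    (by decide) fun m hm hm' => ?_))).trans ?_
  · have g0 := dn_succ (hm (1, 0))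
    simp [monWt, units_apply, zpow_add₀, zpow_sub₀, h0, hp0, hp, dn_zero, qpar_zero] at g0 ⊢
    rw [g0]
    field_simp
    ring
  · simp [monWt, units_apply, zpow_add₀, zpow_sub₀, h0, hp0, hp, dn_zero, qpar_zero]
    field_simp
  · simp [monWt, units_apply, zpow_add₀, zpow_sub₀, h0, hp0, hp, dn_zero, qpar_zero]
    field_simp
  · have g := dn_succ_qpar (hm (1, 1))
    have h2 := qpar_zpow_of_succ (hm (2, 1)).1 (by simpa [units_apply] using (hm' (2, 1)).2)
    simp only [Function.comp_apply, hp] at h2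
    simp [monWt, units_apply, zpow_add₀, zpow_sub₀, h0, hp0, hp, dn_zero, qpar_zero] at g h2 ⊢
    rw [g, h2]
    field_simp
    ring
  · abel

/-- The analogue of `lower_bracket_eq` for creation operators; the two pairs of rows exchange their
roles. -/
theorem raise_bracket_eq (hx : Function.Injective x) (hp : HasPar η x 0 p) :
    qBracket 1 (raisePair η x p
      (fun m => q * q * q ^ m (2, 0) * qpar p ^ m (2, 1) * q ^ m (3, 0) * qpar p ^ m (3, 1)) 0 1)
      (colPairF η x 1 2) =
      q • (qBracket q⁻¹ (colPairE η x 0 1)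
        (qBracket q⁻¹ (colPairE η x 2 3)
        (qBracket q (raisePair η x p (fun _ => 1) 2 3) (colPairE η x 1 2))) *
        colPairK η x 1 2) := by
  rw [raise_bracket_one hx hp, raise_bracket_two hx hp, raise_bracket_three hx hp,
    raise_bracket_four hx hp, colPairK, add_mul, add_mul, lmon_mul_diag hx (by decide),
    lmon_mul_diag hx (by decide), lmon_mul_diag hx (by decide), smul_add, smul_add,
    ← lmon_smul, ← lmon_smul, ← lmon_smul]
  simp only [mul_assoc]

end two

/-! ### The node `0` of type `C` in two and four rows -/

theorem dn_one_zero : dn 1 0 = 0 := by simp [dn, qInt_zero]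
theorem dn_one_one : dn 1 1 = 1 := by simp [dn, qInt_one]
theorem dn_one_two : dn 1 2 = 0 := by simp [dn]

theorem IsConf.zero_or_one {τ : Type} {ζ : τ → Fin 2} {m : τ → ℤ} (hm : IsConf ζ m) {y : τ}
    (hy : ζ y = 1) : m y = 0 ∨ m y = 1 := by
  have h1 := (hm y).1
  have h2 := (hm y).2 hy
  omega

/-- A site of parity `1` which can be raised is empty. -/
theorem IsConf.eq_zero {τ : Type} {ζ : τ → Fin 2} {m v : τ → ℤ} (hm : IsConf ζ m)
    (hm' : IsConf ζ (m + v)) {y : τ} (hy : ζ y = 1) (hv : v y = 1) : m y = 0 := by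
  have h1 := (hm y).1
  have h2 := (hm' y).2 hy
  rw [Pi.add_apply] at h2
  omega

/-- A site of parity `1` which can be lowered is occupied. -/
theorem IsConf.eq_one {τ : Type} {ζ : τ → Fin 2} {m v : τ → ℤ} (hm : IsConf ζ m)
    (hm' : IsConf ζ (m + v)) {y : τ} (hy : ζ y = 1) (hv : v y = -1) : m y = 1 := by
  have h1 := (hm y).2 hy
  have h2 := (hm' y).1
  rw [Pi.add_apply] at h2
  omega

/-- No site of parity `1` can be raised or lowered twice. -/
theorem IsConf.not_two {τ : Type} {ζ : τ → Fin 2} {m v : τ → ℤ} (hm : IsConf ζ m)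
    (hm' : IsConf ζ (m + v)) {y : τ} (hy : ζ y = 1) (hv : v y = 2 ∨ v y = -2) : False := by
  have h1 := (hm y).1
  have h2 := (hm' y).2 hy
  have h3 := (hm y).2 hy
  have h4 := (hm' y).1
  rw [Pi.add_apply] at h2 h4
  omega

section pairC
variable {σ : Type} {η : σ → Fin 2}

/-- Both products vanish, since they lower one site twice. -/
theorem lower_colE_typeC {x : Fin 2 → σ} (hx : Function.Injective x) (h : ∀ y, η (x y) = 1) :
    qBracket 1 (lmon η x (fun _ => 1) [] [0, 1]) (lmon η x (fun _ => 1) [0] [1]) = 0 := by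
  refine lmon_comm hx _ (by decide) fun m hm hm' => ?_
  exact (hm.not_two hm' (y := 1) (h _) (by decide)).elim

theorem lower_colF_typeC {x : Fin 2 → σ} (hx : Function.Injective x) (h : ∀ y, η (x y) = 1) :
    qBracket 1 (lmon η x (fun _ => 1) [] [0, 1]) (lmon η x (fun _ => 1) [1] [0]) = 0 := by
  refine lmon_comm hx _ (by decide) fun m hm hm' => ?_
  exact (hm.not_two hm' (y := 0) (h _) (by decide)).elim

theorem raise_colE_typeC {x : Fin 2 → σ} (hx : Function.Injective x) (h : ∀ y, η (x y) = 1) :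
    qBracket 1 (lmon η x (fun _ => 1) [0, 1] []) (lmon η x (fun _ => 1) [0] [1]) = 0 := by
  refine lmon_comm hx _ (by decide) fun m hm hm' => ?_
  exact (hm.not_two hm' (y := 0) (h _) (by decide)).elim

theorem raise_colF_typeC {x : Fin 2 → σ} (hx : Function.Injective x) (h : ∀ y, η (x y) = 1) :
    qBracket 1 (lmon η x (fun _ => 1) [0, 1] []) (lmon η x (fun _ => 1) [1] [0]) = 0 := by
  refine lmon_comm hx _ (by decide) fun m hm hm' => ?_
  exact (hm.not_two hm' (y := 1) (h _) (by decide)).elim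

theorem lower_colF_middle_typeC {x : Fin 4 → σ} (hx : Function.Injective x) (h : ∀ y, η (x y) = 1) :
    qBracket 1 (lmon η x (fun _ => 1) [] [0, 1]) (lmon η x (fun _ => 1) [2] [1]) = 0 := by
  refine lmon_comm hx _ (by decide) fun m hm hm' => ?_
  exact (hm.not_two hm' (y := 1) (h _) (by decide)).elim

theorem lower_colE_middle_typeC {x : Fin 4 → σ} (hx : Function.Injective x) (h : ∀ y, η (x y) = 1) :
    qBracket q⁻¹ (lmon η x (fun m => q⁻¹ * q⁻¹ * qpar 1 ^ (-(m 0 + m 0)) * qpar 1 ^ (-(m 1 + m 1)))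
      [] [2, 3]) (lmon η x (fun _ => 1) [1] [2]) = 0 := by
  refine lmon_comm hx _ (by decide) fun m hm hm' => ?_
  exact (hm.not_two hm' (y := 2) (h _) (by decide)).elim

theorem lower_bracket_one_typeC {x : Fin 4 → σ} (hx : Function.Injective x) (h : ∀ y, η (x y) = 1) :
    qBracket q (lmon η x (fun _ => 1) [] [0, 1]) (lmon η x (fun _ => 1) [1] [2]) =
      lmon η x (fun m => qpar 1 ^ (-m 1)) [] [0, 2] := by
  have h0 := q_ne_zero
  refine lmon_qcomm hx _ (by decide) fun m hm hm' => ?_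
  have h1 := hm.eq_one hm' (y := 0) (h _) (by decide)
  have h3 := hm.eq_one hm' (y := 2) (h _) (by decide)
  obtain h2 | h2 := hm.zero_or_one (y := 1) (h _) <;>
  simp [monWt, units_apply, h, h1, h2, h3, dn_one_zero, dn_one_one, dn_one_two, qpar_one, zpow_add₀,
    zpow_sub₀, h0]

theorem lower_bracket_two_typeC {x : Fin 4 → σ} (hx : Function.Injective x) (h : ∀ y, η (x y) = 1) :
    qBracket q⁻¹ (lmon η x (fun _ => 1) [2] [3]) (lmon η x (fun m => qpar 1 ^ (-m 1)) [] [0, 2]) =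
      lmon η x (fun m => -q⁻¹ * qpar 1 ^ (-m 1) * qpar 1 ^ (-m 2)) [] [0, 3] := by
  have h0 := q_ne_zero
  refine lmon_qcomm hx _ (by decide) fun m hm hm' => ?_
  have h1 := hm.eq_one hm' (y := 0) (h _) (by decide)
  have h4 := hm.eq_one hm' (y := 3) (h _) (by decide)
  obtain h2 | h2 := hm.zero_or_one (y := 1) (h _) <;>
  obtain h3 | h3 := hm.zero_or_one (y := 2) (h _) <;>
  simp [monWt, units_apply, h, h1, h2, h3, h4, dn_one_zero, dn_one_one, dn_one_two, qpar_one,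
    zpow_add₀, zpow_sub₀, h0]

theorem lower_bracket_three_typeC {x : Fin 4 → σ} (hx : Function.Injective x)
    (h : ∀ y, η (x y) = 1) :
    qBracket q⁻¹ (lmon η x (fun _ => 1) [0] [1])
      (lmon η x (fun m => -q⁻¹ * qpar 1 ^ (-m 1) * qpar 1 ^ (-m 2)) [] [0, 3]) =
      lmon η x (fun m => q⁻¹ * q⁻¹ * qpar 1 ^ (-(m 0 + m 0)) * qpar 1 ^ (-m 2)) [] [1, 3] := by
  have h0 := q_ne_zero
  refine lmon_qcomm hx _ (by decide) fun m hm hm' => ?_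
  have h2 := hm.eq_one hm' (y := 1) (h _) (by decide)
  have h4 := hm.eq_one hm' (y := 3) (h _) (by decide)
  obtain h1 | h1 := hm.zero_or_one (y := 0) (h _) <;>
  obtain h3 | h3 := hm.zero_or_one (y := 2) (h _) <;>
  simp [monWt, units_apply, h, h1, h2, h3, h4, dn_one_zero, dn_one_one, dn_one_two, qpar_one,
    zpow_add₀, zpow_sub₀, h0] <;>
  try field_simp

theorem lower_bracket_four_typeC {x : Fin 4 → σ} (hx : Function.Injective x)
    (h : ∀ y, η (x y) = 1) :
    qBracket 1 (lmon η x (fun m => q⁻¹ * q⁻¹ * qpar 1 ^ (-(m 0 + m 0)) * qpar 1 ^ (-(m 1 + m 1))) []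
      [2, 3]) (lmon η x (fun _ => 1) [2] [1]) =
      lmon η x (fun m => q * (q⁻¹ * q⁻¹ * qpar 1 ^ (-(m 0 + m 0)) * qpar 1 ^ (-m 2) *
      q ^ (-(m 1 - m 2)))) [] [1, 3] := by
  have h0 := q_ne_zero
  refine lmon_qcomm hx _ (by decide) fun m hm hm' => ?_
  have h2 := hm.eq_one hm' (y := 1) (h _) (by decide)
  have h4 := hm.eq_one hm' (y := 3) (h _) (by decide)
  obtain h1 | h1 := hm.zero_or_one (y := 0) (h _) <;>
  obtain h3 | h3 := hm.zero_or_one (y := 2) (h _) <;>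
  simp [monWt, units_apply, h, h1, h2, h3, h4, dn_one_zero, dn_one_one, dn_one_two, qpar_one,
    zpow_add₀, zpow_sub₀, h0] <;>
  try field_simp

/-- The analogue of `lower_bracket_eq` in one column of parity `1`. -/
theorem lower_bracket_eq_typeC {x : Fin 4 → σ} (hx : Function.Injective x) (h : ∀ y, η (x y) = 1) :
    qBracket 1 (lmon η x (fun m => q⁻¹ * q⁻¹ * qpar 1 ^ (-(m 0 + m 0)) * qpar 1 ^ (-(m 1 + m 1))) []
      [2, 3]) (lmon η x (fun _ => 1) [2] [1]) =
      q • (qBracket q⁻¹ (lmon η x (fun _ => 1) [0] [1])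
        (qBracket q⁻¹ (lmon η x (fun _ => 1) [2] [3])
        (qBracket q (lmon η x (fun _ => 1) [] [0, 1]) (lmon η x (fun _ => 1) [1] [2]))) *
        lmon η x (fun m => q ^ (-(m 1 - m 2))) [] []) := by
  rw [lower_bracket_one_typeC hx h, lower_bracket_two_typeC hx h, lower_bracket_three_typeC hx h,
    lower_bracket_four_typeC hx h, lmon_mul_diag hx (by decide), ← lmon_smul]

theorem raise_colF_middle_typeC {x : Fin 4 → σ} (hx : Function.Injective x) (h : ∀ y, η (x y) = 1) :
    qBracket 1 (lmon η x (fun _ => 1) [2, 3] []) (lmon η x (fun _ => 1) [2] [1]) = 0 := by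
  refine lmon_comm hx _ (by decide) fun m hm hm' => ?_
  exact (hm.not_two hm' (y := 2) (h _) (by decide)).elim

theorem raise_colE_middle_typeC {x : Fin 4 → σ} (hx : Function.Injective x) (h : ∀ y, η (x y) = 1) :
    qBracket q⁻¹ (lmon η x (fun m => q * q * qpar 1 ^ (m 2 + m 2) * qpar 1 ^ (m 3 + m 3)) [0, 1] [])
      (lmon η x (fun _ => 1) [1] [2]) = 0 := by
  refine lmon_comm hx _ (by decide) fun m hm hm' => ?_
  exact (hm.not_two hm' (y := 1) (h _) (by decide)).elim

theorem raise_bracket_one_typeC {x : Fin 4 → σ} (hx : Function.Injective x) (h : ∀ y, η (x y) = 1) :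
    qBracket q (lmon η x (fun _ => 1) [2, 3] []) (lmon η x (fun _ => 1) [1] [2]) =
      lmon η x (fun m => -q * qpar 1 ^ m 2) [1, 3] [] := by
  have h0 := q_ne_zero
  refine lmon_qcomm hx _ (by decide) fun m hm hm' => ?_
  have h2 := hm.eq_zero hm' (y := 1) (h _) (by decide)
  have h4 := hm.eq_zero hm' (y := 3) (h _) (by decide)
  obtain h3 | h3 := hm.zero_or_one (y := 2) (h _) <;>
  simp [monWt, units_apply, h, h2, h3, h4, dn_one_zero, dn_one_one, dn_one_two, qpar_one, zpow_add₀,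
    zpow_sub₀, h0]

theorem raise_bracket_two_typeC {x : Fin 4 → σ} (hx : Function.Injective x) (h : ∀ y, η (x y) = 1) :
    qBracket q⁻¹ (lmon η x (fun _ => 1) [2] [3]) (lmon η x (fun m => -q * qpar 1 ^ m 2) [1, 3] []) =
      lmon η x (fun m => -q * qpar 1 ^ (m 3 + m 3)) [1, 2] [] := by
  have h0 := q_ne_zero
  refine lmon_qcomm hx _ (by decide) fun m hm hm' => ?_
  have h2 := hm.eq_zero hm' (y := 1) (h _) (by decide)
  have h3 := hm.eq_zero hm' (y := 2) (h _) (by decide)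
  obtain h4 | h4 := hm.zero_or_one (y := 3) (h _) <;>
  simp [monWt, units_apply, h, h2, h3, h4, dn_one_zero, dn_one_one, dn_one_two, qpar_one, zpow_add₀,
    zpow_sub₀, h0]
  field_simp

theorem raise_bracket_three_typeC {x : Fin 4 → σ} (hx : Function.Injective x)
    (h : ∀ y, η (x y) = 1) :
    qBracket q⁻¹ (lmon η x (fun _ => 1) [0] [1])
      (lmon η x (fun m => -q * qpar 1 ^ (m 3 + m 3)) [1, 2] []) =
      lmon η x (fun m => -q * qpar 1 ^ m 1 * qpar 1 ^ (m 3 + m 3)) [0, 2] [] := by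
  have h0 := q_ne_zero
  refine lmon_qcomm hx _ (by decide) fun m hm hm' => ?_
  have h1 := hm.eq_zero hm' (y := 0) (h _) (by decide)
  have h3 := hm.eq_zero hm' (y := 2) (h _) (by decide)
  obtain h2 | h2 := hm.zero_or_one (y := 1) (h _) <;>
  obtain h4 | h4 := hm.zero_or_one (y := 3) (h _) <;>
  simp [monWt, units_apply, h, h1, h2, h3, h4, dn_one_zero, dn_one_one, dn_one_two, qpar_one,
    zpow_add₀, zpow_sub₀, h0]

theorem raise_bracket_four_typeC {x : Fin 4 → σ} (hx : Function.Injective x)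
    (h : ∀ y, η (x y) = 1) :
    qBracket 1 (lmon η x (fun m => q * q * qpar 1 ^ (m 2 + m 2) * qpar 1 ^ (m 3 + m 3)) [0, 1] [])
      (lmon η x (fun _ => 1) [2] [1]) =
      lmon η x (fun m => q * (-q * qpar 1 ^ m 1 * qpar 1 ^ (m 3 + m 3) * q ^ (-(m 1 - m 2)))) [0, 2]
      [] := by
  have h0 := q_ne_zero
  refine lmon_qcomm hx _ (by decide) fun m hm hm' => ?_
  have h1 := hm.eq_zero hm' (y := 0) (h _) (by decide)
  have h3 := hm.eq_zero hm' (y := 2) (h _) (by decide)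
  obtain h2 | h2 := hm.zero_or_one (y := 1) (h _) <;>
  obtain h4 | h4 := hm.zero_or_one (y := 3) (h _) <;>
  simp [monWt, units_apply, h, h1, h2, h3, h4, dn_one_zero, dn_one_one, dn_one_two, qpar_one,
    zpow_add₀, zpow_sub₀, h0] <;>
  try field_simp

/-- The analogue of `raise_bracket_eq` in one column of parity `1`. -/
theorem raise_bracket_eq_typeC {x : Fin 4 → σ} (hx : Function.Injective x) (h : ∀ y, η (x y) = 1) :
    qBracket 1 (lmon η x (fun m => q * q * qpar 1 ^ (m 2 + m 2) * qpar 1 ^ (m 3 + m 3)) [0, 1] [])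
      (lmon η x (fun _ => 1) [2] [1]) =
      q • (qBracket q⁻¹ (lmon η x (fun _ => 1) [0] [1])
        (qBracket q⁻¹ (lmon η x (fun _ => 1) [2] [3])
        (qBracket q (lmon η x (fun _ => 1) [2, 3] []) (lmon η x (fun _ => 1) [1] [2]))) *
        lmon η x (fun m => q ^ (-(m 1 - m 2))) [] []) := by
  rw [raise_bracket_one_typeC hx h, raise_bracket_two_typeC hx h, raise_bracket_three_typeC hx h,
    raise_bracket_four_typeC hx h, lmon_mul_diag hx (by decide), ← lmon_smul]

end pairC

/-! ### Multiplicative characters and monomials on all sites -/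

section chi
variable {σ τ : Type} {η : σ → Fin 2} {φ φ' : σ → 𝕂}

/-- The multiplicative character `M ↦ ∏ φ(z)^{M(z)}` of the lattice of occupation numbers. -/
def chi [Fintype σ] (φ : σ → 𝕂) (M : σ → ℤ) : 𝕂 := ∏ z, φ z ^ M z

theorem chi_add [Fintype σ] (hφ : ∀ z, φ z ≠ 0) (M v : σ → ℤ) :
    chi φ (M + v) = chi φ M * chi φ v := by
  simp only [chi, Pi.add_apply, zpow_add₀ (hφ _), Finset.prod_mul_distrib]

theorem chi_mul [Fintype σ] (M : σ → ℤ) : chi (fun z => φ z * φ' z) M = chi φ M * chi φ' M := by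
  simp only [chi, mul_zpow, Finset.prod_mul_distrib]

theorem chi_eq_one [Fintype σ] {M : σ → ℤ} (h : ∀ z, φ z = 1 ∨ M z = 0) : chi φ M = 1 :=
  Finset.prod_eq_one fun z _ => by rcases h z with h | h <;> simp [h]

theorem chi_of_range [Fintype σ] [Fintype τ] {x : τ → σ} (hx : Function.Injective x)
    (h : ∀ z, z ∉ Set.range x → φ z = 1) (M : σ → ℤ) :
    chi φ M = ∏ y, φ (x y) ^ M (x y) := by
  refine (Fintype.prod_of_injective x hx _ _ (fun z hz => ?_) fun y => rfl).symm
  rw [h z hz, one_zpow]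

/-- The diagonal operator `|M⟩ ↦ g(M) |M⟩`. -/
def dg (η : σ → Fin 2) (g : (σ → ℤ) → 𝕂) : Module.End 𝕂 (ConfSpace η) := wshift η g 0

theorem admissible_diag (g : (σ → ℤ) → 𝕂) : Admissible η g 0 := by
  constructor
  · intro M z h1 h2
    simp only [Pi.zero_apply] at h2
    omega
  · intro M z _ h1 h2
    simp only [Pi.zero_apply] at h2
    omega

/-- Two shifts commute up to a scalar if each of them rescales the weight of the other. -/
theorem wshift_semicommute {c d : (σ → ℤ) → 𝕂} {v w : σ → ℤ} {a b b' : 𝕂}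
    (hc : Admissible η c v) (hd : Admissible η d w) (h1 : ∀ M, c (M + w) = b * c M)
    (h2 : ∀ M, d (M + v) = b' * d M) (h : b = a * b') :
    wshift η c v * wshift η d w = a • (wshift η d w * wshift η c v) :=
  wshift_qcommute a hc hd fun M _ _ => by rw [h1, h2, h]; ring

theorem wshift_commute {c d : (σ → ℤ) → 𝕂} {v w : σ → ℤ}
    (hc : Admissible η c v) (hd : Admissible η d w) (h1 : ∀ M, c (M + w) = c M)
    (h2 : ∀ M, d (M + v) = d M) : Commute (wshift η c v) (wshift η d w) := by
  have := wshift_semicommute (a := 1) (b := 1) (b' := 1) hc hd (by simpa using h1)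
    (by simpa using h2) (by simp)
  rwa [one_smul] at this

theorem dg_commute {g c : (σ → ℤ) → 𝕂} {v : σ → ℤ} (hc : Admissible η c v)
    (h : ∀ M, g (M + v) = g M) : Commute (dg η g) (wshift η c v) :=
  wshift_commute (admissible_diag g) hc h fun M => by rw [add_zero]

theorem dg_mul_wshift {g c : (σ → ℤ) → 𝕂} {v : σ → ℤ} (hc : Admissible η c v)
    (h : ∀ M, g (M + v) = g M) : dg η g * wshift η c v = wshift η (fun M => g M * c M) v := by
  rw [dg, wshift_mul (admissible_diag g) hc, zero_add]
  congr 1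
  funext M
  rw [h, mul_comm]

variable [DecidableEq σ]

/-- The normally ordered monomial with creation operators at `C`, annihilation operators at `A`,
and the diagonal operator `g` to their right. -/
def mon (η : σ → Fin 2) (g : (σ → ℤ) → 𝕂) (C A : List σ) : Module.End 𝕂 (ConfSpace η) :=
  wshift η (monWt η g A) (units C - units A)

theorem units_map [DecidableEq τ] {x : τ → σ} (hx : Function.Injective x) (L : List τ) :
    units (L.map x) = Function.extend x (units L) 0 := by
  funext z
  rw [units_apply]
  by_cases hz : ∃ y, x y = z
  · obtain ⟨y, rfl⟩ := hz
    rw [hx.extend_apply, units_apply, List.count_map_of_injective _ _ hx]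
  · rw [Function.extend_apply' _ _ _ hz, Pi.zero_apply, Nat.cast_eq_zero, List.count_eq_zero]
    simp only [List.mem_map, not_exists, not_and]
    exact fun y _ h => hz ⟨y, h⟩

theorem extend_units_sub [DecidableEq τ] {x : τ → σ} (hx : Function.Injective x) (C A : List τ) :
    Function.extend x (units C - units A) 0 = units (C.map x) - units (A.map x) := by
  rw [units_map hx, units_map hx, eq_sub_iff_add_eq, extend_add_extend hx, sub_add_cancel]

theorem chi_units [Fintype σ] (hφ : ∀ z, φ z ≠ 0) (C A : List σ) :
    chi φ (units C - units A) = (C.map φ).prod / (A.map φ).prod := by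
  have key : ∀ L : List σ, chi φ (units L) = (L.map φ).prod := by
    intro L
    induction L with
    | nil => simp [units, chi]
    | cons y L ih =>
      have : units (y :: L) = Pi.single y 1 + units L := by simp [units]
      rw [this, chi_add hφ, ih, List.map_cons, List.prod_cons, chi,
        Finset.prod_eq_single y (fun z _ h => by simp [h]) (by simp)]
      simp
  have h0 : chi φ (units A) ≠ 0 := Finset.prod_ne_zero_iff.mpr fun z _ => zpow_ne_zero _ (hφ z)
  rw [← key, ← key, eq_div_iff h0, ← chi_add hφ, sub_add_cancel]

omit [DecidableEq σ] in
theorem monWt_add {g : (σ → ℤ) → 𝕂} {A : List σ} {v : σ → ℤ} {b : 𝕂}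
    (hg : ∀ M, g (M + v) = b * g M) (hA : ∀ z ∈ A, v z = 0) (M : σ → ℤ) :
    monWt η g A (M + v) = b * monWt η g A M := by
  have : (A.map fun y => dn (η y) ((M + v) y)) = A.map fun y => dn (η y) (M y) :=
    List.map_congr_left fun z hz => by rw [Pi.add_apply, hA z hz, add_zero]
  rw [monWt, monWt, hg, this, mul_assoc]

/-- Splitting off the part of a character that does not see a family of sites. -/
theorem wshift_split [Fintype σ] [Fintype τ] {x : τ → σ} {ζ : τ → Fin 2} (hx : Function.Injective x)
    (hζ : ∀ y, η (x y) = ζ y) {φ₀ φ₁ : σ → 𝕂} (h0 : ∀ z, φ₀ z ≠ 0)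
    (h1 : ∀ y, φ₀ (x y) = 1) (h2 : ∀ z, z ∉ Set.range x → φ₁ z = 1)
    {c : (τ → ℤ) → 𝕂} {v : τ → ℤ} (hc : Admissible ζ c v) :
    wshift η (fun M => chi (fun z => φ₀ z * φ₁ z) M * c (M ∘ x)) (Function.extend x v 0) =
      dg η (chi φ₀) * lshift η x (fun m => (∏ y, φ₁ (x y) ^ m y) * c m) v := by
  have hc' : Admissible ζ (fun m => (∏ y, φ₁ (x y) ^ m y) * c m) v :=
    ⟨fun M y a b => by rw [hc.nonneg M y a b, mul_zero],
      fun M y a b d => by rw [hc.le_one M y a b d, mul_zero]⟩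
  rw [lshift, dg_mul_wshift (hc'.extend hx hζ)]
  · congr 1
    funext M
    rw [chi_mul, chi_of_range hx h2, mul_assoc]
    rfl
  · intro M
    rw [chi_add h0, chi_eq_one (M := Function.extend x v 0), mul_one]
    intro z
    by_cases hz : ∃ y, x y = z
    · obtain ⟨y, rfl⟩ := hz
      exact .inl (h1 y)
    · exact .inr (Function.extend_apply' _ _ _ hz)

theorem mon_split [Fintype σ] [Fintype τ] [DecidableEq τ] {x : τ → σ} (hx : Function.Injective x)
    {φ φ₀ φ₁ : σ → 𝕂} (h0 : ∀ z, φ₀ z ≠ 0) (h1 : ∀ y, φ₀ (x y) = 1)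
    (h2 : ∀ z, z ∉ Set.range x → φ₁ z = 1) (h : ∀ z, φ z = φ₀ z * φ₁ z) {C A : List τ}
    (hA : A.Nodup) {c : 𝕂} {g : (τ → ℤ) → 𝕂} (hg : ∀ m, g m = c * ∏ y, φ₁ (x y) ^ m y) :
    mon η (fun M => c * chi φ M) (C.map x) (A.map x) = dg η (chi φ₀) * lmon η x g C A := by
  have e := wshift_split hx (fun _ => rfl) h0 h1 h2 (c := monWt (η ∘ x) (fun _ => c) A)
    (monWt_admissible _ C hA)
  rw [mon, ← extend_units_sub hx, lmon]
  refine Eq.trans ?_ (e.trans ?_)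
  · rw [funext h]
    congr 1
    funext M
    simp only [monWt, List.map_map, Function.comp_def]
    ring
  · congr 2
    funext m
    simp only [monWt, hg]
    ring

end chi

/-! ### The operators of `𝐔(𝔰𝔩_r)` on matrices of occupation numbers -/

section matrices
variable {r n : ℕ}

/-- The parities of the entries of an `r × n` matrix. -/
def colPar (r : ℕ) {n : ℕ} (ε : Fin n → Fin 2) (z : Fin r × Fin n) : Fin 2 := ε z.2

/-- The character `q^{± (M(a, t) - M(b, t))}`, `s = ± 1`, restricted to the columns `t` in `S`. -/
def colChar (S : Fin n → Prop) [DecidablePred S] (a b : Fin r) (s : ℤ) (z : Fin r × Fin n) : 𝕂 :=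
  if S z.2 then if z.1 = a then q ^ s else if z.1 = b then q ^ (-s) else 1 else 1

theorem colChar_ne_zero (S : Fin n → Prop) [DecidablePred S] (a b : Fin r) (s : ℤ)
    (z : Fin r × Fin n) : colChar S a b s z ≠ 0 := by
  have := fun t : ℤ => zpow_ne_zero t q_ne_zero
  unfold colChar
  split_ifs <;> simp [this]

/-- The summand of `e` for the rows `a`, `b` which acts in the column `t`. -/
def colTermE (ε : Fin n → Fin 2) (a b : Fin r) (t : Fin n) :
    Module.End 𝕂 (ConfSpace (colPar r ε)) :=
  mon (colPar r ε) (chi (colChar (· < t) a b 1)) [(a, t)] [(b, t)]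

/-- The summand of `f` for the rows `a`, `b` which acts in the column `t`. -/
def colTermF (ε : Fin n → Fin 2) (a b : Fin r) (t : Fin n) :
    Module.End 𝕂 (ConfSpace (colPar r ε)) :=
  mon (colPar r ε) (chi (colChar (t < ·) a b (-1))) [(b, t)] [(a, t)]

/-- The summand of `e k⁻¹` for the rows `a`, `b` which acts in the column `t`. -/
def colTermEK (ε : Fin n → Fin 2) (a b : Fin r) (t : Fin n) :
    Module.End 𝕂 (ConfSpace (colPar r ε)) :=
  mon (colPar r ε) (chi (colChar (t ≤ ·) a b (-1))) [(a, t)] [(b, t)]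

/-- The operator of `e` for the rows `a` and `b`. -/
def colE (ε : Fin n → Fin 2) (a b : Fin r) : Module.End 𝕂 (ConfSpace (colPar r ε)) :=
  ∑ t, colTermE ε a b t

/-- The operator of `f` for the rows `a` and `b`. -/
def colF (ε : Fin n → Fin 2) (a b : Fin r) : Module.End 𝕂 (ConfSpace (colPar r ε)) :=
  ∑ t, colTermF ε a b t

/-- The operator of `k^s` for the rows `a` and `b`. -/
def colK (ε : Fin n → Fin 2) (a b : Fin r) (s : ℤ) : Module.End 𝕂 (ConfSpace (colPar r ε)) :=
  dg (colPar r ε) (chi (colChar (fun _ => True) a b s))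

theorem colE_mul_colK (ε : Fin n → Fin 2) (a b : Fin r) :
    colE ε a b * colK ε a b (-1) = ∑ t, colTermEK ε a b t := by
  rw [colE, Finset.sum_mul]
  refine Finset.sum_congr rfl fun t _ => ?_
  rw [colTermE, colK, mon, dg, wshift_mul (monWt_admissible _ _ (List.nodup_singleton _))
    (admissible_diag _), add_zero, colTermEK, mon]
  congr 1
  funext M
  have : chi (colChar (t ≤ ·) a b (-1)) M =
      chi (colChar (fun _ => True) a b (-1)) M * chi (colChar (· < t) a b 1) M := by
    rw [← chi_mul]
    congr 1
    funext z
    have h0 := q_ne_zero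
    by_cases hz : z.2 < t
    · have : ¬ t ≤ z.2 := not_le.mpr hz
      simp only [colChar, hz, this, if_true, if_false]
      split_ifs <;> simp [h0]
    · have : t ≤ z.2 := not_lt.mp hz
      simp only [colChar, hz, this, if_true, if_false, mul_one]
  rw [monWt, monWt, this, add_zero]
  ring

/-- Commutation with `e`, `f` and `k^{±1}` for the rows `a` and `b`. -/
structure CommutesCol (ε : Fin n → Fin 2) (a b : Fin r)
    (T : Module.End 𝕂 (ConfSpace (colPar r ε))) :
    Prop where
  e : Commute T (colE ε a b)
  f : Commute T (colF ε a b)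
  k (s : ℤ) : Commute T (colK ε a b s)

variable {ε : Fin n → Fin 2} {a b : Fin r} {T T' : Module.End 𝕂 (ConfSpace (colPar r ε))}

theorem CommutesCol.add (h : CommutesCol ε a b T) (h' : CommutesCol ε a b T') :
    CommutesCol ε a b (T + T') :=
  ⟨h.e.add_left h'.e, h.f.add_left h'.f, fun s => (h.k s).add_left (h'.k s)⟩

theorem CommutesCol.mul (h : CommutesCol ε a b T) (h' : CommutesCol ε a b T') :
    CommutesCol ε a b (T * T') :=
  ⟨h.e.mul_left h'.e, h.f.mul_left h'.f, fun s => (h.k s).mul_left (h'.k s)⟩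

theorem CommutesCol.smul (h : CommutesCol ε a b T) (c : 𝕂) : CommutesCol ε a b (c • T) :=
  ⟨h.e.smul_left c, h.f.smul_left c, fun s => (h.k s).smul_left c⟩

theorem CommutesCol.sum {ι : Type} {s : Finset ι} {T : ι → Module.End 𝕂 (ConfSpace (colPar r ε))}
    (h : ∀ i ∈ s, CommutesCol ε a b (T i)) : CommutesCol ε a b (∑ i ∈ s, T i) :=
  ⟨Commute.sum_left _ _ _ fun i hi => (h i hi).e, Commute.sum_left _ _ _ fun i hi => (h i hi).f,
    fun c => Commute.sum_left _ _ _ fun i hi => (h i hi).k c⟩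

/-- A character which takes the same values on the rows `a` and `b` is invariant under moves between
these rows within a column. -/
theorem chi_hop {φ : Fin r × Fin n → 𝕂} (hφ : ∀ z, φ z ≠ 0) (hab : a ≠ b)
    (h : ∀ t, φ (a, t) = φ (b, t)) {w : Fin r × Fin n → ℤ}
    (hw : ∀ z, z.1 ≠ a → z.1 ≠ b → w z = 0) (hw' : ∀ t, w (a, t) + w (b, t) = 0)
    (M : Fin r × Fin n → ℤ) : chi φ (M + w) = chi φ M := by
  have : chi φ w = 1 := by
    rw [chi, Fintype.prod_prod_type, Finset.prod_comm]
    refine Finset.prod_eq_one fun t _ => ?_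
    rw [Fintype.prod_eq_mul a b hab fun s hs => by rw [hw (s, t) hs.1 hs.2, zpow_zero], h,
      ← zpow_add₀ (hφ _), hw', zpow_zero]
  rw [chi_add hφ, this, mul_one]

theorem units_hop (hab : a ≠ b) (t : Fin n) :
    (∀ z : Fin r × Fin n, z.1 ≠ a → z.1 ≠ b → (units [(a, t)] - units [(b, t)] : _ → ℤ) z = 0) ∧
      ∀ t', (units [(a, t)] - units [(b, t)] : _ → ℤ) (a, t') +
        (units [(a, t)] - units [(b, t)] : Fin r × Fin n → ℤ) (b, t') = 0 := by
  refine ⟨fun z h1 h2 => ?_, fun t' => ?_⟩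
  · have e1 : (a, t) ≠ z := fun h => h1 (by rw [← h])
    have e2 : (b, t) ≠ z := fun h => h2 (by rw [← h])
    simp [units_apply, List.count_singleton, e1, e2]
  · by_cases ht : t = t' <;> simp [units_apply, List.count_singleton, hab, hab.symm, ht]

/-- An operator which neither changes the rows `a` and `b`, nor sees the moves between them,
commutes with `e`, `f` and `k^{±1}` for these rows. -/
theorem commutesCol_of_far (hab : a ≠ b) {c : (Fin r × Fin n → ℤ) → 𝕂} {v : Fin r × Fin n → ℤ}
    (hc : Admissible (colPar r ε) c v) (hv : ∀ t, v (a, t) = 0 ∧ v (b, t) = 0)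
    (hinv : ∀ M w : Fin r × Fin n → ℤ, (∀ z, z.1 ≠ a → z.1 ≠ b → w z = 0) →
      (∀ t, w (a, t) + w (b, t) = 0) → c (M + w) = c M) :
    CommutesCol ε a b (wshift (colPar r ε) c v) := by
  have hchi : ∀ (S : Fin n → Prop) [DecidablePred S] (s : ℤ) (M : Fin r × Fin n → ℤ),
      chi (colChar S a b s) (M + v) = chi (colChar S a b s) M := by
    intro S _ s M
    rw [chi_add (colChar_ne_zero S a b s), chi_eq_one (M := v), mul_one]
    intro z
    by_cases h1 : z.1 = a
    · exact .inr (by rw [← (hv z.2).1, ← h1])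
    by_cases h2 : z.1 = b
    · exact .inr (by rw [← (hv z.2).2, ← h2])
    · exact .inl (by simp [colChar, h1, h2])
  refine ⟨Commute.sum_right _ _ _ fun t _ => ?_, Commute.sum_right _ _ _ fun t _ => ?_,
    fun s => ?_⟩
  · refine wshift_commute hc (monWt_admissible _ _ (List.nodup_singleton _))
      (fun M => hinv M _ (units_hop hab t).1 (units_hop hab t).2) fun M => ?_
    rw [monWt_add (b := 1), one_mul]
    · intro M; rw [hchi, one_mul]
    · intro z hz; rw [List.mem_singleton] at hz; rw [hz, (hv t).2]
  · refine wshift_commute hc (monWt_admissible _ _ (List.nodup_singleton _))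
      (fun M => hinv M _ (fun z h1 h2 => (units_hop hab.symm t).1 z h2 h1)
        fun t' => by rw [add_comm]; exact (units_hop hab.symm t).2 t') fun M => ?_
    rw [monWt_add (b := 1), one_mul]
    · intro M; rw [hchi, one_mul]
    · intro z hz; rw [List.mem_singleton] at hz; rw [hz, (hv t).1]
  · exact (dg_commute hc fun M => hchi _ s M).symm

end matrices

/-! ### Windows of rows and columns -/

section window
variable {σ τ : Type} [Fintype σ] [DecidableEq σ] [DecidableEq τ] {η : σ → Fin 2} {x : τ → σ}
  {φ : σ → 𝕂} {g : (τ → ℤ) → 𝕂} {C A : List τ}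

theorem chi_add_extend (hx : Function.Injective x) (hφ : ∀ z, φ z ≠ 0) {a : 𝕂}
    (h : (A.map fun y => φ (x y)).prod = a * (C.map fun y => φ (x y)).prod) (M : σ → ℤ) :
    a * chi φ (M + Function.extend x (units C - units A) 0) = chi φ M := by
  have hC : (A.map fun y => φ (x y)).prod ≠ 0 := by
    rw [Ne, List.prod_eq_zero_iff, List.mem_map]
    rintro ⟨y, _, hy⟩
    exact hφ _ hy
  rw [chi_add hφ, extend_units_sub hx, chi_units hφ, List.map_map, List.map_map]
  simp only [Function.comp_def]
  have : a * ((C.map fun y => φ (x y)).prod / (A.map fun y => φ (x y)).prod) = 1 := by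
    rw [← mul_div_assoc, ← h, div_self hC]
  linear_combination chi φ M * this

omit [Fintype σ] [DecidableEq σ] [DecidableEq τ] in
theorem extend_of_ne {z : σ} (h : ∀ y, x y ≠ z) (v : τ → ℤ) :
    Function.extend x v 0 z = 0 :=
  Function.extend_apply' _ _ _ fun ⟨y, hy⟩ => h y hy

/-- A monomial of a window `a`-commutes with a monomial outside of the window. -/
theorem lmon_mon_far (hx : Function.Injective x) (hA : A.Nodup) (hφ : ∀ z, φ z ≠ 0) {z z' : σ}
    (hz : ∀ y, x y ≠ z) (hz' : ∀ y, x y ≠ z') {a : 𝕂}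
    (h : (A.map fun y => φ (x y)).prod = a * (C.map fun y => φ (x y)).prod) :
    lmon η x g C A * mon η (chi φ) [z] [z'] = a • (mon η (chi φ) [z] [z'] * lmon η x g C A) := by
  have h1 := chi_add_extend hx hφ h
  have ha : a ≠ 0 := by
    rintro rfl
    have h2 := h1 0
    rw [zero_mul] at h2
    exact (Finset.prod_ne_zero_iff.mpr fun z _ => zpow_ne_zero _ (hφ z)) h2.symm
  unfold lmon lshift mon
  refine wshift_semicommute (b := 1) (b' := a⁻¹)
    ((monWt_admissible (ζ := η ∘ x) _ _ hA).extend hx fun _ => rfl)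
    (monWt_admissible _ _ (List.nodup_singleton _)) (fun M => ?_) (fun M => ?_)
    (mul_inv_cancel₀ ha).symm
  · have : (M + (units [z] - units [z'])) ∘ x = M ∘ x := by
      funext y
      simp [units_apply, List.count_singleton, (hz y).symm, (hz' y).symm]
    rw [this, one_mul]
  · refine monWt_add (fun M => ?_) (fun w hw => ?_) M
    · rw [← h1 M, inv_mul_cancel_left₀ ha]
    · rw [List.mem_singleton] at hw
      rw [hw, extend_of_ne hz']

theorem lmon_dg (hx : Function.Injective x) (hA : A.Nodup) (hφ : ∀ z, φ z ≠ 0) {a : 𝕂}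
    (h : (A.map fun y => φ (x y)).prod = a * (C.map fun y => φ (x y)).prod) :
    lmon η x g C A * dg η (chi φ) = a • (dg η (chi φ) * lmon η x g C A) := by
  have h1 := chi_add_extend hx hφ h
  have ha : a ≠ 0 := by
    rintro rfl
    have h2 := h1 0
    rw [zero_mul] at h2
    exact (Finset.prod_ne_zero_iff.mpr fun z _ => zpow_ne_zero _ (hφ z)) h2.symm
  unfold lmon lshift dg
  refine wshift_semicommute (b := 1) (b' := a⁻¹)
    ((monWt_admissible (ζ := η ∘ x) _ _ hA).extend hx fun _ => rfl)
    (admissible_diag _) (fun M => ?_) (fun M => ?_) (mul_inv_cancel₀ ha).symm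
  · rw [add_zero, one_mul]
  · rw [← h1 M, inv_mul_cancel_left₀ ha]

end window

section columns
variable {r n : ℕ} {ε : Fin n → Fin 2} {a b : Fin r} {τ : Type} [Fintype τ] [DecidableEq τ]
  {x : τ → Fin r × Fin n} {S S₀ S₁ : Fin n → Prop} [DecidablePred S] [DecidablePred S₀]
  [DecidablePred S₁]

theorem mon_colChar (hx : Function.Injective x) {s : ℤ} (hS : ∀ t, S t ↔ S₀ t ∨ S₁ t)
    (hd : ∀ t, S₀ t → ¬ S₁ t) (h0 : ∀ y, ¬ S₀ (x y).2)
    (h1 : ∀ t, S₁ t → (a, t) ∈ Set.range x ∧ (b, t) ∈ Set.range x) {C A : List τ} (hA : A.Nodup)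
    {g : (τ → ℤ) → 𝕂} (hg : ∀ m, g m = ∏ y, colChar S₁ a b s (x y) ^ m y) :
    mon (colPar r ε) (chi (colChar S a b s)) (C.map x) (A.map x) =
      dg (colPar r ε) (chi (colChar S₀ a b s)) * lmon (colPar r ε) x g C A := by
  have := mon_split (η := colPar r ε) (C := C) (c := 1) (φ := colChar S a b s) (g := g) hx
    (colChar_ne_zero S₀ a b s) (fun y => by simp [colChar, h0]) (φ₁ := colChar S₁ a b s)
    (fun z hz => ?_) (fun z => ?_) hA (fun m => by rw [hg, one_mul])
  · simp only [one_mul] at this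
    exact this
  · by_contra h
    simp only [colChar] at h
    split_ifs at h with h2 h3 h4
    · exact hz (by rw [← Prod.mk.eta (p := z), h3]; exact (h1 _ h2).1)
    · exact hz (by rw [← Prod.mk.eta (p := z), h4]; exact (h1 _ h2).2)
    all_goals exact h rfl
  · by_cases h2 : S₀ z.2
    · simp [colChar, hS, h2, hd]
    · simp [colChar, hS, h2]

end columns

section twoColumns
variable {r n : ℕ} {ε : Fin n → Fin 2} {ρ : Type}

/-- The sites in the rows `f i` and in the two columns `c₀`, `c₁`. -/
def win (f : ρ → Fin r) (c₀ c₁ : Fin n) (y : ρ × Fin 2) : Fin r × Fin n := (f y.1, ![c₀, c₁] y.2)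

theorem win_injective {f : ρ → Fin r} (hf : Function.Injective f) {c₀ c₁ : Fin n} (h : c₀ ≠ c₁) :
    Function.Injective (win f c₀ c₁) := by
  rintro ⟨i, s⟩ ⟨j, t⟩ hij
  simp only [win, Prod.mk.injEq] at hij
  refine Prod.ext (hf hij.1) ?_
  rcases two_cases s with rfl | rfl <;> rcases two_cases t with rfl | rfl <;> simp_all [h.symm]

theorem win_hasPar (f : ρ → Fin r) (c₀ c₁ : Fin n) :
    HasPar (colPar r ε) (win f c₀ c₁) (ε c₀) (ε c₁) := by
  rintro ⟨i, s⟩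
  rcases two_cases s with rfl | rfl <;> rfl

theorem win_ne (f : ρ → Fin r) {c₀ c₁ t : Fin n} (h0 : t ≠ c₀) (h1 : t ≠ c₁) (s : Fin r)
    (y : ρ × Fin 2) : win f c₀ c₁ y ≠ (s, t) := by
  obtain ⟨i, u⟩ := y
  rcases two_cases u with rfl | rfl
  · exact fun h => h0 (congrArg Prod.snd h).symm
  · exact fun h => h1 (congrArg Prod.snd h).symm

theorem win_forall {f : ρ → Fin r} {c₀ c₁ : Fin n} {P : Fin n → Prop} (h0 : P c₀) (h1 : P c₁)
    (y : ρ × Fin 2) : P (win f c₀ c₁ y).2 := by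
  obtain ⟨i, u⟩ := y
  rcases two_cases u with rfl | rfl
  · exact h0
  · exact h1

theorem mem_range_win (f : ρ → Fin r) {c₀ c₁ t : Fin n} (i : ρ) (h : t = c₀ ∨ t = c₁) :
    (f i, t) ∈ Set.range (win f c₀ c₁) := by
  rcases h with h | h
  · exact ⟨(i, 0), Prod.ext rfl h.symm⟩
  · exact ⟨(i, 1), Prod.ext rfl h.symm⟩

variable [Fintype ρ] [DecidableEq ρ] {f : ρ → Fin r} {c₀ c₁ : Fin n} {i j : ρ}

omit [DecidableEq ρ] in
theorem prod_colChar_win (hf : Function.Injective f) (hij : i ≠ j) (S : Fin n → Prop)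
    [DecidablePred S] (s : ℤ) (m : ρ × Fin 2 → ℤ) :
    ∏ y, colChar S (f i) (f j) s (win f c₀ c₁ y) ^ m y =
      (if S c₀ then q ^ (s * (m (i, 0) - m (j, 0))) else 1) *
        (if S c₁ then q ^ (s * (m (i, 1) - m (j, 1))) else 1) := by
  have h0 := q_ne_zero
  rw [Fintype.prod_prod_type, Fintype.prod_eq_mul i j hij]
  · simp only [Fin.prod_univ_two, colChar, win, Matrix.cons_val_zero, Matrix.cons_val_one, if_true,
      if_neg (hf.ne hij.symm)]
    by_cases h2 : S c₀ <;> by_cases h3 : S c₁ <;>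
      simp [h2, h3, mul_sub, zpow_sub₀ h0, zpow_mul, div_eq_mul_inv]
    ring
  · intro k hk
    simp [colChar, win, hf.ne hk.1, hf.ne hk.2]

/-- The part in two columns of the operator of `e k⁻¹` for the rows `i` and `j`. -/
def colPairEK {σ : Type} (η : σ → Fin 2) (x : ρ × Fin 2 → σ) (i j : ρ) :
    Module.End 𝕂 (ConfSpace η) :=
  lmon η x (fun m => q ^ (-(m (i, 0) - m (j, 0)) - (m (i, 1) - m (j, 1)))) [(i, 0)] [(j, 0)] +
    lmon η x (fun m => q ^ (-(m (i, 1) - m (j, 1)))) [(i, 1)] [(j, 1)]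

variable (hf : Function.Injective f) (hc : c₀.val + 1 = c₁.val) (hij : i ≠ j)
include hf hc hij

theorem colTermE_add_colTermE :
    colTermE ε (f i) (f j) c₀ + colTermE ε (f i) (f j) c₁ =
      dg (colPar r ε) (chi (colChar (· < c₀) (f i) (f j) 1)) *
        colPairE (colPar r ε) (win f c₀ c₁) i j := by
  have hc' : c₀ ≠ c₁ := fun h => by rw [h] at hc; omega
  have hx := win_injective hf hc'
  have hl : ¬ c₁ < c₀ := by rw [Fin.lt_def]; omega
  rw [colPairE, mul_add]
  congr 1
  · refine mon_colChar (C := [(i, 0)]) (A := [(j, 0)]) (S₁ := fun _ => False) hx (by simp) (by simp)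
      (win_forall (P := fun t => ¬ t < c₀) (lt_irrefl _) hl) (by simp) (List.nodup_singleton _)
        fun m => ?_
    rw [prod_colChar_win hf hij]
    simp
  · refine mon_colChar (C := [(i, 1)]) (A := [(j, 1)]) (S₁ := (· = c₀)) hx (fun t => ?_)
      (fun t h => h.ne) (win_forall (P := fun t => ¬ t < c₀) (lt_irrefl _) hl)
      (fun t h => ⟨mem_range_win f i (.inl h), mem_range_win f j (.inl h)⟩)
      (List.nodup_singleton _) fun m => ?_
    · rw [Fin.lt_def, Fin.lt_def, Fin.ext_iff]; omega
    · rw [prod_colChar_win hf hij]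
      simp [hc'.symm]

theorem colTermF_add_colTermF :
    colTermF ε (f i) (f j) c₀ + colTermF ε (f i) (f j) c₁ =
      dg (colPar r ε) (chi (colChar (c₁ < ·) (f i) (f j) (-1))) *
        colPairF (colPar r ε) (win f c₀ c₁) i j := by
  have hc' : c₀ ≠ c₁ := fun h => by rw [h] at hc; omega
  have hx := win_injective hf hc'
  have hl : ¬ c₁ < c₀ := by rw [Fin.lt_def]; omega
  rw [colPairF, mul_add]
  congr 1
  · refine mon_colChar (C := [(j, 0)]) (A := [(i, 0)]) (S₁ := (· = c₁)) hx (fun t => ?_)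
      (fun t h => h.ne') (win_forall (P := fun t => ¬ c₁ < t) hl (lt_irrefl _))
      (fun t h => ⟨mem_range_win f i (.inr h), mem_range_win f j (.inr h)⟩)
      (List.nodup_singleton _) fun m => ?_
    · rw [Fin.lt_def, Fin.lt_def, Fin.ext_iff]; omega
    · rw [prod_colChar_win hf hij]
      simp [hc']
  · refine mon_colChar (C := [(j, 1)]) (A := [(i, 1)]) (S₁ := fun _ => False) hx (by simp) (by simp)
      (win_forall (P := fun t => ¬ c₁ < t) hl (lt_irrefl _)) (by simp) (List.nodup_singleton _)
      fun m => ?_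
    rw [prod_colChar_win hf hij]
    simp

theorem colTermEK_add_colTermEK :
    colTermEK ε (f i) (f j) c₀ + colTermEK ε (f i) (f j) c₁ =
      dg (colPar r ε) (chi (colChar (c₁ < ·) (f i) (f j) (-1))) *
        colPairEK (colPar r ε) (win f c₀ c₁) i j := by
  have hc' : c₀ ≠ c₁ := fun h => by rw [h] at hc; omega
  have hx := win_injective hf hc'
  have hl : ¬ c₁ < c₀ := by rw [Fin.lt_def]; omega
  rw [colPairEK, mul_add]
  congr 1
  · refine mon_colChar (C := [(i, 0)]) (A := [(j, 0)]) (S₁ := fun t => t = c₀ ∨ t = c₁) hx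
      (fun t => ?_) (fun t h => ?_) (win_forall (P := fun t => ¬ c₁ < t) hl (lt_irrefl _))
      (fun t h => ⟨mem_range_win f i h, mem_range_win f j h⟩)
      (List.nodup_singleton _) fun m => ?_
    · rw [Fin.le_def, Fin.lt_def, Fin.ext_iff, Fin.ext_iff]; omega
    · rw [Fin.lt_def] at h; rw [Fin.ext_iff, Fin.ext_iff]; omega
    · rw [prod_colChar_win hf hij]
      simp [zpow_sub₀ q_ne_zero, zpow_add₀ q_ne_zero, div_eq_mul_inv]
  · refine mon_colChar (C := [(i, 1)]) (A := [(j, 1)]) (S₁ := (· = c₁)) hx (fun t => ?_)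
      (fun t h => h.ne') (win_forall (P := fun t => ¬ c₁ < t) hl (lt_irrefl _))
      (fun t h => ⟨mem_range_win f i (.inr h), mem_range_win f j (.inr h)⟩)
      (List.nodup_singleton _) fun m => ?_
    · rw [Fin.le_def, Fin.lt_def, Fin.ext_iff]; omega
    · rw [prod_colChar_win hf hij]
      simp [hc']

theorem colK_eq_window (h0 : c₀.val = 0) :
    colK ε (f i) (f j) (-1) = dg (colPar r ε) (chi (colChar (c₁ < ·) (f i) (f j) (-1))) *
        colPairK (colPar r ε) (win f c₀ c₁) i j := by
  have hc' : c₀ ≠ c₁ := fun h => by rw [h] at hc; omega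
  have hx := win_injective hf hc'
  have hl : ¬ c₁ < c₀ := by rw [Fin.lt_def]; omega
  have := mon_colChar (ε := ε) (S := fun _ => True) (S₀ := (c₁ < ·)) (a := f i) (b := f j) (s := -1)
    (C := []) (A := []) (S₁ := fun t => t = c₀ ∨ t = c₁)
    (g := fun m => q ^ (-(m (i, 0) - m (j, 0)) - (m (i, 1) - m (j, 1)))) hx
      (fun t => ?_) (fun t h => ?_) (win_forall (P := fun t => ¬ c₁ < t) hl (lt_irrefl _))
      (fun t h => ⟨mem_range_win f i h, mem_range_win f j h⟩) List.nodup_nil fun m => ?_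
  · rw [colPairK, ← this, colK, dg, mon]
    congr 1
    funext M
    simp [monWt]
  · rw [Fin.lt_def, Fin.ext_iff, Fin.ext_iff, true_iff]; omega
  · rw [Fin.lt_def] at h; rw [Fin.ext_iff, Fin.ext_iff]; omega
  · rw [prod_colChar_win hf hij]
    simp [zpow_sub₀ q_ne_zero, zpow_add₀ q_ne_zero, div_eq_mul_inv]

end twoColumns

theorem units_of_not_mem {σ : Type} [DecidableEq σ] {L : List σ} {z : σ} (h : z ∉ L) :
    units L z = 0 := by
  rw [units_apply, List.count_eq_zero_of_not_mem h, Nat.cast_zero]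

/-! ### Operators that commute with `𝐔(𝔰𝔩_r)` up to scalars -/

section farScale
variable {σ τ : Type} [Fintype σ] [DecidableEq σ] {η : σ → Fin 2} {x : τ → σ}
  {φ : σ → 𝕂} {a a' : 𝕂} {T T' : Module.End 𝕂 (ConfSpace η)}

/-- The operator `T` multiplies the character `φ` by `a`, and otherwise only involves the sites
`x y`. -/
structure FarScale (η : σ → Fin 2) (x : τ → σ) (φ : σ → 𝕂) (a : 𝕂)
    (T : Module.End 𝕂 (ConfSpace η)) : Prop where
  mon (z z' : σ) (hz : ∀ y, x y ≠ z) (hz' : ∀ y, x y ≠ z') :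
    T * mon η (chi φ) [z] [z'] = a • (FockDuality.mon η (chi φ) [z] [z'] * T)
  dg : T * dg η (chi φ) = a • (FockDuality.dg η (chi φ) * T)

theorem FarScale.lmon [DecidableEq τ] (hx : Function.Injective x) (hφ : ∀ z, φ z ≠ 0)
    {g : (τ → ℤ) → 𝕂} {C A : List τ} (hA : A.Nodup)
    (h : (A.map fun y => φ (x y)).prod = a * (C.map fun y => φ (x y)).prod) :
    FarScale η x φ a (lmon η x g C A) :=
  ⟨fun _ _ hz hz' => lmon_mon_far hx hA hφ hz hz' h, lmon_dg hx hA hφ h⟩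

theorem FarScale.add (h : FarScale η x φ a T) (h' : FarScale η x φ a T') :
    FarScale η x φ a (T + T') :=
  ⟨fun z z' hz hz' => by rw [add_mul, mul_add, smul_add, h.mon z z' hz hz', h'.mon z z' hz hz'],
    by rw [add_mul, mul_add, smul_add, h.dg, h'.dg]⟩

theorem FarScale.smul (h : FarScale η x φ a T) (c : 𝕂) : FarScale η x φ a (c • T) :=
  ⟨fun z z' hz hz' => by rw [smul_mul_assoc, mul_smul_comm, h.mon z z' hz hz', smul_comm],
    by rw [smul_mul_assoc, mul_smul_comm, h.dg, smul_comm]⟩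

theorem FarScale.mul (h : FarScale η x φ a T) (h' : FarScale η x φ a' T') :
    FarScale η x φ (a * a') (T * T') :=
  ⟨fun z z' hz hz' => by
      rw [mul_assoc, h'.mon z z' hz hz', mul_smul_comm, ← mul_assoc, h.mon z z' hz hz',
        smul_mul_assoc, smul_smul, mul_comm a', mul_assoc],
    by rw [mul_assoc, h'.dg, mul_smul_comm, ← mul_assoc, h.dg, smul_mul_assoc, smul_smul,
      mul_comm a', mul_assoc]⟩

theorem FarScale.qBracket (h : FarScale η x φ a T) (h' : FarScale η x φ a' T') (c : 𝕂) :
    FarScale η x φ (a * a') (qBracket c T T') := by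
  rw [FockDuality.qBracket, sub_eq_add_neg, ← neg_smul]
  exact (h.mul h').add ((mul_comm a' a ▸ h'.mul h).smul _)

theorem FarScale.commute_dg (h : FarScale η x φ 1 T) : Commute T (FockDuality.dg η (chi φ)) := by
  have := h.dg
  rwa [one_smul] at this

theorem FarScale.commute_mon (h : FarScale η x φ 1 T) {z z' : σ} (hz : ∀ y, x y ≠ z)
    (hz' : ∀ y, x y ≠ z') : Commute T (FockDuality.mon η (chi φ) [z] [z']) := by
  have := h.mon z z' hz hz'
  rwa [one_smul] at this

end farScale

section commutesCol
variable {r n : ℕ} {ε : Fin n → Fin 2} {a b : Fin r} {τ : Type}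
  {x : τ → Fin r × Fin n} {T e f : Module.End 𝕂 (ConfSpace (colPar r ε))}

/-- An operator which preserves the total occupation numbers of the rows `a` and `b` within a set
of consecutive columns, and commutes with the part of `e` and `f` in these columns, commutes with
`e`, `f` and `k^{±1}`. -/
theorem commutesCol_of_window (cols : Finset (Fin n)) (S S' : Fin n → Prop) [DecidablePred S]
    [DecidablePred S']
    (hx : ∀ t ∉ cols, ∀ s y, x y ≠ (s, t))
    (hcols : ∀ t ∉ cols, ∀ u ∈ cols, ∀ u' ∈ cols, u < t ↔ u' < t)
    (hS : ∀ u ∈ cols, ¬ S u) (hS' : ∀ u ∈ cols, ¬ S' u)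
    (hE : ∑ t ∈ cols, colTermE ε a b t = dg (colPar r ε) (chi (colChar S a b 1)) * e)
    (hF : ∑ t ∈ cols, colTermF ε a b t = dg (colPar r ε) (chi (colChar S' a b (-1))) * f)
    (hT : ∀ (R : Fin n → Prop) [DecidablePred R] (s : ℤ), (∀ u ∈ cols, ∀ u' ∈ cols, R u ↔ R u') →
      FarScale (colPar r ε) x (colChar R a b s) 1 T)
    (he : Commute T e) (hf : Commute T f) : CommutesCol ε a b T := by
  refine ⟨?_, ?_, fun s => ?_⟩
  · rw [colE, ← Finset.sum_add_sum_compl cols, hE]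
    refine ((hT S 1 fun u hu u' hu' => ?_).commute_dg.mul_right he).add_right
      (Commute.sum_right _ _ _ fun t ht => ?_)
    · simp [hS u hu, hS u' hu']
    · rw [Finset.mem_compl] at ht
      exact (hT _ 1 (hcols t ht)).commute_mon (hx t ht a) (hx t ht b)
  · rw [colF, ← Finset.sum_add_sum_compl cols, hF]
    refine ((hT S' (-1) fun u hu u' hu' => ?_).commute_dg.mul_right hf).add_right
      (Commute.sum_right _ _ _ fun t ht => ?_)
    · simp [hS' u hu, hS' u' hu']
    · rw [Finset.mem_compl] at ht
      refine (hT _ (-1) fun u hu u' hu' => ?_).commute_mon (hx t ht b) (hx t ht a)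
      have h1 : u ≠ t := fun h => ht (h ▸ hu)
      have h2 : u' ≠ t := fun h => ht (h ▸ hu')
      have h3 := hcols t ht u hu u' hu'
      rw [lt_iff_not_ge, lt_iff_not_ge, not_iff_not, h1.le_iff_lt, h2.le_iff_lt, h3]
  · exact (hT _ s fun _ _ _ _ => Iff.rfl).commute_dg

theorem commutesCol_of_win {ρ : Type} [Fintype ρ] [DecidableEq ρ] {f : ρ → Fin r} {c₀ c₁ : Fin n}
    {i j : ρ} (hf : Function.Injective f) (hc : c₀.val + 1 = c₁.val) (hij : i ≠ j)
    (hT : ∀ (R : Fin n → Prop) [DecidablePred R] (s : ℤ), (R c₀ ↔ R c₁) →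
      FarScale (colPar r ε) (win f c₀ c₁) (colChar R (f i) (f j) s) 1 T)
    (he : Commute T (colPairE (colPar r ε) (win f c₀ c₁) i j))
    (hf' : Commute T (colPairF (colPar r ε) (win f c₀ c₁) i j)) :
    CommutesCol ε (f i) (f j) T := by
  have hc' : c₀ ≠ c₁ := fun h => by rw [h] at hc; omega
  refine commutesCol_of_window (x := win f c₀ c₁) {c₀, c₁} (· < c₀) (c₁ < ·) (fun t ht s => ?_)
    (fun t ht => ?_)
    ?_ ?_ ((Finset.sum_pair hc').trans (colTermE_add_colTermE hf hc hij))
    ((Finset.sum_pair hc').trans (colTermF_add_colTermF hf hc hij)) (fun R _ s h => ?_) he hf'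
  · simp only [Finset.mem_insert, Finset.mem_singleton, not_or] at ht
    exact win_ne f ht.1 ht.2 s
  · simp only [Finset.mem_insert, Finset.mem_singleton, not_or, Fin.ext_iff] at ht
    simp only [Finset.mem_insert, Finset.mem_singleton, Fin.lt_def]
    rintro u (rfl | rfl) u' (rfl | rfl) <;> omega
  · simp only [Finset.mem_insert, Finset.mem_singleton, forall_eq_or_imp, forall_eq, Fin.lt_def]
    omega
  · simp only [Finset.mem_insert, Finset.mem_singleton, forall_eq_or_imp, forall_eq, Fin.lt_def]
    omega
  · exact hT R s (h c₀ (by simp) c₁ (by simp))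

/-- Monomials outside of the rows `a` and `b`, with a weight that takes the same values on both. -/
theorem commutesCol_mon_far (hab : a ≠ b) {φ : Fin r × Fin n → 𝕂} (hφ : ∀ z, φ z ≠ 0)
    (h : ∀ t, φ (a, t) = φ (b, t)) (c : 𝕂) {C A : List (Fin r × Fin n)} (hA : A.Nodup)
    (hC : ∀ z ∈ C ++ A, z.1 ≠ a ∧ z.1 ≠ b) :
    CommutesCol ε a b (mon (colPar r ε) (fun M => c * chi φ M) C A) := by
  refine commutesCol_of_far hab (monWt_admissible _ _ hA) (fun t => ?_) fun M w hw hw' => ?_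
  · rw [Pi.sub_apply, Pi.sub_apply,
      units_of_not_mem fun hz => (hC (a, t) (List.mem_append_left _ hz)).1 rfl,
      units_of_not_mem fun hz => (hC (a, t) (List.mem_append_right _ hz)).1 rfl,
      units_of_not_mem fun hz => (hC (b, t) (List.mem_append_left _ hz)).2 rfl,
      units_of_not_mem fun hz => (hC (b, t) (List.mem_append_right _ hz)).2 rfl]
    simp
  · have := monWt_add (η := colPar r ε) (g := fun M => c * chi φ M) (A := A) (v := w) (b := 1)
      (fun M => by rw [chi_hop hφ hab h hw hw', one_mul])
      (fun z hz => hw z (hC z (List.mem_append_right _ hz)).1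
        (hC z (List.mem_append_right _ hz)).2) M
    rw [this, one_mul]

theorem commutesCol_dg (hab : a ≠ b) {φ : Fin r × Fin n → 𝕂} (hφ : ∀ z, φ z ≠ 0)
    (h : ∀ t, φ (a, t) = φ (b, t)) : CommutesCol ε a b (dg (colPar r ε) (chi φ)) :=
  commutesCol_of_far hab (admissible_diag _) (fun _ => ⟨rfl, rfl⟩)
    fun M _ hw hw' => chi_hop hφ hab h hw hw' M

end commutesCol

/-! ### The nodes `i ≠ 0` of `𝒰_X(ε)` -/

section rows
variable {r n : ℕ} {ε : Fin n → Fin 2} {κ : Fin n → 𝕂} {S S₀ S₁ : Fin r → Prop} [DecidablePred S]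
  [DecidablePred S₀] [DecidablePred S₁] {τ : Type} [Fintype τ] [DecidableEq τ]
  {x : τ → Fin r × Fin n}

/-- The character `∏ κ_t^{M(s, t)}`, the product over the rows `s` in `S` and all columns `t`. -/
def rowChar (S : Fin r → Prop) [DecidablePred S] (κ : Fin n → 𝕂) (z : Fin r × Fin n) : 𝕂 :=
  if S z.1 then κ z.2 else 1

theorem rowChar_ne_zero (hκ : ∀ t, κ t ≠ 0) (z : Fin r × Fin n) : rowChar S κ z ≠ 0 := by
  unfold rowChar
  split_ifs
  · exact hκ _
  · exact one_ne_zero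

theorem mon_rowChar (hx : Function.Injective x) (hκ : ∀ t, κ t ≠ 0) (hS : ∀ s, S s ↔ S₀ s ∨ S₁ s)
    (hd : ∀ s, S₀ s → ¬ S₁ s) (h0 : ∀ y, ¬ S₀ (x y).1)
    (h1 : ∀ s t, S₁ s → κ t ≠ 1 → (s, t) ∈ Set.range x) {ψ : Fin r × Fin n → 𝕂}
    (hψ : ∀ z, z ∉ Set.range x → ψ z = 1) {c : 𝕂} {C A : List τ} (hA : A.Nodup)
    {g : (τ → ℤ) → 𝕂} (hg : ∀ m, g m = c * ∏ y, (rowChar S₁ κ (x y) * ψ (x y)) ^ m y) :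
    mon (colPar r ε) (fun M => c * chi (fun z => rowChar S κ z * ψ z) M) (C.map x) (A.map x) =
      dg (colPar r ε) (chi (rowChar S₀ κ)) * lmon (colPar r ε) x g C A := by
  refine mon_split (φ₁ := fun z => rowChar S₁ κ z * ψ z) hx (rowChar_ne_zero hκ)
    (fun y => if_neg (h0 y)) (fun z hz => ?_) (fun z => ?_) hA hg
  · rw [hψ z hz, mul_one]
    by_contra h
    simp only [rowChar] at h
    split_ifs at h with h2
    · exact hz (h1 z.1 z.2 h2 h)
    · exact h rfl
  · by_cases h2 : S₀ z.1
    · simp [rowChar, hS, h2, hd]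
    · simp [rowChar, hS, h2]

end rows

section howe
variable {r n : ℕ} {ε : Fin n → Fin 2} {κ : Fin n → 𝕂} {S S₀ S₁ : Fin r → Prop} [DecidablePred S]
  [DecidablePred S₀] [DecidablePred S₁] {a b : Fin r} {c₀ c₁ : Fin n}

/-- The summand of `e_i`, `i ≠ 0`, which acts in the row `s`. -/
def rowTermE (ε : Fin n → Fin 2) (κ : Fin n → 𝕂) (c₀ c₁ : Fin n) (s : Fin r) :
    Module.End 𝕂 (ConfSpace (colPar r ε)) :=
  mon (colPar r ε) (chi (rowChar (· < s) κ)) [(s, c₀)] [(s, c₁)]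

/-- The summand of `f_i`, `i ≠ 0`, which acts in the row `s`. -/
def rowTermF (ε : Fin n → Fin 2) (κ : Fin n → 𝕂) (c₀ c₁ : Fin n) (s : Fin r) :
    Module.End 𝕂 (ConfSpace (colPar r ε)) :=
  mon (colPar r ε) (chi (rowChar (s < ·) fun t => (κ t)⁻¹)) [(s, c₁)] [(s, c₀)]

theorem mon_rowChar_win {ρ : Type} [Fintype ρ] [DecidableEq ρ] {f : ρ → Fin r}
    (hf : Function.Injective f) (hc : c₀ ≠ c₁) (hκ : ∀ t, κ t ≠ 0)
    (hκ' : ∀ t, t ≠ c₀ → t ≠ c₁ → κ t = 1) (hS : ∀ s, S s ↔ S₀ s ∨ S₁ s)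
    (hd : ∀ s, S₀ s → ¬ S₁ s) (h0 : ∀ y, ¬ S₀ (f y)) (h1 : ∀ s, S₁ s → s ∈ Set.range f)
    {ψ : Fin r × Fin n → 𝕂} (hψ : ∀ z, z ∉ Set.range (win f c₀ c₁) → ψ z = 1) {c : 𝕂}
    {C A : List (ρ × Fin 2)} (hA : A.Nodup) {g : (ρ × Fin 2 → ℤ) → 𝕂}
    (hg : ∀ m, g m = c * ∏ y, (rowChar S₁ κ (win f c₀ c₁ y) * ψ (win f c₀ c₁ y)) ^ m y) :
    mon (colPar r ε) (fun M => c * chi (fun z => rowChar S κ z * ψ z) M) (C.map (win f c₀ c₁))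
        (A.map (win f c₀ c₁)) =
      dg (colPar r ε) (chi (rowChar S₀ κ)) * lmon (colPar r ε) (win f c₀ c₁) g C A := by
  refine mon_rowChar (win_injective hf hc) hκ hS hd (fun y => h0 y.1) (fun s t hs ht => ?_) hψ hA hg
  obtain ⟨i, rfl⟩ := h1 s hs
  refine mem_range_win f i ?_
  by_contra h
  rw [not_or] at h
  exact ht (hκ' t h.1 h.2)

theorem injective_pair {a b : Fin r} (hab : a ≠ b) : Function.Injective ![a, b] := by
  intro i j h
  fin_cases i <;> fin_cases j <;> simp_all

variable (hκ0 : κ c₀ = qpar (ε c₀)) (hκ1 : κ c₁ = (qpar (ε c₁))⁻¹)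
  (hκ : ∀ t, t ≠ c₀ → t ≠ c₁ → κ t = 1) (hc : c₀.val + 1 = c₁.val) (hab : a.val + 1 = b.val)
include hκ0 hκ1 hκ hc hab

theorem rowTermE_add_rowTermE :
    rowTermE ε κ c₀ c₁ a + rowTermE ε κ c₀ c₁ b = dg (colPar r ε) (chi (rowChar (· < a) κ)) *
      (lmon (colPar r ε) (win ![a, b] c₀ c₁) (fun _ => 1) [(0, 0)] [(0, 1)] +
        lmon (colPar r ε) (win ![a, b] c₀ c₁)
          (fun m => qpar (ε c₀) ^ m (0, 0) * qpar (ε c₁) ^ (-m (0, 1))) [(1, 0)] [(1, 1)]) := by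
  have hc' : c₀ ≠ c₁ := fun h => by rw [h] at hc; omega
  have hab' : a ≠ b := fun h => by rw [h] at hab; omega
  have hle : a ≤ b := Fin.le_def.mpr (by omega)
  have hf := injective_pair hab'
  have hn : ∀ t, κ t ≠ 0 := by
    intro t
    by_cases h0 : t = c₀
    · rw [h0, hκ0]; exact qpar_ne_zero _
    by_cases h1 : t = c₁
    · rw [h1, hκ1]; exact inv_ne_zero (qpar_ne_zero _)
    · rw [hκ t h0 h1]; exact one_ne_zero
  rw [mul_add]
  congr 1
  · have := mon_rowChar_win (ε := ε) (S := (· < a)) (S₀ := (· < a)) (S₁ := fun _ => False)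
      (C := [(0, 0)]) (A := [(0, 1)]) (ψ := fun _ => 1) (c := 1) (g := fun _ => 1)
      hf hc' hn hκ (by simp) (by simp) ?_ (by simp) (by simp) (by simp) ?_
    · rw [← this]
      simp only [one_mul, mul_one]
      rfl
    · exact Fin.forall_fin_two.mpr ⟨lt_irrefl a, not_lt.mpr hle⟩
    · simp [rowChar]
  · have := mon_rowChar_win (ε := ε) (S := (· < b)) (S₀ := (· < a)) (S₁ := (· = a))
      (C := [(1, 0)]) (A := [(1, 1)]) (ψ := fun _ => 1) (c := 1)
      (g := fun m => qpar (ε c₀) ^ m (0, 0) * qpar (ε c₁) ^ (-m (0, 1)))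
      hf hc' hn hκ ?_ ?_ ?_ ?_ (by simp) (by simp) ?_
    · rw [← this]
      simp only [one_mul, mul_one]
      rfl
    · intro s; rw [Fin.lt_def, Fin.lt_def, Fin.ext_iff]; omega
    · intro s h; exact h.ne
    · exact Fin.forall_fin_two.mpr ⟨lt_irrefl a, not_lt.mpr hle⟩
    · rintro s rfl; exact ⟨0, rfl⟩
    · intro m
      simp [rowChar, win, Fintype.prod_prod_type, Fin.prod_univ_two, hκ0, hκ1, hab'.symm]

theorem rowTermF_add_rowTermF :
    rowTermF ε κ c₀ c₁ b + rowTermF ε κ c₀ c₁ a =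
      dg (colPar r ε) (chi (rowChar (b < ·) fun t => (κ t)⁻¹)) *
      (lmon (colPar r ε) (win ![a, b] c₀ c₁) (fun _ => 1) [(1, 1)] [(1, 0)] +
        lmon (colPar r ε) (win ![a, b] c₀ c₁)
          (fun m => qpar (ε c₀) ^ (-m (1, 0)) * qpar (ε c₁) ^ m (1, 1)) [(0, 1)] [(0, 0)]) := by
  have hc' : c₀ ≠ c₁ := fun h => by rw [h] at hc; omega
  have hab' : a ≠ b := fun h => by rw [h] at hab; omega
  have hle : a ≤ b := Fin.le_def.mpr (by omega)
  have hf := injective_pair hab'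
  have hn : ∀ t, (κ t)⁻¹ ≠ 0 := by
    intro t
    by_cases h0 : t = c₀
    · rw [h0, hκ0]; exact inv_ne_zero (qpar_ne_zero _)
    by_cases h1 : t = c₁
    · rw [h1, hκ1, inv_inv]; exact qpar_ne_zero _
    · rw [hκ t h0 h1, inv_one]; exact one_ne_zero
  have hκ' : ∀ t, t ≠ c₀ → t ≠ c₁ → (κ t)⁻¹ = 1 := fun t h0 h1 => by rw [hκ t h0 h1, inv_one]
  rw [mul_add]
  congr 1
  · have := mon_rowChar_win (ε := ε) (S := (b < ·)) (S₀ := (b < ·)) (S₁ := fun _ => False)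
      (C := [(1, 1)]) (A := [(1, 0)]) (ψ := fun _ => 1) (c := 1) (g := fun _ => 1)
      hf hc' hn hκ' (by simp) (by simp) ?_ (by simp) (by simp) (by simp) ?_
    · rw [← this]
      simp only [one_mul, mul_one]
      rfl
    · exact Fin.forall_fin_two.mpr ⟨not_lt.mpr hle, lt_irrefl b⟩
    · simp [rowChar]
  · have := mon_rowChar_win (ε := ε) (S := (a < ·)) (S₀ := (b < ·)) (S₁ := (· = b))
      (C := [(0, 1)]) (A := [(0, 0)]) (ψ := fun _ => 1) (c := 1)
      (g := fun m => qpar (ε c₀) ^ (-m (1, 0)) * qpar (ε c₁) ^ m (1, 1))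
      hf hc' hn hκ' ?_ ?_ ?_ ?_ (by simp) (by simp) ?_
    · rw [← this]
      simp only [one_mul, mul_one]
      rfl
    · intro s; rw [Fin.lt_def, Fin.lt_def, Fin.ext_iff]; omega
    · intro s h; exact h.ne'
    · exact Fin.forall_fin_two.mpr ⟨not_lt.mpr hle, lt_irrefl b⟩
    · rintro s rfl; exact ⟨1, rfl⟩
    · intro m
      simp [rowChar, win, Fintype.prod_prod_type, Fin.prod_univ_two, hκ0, hκ1, hab']

/-- The `(𝔤𝔩, 𝔤𝔩)` duality for `e_i`, `i ≠ 0`. -/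
theorem commutesCol_rowE : CommutesCol ε a b (∑ s, rowTermE ε κ c₀ c₁ s) := by
  have hc' : c₀ ≠ c₁ := fun h => by rw [h] at hc; omega
  have hab' : a ≠ b := fun h => by rw [h] at hab; omega
  have hle : a ≤ b := Fin.le_def.mpr (by omega)
  have hx := win_injective (injective_pair hab') hc'
  have hn : ∀ t, κ t ≠ 0 := by
    intro t
    by_cases h0 : t = c₀
    · rw [h0, hκ0]; exact qpar_ne_zero _
    by_cases h1 : t = c₁
    · rw [h1, hκ1]; exact inv_ne_zero (qpar_ne_zero _)
    · rw [hκ t h0 h1]; exact one_ne_zero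
  rw [← Finset.sum_add_sum_compl {a, b}, Finset.sum_pair hab',
    rowTermE_add_rowTermE hκ0 hκ1 hκ hc hab]
  refine CommutesCol.add (CommutesCol.mul (commutesCol_dg hab' (rowChar_ne_zero hn) ?_) ?_)
    (CommutesCol.sum fun s hs => ?_)
  · intro t; rw [rowChar, rowChar, if_neg (lt_irrefl a), if_neg (not_lt.mpr hle)]
  · refine commutesCol_of_win (f := ![a, b]) (i := 0) (j := 1) (injective_pair hab') hc
      (by decide) (fun R _ s h => ?_) (rowE_colE_local hx (win_hasPar _ _ _)) ?_
    · refine .add (.lmon hx (colChar_ne_zero _ _ _ _) (by simp) ?_)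
        (.lmon hx (colChar_ne_zero _ _ _ _) (by simp) ?_) <;> simp [win, colChar, h]
    · have := rowE_colF_local hx (win_hasPar (ε := ε) ![a, b] c₀ c₁)
      rw [colPairF, add_comm (lmon _ _ _ [(1, 0)] _)]
      simpa only [neg_sub] using this
  · simp only [Finset.mem_compl, Finset.mem_insert, Finset.mem_singleton, not_or] at hs
    have := commutesCol_mon_far (ε := ε) (φ := rowChar (· < s) κ) (C := [(s, c₀)]) (A := [(s, c₁)])
      hab' (rowChar_ne_zero hn) ?_ 1 (by simp) (by simp [hs])
    · simp only [one_mul] at this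
      exact this
    · intro t
      have : a < s ↔ b < s := by
        have := hs.1; have := hs.2; rw [Fin.ext_iff] at *; rw [Fin.lt_def, Fin.lt_def]; omega
      simp [rowChar, this]

/-- The `(𝔤𝔩, 𝔤𝔩)` duality for `f_i`, `i ≠ 0`. -/
theorem commutesCol_rowF : CommutesCol ε a b (∑ s, rowTermF ε κ c₀ c₁ s) := by
  have hc' : c₀ ≠ c₁ := fun h => by rw [h] at hc; omega
  have hab' : a ≠ b := fun h => by rw [h] at hab; omega
  have hle : a ≤ b := Fin.le_def.mpr (by omega)
  have hx := win_injective (injective_pair hab') hc'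
  have hn : ∀ t, (κ t)⁻¹ ≠ 0 := by
    intro t
    by_cases h0 : t = c₀
    · rw [h0, hκ0]; exact inv_ne_zero (qpar_ne_zero _)
    by_cases h1 : t = c₁
    · rw [h1, hκ1, inv_inv]; exact qpar_ne_zero _
    · rw [hκ t h0 h1, inv_one]; exact one_ne_zero
  rw [← Finset.sum_add_sum_compl {b, a}, Finset.sum_pair hab'.symm,
    rowTermF_add_rowTermF hκ0 hκ1 hκ hc hab]
  refine CommutesCol.add (CommutesCol.mul (commutesCol_dg hab' (rowChar_ne_zero hn) ?_) ?_)
    (CommutesCol.sum fun s hs => ?_)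
  · intro t; rw [rowChar, rowChar, if_neg (not_lt.mpr hle), if_neg (lt_irrefl b)]
  · refine commutesCol_of_win (f := ![a, b]) (i := 0) (j := 1) (injective_pair hab') hc
      (by decide) (fun R _ s h => ?_) (rowF_colE_local hx (win_hasPar _ _ _)) ?_
    · refine .add (.lmon hx (colChar_ne_zero _ _ _ _) (by simp) ?_)
        (.lmon hx (colChar_ne_zero _ _ _ _) (by simp) ?_) <;> simp [win, colChar, h]
    · have := rowF_colF_local hx (win_hasPar (ε := ε) ![a, b] c₀ c₁)
      rw [colPairF, add_comm (lmon _ _ _ [(1, 0)] _)]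
      simpa only [neg_sub] using this
  · simp only [Finset.mem_compl, Finset.mem_insert, Finset.mem_singleton, not_or] at hs
    have := commutesCol_mon_far (ε := ε) (φ := rowChar (s < ·) fun t => (κ t)⁻¹) (C := [(s, c₁)])
      (A := [(s, c₀)]) hab' (rowChar_ne_zero hn) ?_ 1 (by simp) (by simp [hs])
    · simp only [one_mul] at this
      exact this
    · intro t
      have : s < a ↔ s < b := by
        have := hs.1; have := hs.2; rw [Fin.ext_iff] at *; rw [Fin.lt_def, Fin.lt_def]; omega
      simp [rowChar, this]

end howe

/-! ### The node `0` of type `D` and `𝐔^ı(𝔰𝔬_ℓ)` -/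

section so
variable {r n : ℕ} {ε : Fin n → Fin 2} {a b : Fin r} {κ : Fin n → 𝕂} {c₀ c₁ : Fin n}

/-- The operator of `f - q⁻¹ e k⁻¹` for the rows `a` and `b`. -/
def soB (ε : Fin n → Fin 2) (a b : Fin r) : Module.End 𝕂 (ConfSpace (colPar r ε)) :=
  colF ε a b - q⁻¹ • (colE ε a b * colK ε a b (-1))

theorem CommutesCol.soB {T : Module.End 𝕂 (ConfSpace (colPar r ε))} (h : CommutesCol ε a b T) :
    Commute T (soB ε a b) :=
  h.f.sub_right ((h.e.mul_right (h.k _)).smul_right _)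

/-- Commutation with `soB`, reduced to the first columns. In each later column, `soB` acts by a unit
move times a character of the columns before or after, which an operator on the first columns does
not change up to the scalar `1`. -/
theorem commute_soB_of_window {τ : Type} {x : τ → Fin r × Fin n}
    {T B : Module.End 𝕂 (ConfSpace (colPar r ε))} (cols : Finset (Fin n)) (S : Fin n → Prop)
    [DecidablePred S] (hx : ∀ t ∉ cols, ∀ s y, x y ≠ (s, t))
    (hcols : ∀ t ∉ cols, ∀ u ∈ cols, u < t) (hS : ∀ u ∈ cols, ¬ S u)
    (hB : ∑ t ∈ cols, (colTermF ε a b t - q⁻¹ • colTermEK ε a b t) =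
      dg (colPar r ε) (chi (colChar S a b (-1))) * B)
    (hT : ∀ (R : Fin n → Prop) [DecidablePred R], (∀ u ∈ cols, ¬ R u) →
      FarScale (colPar r ε) x (colChar R a b (-1)) 1 T)
    (h : Commute T B) : Commute T (soB ε a b) := by
  rw [soB, colE_mul_colK, colF, Finset.smul_sum, ← Finset.sum_sub_distrib,
    ← Finset.sum_add_sum_compl cols, hB]
  refine ((hT S hS).commute_dg.mul_right h).add_right (Commute.sum_right _ _ _ fun t ht => ?_)
  rw [Finset.mem_compl] at ht
  refine Commute.sub_right ?_ (Commute.smul_right ?_ _)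
  · exact (hT _ fun u hu => (hcols t ht u hu).le.not_gt).commute_mon (hx t ht b) (hx t ht a)
  · exact (hT _ fun u hu => (hcols t ht u hu).not_ge).commute_mon (hx t ht a) (hx t ht b)

section typeD

theorem commute_soB_of_win {T : Module.End 𝕂 (ConfSpace (colPar r ε))} (hab : a ≠ b)
    (h0 : c₀.val = 0) (h1 : c₁.val = 1)
    (hT : ∀ (R : Fin n → Prop) [DecidablePred R], ¬ R c₀ → ¬ R c₁ →
      FarScale (colPar r ε) (win ![a, b] c₀ c₁) (colChar R a b (-1)) 1 T)
    (h : Commute T (colPairF (colPar r ε) (win ![a, b] c₀ c₁) 0 1 -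
      q⁻¹ • colPairEK (colPar r ε) (win ![a, b] c₀ c₁) 0 1)) : Commute T (soB ε a b) := by
  have hc : c₀.val + 1 = c₁.val := by omega
  have hc' : c₀ ≠ c₁ := fun h => by rw [h] at hc; omega
  refine commute_soB_of_window (x := win ![a, b] c₀ c₁) {c₀, c₁} (c₁ < ·) (fun t ht s => ?_)
    (fun t ht => ?_) ?_ ?_ (fun R _ h => hT R (h _ (by simp)) (h _ (by simp))) h
  · simp only [Finset.mem_insert, Finset.mem_singleton, not_or] at ht
    exact win_ne _ ht.1 ht.2 s
  · simp only [Finset.mem_insert, Finset.mem_singleton, not_or, Fin.ext_iff] at ht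
    simp only [Finset.mem_insert, Finset.mem_singleton, forall_eq_or_imp, forall_eq, Fin.lt_def]
    omega
  · simp only [Finset.mem_insert, Finset.mem_singleton, forall_eq_or_imp, forall_eq, Fin.lt_def]
    omega
  · have hF := colTermF_add_colTermF (ε := ε) (injective_pair hab) hc (i := 0) (j := 1) (by decide)
    have hE := colTermEK_add_colTermEK (ε := ε) (injective_pair hab) hc (i := 0) (j := 1)
      (by decide)
    simp only [Matrix.cons_val_zero, Matrix.cons_val_one] at hF hE
    rw [mul_sub, mul_smul_comm, ← hF, ← hE, Finset.sum_pair hc', smul_add]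
    abel

/-- The summand of `e_0` of type `D` which acts in the row `s`. -/
def soTermED (ε : Fin n → Fin 2) (κ : Fin n → 𝕂) (c₀ c₁ : Fin n) (s : Fin r) :
    Module.End 𝕂 (ConfSpace (colPar r ε)) :=
  mon (colPar r ε) (fun M => q⁻¹ ^ s.val * chi (rowChar (· < s) κ) M) [] [(s, c₀), (s, c₁)]

/-- The summand of `-f_0` of type `D` which acts in the row `s`. -/
def soTermFD (ε : Fin n → Fin 2) (κ : Fin n → 𝕂) (c₀ c₁ : Fin n) (s : Fin r) :
    Module.End 𝕂 (ConfSpace (colPar r ε)) :=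
  mon (colPar r ε) (fun M => q ^ (r - 1 - s.val) * chi (rowChar (s < ·) fun t => (κ t)⁻¹) M)
    [(s, c₀), (s, c₁)] []

variable (hε : ε c₀ = 1) (hκ0 : κ c₀ = (qpar (ε c₀))⁻¹) (hκ1 : κ c₁ = (qpar (ε c₁))⁻¹)
  (hκ : ∀ t, t ≠ c₀ → t ≠ c₁ → κ t = 1) (h0 : c₀.val = 0) (h1 : c₁.val = 1)
  (hab : a.val + 1 = b.val)
include hε hκ0 hκ1 hκ h0 h1 hab

theorem soTermED_add_soTermED :
    soTermED ε κ c₀ c₁ a + soTermED ε κ c₀ c₁ b =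
      q⁻¹ ^ a.val • (dg (colPar r ε) (chi (rowChar (· < a) κ)) *
      (lmon (colPar r ε) (win ![a, b] c₀ c₁) (fun _ => 1) [] [(0, 0), (0, 1)] +
        lmon (colPar r ε) (win ![a, b] c₀ c₁)
          (fun m => q⁻¹ * qpar 1 ^ (-m (0, 0)) * qpar (ε c₁) ^ (-m (0, 1))) []
            [(1, 0), (1, 1)])) := by
  have hc' : c₀ ≠ c₁ := fun h => by rw [h] at h0; omega
  have hab' : a ≠ b := fun h => by rw [h] at hab; omega
  have hle : a ≤ b := Fin.le_def.mpr (by omega)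
  have hf := injective_pair hab'
  have hn : ∀ t, κ t ≠ 0 := by
    intro t
    by_cases h0 : t = c₀
    · rw [h0, hκ0]; exact inv_ne_zero (qpar_ne_zero _)
    by_cases h1 : t = c₁
    · rw [h1, hκ1]; exact inv_ne_zero (qpar_ne_zero _)
    · rw [hκ t h0 h1]; exact one_ne_zero
  rw [← mul_smul_comm, smul_add, ← lmon_smul, ← lmon_smul, mul_add]
  congr 1
  · have := mon_rowChar_win (ε := ε) (S := (· < a)) (S₀ := (· < a)) (S₁ := fun _ => False)
      (C := []) (A := [(0, 0), (0, 1)]) (ψ := fun _ => 1) (c := q⁻¹ ^ a.val)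
      (g := fun _ => q⁻¹ ^ a.val * 1)
      hf hc' hn hκ (by simp) (by simp) ?_ (by simp) (by simp) (by decide) ?_
    · rw [← this]
      simp only [mul_one]
      rfl
    · exact Fin.forall_fin_two.mpr ⟨lt_irrefl a, not_lt.mpr hle⟩
    · simp [rowChar]
  · have := mon_rowChar_win (ε := ε) (S := (· < b)) (S₀ := (· < a)) (S₁ := (· = a))
      (C := []) (A := [(1, 0), (1, 1)]) (ψ := fun _ => 1) (c := q⁻¹ ^ b.val)
      (g := fun m => q⁻¹ ^ a.val * (q⁻¹ * qpar 1 ^ (-m (0, 0)) * qpar (ε c₁) ^ (-m (0, 1))))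
      hf hc' hn hκ ?_ ?_ ?_ ?_ (by simp) (by decide) ?_
    · rw [← this]
      simp only [mul_one]
      rfl
    · intro s; rw [Fin.lt_def, Fin.lt_def, Fin.ext_iff]; omega
    · intro s h; exact h.ne
    · exact Fin.forall_fin_two.mpr ⟨lt_irrefl a, not_lt.mpr hle⟩
    · rintro s rfl; exact ⟨0, rfl⟩
    · intro m
      simp [rowChar, win, Fintype.prod_prod_type, Fin.prod_univ_two, hκ0, hκ1, hab'.symm, hε,
        ← hab, pow_succ, mul_assoc]

theorem soTermFD_add_soTermFD :
    soTermFD ε κ c₀ c₁ a + soTermFD ε κ c₀ c₁ b =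
      q ^ (r - 1 - b.val) • (dg (colPar r ε) (chi (rowChar (b < ·) fun t => (κ t)⁻¹)) *
      (lmon (colPar r ε) (win ![a, b] c₀ c₁)
          (fun m => q * qpar 1 ^ m (1, 0) * qpar (ε c₁) ^ m (1, 1)) [(0, 0), (0, 1)] [] +
        lmon (colPar r ε) (win ![a, b] c₀ c₁) (fun _ => 1) [(1, 0), (1, 1)] [])) := by
  have hc' : c₀ ≠ c₁ := fun h => by rw [h] at h0; omega
  have hab' : a ≠ b := fun h => by rw [h] at hab; omega
  have hle : a ≤ b := Fin.le_def.mpr (by omega)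
  have hf := injective_pair hab'
  have hn : ∀ t, (κ t)⁻¹ ≠ 0 := by
    intro t
    by_cases h0 : t = c₀
    · rw [h0, hκ0, inv_inv]; exact qpar_ne_zero _
    by_cases h1 : t = c₁
    · rw [h1, hκ1, inv_inv]; exact qpar_ne_zero _
    · rw [hκ t h0 h1, inv_one]; exact one_ne_zero
  have hκ' : ∀ t, t ≠ c₀ → t ≠ c₁ → (κ t)⁻¹ = 1 := fun t h0 h1 => by rw [hκ t h0 h1, inv_one]
  have hr : r - 1 - a.val = r - 1 - b.val + 1 := by omega
  rw [← mul_smul_comm, smul_add, ← lmon_smul, ← lmon_smul, mul_add]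
  congr 1
  · have := mon_rowChar_win (ε := ε) (S := (a < ·)) (S₀ := (b < ·)) (S₁ := (· = b))
      (C := [(0, 0), (0, 1)]) (A := []) (ψ := fun _ => 1) (c := q ^ (r - 1 - a.val))
      (g := fun m => q ^ (r - 1 - b.val) * (q * qpar 1 ^ m (1, 0) * qpar (ε c₁) ^ m (1, 1)))
      hf hc' hn hκ' ?_ ?_ ?_ ?_ (by simp) (by decide) ?_
    · rw [← this]
      simp only [mul_one]
      rfl
    · intro s; rw [Fin.lt_def, Fin.lt_def, Fin.ext_iff]; omega
    · intro s h; exact h.ne'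
    · exact Fin.forall_fin_two.mpr ⟨not_lt.mpr hle, lt_irrefl b⟩
    · rintro s rfl; exact ⟨1, rfl⟩
    · intro m
      simp [rowChar, win, Fintype.prod_prod_type, Fin.prod_univ_two, hκ0, hκ1, hab', hε,
        hr, pow_succ, mul_assoc]
  · have := mon_rowChar_win (ε := ε) (S := (b < ·)) (S₀ := (b < ·)) (S₁ := fun _ => False)
      (C := [(1, 0), (1, 1)]) (A := []) (ψ := fun _ => 1) (c := q ^ (r - 1 - b.val))
      (g := fun _ => q ^ (r - 1 - b.val) * 1)
      hf hc' hn hκ' (by simp) (by simp) ?_ (by simp) (by simp) (by decide) ?_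
    · rw [← this]
      simp only [mul_one]
      rfl
    · exact Fin.forall_fin_two.mpr ⟨not_lt.mpr hle, lt_irrefl b⟩
    · simp [rowChar]

/-- The rows `a` and `b` are covered by `soE_local_typeD`; the group-like factors of the other rows
take the same values on both rows. -/
theorem commute_soED_soB : Commute (∑ s, soTermED ε κ c₀ c₁ s) (soB ε a b) := by
  have hc' : c₀ ≠ c₁ := fun h => by rw [h] at h0; omega
  have hab' : a ≠ b := fun h => by rw [h] at hab; omega
  have hle : a ≤ b := Fin.le_def.mpr (by omega)
  have hx := win_injective (injective_pair hab') hc'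
  have hn : ∀ t, κ t ≠ 0 := by
    intro t
    by_cases h0 : t = c₀
    · rw [h0, hκ0]; exact inv_ne_zero (qpar_ne_zero _)
    by_cases h1 : t = c₁
    · rw [h1, hκ1]; exact inv_ne_zero (qpar_ne_zero _)
    · rw [hκ t h0 h1]; exact one_ne_zero
  rw [← Finset.sum_add_sum_compl {a, b}, Finset.sum_pair hab',
    soTermED_add_soTermED hε hκ0 hκ1 hκ h0 h1 hab]
  refine Commute.add_left (Commute.smul_left (Commute.mul_left
    (commutesCol_dg hab' (rowChar_ne_zero hn) ?_).soB ?_) _) (Commute.sum_left _ _ _ fun s hs => ?_)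
  · intro t; rw [rowChar, rowChar, if_neg (lt_irrefl a), if_neg (not_lt.mpr hle)]
  · refine commute_soB_of_win hab' h0 h1 (fun R _ hR0 hR1 => ?_) ?_
    · refine .add (.lmon hx (colChar_ne_zero _ _ _ _) (by decide) ?_)
        (.lmon hx (colChar_ne_zero _ _ _ _) (by decide) ?_) <;> simp [win, colChar, hR0, hR1]
    · have := soE_local_typeD hx (p' := ε c₁) (hε ▸ win_hasPar (ε := ε) ![a, b] c₀ c₁)
      rw [lmon_smul, lmon_smul] at this
      rw [colPairF, colPairEK]
      convert this using 1
      simp only [neg_smul, smul_add]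
      abel
  · simp only [Finset.mem_compl, Finset.mem_insert, Finset.mem_singleton, not_or] at hs
    refine (commutesCol_mon_far hab' (rowChar_ne_zero hn) ?_ _ ?_ (by simp [hs])).soB
    · intro t
      have : a < s ↔ b < s := by
        have := hs.1; have := hs.2; rw [Fin.ext_iff] at *; rw [Fin.lt_def, Fin.lt_def]; omega
      simp [rowChar, this]
    · simp [hc']

theorem commute_soFD_soB : Commute (∑ s, soTermFD ε κ c₀ c₁ s) (soB ε a b) := by
  have hc' : c₀ ≠ c₁ := fun h => by rw [h] at h0; omega
  have hab' : a ≠ b := fun h => by rw [h] at hab; omega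
  have hle : a ≤ b := Fin.le_def.mpr (by omega)
  have hx := win_injective (injective_pair hab') hc'
  have hn : ∀ t, (κ t)⁻¹ ≠ 0 := by
    intro t
    by_cases h0 : t = c₀
    · rw [h0, hκ0, inv_inv]; exact qpar_ne_zero _
    by_cases h1 : t = c₁
    · rw [h1, hκ1, inv_inv]; exact qpar_ne_zero _
    · rw [hκ t h0 h1, inv_one]; exact one_ne_zero
  rw [← Finset.sum_add_sum_compl {a, b}, Finset.sum_pair hab',
    soTermFD_add_soTermFD hε hκ0 hκ1 hκ h0 h1 hab]
  refine Commute.add_left (Commute.smul_left (Commute.mul_left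
    (commutesCol_dg hab' (rowChar_ne_zero hn) ?_).soB ?_) _) (Commute.sum_left _ _ _ fun s hs => ?_)
  · intro t; rw [rowChar, rowChar, if_neg (not_lt.mpr hle), if_neg (lt_irrefl b)]
  · refine commute_soB_of_win hab' h0 h1 (fun R _ hR0 hR1 => ?_) ?_
    · refine .add (.lmon hx (colChar_ne_zero _ _ _ _) (by decide) ?_)
        (.lmon hx (colChar_ne_zero _ _ _ _) (by decide) ?_) <;> simp [win, colChar, hR0, hR1]
    · have := soF_local_typeD hx (p' := ε c₁) (hε ▸ win_hasPar (ε := ε) ![a, b] c₀ c₁)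
      rw [lmon_smul, lmon_smul] at this
      rw [colPairF, colPairEK]
      convert this using 1
      simp only [neg_smul, smul_add]
      abel
  · simp only [Finset.mem_compl, Finset.mem_insert, Finset.mem_singleton, not_or] at hs
    refine (commutesCol_mon_far hab' (rowChar_ne_zero hn) ?_ _ (by simp) (by simp [hs])).soB
    intro t
    have : s < a ↔ s < b := by
      have := hs.1; have := hs.2; rw [Fin.ext_iff] at *; rw [Fin.lt_def, Fin.lt_def]; omega
    simp [rowChar, this]

end typeD
end so

/-! ### The node `0` of type `C` and `𝐔^ı(𝔰𝔬_ℓ)` -/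

section soC
variable {r n : ℕ} {ε : Fin n → Fin 2} {a b : Fin r} {κ : Fin n → 𝕂} {c₀ : Fin n} {ρ : Type}

/-- The sites in the rows `f i` and in the column `c₀`. -/
def win₁ (f : ρ → Fin r) (c₀ : Fin n) (y : ρ) : Fin r × Fin n := (f y, c₀)

theorem win₁_injective {f : ρ → Fin r} (hf : Function.Injective f) (c₀ : Fin n) :
    Function.Injective (win₁ f c₀) := fun _ _ h => hf (congrArg Prod.fst h)

theorem win₁_ne (f : ρ → Fin r) {t : Fin n} (h : t ≠ c₀) (s : Fin r) (y : ρ) :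
    win₁ f c₀ y ≠ (s, t) := fun h' => h (congrArg Prod.snd h').symm

section split
variable [Fintype ρ] [DecidableEq ρ] {f : ρ → Fin r} {i j : ρ}

omit [DecidableEq ρ] in
theorem prod_colChar_win₁ (hf : Function.Injective f) (hij : i ≠ j) (S : Fin n → Prop)
    [DecidablePred S] (s : ℤ) (m : ρ → ℤ) :
    ∏ y, colChar S (f i) (f j) s (win₁ f c₀ y) ^ m y =
      if S c₀ then q ^ (s * (m i - m j)) else 1 := by
  have h0 := q_ne_zero
  rw [Fintype.prod_eq_mul i j hij]
  · by_cases h2 : S c₀ <;>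
      simp [h2, colChar, win₁, hf.ne hij.symm, mul_sub, zpow_sub₀ h0, zpow_mul, div_eq_mul_inv]
  · intro k hk
    simp [colChar, win₁, hf.ne hk.1, hf.ne hk.2]

variable (hf : Function.Injective f) (hij : i ≠ j)
include hf hij

theorem colTermE_eq_window :
    colTermE ε (f i) (f j) c₀ = dg (colPar r ε) (chi (colChar (· < c₀) (f i) (f j) 1)) *
      lmon (colPar r ε) (win₁ f c₀) (fun _ => 1) [i] [j] :=
  mon_colChar (C := [i]) (A := [j]) (S₁ := fun _ => False) (win₁_injective hf c₀) (by simp)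
    (by simp) (fun _ => lt_irrefl _) (by simp) (List.nodup_singleton _) fun m => by
      rw [prod_colChar_win₁ hf hij, if_neg not_false]

theorem colTermF_eq_window :
    colTermF ε (f i) (f j) c₀ = dg (colPar r ε) (chi (colChar (c₀ < ·) (f i) (f j) (-1))) *
      lmon (colPar r ε) (win₁ f c₀) (fun _ => 1) [j] [i] :=
  mon_colChar (C := [j]) (A := [i]) (S₁ := fun _ => False) (win₁_injective hf c₀) (by simp)
    (by simp) (fun _ => lt_irrefl _) (by simp) (List.nodup_singleton _) fun m => by
      rw [prod_colChar_win₁ hf hij, if_neg not_false]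

theorem colTermEK_eq_window :
    colTermEK ε (f i) (f j) c₀ = dg (colPar r ε) (chi (colChar (c₀ < ·) (f i) (f j) (-1))) *
      lmon (colPar r ε) (win₁ f c₀) (fun m => q ^ (-(m i - m j))) [i] [j] := by
  refine mon_colChar (C := [i]) (A := [j]) (S₁ := (· = c₀)) (win₁_injective hf c₀)
    (fun t => ?_) (fun t h => h.ne') (fun _ => lt_irrefl _)
    (fun t h => ⟨⟨i, Prod.ext rfl h.symm⟩, ⟨j, Prod.ext rfl h.symm⟩⟩) (List.nodup_singleton _)
    fun m => ?_
  · rw [le_iff_lt_or_eq, eq_comm (a := c₀)]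
  · refine Eq.symm ((prod_colChar_win₁ (c₀ := c₀) hf hij (· = c₀) (-1) m).trans ?_)
    rw [if_pos rfl, neg_one_mul]

theorem colK_eq_window₁ (h0 : c₀.val = 0) :
    colK ε (f i) (f j) (-1) = dg (colPar r ε) (chi (colChar (c₀ < ·) (f i) (f j) (-1))) *
      lmon (colPar r ε) (win₁ f c₀) (fun m => q ^ (-(m i - m j))) [] [] := by
  have := mon_colChar (ε := ε) (S := fun _ => True) (S₀ := (c₀ < ·)) (a := f i) (b := f j)
    (s := -1) (C := []) (A := []) (S₁ := (· = c₀)) (g := fun m => q ^ (-(m i - m j)))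
    (win₁_injective hf c₀) (fun t => ?_) (fun t h => h.ne') (fun _ => lt_irrefl _)
    (fun t h => ⟨⟨i, Prod.ext rfl h.symm⟩, ⟨j, Prod.ext rfl h.symm⟩⟩) List.nodup_nil fun m => ?_
  · rw [← this, colK, dg, mon]
    congr 1
    funext M
    simp [monWt]
  · rw [Fin.lt_def, Fin.ext_iff, true_iff]; omega
  · rw [prod_colChar_win₁ hf hij, if_pos rfl, neg_one_mul]

end split

theorem commute_soB_of_win₁ {T : Module.End 𝕂 (ConfSpace (colPar r ε))} (hab : a ≠ b)
    (h0 : c₀.val = 0)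
    (hT : ∀ (R : Fin n → Prop) [DecidablePred R], ¬ R c₀ →
      FarScale (colPar r ε) (win₁ ![a, b] c₀) (colChar R a b (-1)) 1 T)
    (h : Commute T (lmon (colPar r ε) (win₁ ![a, b] c₀) (fun _ => 1) [1] [0] -
      q⁻¹ • lmon (colPar r ε) (win₁ ![a, b] c₀) (fun m => q ^ (-(m 0 - m 1))) [0] [1])) :
    Commute T (soB ε a b) := by
  refine commute_soB_of_window (x := win₁ ![a, b] c₀) {c₀} (c₀ < ·) (fun t ht s => ?_)
    (fun t ht => ?_) ?_ ?_ (fun R _ h => hT R (h _ (by simp))) h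
  · exact win₁_ne _ (by simpa using ht) s
  · simp only [Finset.mem_singleton, Fin.ext_iff] at ht
    simp only [Finset.mem_singleton, forall_eq, Fin.lt_def]
    omega
  · simp
  · have hF := colTermF_eq_window (ε := ε) (c₀ := c₀) (injective_pair hab) (i := 0) (j := 1)
      (by decide)
    have hE := colTermEK_eq_window (ε := ε) (c₀ := c₀) (injective_pair hab) (i := 0) (j := 1)
      (by decide)
    simp only [Matrix.cons_val_zero, Matrix.cons_val_one] at hF hE
    rw [mul_sub, mul_smul_comm, ← hF, ← hE, Finset.sum_singleton]

theorem FarScale.lshift {σ τ : Type} [Fintype σ] [DecidableEq σ] [DecidableEq τ]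
    {η : σ → Fin 2} {x : τ → σ}
    (hx : Function.Injective x) {φ : σ → 𝕂} (hφ : ∀ z, φ z ≠ 0) {c : (τ → ℤ) → 𝕂} {v : τ → ℤ}
    (hc : Admissible (η ∘ x) c v) (h : ∀ y, φ (x y) = 1) : FarScale η x φ 1 (lshift η x c v) := by
  have hc' := hc.extend hx fun _ => rfl
  have h1 : ∀ M, chi φ (M + Function.extend x v 0) = chi φ M := by
    intro M
    rw [chi_add hφ, chi_eq_one (M := Function.extend x v 0), mul_one]
    intro z
    by_cases hz : ∃ y, x y = z
    · obtain ⟨y, rfl⟩ := hz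
      exact .inl (h y)
    · exact .inr (Function.extend_apply' _ _ _ hz)
  refine ⟨fun z z' hz hz' => ?_, ?_⟩
  · rw [one_smul]
    refine wshift_commute hc' (monWt_admissible _ _ (List.nodup_singleton _)) (fun M => ?_)
      fun M => ?_
    · congr 1
      funext y
      simp [units_apply, List.count_singleton, (hz y).symm, (hz' y).symm]
    · rw [monWt_add (b := 1), one_mul]
      · intro M; rw [h1, one_mul]
      · intro w hw
        rw [List.mem_singleton] at hw
        rw [hw, extend_of_ne hz']
  · rw [one_smul]
    exact (dg_commute hc' h1).symm

/-- The summand of `[2]² e_0` of type `C` which acts in the row `s`. -/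
def soTermEC (ε : Fin n → Fin 2) (κ : Fin n → 𝕂) (c₀ : Fin n) (s : Fin r) :
    Module.End 𝕂 (ConfSpace (colPar r ε)) :=
  wshift (colPar r ε) (fun M => (q⁻¹ ^ s.val * chi (rowChar (· < s) κ) M) *
    (qInt (M (s, c₀)) * qInt (M (s, c₀) - 1))) (units [] - units [(s, c₀), (s, c₀)])

/-- The summand of `-f_0` of type `C` which acts in the row `s`. -/
def soTermFC (ε : Fin n → Fin 2) (κ : Fin n → 𝕂) (c₀ : Fin n) (s : Fin r) :
    Module.End 𝕂 (ConfSpace (colPar r ε)) :=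
  wshift (colPar r ε)
    (fun M => q ^ (r - 1 - s.val) * chi (rowChar (s < ·) fun t => (κ t)⁻¹) M)
    (units [(s, c₀), (s, c₀)] - units [])

theorem wshift_rowChar {S S₀ S₁ : Fin r → Prop} [DecidablePred S] [DecidablePred S₀]
    [DecidablePred S₁] {f : Fin 2 → Fin r} (hf : Function.Injective f) (hκ : ∀ t, κ t ≠ 0)
    (hκ' : ∀ t, t ≠ c₀ → κ t = 1) (hS : ∀ s, S s ↔ S₀ s ∨ S₁ s) (hd : ∀ s, S₀ s → ¬ S₁ s)
    (h0 : ∀ y, ¬ S₀ (f y)) (h1 : ∀ s, S₁ s → s ∈ Set.range f) {c : (Fin 2 → ℤ) → 𝕂}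
    {C A : List (Fin 2)} (hc : Admissible (colPar r ε ∘ win₁ f c₀) c (units C - units A)) :
    wshift (colPar r ε) (fun M => chi (rowChar S κ) M * c (M ∘ win₁ f c₀))
        (units (C.map (win₁ f c₀)) - units (A.map (win₁ f c₀))) =
      dg (colPar r ε) (chi (rowChar S₀ κ)) * lshift (colPar r ε) (win₁ f c₀)
        (fun m => (∏ y, rowChar S₁ κ (win₁ f c₀ y) ^ m y) * c m) (units C - units A) := by
  rw [← extend_units_sub (win₁_injective hf c₀), ← wshift_split (win₁_injective hf c₀)
    (fun _ => rfl) (rowChar_ne_zero hκ) (fun y => if_neg (h0 y)) (fun z hz => ?_) hc]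
  · congr 1
    funext M
    congr 2
    funext z
    by_cases h2 : S₀ z.1
    · simp [rowChar, hS, h2, hd]
    · simp [rowChar, hS, h2]
  · by_contra h
    simp only [rowChar] at h
    split_ifs at h with h2
    · obtain ⟨i, hi⟩ := h1 z.1 h2
      refine hz ⟨i, Prod.ext hi ?_⟩
      by_contra h3
      exact h (hκ' _ (Ne.symm h3))
    · exact h rfl

variable (hε : ε c₀ = 0) (hκ0 : κ c₀ = q⁻¹ * q⁻¹) (hκ : ∀ t, t ≠ c₀ → κ t = 1) (h0 : c₀.val = 0)
  (hab : a.val + 1 = b.val)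
include hε hκ0 hκ h0 hab

theorem commute_soEC_soB : Commute (∑ s, soTermEC ε κ c₀ s) (soB ε a b) := by
  have hab' : a ≠ b := fun h => by rw [h] at hab; omega
  have hle : a ≤ b := Fin.le_def.mpr (by omega)
  have hf := injective_pair hab'
  have hx := win₁_injective hf c₀
  have hq := inv_ne_zero q_ne_zero
  have hn : ∀ t, κ t ≠ 0 := by
    intro t
    by_cases h0 : t = c₀
    · rw [h0, hκ0]; exact mul_ne_zero hq hq
    · rw [hκ t h0]; exact one_ne_zero
  have hA : ∀ (g : (Fin 2 → ℤ) → 𝕂) (s : Fin 2), Admissible (colPar r ε ∘ win₁ ![a, b] c₀)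
      (fun m => g m * (qInt (m s) * qInt (m s - 1))) (units [] - units [s, s]) :=
    fun g s => admissible_lower_two (ζ := colPar r ε ∘ win₁ ![a, b] c₀) (s := s) hε g
  have e1 : soTermEC ε κ c₀ a = dg (colPar r ε) (chi (rowChar (· < a) κ)) *
      lshift (colPar r ε) (win₁ ![a, b] c₀)
        (fun m => q⁻¹ ^ a.val * (qInt (m 0) * qInt (m 0 - 1))) (units [] - units [0, 0]) := by
    have := wshift_rowChar (ε := ε) (κ := κ) (S := (· < a)) (S₀ := (· < a))
      (S₁ := fun _ => False) hf hn hκ (by simp) (by simp) ?_ (by simp) (hA (fun _ => q⁻¹ ^ a.val) 0)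
    · refine Eq.trans ?_ (this.trans ?_)
      · rw [soTermEC]
        congr 1
        funext M
        rw [mul_comm (q⁻¹ ^ a.val), mul_assoc]
        rfl
      · simp [rowChar]
    · exact Fin.forall_fin_two.mpr ⟨lt_irrefl a, not_lt.mpr hle⟩
  have e2 : soTermEC ε κ c₀ b = dg (colPar r ε) (chi (rowChar (· < a) κ)) *
      lshift (colPar r ε) (win₁ ![a, b] c₀)
        (fun m => q⁻¹ ^ a.val * q⁻¹ * q ^ (-m 0 - m 0) * (qInt (m 1) * qInt (m 1 - 1)))
          (units [] - units [1, 1]) := by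
    have := wshift_rowChar (ε := ε) (κ := κ) (S := (· < b)) (S₀ := (· < a))
      (S₁ := (· = a)) hf hn hκ ?_ ?_ ?_ ?_ (hA (fun _ => q⁻¹ ^ b.val) 1)
    · refine Eq.trans ?_ (this.trans ?_)
      · rw [soTermEC]
        congr 1
        funext M
        rw [mul_comm (q⁻¹ ^ b.val), mul_assoc]
        rfl
      · congr 2
        funext m
        simp [rowChar, win₁, Fin.prod_univ_two, hκ0, hab'.symm, ← hab, pow_succ, mul_zpow,
          zpow_sub₀ q_ne_zero, div_eq_mul_inv]
        ring
    · intro s; rw [Fin.lt_def, Fin.lt_def, Fin.ext_iff]; omega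
    · intro s h; exact h.ne
    · exact Fin.forall_fin_two.mpr ⟨lt_irrefl a, not_lt.mpr hle⟩
    · rintro s rfl; exact ⟨0, rfl⟩
  rw [← Finset.sum_add_sum_compl {a, b}, Finset.sum_pair hab', e1, e2, ← mul_add]
  refine Commute.add_left (Commute.mul_left
    (commutesCol_dg hab' (rowChar_ne_zero hn) ?_).soB ?_) (Commute.sum_left _ _ _ fun s hs => ?_)
  · intro t; rw [rowChar, rowChar, if_neg (lt_irrefl a), if_neg (not_lt.mpr hle)]
  · refine commute_soB_of_win₁ hab' h0 (fun R _ hR => ?_) ?_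
    · exact .add (.lshift hx (colChar_ne_zero _ _ _ _) (hA _ _) fun y => if_neg hR)
        (.lshift hx (colChar_ne_zero _ _ _ _) (hA _ _) fun y => if_neg hR)
    · have := soE_local_typeC (η := colPar r ε) hx (fun _ => hε) (q⁻¹ ^ a.val)
      rw [lmon_smul] at this
      simpa only [neg_sub, neg_smul, ← sub_eq_add_neg] using this
  · simp only [Finset.mem_compl, Finset.mem_insert, Finset.mem_singleton, not_or] at hs
    have hz : ∀ s' t, s' ≠ s →
        (units [] - units [(s, c₀), (s, c₀)] : Fin r × Fin n → ℤ) (s', t) = 0 := by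
      intro s' t hs'
      rw [Pi.sub_apply, units_of_not_mem (by simp), units_of_not_mem (by simp [hs']), sub_zero]
    refine (commutesCol_of_far hab' (admissible_lower_two (ζ := colPar r ε) (s := (s, c₀)) hε _)
      (fun t => ⟨hz a t (Ne.symm hs.1), hz b t (Ne.symm hs.2)⟩) fun M w hw hw' => ?_).soB
    rw [chi_hop (rowChar_ne_zero hn) hab' ?_ hw hw', Pi.add_apply, hw (s, c₀) hs.1 hs.2, add_zero]
    intro t
    have : a < s ↔ b < s := by
      have := hs.1; have := hs.2; rw [Fin.ext_iff] at *; rw [Fin.lt_def, Fin.lt_def]; omega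
    simp [rowChar, this]

theorem commute_soFC_soB : Commute (∑ s, soTermFC ε κ c₀ s) (soB ε a b) := by
  have hab' : a ≠ b := fun h => by rw [h] at hab; omega
  have hle : a ≤ b := Fin.le_def.mpr (by omega)
  have hf := injective_pair hab'
  have hx := win₁_injective hf c₀
  have hn : ∀ t, (κ t)⁻¹ ≠ 0 := by
    intro t
    by_cases h0 : t = c₀
    · rw [h0, hκ0, ← mul_inv, inv_inv]; exact mul_ne_zero q_ne_zero q_ne_zero
    · rw [hκ t h0, inv_one]; exact one_ne_zero
  have hκ' : ∀ t, t ≠ c₀ → (κ t)⁻¹ = 1 := fun t h => by rw [hκ t h, inv_one]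
  have hA : ∀ (g : (Fin 2 → ℤ) → 𝕂) (C : List (Fin 2)),
      Admissible (colPar r ε ∘ win₁ ![a, b] c₀) g (units C - units []) := admissible_raise
  have hr : r - 1 - a.val = r - 1 - b.val + 1 := by omega
  have e1 : soTermFC ε κ c₀ a = q ^ (r - 1 - b.val) •
      (dg (colPar r ε) (chi (rowChar (b < ·) fun t => (κ t)⁻¹)) *
      lshift (colPar r ε) (win₁ ![a, b] c₀)
        (fun m => q * q ^ (m 1 + m 1)) (units [0, 0] - units [])) := by
    rw [← mul_smul_comm, ← lshift_smul]
    have := wshift_rowChar (ε := ε) (S := (a < ·)) (S₀ := (b < ·))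
      (S₁ := (· = b)) hf hn hκ' ?_ ?_ ?_ ?_ (hA (fun _ => q ^ (r - 1 - a.val)) [0, 0])
    · refine Eq.trans ?_ (this.trans ?_)
      · rw [soTermFC]
        congr 1
        funext M
        rw [mul_comm]
      · congr 2
        funext m
        simp [rowChar, win₁, Fin.prod_univ_two, hκ0, hab', hr, pow_succ, mul_zpow,
          zpow_add₀ q_ne_zero]
        ring
    · intro s; rw [Fin.lt_def, Fin.lt_def, Fin.ext_iff]; omega
    · intro s h; exact h.ne'
    · exact Fin.forall_fin_two.mpr ⟨not_lt.mpr hle, lt_irrefl b⟩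
    · rintro s rfl; exact ⟨1, rfl⟩
  have e2 : soTermFC ε κ c₀ b = q ^ (r - 1 - b.val) •
      (dg (colPar r ε) (chi (rowChar (b < ·) fun t => (κ t)⁻¹)) *
      lshift (colPar r ε) (win₁ ![a, b] c₀) (fun _ => 1) (units [1, 1] - units [])) := by
    rw [← mul_smul_comm, ← lshift_smul]
    have := wshift_rowChar (ε := ε) (S := (b < ·)) (S₀ := (b < ·))
      (S₁ := fun _ => False) hf hn hκ' (by simp) (by simp) ?_ (by simp)
      (hA (fun _ => q ^ (r - 1 - b.val)) [1, 1])
    · refine Eq.trans ?_ (this.trans ?_)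
      · rw [soTermFC]
        congr 1
        funext M
        rw [mul_comm]
      · simp [rowChar]
    · exact Fin.forall_fin_two.mpr ⟨not_lt.mpr hle, lt_irrefl b⟩
  rw [← Finset.sum_add_sum_compl {a, b}, Finset.sum_pair hab', e1, e2, ← smul_add, ← mul_add]
  refine Commute.add_left (Commute.smul_left (Commute.mul_left
    (commutesCol_dg hab' (rowChar_ne_zero hn) ?_).soB ?_) _) (Commute.sum_left _ _ _ fun s hs => ?_)
  · intro t; rw [rowChar, rowChar, if_neg (not_lt.mpr hle), if_neg (lt_irrefl b)]
  · refine commute_soB_of_win₁ hab' h0 (fun R _ hR => ?_) ?_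
    · exact .add (.lshift hx (colChar_ne_zero _ _ _ _) (hA _ _) fun y => if_neg hR)
        (.lshift hx (colChar_ne_zero _ _ _ _) (hA _ _) fun y => if_neg hR)
    · have := soF_local_typeC (η := colPar r ε) hx (fun _ => hε)
      rw [lmon_smul, add_comm (_ • _) (lmon _ _ _ _ _)] at this
      simpa only [neg_sub, neg_smul, ← sub_eq_add_neg] using this
  · simp only [Finset.mem_compl, Finset.mem_insert, Finset.mem_singleton, not_or] at hs
    have hz : ∀ s' t, s' ≠ s →
        (units [(s, c₀), (s, c₀)] - units [] : Fin r × Fin n → ℤ) (s', t) = 0 := by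
      intro s' t hs'
      rw [Pi.sub_apply, units_of_not_mem (by simp [hs']), units_of_not_mem (by simp), sub_zero]
    refine (commutesCol_of_far hab' (admissible_raise (ζ := colPar r ε) _ _)
      (fun t => ⟨hz a t (Ne.symm hs.1), hz b t (Ne.symm hs.2)⟩) fun M w hw hw' => ?_).soB
    rw [chi_hop (rowChar_ne_zero hn) hab' ?_ hw hw']
    intro t
    have : s < a ↔ s < b := by
      have := hs.1; have := hs.2; rw [Fin.ext_iff] at *; rw [Fin.lt_def, Fin.lt_def]; omega
    simp [rowChar, this]

end soC

/-! ### Commutation with the generators of `𝐔^ı(𝔰𝔭_{2ℓ})` -/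

section ring
variable {A : Type*} [Ring A] [Algebra 𝕂 A] {X X₁ X₂ u v e a E₁ E₂ E₃ F K : A} {α β c c' : 𝕂}

/-- If `X` commutes with `u` and `v` up to scalars, then so it does with their brackets. -/
theorem mul_qBracket (hu : X * u = α • (u * X)) (hv : X * v = β • (v * X)) :
    X * qBracket c u v = (α * β) • (qBracket c u v * X) := by
  rw [qBracket, mul_sub, mul_smul_comm, ← mul_assoc, ← mul_assoc, hu, hv, smul_mul_assoc,
    smul_mul_assoc, mul_assoc, mul_assoc, hu, hv, sub_mul, smul_mul_assoc, smul_sub, mul_smul_comm,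
    mul_smul_comm, ← mul_assoc, ← mul_assoc]
  module

/-- The Jacobi identity for commuting elements. -/
theorem qBracket_qBracket (h : Commute X u) :
    qBracket c X (qBracket c' u v) = qBracket c' u (qBracket c X v) := by
  simp only [qBracket, mul_sub, sub_mul, mul_smul_comm, smul_mul_assoc, ← mul_assoc, h.eq]
  simp only [mul_assoc, h.eq]
  module

/-- Summands which `c`-commute drop out of the `c⁻¹`-bracket. -/
theorem qBracket_add_of_mul_eq (h : u * a = c • (a * u)) (hc : c ≠ 0) :
    qBracket c⁻¹ (e + a) u = qBracket c⁻¹ e u := by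
  rw [qBracket, qBracket, add_mul, mul_add, h, smul_add, inv_smul_smul₀ hc]
  abel

/-- The commutation of `X₁ + X₂` with `F - q T K`, where `T = [E₁, [E₃, E₂]]`. -/
theorem commute_sub_bracket (h11 : Commute X₁ E₁) (h13 : Commute X₁ E₃) (h21 : Commute X₂ E₁)
    (h23 : Commute X₂ E₃) (h1F : Commute X₁ F) (h2 : X₂ * E₂ = q⁻¹ • (E₂ * X₂))
    (hK1 : X₁ * K = q⁻¹ • (K * X₁)) (hK2 : X₂ * K = q • (K * X₂))
    (h2F : qBracket 1 X₂ F =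
      q • (qBracket q⁻¹ E₁ (qBracket q⁻¹ E₃ (qBracket q X₁ E₂)) * K)) :
    Commute (X₁ + X₂) (F - q • (qBracket q⁻¹ E₁ (qBracket q⁻¹ E₃ E₂) * K)) := by
  have h0 := q_ne_zero
  rw [← qBracket_qBracket h13, ← qBracket_qBracket h11] at h2F
  -- The element `X₂` `q`-commutes with `T`, and with `K` by the inverse factor.
  have h2T : X₂ * qBracket q⁻¹ E₁ (qBracket q⁻¹ E₃ E₂) =
      (1 * (1 * q⁻¹)) • (qBracket q⁻¹ E₁ (qBracket q⁻¹ E₃ E₂) * X₂) :=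
    mul_qBracket (by rw [one_smul]; exact h21)
      (mul_qBracket (by rw [one_smul]; exact h23) h2)
  generalize qBracket q⁻¹ E₁ (qBracket q⁻¹ E₃ E₂) = T at *
  rw [one_mul, one_mul] at h2T
  have hK1' : K * X₁ = q • (X₁ * K) := by rw [hK1, smul_inv_smul₀ h0]
  have hK2' : K * X₂ = q⁻¹ • (X₂ * K) := by rw [hK2, inv_smul_smul₀ h0]
  simp only [qBracket, one_smul] at h2F
  have h3 : X₂ * F = q • ((X₁ * T - q • (T * X₁)) * K) + F * X₂ := sub_eq_iff_eq_add.mp h2F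
  rw [Commute, SemiconjBy, mul_sub, sub_mul, add_mul, mul_add, h3, h1F.eq, mul_smul_comm,
    smul_mul_assoc, add_mul, mul_add, ← mul_assoc, ← mul_assoc, h2T, mul_assoc T K, mul_assoc T K,
    hK1', hK2']
  simp only [sub_mul, smul_mul_assoc, mul_smul_comm, mul_assoc]
  module

end ring

section sp
variable {r n : ℕ} {ε : Fin n → Fin 2} {a b c d : Fin r}

/-- The operator of `f - q T k⁻¹` for the rows `b` and `c`, where `T = [e, [e'', e']]` with the
operators `e`, `e'`, `e''` for the rows `a` and `b`, `b` and `c`, `c` and `d`. -/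
def spB (ε : Fin n → Fin 2) (a b c d : Fin r) : Module.End 𝕂 (ConfSpace (colPar r ε)) :=
  colF ε b c -
    q • (qBracket q⁻¹ (colE ε a b) (qBracket q⁻¹ (colE ε c d) (colE ε b c)) * colK ε b c (-1))

theorem Commute.qBracket {A : Type*} [Ring A] [Algebra 𝕂 A] {T u v : A} (hu : Commute T u)
    (hv : Commute T v) (s : 𝕂) : Commute T (qBracket s u v) :=
  (hu.mul_right hv).sub_right ((hv.mul_right hu).smul_right s)

theorem CommutesCol.spB {T : Module.End 𝕂 (ConfSpace (colPar r ε))} (h : CommutesCol ε a b T)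
    (h' : CommutesCol ε b c T) (h'' : CommutesCol ε c d T) : Commute T (spB ε a b c d) :=
  h'.f.sub_right (((Commute.qBracket h.e (Commute.qBracket h''.e h'.e _) _).mul_right
    (h'.k _)).smul_right _)

theorem FarScale.mul_sum {τ : Type} {x : τ → Fin r × Fin n} {φ : Fin n → Fin r × Fin n → 𝕂}
    {T : Module.End 𝕂 (ConfSpace (colPar r ε))} {s : 𝕂} {cols : Finset (Fin n)}
    (hx : ∀ t ∉ cols, ∀ i y, x y ≠ (i, t)) (hT : ∀ t ∉ cols, FarScale (colPar r ε) x (φ t) s T)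
    (i j : Fin r) :
    T * ∑ t ∈ colsᶜ, FockDuality.mon (colPar r ε) (chi (φ t)) [(i, t)] [(j, t)] =
      s • ((∑ t ∈ colsᶜ, FockDuality.mon (colPar r ε) (chi (φ t)) [(i, t)] [(j, t)]) * T) := by
  rw [Finset.mul_sum, Finset.sum_mul, Finset.smul_sum]
  refine Finset.sum_congr rfl fun t ht => ?_
  rw [Finset.mem_compl] at ht
  exact (hT t ht).mon _ _ (hx t ht i) (hx t ht j)

variable {τ : Type} {x : τ → Fin r × Fin n}
  {X₁ X₂ e₁ e₂ e₃ f k : Module.End 𝕂 (ConfSpace (colPar r ε))}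

/-- Commutation with `spB`, reduced to the first columns. -/
theorem commute_spB_of_window (cols : Finset (Fin n)) (S : Fin n → Prop) [DecidablePred S]
    (hx : ∀ t ∉ cols, ∀ s y, x y ≠ (s, t)) (hcols : ∀ t ∉ cols, ∀ u ∈ cols, u < t)
    (hS : ∀ u ∈ cols, ¬ S u) (hE₁ : ∑ t ∈ cols, colTermE ε a b t = e₁)
    (hE₂ : ∑ t ∈ cols, colTermE ε b c t = e₂) (hE₃ : ∑ t ∈ cols, colTermE ε c d t = e₃)
    (hF : ∑ t ∈ cols, colTermF ε b c t = dg (colPar r ε) (chi (colChar S b c (-1))) * f)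
    (hK : colK ε b c (-1) = dg (colPar r ε) (chi (colChar S b c (-1))) * k)
    (hX₁ : ∀ (R : Fin n → Prop) [DecidablePred R] (s : ℤ), (∀ u ∈ cols, R u) →
      FarScale (colPar r ε) x (colChar R b c s) (q ^ s) X₁)
    (hX₂ : ∀ (R : Fin n → Prop) [DecidablePred R] (s : ℤ), (∀ u ∈ cols, R u) →
      FarScale (colPar r ε) x (colChar R b c s) (q ^ (-s)) X₂)
    (hX₁c : ∀ (R : Fin n → Prop) [DecidablePred R], (∀ u ∈ cols, R u) →
      FarScale (colPar r ε) x (colChar R c d 1) 1 X₁)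
    (he₂c : ∀ (R : Fin n → Prop) [DecidablePred R], (∀ u ∈ cols, R u) →
      FarScale (colPar r ε) x (colChar R c d 1) q e₂)
    (hX₁a : ∀ (R : Fin n → Prop) [DecidablePred R], (∀ u ∈ cols, R u) →
      FarScale (colPar r ε) x (colChar R a b 1) 1 X₁)
    (he₂a : ∀ (R : Fin n → Prop) [DecidablePred R], (∀ u ∈ cols, R u) →
      FarScale (colPar r ε) x (colChar R a b 1) q e₂)
    (he₃a : ∀ (R : Fin n → Prop) [DecidablePred R], (∀ u ∈ cols, R u) →
      FarScale (colPar r ε) x (colChar R a b 1) 1 e₃)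
    (hfar : ∀ (R : Fin n → Prop) [DecidablePred R], (∀ u ∈ cols, ¬ R u) →
      ∀ T ∈ [X₁, X₂, e₁, e₂, e₃], FarScale (colPar r ε) x (colChar R b c (-1)) 1 T)
    (h11 : Commute X₁ (colE ε a b)) (h13 : Commute X₁ (colE ε c d))
    (h21 : Commute X₂ (colE ε a b)) (h23 : Commute X₂ (colE ε c d))
    (h1f : qBracket 1 X₁ f = 0) (h2e : qBracket q⁻¹ X₂ e₂ = 0)
    (h2f : qBracket 1 X₂ f =
      q • (qBracket q⁻¹ e₁ (qBracket q⁻¹ e₃ (qBracket q X₁ e₂)) * k)) :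
    Commute (X₁ + X₂) (spB ε a b c d) := by
  have h0 := q_ne_zero
  have split : ∀ T : Fin n → Module.End 𝕂 (ConfSpace (colPar r ε)),
      ∑ t, T t = ∑ t ∈ cols, T t + ∑ t ∈ colsᶜ, T t := fun T =>
    (Finset.sum_add_sum_compl cols T).symm
  have far : ∀ t ∉ cols, ∀ u ∈ cols, ¬ t < u := fun t ht u hu => (hcols t ht u hu).not_gt
  have farX : ∀ T ∈ [X₁, X₂], T * (∑ t ∈ colsᶜ, colTermF ε b c t) =
      (1 : 𝕂) • ((∑ t ∈ colsᶜ, colTermF ε b c t) * T) := fun T hT =>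
    FarScale.mul_sum hx (fun t ht => hfar _ (far t ht) T (by simp at hT ⊢; tauto)) _ _
  have farH : ∀ T ∈ [X₁, X₂, e₁, e₂, e₃],
      Commute T (dg (colPar r ε) (chi (colChar S b c (-1)))) :=
    fun T hT => (hfar S hS T hT).commute_dg
  -- In each of the three brackets, the columns outside of the window `q`-commute and drop out.
  have hR : qBracket q X₁ (colE ε b c) = qBracket q X₁ e₂ := by
    have : X₁ * (∑ t ∈ colsᶜ, colTermE ε b c t) = q • ((∑ t ∈ colsᶜ, colTermE ε b c t) * X₁) :=
      FarScale.mul_sum hx (fun t ht => by simpa using hX₁ _ 1 (hcols t ht)) _ _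
    rw [colE, split, hE₂, qBracket, qBracket, mul_add, add_mul, this, smul_add]
    abel
  have hR' : qBracket q⁻¹ (colE ε c d) (qBracket q X₁ e₂) =
      qBracket q⁻¹ e₃ (qBracket q X₁ e₂) := by
    rw [colE, split, hE₃]
    refine qBracket_add_of_mul_eq (FarScale.mul_sum hx (fun t ht => ?_) _ _) h0
    have := (hX₁c _ (hcols t ht)).qBracket (he₂c _ (hcols t ht)) q
    rwa [one_mul] at this
  have hZ : qBracket q⁻¹ (colE ε a b) (qBracket q⁻¹ e₃ (qBracket q X₁ e₂)) =
      qBracket q⁻¹ e₁ (qBracket q⁻¹ e₃ (qBracket q X₁ e₂)) := by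
    rw [colE, split, hE₁]
    refine qBracket_add_of_mul_eq (FarScale.mul_sum hx (fun t ht => ?_) _ _) h0
    have := (he₃a _ (hcols t ht)).qBracket
      ((hX₁a _ (hcols t ht)).qBracket (he₂a _ (hcols t ht)) q) q⁻¹
    rwa [one_mul, one_mul] at this
  have hK1 := (hX₁ (fun _ => True) (-1) fun _ _ => trivial).dg
  have hK2 := (hX₂ (fun _ => True) (-1) fun _ _ => trivial).dg
  rw [zpow_neg_one] at hK1
  rw [neg_neg, zpow_one] at hK2
  refine commute_sub_bracket h11 h13 h21 h23 ?_ ?_ hK1 hK2 ?_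
  · rw [colF, split, hF]
    refine ((farH X₁ (by simp)).mul_right ?_).add_right ?_
    · rw [qBracket, one_smul, sub_eq_zero] at h1f
      exact h1f
    · have := farX X₁ (by simp)
      rwa [one_smul] at this
  · have h1 : X₂ * (∑ t ∈ colsᶜ, colTermE ε b c t) =
        q⁻¹ • ((∑ t ∈ colsᶜ, colTermE ε b c t) * X₂) :=
      FarScale.mul_sum hx (fun t ht => by simpa using hX₂ _ 1 (hcols t ht)) _ _
    rw [colE, split, hE₂, mul_add, add_mul, h1, sub_eq_zero.mp h2e, smul_add]
  · rw [hR, hR', hZ, hK]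
    have hH : Commute (qBracket q⁻¹ e₁ (qBracket q⁻¹ e₃ (qBracket q X₁ e₂)))
        (dg (colPar r ε) (chi (colChar S b c (-1)))) :=
      (Commute.qBracket (farH e₁ (by simp)).symm (Commute.qBracket (farH e₃ (by simp)).symm
        (Commute.qBracket (farH X₁ (by simp)).symm (farH e₂ (by simp)).symm _) _) _).symm
    have h1 := farX X₂ (by simp)
    have h2 := (farH X₂ (by simp)).eq
    rw [one_smul] at h1
    rw [← mul_assoc, hH.eq, mul_assoc, ← mul_smul_comm, ← h2f, colF, split, hF, qBracket, qBracket,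
      one_smul, one_smul, mul_add, add_mul, h1, ← mul_assoc, h2, mul_sub, mul_assoc, mul_assoc]
    abel

end sp

section pairs
variable {r ℓ n : ℕ} {ε : Fin n → Fin 2}

/-- The first row of the pair `p`. -/
def evenRow (p : Fin ℓ) : Fin (2 * ℓ) := ⟨2 * p.val, by omega⟩

/-- The second row of the pair `p`. -/
def oddRow (p : Fin ℓ) : Fin (2 * ℓ) := ⟨2 * p.val + 1, by omega⟩

/-- Operators `T a b` for pairs of consecutive rows, whose sum over all pairs will commute with
`𝐔^ı(𝔰𝔭_{2ℓ})`. -/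
structure IsSpNode (ε : Fin n → Fin 2) (T : Fin r → Fin r → Module.End 𝕂 (ConfSpace (colPar r ε))) :
    Prop where
  /-- Invariance under moves within the pair. -/
  levi (a b : Fin r) (hab : a.val + 1 = b.val) : CommutesCol ε a b (T a b)
  /-- Invariance under moves between two rows on the same side of the pair. -/
  far (a b c d : Fin r) (hab : a.val + 1 = b.val) (hcd : c.val + 1 = d.val)
    (h : b.val < c.val ∨ d.val < a.val) : CommutesCol ε a b (T c d)
  /-- Two neighbouring pairs of rows. -/
  window (f : Fin 4 → Fin r) (hf : ∀ i, (f i).val = (f 0).val + i.val) :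
    Commute (T (f 0) (f 1) + T (f 2) (f 3)) (spB ε (f 0) (f 1) (f 2) (f 3))

variable {T : Fin (2 * ℓ) → Fin (2 * ℓ) → Module.End 𝕂 (ConfSpace (colPar (2 * ℓ) ε))}

theorem IsSpNode.commutesCol (h : IsSpNode ε T) (p : Fin ℓ) :
    CommutesCol ε (evenRow p) (oddRow p) (∑ p, T (evenRow p) (oddRow p)) := by
  refine CommutesCol.sum fun p' _ => ?_
  by_cases hp : p' = p
  · rw [hp]
    exact h.levi _ _ rfl
  · rw [Fin.ext_iff] at hp
    exact h.far _ _ _ _ rfl rfl (by simp only [evenRow, oddRow]; omega)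

theorem IsSpNode.commute_spB (h : IsSpNode ε T) {p p' : Fin ℓ} (hp : p.val + 1 = p'.val) :
    Commute (∑ p, T (evenRow p) (oddRow p))
      (spB ε (evenRow p) (oddRow p) (evenRow p') (oddRow p')) := by
  have hne : p ≠ p' := fun e => by rw [e] at hp; omega
  rw [← Finset.sum_add_sum_compl {p, p'}, Finset.sum_pair hne]
  refine Commute.add_left ?_ (Commute.sum_left _ _ _ fun p'' hp'' => ?_)
  · refine h.window ![evenRow p, oddRow p, evenRow p', oddRow p'] fun i => ?_
    fin_cases i <;> simp [evenRow, oddRow] <;> omega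
  · simp only [Finset.mem_compl, Finset.mem_insert, Finset.mem_singleton, not_or, Fin.ext_iff]
      at hp''
    refine CommutesCol.spB (h.far _ _ _ _ rfl rfl ?_) (h.far _ _ _ _ ?_ rfl ?_)
      (h.far _ _ _ _ rfl rfl ?_) <;> simp only [evenRow, oddRow] <;> omega

end pairs

/-! ### The node `0` of type `D` and `𝐔^ı(𝔰𝔭_{2ℓ})` -/

section typeD
variable {r n : ℕ} {ε : Fin n → Fin 2} {κ : Fin n → 𝕂} {c₀ c₁ : Fin n} {a b : Fin r}

/-- The character `κ_t^{M(z)} κ_{t'}^{M(z')}` for two sites `z`, `z'` in the columns `t`, `t'`. -/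
def pairChar (κ : Fin n → 𝕂) (z₁ z₂ z : Fin r × Fin n) : 𝕂 := if z = z₁ ∨ z = z₂ then κ z.2 else 1

theorem pairChar_ne_zero (hκ : ∀ t, κ t ≠ 0) (z₁ z₂ z : Fin r × Fin n) :
    pairChar κ z₁ z₂ z ≠ 0 := by
  unfold pairChar
  split_ifs
  · exact hκ _
  · exact one_ne_zero

theorem prod_pairChar {τ : Type} [Fintype τ] [DecidableEq τ] {x : τ → Fin r × Fin n}
    (hx : Function.Injective x) {y₁ y₂ : τ} (h : y₁ ≠ y₂) (m : τ → ℤ) :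
    ∏ y, pairChar κ (x y₁) (x y₂) (x y) ^ m y = κ (x y₁).2 ^ m y₁ * κ (x y₂).2 ^ m y₂ := by
  rw [Fintype.prod_eq_mul y₁ y₂ h]
  · simp [pairChar]
  · intro y hy
    simp [pairChar, hx.eq_iff, hy.1, hy.2]

theorem pairChar_of_not_mem {τ : Type} {x : τ → Fin r × Fin n} (y₁ y₂ : τ) {z : Fin r × Fin n}
    (hz : z ∉ Set.range x) : pairChar κ (x y₁) (x y₂) z = 1 :=
  if_neg fun h => hz (h.elim (fun h => ⟨y₁, h.symm⟩) fun h => ⟨y₂, h.symm⟩)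

/-- The summand of `e_0` of type `D` which acts in the pair of rows `a`, `b`. -/
def spTermED (ε : Fin n → Fin 2) (κ : Fin n → 𝕂) (c₀ c₁ : Fin n) (a b : Fin r) :
    Module.End 𝕂 (ConfSpace (colPar r ε)) :=
  mon (colPar r ε) (fun M => q⁻¹ ^ a.val * chi (rowChar (· < a) κ) M) [] [(a, c₁), (b, c₀)] +
    mon (colPar r ε) (fun M => -q⁻¹ * q⁻¹ ^ a.val *
      chi (fun z => rowChar (· < a) κ z * pairChar κ (b, c₀) (a, c₁) z) M) [] [(a, c₀), (b, c₁)]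

/-- The summand of `f_0` of type `D` which acts in the pair of rows `a`, `b`. -/
def spTermFD (ε : Fin n → Fin 2) (κ : Fin n → 𝕂) (c₀ c₁ : Fin n) (a b : Fin r) :
    Module.End 𝕂 (ConfSpace (colPar r ε)) :=
  mon (colPar r ε) (fun M => -q * q ^ (r - 1 - b.val) *
      chi (fun z => rowChar (b < ·) (fun t => (κ t)⁻¹) z *
        pairChar (fun t => (κ t)⁻¹) (a, c₀) (b, c₁) z) M) [(a, c₁), (b, c₀)] [] +
    mon (colPar r ε) (fun M => q ^ (r - 1 - b.val) * chi (rowChar (b < ·) fun t => (κ t)⁻¹) M)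
      [(a, c₀), (b, c₁)] []

theorem lowerPair_smul {σ ρ : Type} [DecidableEq ρ] (η : σ → Fin 2) (x : ρ × Fin 2 → σ) (p : Fin 2)
    (s : 𝕂) (g : (ρ × Fin 2 → ℤ) → 𝕂) (i j : ρ) :
    lowerPair η x p (fun m => s * g m) i j = s • lowerPair η x p g i j := by
  rw [lowerPair, lowerPair, smul_add, ← lmon_smul, ← lmon_smul]
  congr 2
  funext m
  ring

theorem raisePair_smul {σ ρ : Type} [DecidableEq ρ] (η : σ → Fin 2) (x : ρ × Fin 2 → σ) (p : Fin 2)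
    (s : 𝕂) (g : (ρ × Fin 2 → ℤ) → 𝕂) (i j : ρ) :
    raisePair η x p (fun m => s * g m) i j = s • raisePair η x p g i j := by
  rw [raisePair, raisePair, smul_add, ← lmon_smul, ← lmon_smul]
  congr 2
  funext m
  ring

section window
variable {S₀ S₁ : Fin r → Prop} [DecidablePred S₀] [DecidablePred S₁] {ρ : Type} [Fintype ρ]
  [DecidableEq ρ] {f : ρ → Fin r} {i j : ρ}

theorem spTermED_eq_window (hκ0 : κ c₀ = q⁻¹) (hκ1 : κ c₁ = (qpar (ε c₁))⁻¹)
    (hκ : ∀ t, t ≠ c₀ → t ≠ c₁ → κ t = 1) (hn : ∀ t, κ t ≠ 0) (hf : Function.Injective f)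
    (hc : c₀ ≠ c₁) (hS : ∀ s, s < f i ↔ S₀ s ∨ S₁ s)
    (hd : ∀ s, S₀ s → ¬ S₁ s) (h0 : ∀ y, ¬ S₀ (f y)) (h1 : ∀ s, S₁ s → s ∈ Set.range f)
    {g : (ρ × Fin 2 → ℤ) → 𝕂}
    (hg : ∀ m, g m = q⁻¹ ^ (f i).val * ∏ y, rowChar S₁ κ (win f c₀ c₁ y) ^ m y) :
    spTermED ε κ c₀ c₁ (f i) (f j) = dg (colPar r ε) (chi (rowChar S₀ κ)) *
      lowerPair (colPar r ε) (win f c₀ c₁) (ε c₁) g i j := by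
  have hx := win_injective hf hc
  rw [lowerPair, mul_add]
  refine congrArg₂ (· + ·) ?_ ?_
  · have := mon_rowChar_win (ε := ε) (S := (· < f i)) (C := []) (A := [(i, 1), (j, 0)])
      (ψ := fun _ => 1) (c := q⁻¹ ^ (f i).val) (g := g) hf hc hn hκ hS hd h0 h1 (by simp)
      (by simp) fun m => by simp [hg]
    rw [← this]
    simp only [mul_one]
    rfl
  · have := mon_rowChar_win (ε := ε) (S := (· < f i)) (C := []) (A := [(i, 0), (j, 1)])
      (ψ := pairChar κ (win f c₀ c₁ (j, 0)) (win f c₀ c₁ (i, 1))) (c := -q⁻¹ * q⁻¹ ^ (f i).val)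
      (g := fun m => -q⁻¹ * g m * q ^ (-m (j, 0)) * qpar (ε c₁) ^ (-m (i, 1)))
      hf hc hn hκ hS hd h0 h1 (fun z hz => pairChar_of_not_mem _ _ hz) (by simp) fun m => ?_
    · rw [← this]
      rfl
    · simp only [mul_zpow, Finset.prod_mul_distrib, hg]
      rw [prod_pairChar hx (by simp)]
      simp only [win, Matrix.cons_val_zero, Matrix.cons_val_one, hκ0, hκ1, inv_zpow']
      ring

theorem spTermFD_eq_window (hκ0 : κ c₀ = q⁻¹) (hκ1 : κ c₁ = (qpar (ε c₁))⁻¹)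
    (hκ : ∀ t, t ≠ c₀ → t ≠ c₁ → κ t = 1) (hn : ∀ t, κ t ≠ 0) (hf : Function.Injective f)
    (hc : c₀ ≠ c₁) (hS : ∀ s, f j < s ↔ S₀ s ∨ S₁ s)
    (hd : ∀ s, S₀ s → ¬ S₁ s) (h0 : ∀ y, ¬ S₀ (f y)) (h1 : ∀ s, S₁ s → s ∈ Set.range f)
    {g : (ρ × Fin 2 → ℤ) → 𝕂}
    (hg : ∀ m, g m = q ^ (r - 1 - (f j).val) *
      ∏ y, rowChar S₁ (fun t => (κ t)⁻¹) (win f c₀ c₁ y) ^ m y) :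
    spTermFD ε κ c₀ c₁ (f i) (f j) = dg (colPar r ε) (chi (rowChar S₀ fun t => (κ t)⁻¹)) *
      raisePair (colPar r ε) (win f c₀ c₁) (ε c₁) g i j := by
  have hx := win_injective hf hc
  have hn' : ∀ t, (κ t)⁻¹ ≠ 0 := fun t => inv_ne_zero (hn t)
  have hκ' : ∀ t, t ≠ c₀ → t ≠ c₁ → (κ t)⁻¹ = 1 := fun t h0 h1 => by rw [hκ t h0 h1, inv_one]
  rw [raisePair, mul_add]
  refine congrArg₂ (· + ·) ?_ ?_
  · have := mon_rowChar_win (ε := ε) (S := (f j < ·)) (C := [(i, 1), (j, 0)]) (A := [])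
      (ψ := pairChar (fun t => (κ t)⁻¹) (win f c₀ c₁ (i, 0)) (win f c₀ c₁ (j, 1)))
      (c := -q * q ^ (r - 1 - (f j).val))
      (g := fun m => -q * g m * q ^ m (i, 0) * qpar (ε c₁) ^ m (j, 1))
      hf hc hn' hκ' hS hd h0 h1 (fun z hz => pairChar_of_not_mem _ _ hz) (by simp) fun m => ?_
    · rw [← this]
      rfl
    · simp only [mul_zpow, Finset.prod_mul_distrib, hg]
      rw [prod_pairChar hx (by simp)]
      simp only [win, Matrix.cons_val_zero, Matrix.cons_val_one, hκ0, hκ1, inv_inv]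
      ring
  · have := mon_rowChar_win (ε := ε) (S := (f j < ·)) (C := [(i, 0), (j, 1)]) (A := [])
      (ψ := fun _ => 1) (c := q ^ (r - 1 - (f j).val)) (g := g) hf hc hn' hκ' hS hd h0 h1 (by simp)
      (by simp) fun m => by simp [hg]
    rw [← this]
    simp only [mul_one]
    rfl

end window
end typeD

section farScale
variable {σ ρ : Type} [Fintype σ] [DecidableEq σ] [DecidableEq ρ] {η : σ → Fin 2}
  {x : ρ × Fin 2 → σ} {φ : σ → 𝕂} {s : 𝕂} {p : Fin 2} {i j : ρ}

theorem FarScale.lowerPair (hx : Function.Injective x) (hφ : ∀ z, φ z ≠ 0)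
    (h : φ (x (i, 1)) * φ (x (j, 0)) = s) (h' : φ (x (i, 0)) * φ (x (j, 1)) = s)
    (g : (ρ × Fin 2 → ℤ) → 𝕂) : FarScale η x φ s (lowerPair η x p g i j) :=
  .add (.lmon hx hφ (by simp) (by simp [h])) (.lmon hx hφ (by simp) (by simp [h']))

theorem FarScale.raisePair (hx : Function.Injective x) (hφ : ∀ z, φ z ≠ 0)
    (h : s * (φ (x (i, 1)) * φ (x (j, 0))) = 1) (h' : s * (φ (x (i, 0)) * φ (x (j, 1))) = 1)
    (g : (ρ × Fin 2 → ℤ) → 𝕂) : FarScale η x φ s (raisePair η x p g i j) :=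
  .add (.lmon hx hφ (by simp) (by simp [h])) (.lmon hx hφ (by simp) (by simp [h']))

theorem FarScale.colPairE (hx : Function.Injective x) (hφ : ∀ z, φ z ≠ 0)
    (h : φ (x (j, 0)) = s * φ (x (i, 0))) (h' : φ (x (j, 1)) = s * φ (x (i, 1))) :
    FarScale η x φ s (colPairE η x i j) :=
  .add (.lmon hx hφ (by simp) (by simp [h])) (.lmon hx hφ (by simp) (by simp [h']))

end farScale

section typeD
variable {r n : ℕ} {ε : Fin n → Fin 2} {κ : Fin n → 𝕂} {c₀ c₁ : Fin n} {a b c d : Fin r}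

/-- A factor which takes the same values on both rows can be cancelled. -/
theorem CommutesCol.of_dg_mul {T : Module.End 𝕂 (ConfSpace (colPar r ε))} {φ : Fin r × Fin n → 𝕂}
    {s : 𝕂} (hab : a ≠ b) (hφ : ∀ z, φ z ≠ 0) (h : ∀ t, φ (a, t) = φ (b, t)) (hs : s ≠ 0)
    (hT : CommutesCol ε a b (dg (colPar r ε) (chi φ) * (s • T))) : CommutesCol ε a b T := by
  have h1 : dg (colPar r ε) (chi fun z => (φ z)⁻¹) * dg (colPar r ε) (chi φ) = 1 := by
    rw [dg, dg, wshift_mul (admissible_diag _) (admissible_diag _), add_zero, ← wshift_one]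
    congr 1
    funext M
    rw [add_zero, ← chi_mul]
    exact chi_eq_one fun z => .inl (mul_inv_cancel₀ (hφ z))
  have h2 := ((commutesCol_dg (ε := ε) hab (fun z => inv_ne_zero (hφ z))
    fun t => by rw [h]).mul hT).smul s⁻¹
  rwa [← mul_assoc, h1, one_mul, inv_smul_smul₀ hs] at h2

theorem injective_of_val {k : ℕ} {f : Fin (k + 1) → Fin r}
    (hf : ∀ i, (f i).val = (f 0).val + i.val) : Function.Injective f := by
  intro i j h
  have h1 := hf i
  have h2 := hf j
  rw [h] at h1
  exact Fin.ext (by omega)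

theorem kappa_ne_zero (hκ0 : κ c₀ = q⁻¹) (hκ1 : κ c₁ = (qpar (ε c₁))⁻¹)
    (hκ : ∀ t, t ≠ c₀ → t ≠ c₁ → κ t = 1) (t : Fin n) : κ t ≠ 0 := by
  by_cases h0 : t = c₀
  · rw [h0, hκ0]; exact inv_ne_zero q_ne_zero
  by_cases h1 : t = c₁
  · rw [h1, hκ1]; exact inv_ne_zero (qpar_ne_zero _)
  · rw [hκ t h0 h1]; exact one_ne_zero

theorem colTermE_eq_first {ρ : Type} [Fintype ρ] [DecidableEq ρ] {f : ρ → Fin r} {i j : ρ}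
    (hf : Function.Injective f) (h0 : c₀.val = 0) (hc : c₀.val + 1 = c₁.val) (hij : i ≠ j) :
    colTermE ε (f i) (f j) c₀ + colTermE ε (f i) (f j) c₁ =
      colPairE (colPar r ε) (win f c₀ c₁) i j := by
  rw [colTermE_add_colTermE hf hc hij]
  have : chi (colChar (· < c₀) (f i) (f j) 1) = fun _ => 1 := by
    funext M
    refine chi_eq_one fun z => .inl (if_neg ?_)
    change ¬ z.2 < c₀
    rw [Fin.lt_def]
    omega
  rw [this, dg, wshift_one, one_mul]

variable (hε : ε c₀ = 0) (hκ0 : κ c₀ = q⁻¹) (hκ1 : κ c₁ = (qpar (ε c₁))⁻¹)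
  (hκ : ∀ t, t ≠ c₀ → t ≠ c₁ → κ t = 1) (h0 : c₀.val = 0) (h1 : c₁.val = 1)
include hε hκ0 hκ1 hκ h0 h1

theorem commutesCol_spED (hab : a.val + 1 = b.val) :
    CommutesCol ε a b (spTermED ε κ c₀ c₁ a b) := by
  have hc' : c₀ ≠ c₁ := fun h => by rw [h] at h0; omega
  have hab' : a ≠ b := fun h => by rw [h] at hab; omega
  have hle : a ≤ b := Fin.le_def.mpr (by omega)
  have hf := injective_pair hab'
  have hn := kappa_ne_zero hκ0 hκ1 hκ
  have hx := win_injective hf hc'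
  have := spTermED_eq_window (i := 0) (j := 1) (S₀ := (· < a)) (S₁ := fun _ => False)
    (g := fun _ => q⁻¹ ^ a.val * 1) hκ0 hκ1 hκ hn hf hc'
    (by simp) (by simp) (Fin.forall_fin_two.mpr ⟨lt_irrefl a, not_lt.mpr hle⟩) (by simp)
      (by simp [rowChar])
  rw [lowerPair_smul] at this
  simp only [Matrix.cons_val_zero, Matrix.cons_val_one] at this
  rw [this]
  refine (commutesCol_dg hab' (rowChar_ne_zero hn) fun t => ?_).mul (CommutesCol.smul ?_ _)
  · rw [rowChar, rowChar, if_neg (lt_irrefl a), if_neg (not_lt.mpr hle)]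
  refine commutesCol_of_win (f := ![a, b]) (i := 0) (j := 1) hf (by omega) (by decide)
    (fun R _ s h => .lowerPair hx (colChar_ne_zero _ _ _ _) ?_ ?_ _)
    (lowerPair_colPairE hx (hε ▸ win_hasPar (ε := ε) _ _ _))
    (lowerPair_colPairF hx (hε ▸ win_hasPar (ε := ε) _ _ _))
  all_goals
    by_cases hR : R c₁ <;>
      simp [win, colChar, h, hR, hab'.symm, zpow_ne_zero s q_ne_zero]

theorem isSpNode_ED : IsSpNode (r := r) ε (spTermED ε κ c₀ c₁) := by
  have hc' : c₀ ≠ c₁ := fun h => by rw [h] at h0; omega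
  have hn := kappa_ne_zero hκ0 hκ1 hκ
  have hq := q_ne_zero
  have hqs := fun s : ℤ => zpow_ne_zero s hq
  have far : ∀ a b c d : Fin r, a.val + 1 = b.val → c.val + 1 = d.val →
      (b.val < c.val ∨ d.val < a.val) → CommutesCol ε a b (spTermED ε κ c₀ c₁ c d) := by
    intro a b c d hab hcd h
    have hab' : a ≠ b := fun h => by rw [h] at hab; omega
    have hac : a ≠ c := fun h' => by rw [h'] at hab h; omega
    have had : a ≠ d := fun h' => by rw [h'] at hab h; omega
    have hbc : b ≠ c := fun h' => by rw [h'] at hab h; omega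
    have hbd : b ≠ d := fun h' => by rw [h'] at hab h; omega
    have hlt : (a < c ↔ b < c) := by rw [Fin.lt_def, Fin.lt_def]; omega
    refine .add (commutesCol_mon_far hab' ?_ (fun t => ?_) _ (by simp [hc', hc'.symm]) ?_)
      (commutesCol_mon_far hab' ?_ (fun t => ?_) _ (by simp [hc', hc'.symm]) ?_)
    · exact rowChar_ne_zero hn
    · simp [rowChar, pairChar, hlt, hac, had, hbc, hbd]
    · simp [hac.symm, had.symm, hbc.symm, hbd.symm]
    · exact fun z => mul_ne_zero (rowChar_ne_zero hn z) (pairChar_ne_zero hn _ _ z)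
    · simp [rowChar, pairChar, hlt, hac, had, hbc, hbd]
    · simp [hac.symm, had.symm, hbc.symm, hbd.symm]
  refine ⟨fun a b hab => commutesCol_spED hε hκ0 hκ1 hκ h0 h1 hab, far, fun f hf => ?_⟩
  have hv1 : (f 1).val = (f 0).val + 1 := hf 1
  have hv2 : (f 2).val = (f 0).val + 2 := hf 2
  have hv3 : (f 3).val = (f 0).val + 3 := hf 3
  have hinj := injective_of_val hf
  have hx := win_injective hinj hc'
  have hne : ∀ i j, i ≠ j → f i ≠ f j := fun i j h => hinj.ne h
  have hp : HasPar (colPar r ε) (win f c₀ c₁) 0 (ε c₁) := hε ▸ win_hasPar (ε := ε) f c₀ c₁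
  have hcc : c₀.val + 1 = c₁.val := by omega
  have hnot : ∀ y, ¬ f y < f 0 := fun y => not_lt.mpr (Fin.le_def.mpr (by rw [hf y]; omega))
  -- Both summands have the character of the rows before the window as a common factor.
  have e1 : spTermED ε κ c₀ c₁ (f 0) (f 1) = dg (colPar r ε) (chi (rowChar (· < f 0) κ)) *
      (q⁻¹ ^ (f 0).val • lowerPair (colPar r ε) (win f c₀ c₁) (ε c₁) (fun _ => 1) 0 1) := by
    rw [← lowerPair_smul]
    exact spTermED_eq_window (S₁ := fun _ => False) hκ0 hκ1 hκ hn hinj hc' (by simp) (by simp)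
      hnot (by simp) (by simp [rowChar])
  have e2 : spTermED ε κ c₀ c₁ (f 2) (f 3) = dg (colPar r ε) (chi (rowChar (· < f 0) κ)) *
      (q⁻¹ ^ (f 0).val • lowerPair (colPar r ε) (win f c₀ c₁) (ε c₁)
        (fun m => q⁻¹ * q⁻¹ * q ^ (-m (0, 0)) * qpar (ε c₁) ^ (-m (0, 1)) *
          q ^ (-m (1, 0)) * qpar (ε c₁) ^ (-m (1, 1))) 2 3) := by
    rw [← lowerPair_smul]
    refine spTermED_eq_window (S₁ := fun s => s = f 0 ∨ s = f 1) hκ0 hκ1 hκ hn hinj hc'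
      (fun s => ?_) (fun s h => ?_) hnot (fun s h => ?_) fun m => ?_
    · rw [Fin.lt_def, Fin.lt_def, Fin.ext_iff, Fin.ext_iff]; omega
    · rw [Fin.lt_def] at h; rw [Fin.ext_iff, Fin.ext_iff]; omega
    · rcases h with rfl | rfl
      · exact ⟨0, rfl⟩
      · exact ⟨1, rfl⟩
    · rw [Fintype.prod_prod_type, Fin.prod_univ_four]
      simp only [Fin.prod_univ_two, rowChar, win, hinj.eq_iff]
      simp [hκ0, hκ1, hv2, pow_succ]
      ring
  have hs : q⁻¹ ^ (f 0).val ≠ 0 := pow_ne_zero _ (inv_ne_zero hq)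
  have same : ∀ i j t, rowChar (· < f 0) κ (f i, t) = rowChar (· < f 0) κ (f j, t) :=
    fun i j t => by rw [rowChar, rowChar, if_neg (hnot i), if_neg (hnot j)]
  have hG : ∀ i j, i ≠ j →
      CommutesCol ε (f i) (f j) (dg (colPar r ε) (chi (rowChar (· < f 0) κ))) := fun i j h =>
    commutesCol_dg (hne i j h) (rowChar_ne_zero hn) (same i j)
  have l1 := commutesCol_spED (r := r) (a := f 0) (b := f 1) hε hκ0 hκ1 hκ h0 h1 (by omega)
  have l2 := far (f 2) (f 3) (f 0) (f 1) (by omega) (by omega) (by omega)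
  have l3 := far (f 0) (f 1) (f 2) (f 3) (by omega) (by omega) (by omega)
  have l4 := commutesCol_spED (r := r) (a := f 2) (b := f 3) hε hκ0 hκ1 hκ h0 h1 (by omega)
  rw [e1] at l1 l2
  rw [e2] at l3 l4
  have m1 := l1.of_dg_mul (hne _ _ (by decide)) (rowChar_ne_zero hn) (same _ _) hs
  have m2 := l2.of_dg_mul (hne _ _ (by decide)) (rowChar_ne_zero hn) (same _ _) hs
  have m3 := l3.of_dg_mul (hne _ _ (by decide)) (rowChar_ne_zero hn) (same _ _) hs
  have m4 := l4.of_dg_mul (hne _ _ (by decide)) (rowChar_ne_zero hn) (same _ _) hs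
  rw [e1, e2, ← mul_add, ← smul_add]
  refine Commute.mul_left (CommutesCol.spB (hG _ _ (by decide)) (hG _ _ (by decide))
    (hG _ _ (by decide))) (Commute.smul_left ?_ _)
  refine commute_spB_of_window (x := win f c₀ c₁) {c₀, c₁} (c₁ < ·)
    (fun t ht s => ?_) (fun t ht => ?_) ?_ ?_ ?_ ?_
    ((Finset.sum_pair hc').trans (colTermF_add_colTermF hinj hcc (by decide)))
    (colK_eq_window hinj hcc (by decide) h0) (fun R _ s h => ?_) (fun R _ s h => ?_)
    (fun R _ h => ?_) (fun R _ h => ?_) (fun R _ h => ?_) (fun R _ h => ?_) (fun R _ h => ?_)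
    (fun R _ h => ?_) m1.e m2.e m3.e m4.e
    (lowerPair_colPairF_middle hx hp) (lowerPair_colPairE_middle hx hp) (lower_bracket_eq hx hp)
  · simp only [Finset.mem_insert, Finset.mem_singleton, not_or] at ht
    exact win_ne _ ht.1 ht.2 s
  · simp only [Finset.mem_insert, Finset.mem_singleton, not_or, Fin.ext_iff] at ht
    simp only [Finset.mem_insert, Finset.mem_singleton, forall_eq_or_imp, forall_eq, Fin.lt_def]
    omega
  · simp only [Finset.mem_insert, Finset.mem_singleton, forall_eq_or_imp, forall_eq, Fin.lt_def]
    omega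
  · exact (Finset.sum_pair hc').trans (colTermE_eq_first hinj h0 hcc (by decide))
  · exact (Finset.sum_pair hc').trans (colTermE_eq_first hinj h0 hcc (by decide))
  · exact (Finset.sum_pair hc').trans (colTermE_eq_first hinj h0 hcc (by decide))
  · have hR0 := h c₀ (by simp)
    have hR1 := h c₁ (by simp)
    refine .lowerPair hx (colChar_ne_zero _ _ _ _) ?_ ?_ _ <;>
      simp [win, colChar, hR0, hR1, hinj.eq_iff, hqs, hq]
  · have hR0 := h c₀ (by simp)
    have hR1 := h c₁ (by simp)
    refine .lowerPair hx (colChar_ne_zero _ _ _ _) ?_ ?_ _ <;>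
      simp [win, colChar, hR0, hR1, hinj.eq_iff, hqs, hq]
  · have hR0 := h c₀ (by simp)
    have hR1 := h c₁ (by simp)
    refine .lowerPair hx (colChar_ne_zero _ _ _ _) ?_ ?_ _ <;>
      simp [win, colChar, hR0, hR1, hinj.eq_iff, hqs, hq]
  · have hR0 := h c₀ (by simp)
    have hR1 := h c₁ (by simp)
    refine .colPairE hx (colChar_ne_zero _ _ _ _) ?_ ?_ <;>
      simp [win, colChar, hR0, hR1, hinj.eq_iff, hq]
  · have hR0 := h c₀ (by simp)
    have hR1 := h c₁ (by simp)
    refine .lowerPair hx (colChar_ne_zero _ _ _ _) ?_ ?_ _ <;>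
      simp [win, colChar, hR0, hR1, hinj.eq_iff, hqs, hq]
  · have hR0 := h c₀ (by simp)
    have hR1 := h c₁ (by simp)
    refine .colPairE hx (colChar_ne_zero _ _ _ _) ?_ ?_ <;>
      simp [win, colChar, hR0, hR1, hinj.eq_iff, hq]
  · have hR0 := h c₀ (by simp)
    have hR1 := h c₁ (by simp)
    refine .colPairE hx (colChar_ne_zero _ _ _ _) ?_ ?_ <;>
      simp [win, colChar, hR0, hR1, hinj.eq_iff, hq]
  have hR0 := h c₀ (by simp)
  have hR1 := h c₁ (by simp)
  simp only [List.mem_cons, List.not_mem_nil, or_false, forall_eq_or_imp, forall_eq]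
  refine ⟨.lowerPair hx (colChar_ne_zero _ _ _ _) ?_ ?_ _,
    .lowerPair hx (colChar_ne_zero _ _ _ _) ?_ ?_ _,
    .colPairE hx (colChar_ne_zero _ _ _ _) ?_ ?_, .colPairE hx (colChar_ne_zero _ _ _ _) ?_ ?_,
    .colPairE hx (colChar_ne_zero _ _ _ _) ?_ ?_⟩ <;> simp [win, colChar, hR0, hR1]

theorem commutesCol_spFD (hab : a.val + 1 = b.val) :
    CommutesCol ε a b (spTermFD ε κ c₀ c₁ a b) := by
  have hc' : c₀ ≠ c₁ := fun h => by rw [h] at h0; omega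
  have hab' : a ≠ b := fun h => by rw [h] at hab; omega
  have hle : a ≤ b := Fin.le_def.mpr (by omega)
  have hf := injective_pair hab'
  have hn := kappa_ne_zero hκ0 hκ1 hκ
  have hx := win_injective hf hc'
  have := spTermFD_eq_window (i := 0) (j := 1) (S₀ := (b < ·)) (S₁ := fun _ => False)
    (g := fun _ => q ^ (r - 1 - b.val) * 1) hκ0 hκ1 hκ hn hf hc'
    (by simp) (by simp) (Fin.forall_fin_two.mpr ⟨not_lt.mpr hle, lt_irrefl b⟩) (by simp)
      (by simp [rowChar])
  rw [raisePair_smul] at this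
  simp only [Matrix.cons_val_zero, Matrix.cons_val_one] at this
  rw [this]
  refine (commutesCol_dg hab' (rowChar_ne_zero (fun t => inv_ne_zero (hn t))) fun t => ?_).mul
    (CommutesCol.smul ?_ _)
  · rw [rowChar, rowChar, if_neg (not_lt.mpr hle), if_neg (lt_irrefl b)]
  refine commutesCol_of_win (f := ![a, b]) (i := 0) (j := 1) hf (by omega) (by decide)
    (fun R _ s h => .raisePair hx (colChar_ne_zero _ _ _ _) ?_ ?_ _)
    (raisePair_colPairE hx (hε ▸ win_hasPar (ε := ε) _ _ _))
    (raisePair_colPairF hx (hε ▸ win_hasPar (ε := ε) _ _ _))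
  all_goals
    by_cases hR : R c₁ <;>
      simp [win, colChar, h, hR, hab'.symm, zpow_ne_zero s q_ne_zero]

theorem isSpNode_FD : IsSpNode (r := r) ε (spTermFD ε κ c₀ c₁) := by
  have hc' : c₀ ≠ c₁ := fun h => by rw [h] at h0; omega
  have hn := kappa_ne_zero hκ0 hκ1 hκ
  have hq := q_ne_zero
  have hqs := fun s : ℤ => zpow_ne_zero s hq
  have far : ∀ a b c d : Fin r, a.val + 1 = b.val → c.val + 1 = d.val →
      (b.val < c.val ∨ d.val < a.val) → CommutesCol ε a b (spTermFD ε κ c₀ c₁ c d) := by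
    intro a b c d hab hcd h
    have hab' : a ≠ b := fun h => by rw [h] at hab; omega
    have hac : a ≠ c := fun h' => by rw [h'] at hab h; omega
    have had : a ≠ d := fun h' => by rw [h'] at hab h; omega
    have hbc : b ≠ c := fun h' => by rw [h'] at hab h; omega
    have hbd : b ≠ d := fun h' => by rw [h'] at hab h; omega
    have hlt : (d < a ↔ d < b) := by rw [Fin.lt_def, Fin.lt_def]; omega
    refine .add (commutesCol_mon_far hab' ?_ (fun t => ?_) _ (by simp [hc', hc'.symm]) ?_)
      (commutesCol_mon_far hab' ?_ (fun t => ?_) _ (by simp [hc', hc'.symm]) ?_)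
    · exact fun z => mul_ne_zero (rowChar_ne_zero (fun t => inv_ne_zero (hn t)) z)
        (pairChar_ne_zero (fun t => inv_ne_zero (hn t)) _ _ z)
    · simp [rowChar, pairChar, hlt, hac, had, hbc, hbd]
    · simp [hac.symm, had.symm, hbc.symm, hbd.symm]
    · exact rowChar_ne_zero (fun t => inv_ne_zero (hn t))
    · simp [rowChar, pairChar, hlt, hac, had, hbc, hbd]
    · simp [hac.symm, had.symm, hbc.symm, hbd.symm]
  refine ⟨fun a b hab => commutesCol_spFD hε hκ0 hκ1 hκ h0 h1 hab, far, fun f hf => ?_⟩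
  have hv1 : (f 1).val = (f 0).val + 1 := hf 1
  have hv2 : (f 2).val = (f 0).val + 2 := hf 2
  have hv3 : (f 3).val = (f 0).val + 3 := hf 3
  have hinj := injective_of_val hf
  have hx := win_injective hinj hc'
  have hne : ∀ i j, i ≠ j → f i ≠ f j := fun i j h => hinj.ne h
  have hp : HasPar (colPar r ε) (win f c₀ c₁) 0 (ε c₁) := hε ▸ win_hasPar (ε := ε) f c₀ c₁
  have hpow : r - 1 - (f 1).val = r - 1 - (f 3).val + 2 := by omega
  have hcc : c₀.val + 1 = c₁.val := by omega
  have hnot : ∀ y, ¬ f 3 < f y := fun y => not_lt.mpr (Fin.le_def.mpr (by rw [hf y, hv3]; omega))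
  have e1 : spTermFD ε κ c₀ c₁ (f 2) (f 3) =
      dg (colPar r ε) (chi (rowChar (f 3 < ·) (fun t => (κ t)⁻¹))) *
      (q ^ (r - 1 - (f 3).val) • raisePair (colPar r ε) (win f c₀ c₁) (ε c₁) (fun _ => 1) 2 3) := by
    rw [← raisePair_smul]
    exact spTermFD_eq_window (S₁ := fun _ => False) hκ0 hκ1 hκ hn hinj hc' (by simp) (by simp)
      hnot (by simp) (by simp [rowChar])
  have e2 : spTermFD ε κ c₀ c₁ (f 0) (f 1) =
      dg (colPar r ε) (chi (rowChar (f 3 < ·) (fun t => (κ t)⁻¹))) *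
      (q ^ (r - 1 - (f 3).val) • raisePair (colPar r ε) (win f c₀ c₁) (ε c₁)
        (fun m => q * q * q ^ m (2, 0) * qpar (ε c₁) ^ m (2, 1) * q ^ m (3, 0) *
          qpar (ε c₁) ^ m (3, 1)) 0 1) := by
    rw [← raisePair_smul]
    refine spTermFD_eq_window (S₁ := fun s => s = f 2 ∨ s = f 3) hκ0 hκ1 hκ hn hinj hc'
      (fun s => ?_) (fun s h => ?_) hnot (fun s h => ?_) fun m => ?_
    · rw [Fin.lt_def, Fin.lt_def, Fin.ext_iff, Fin.ext_iff]; omega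
    · rw [Fin.lt_def] at h; rw [Fin.ext_iff, Fin.ext_iff]; omega
    · rcases h with rfl | rfl
      · exact ⟨2, rfl⟩
      · exact ⟨3, rfl⟩
    · rw [Fintype.prod_prod_type, Fin.prod_univ_four]
      simp only [Fin.prod_univ_two, rowChar, win, hinj.eq_iff]
      simp [hκ0, hκ1, hpow, pow_succ]
      ring
  have hs : q ^ (r - 1 - (f 3).val) ≠ 0 := pow_ne_zero _ hq
  have same : ∀ i j t, rowChar (f 3 < ·) (fun t => (κ t)⁻¹) (f i, t) =
      rowChar (f 3 < ·) (fun t => (κ t)⁻¹) (f j, t) :=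
    fun i j t => by rw [rowChar, rowChar, if_neg (hnot i), if_neg (hnot j)]
  have hG : ∀ i j, i ≠ j →
      CommutesCol ε (f i) (f j) (dg (colPar r ε) (chi (rowChar (f 3 < ·) (fun t => (κ t)⁻¹)))) :=
        fun i j h =>
    commutesCol_dg (hne i j h) (rowChar_ne_zero (fun t => inv_ne_zero (hn t))) (same i j)
  have l1 := commutesCol_spFD (r := r) (a := f 2) (b := f 3) hε hκ0 hκ1 hκ h0 h1 (by omega)
  have l2 := far (f 0) (f 1) (f 2) (f 3) (by omega) (by omega) (by omega)
  have l3 := far (f 2) (f 3) (f 0) (f 1) (by omega) (by omega) (by omega)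
  have l4 := commutesCol_spFD (r := r) (a := f 0) (b := f 1) hε hκ0 hκ1 hκ h0 h1 (by omega)
  rw [e1] at l1 l2
  rw [e2] at l3 l4
  have m1 := l1.of_dg_mul (hne _ _ (by decide)) (rowChar_ne_zero (fun t => inv_ne_zero (hn t)))
      (same _ _) hs
  have m2 := l2.of_dg_mul (hne _ _ (by decide)) (rowChar_ne_zero (fun t => inv_ne_zero (hn t)))
      (same _ _) hs
  have m3 := l3.of_dg_mul (hne _ _ (by decide)) (rowChar_ne_zero (fun t => inv_ne_zero (hn t)))
      (same _ _) hs
  have m4 := l4.of_dg_mul (hne _ _ (by decide)) (rowChar_ne_zero (fun t => inv_ne_zero (hn t)))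
      (same _ _) hs
  rw [add_comm, e1, e2, ← mul_add, ← smul_add]
  refine Commute.mul_left (CommutesCol.spB (hG _ _ (by decide)) (hG _ _ (by decide))
    (hG _ _ (by decide))) (Commute.smul_left ?_ _)
  refine commute_spB_of_window (x := win f c₀ c₁) {c₀, c₁} (c₁ < ·)
    (fun t ht s => ?_) (fun t ht => ?_) ?_ ?_ ?_ ?_
    ((Finset.sum_pair hc').trans (colTermF_add_colTermF hinj hcc (by decide)))
    (colK_eq_window hinj hcc (by decide) h0) (fun R _ s h => ?_) (fun R _ s h => ?_)
    (fun R _ h => ?_) (fun R _ h => ?_) (fun R _ h => ?_) (fun R _ h => ?_) (fun R _ h => ?_)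
    (fun R _ h => ?_) m2.e m1.e m4.e m3.e
    (raisePair_colPairF_middle hx hp) (raisePair_colPairE_middle hx hp) (raise_bracket_eq hx hp)
  · simp only [Finset.mem_insert, Finset.mem_singleton, not_or] at ht
    exact win_ne _ ht.1 ht.2 s
  · simp only [Finset.mem_insert, Finset.mem_singleton, not_or, Fin.ext_iff] at ht
    simp only [Finset.mem_insert, Finset.mem_singleton, forall_eq_or_imp, forall_eq, Fin.lt_def]
    omega
  · simp only [Finset.mem_insert, Finset.mem_singleton, forall_eq_or_imp, forall_eq, Fin.lt_def]
    omega
  · exact (Finset.sum_pair hc').trans (colTermE_eq_first hinj h0 hcc (by decide))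
  · exact (Finset.sum_pair hc').trans (colTermE_eq_first hinj h0 hcc (by decide))
  · exact (Finset.sum_pair hc').trans (colTermE_eq_first hinj h0 hcc (by decide))
  · have hR0 := h c₀ (by simp)
    have hR1 := h c₁ (by simp)
    refine .raisePair hx (colChar_ne_zero _ _ _ _) ?_ ?_ _ <;>
      simp [win, colChar, hR0, hR1, hinj.eq_iff, hqs, hq]
  · have hR0 := h c₀ (by simp)
    have hR1 := h c₁ (by simp)
    refine .raisePair hx (colChar_ne_zero _ _ _ _) ?_ ?_ _ <;>
      simp [win, colChar, hR0, hR1, hinj.eq_iff, hqs, hq]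
  · have hR0 := h c₀ (by simp)
    have hR1 := h c₁ (by simp)
    refine .raisePair hx (colChar_ne_zero _ _ _ _) ?_ ?_ _ <;>
      simp [win, colChar, hR0, hR1, hinj.eq_iff, hqs, hq]
  · have hR0 := h c₀ (by simp)
    have hR1 := h c₁ (by simp)
    refine .colPairE hx (colChar_ne_zero _ _ _ _) ?_ ?_ <;>
      simp [win, colChar, hR0, hR1, hinj.eq_iff, hq]
  · have hR0 := h c₀ (by simp)
    have hR1 := h c₁ (by simp)
    refine .raisePair hx (colChar_ne_zero _ _ _ _) ?_ ?_ _ <;>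
      simp [win, colChar, hR0, hR1, hinj.eq_iff, hqs, hq]
  · have hR0 := h c₀ (by simp)
    have hR1 := h c₁ (by simp)
    refine .colPairE hx (colChar_ne_zero _ _ _ _) ?_ ?_ <;>
      simp [win, colChar, hR0, hR1, hinj.eq_iff, hq]
  · have hR0 := h c₀ (by simp)
    have hR1 := h c₁ (by simp)
    refine .colPairE hx (colChar_ne_zero _ _ _ _) ?_ ?_ <;>
      simp [win, colChar, hR0, hR1, hinj.eq_iff, hq]
  have hR0 := h c₀ (by simp)
  have hR1 := h c₁ (by simp)
  simp only [List.mem_cons, List.not_mem_nil, or_false, forall_eq_or_imp, forall_eq]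
  refine ⟨.raisePair hx (colChar_ne_zero _ _ _ _) ?_ ?_ _,
    .raisePair hx (colChar_ne_zero _ _ _ _) ?_ ?_ _,
    .colPairE hx (colChar_ne_zero _ _ _ _) ?_ ?_, .colPairE hx (colChar_ne_zero _ _ _ _) ?_ ?_,
    .colPairE hx (colChar_ne_zero _ _ _ _) ?_ ?_⟩ <;> simp [win, colChar, hR0, hR1]

end typeD

/-! ### The node `0` of type `C` and `𝐔^ı(𝔰𝔭_{2ℓ})` -/

section typeC
variable {r n : ℕ} {ε : Fin n → Fin 2} {κ : Fin n → 𝕂} {c₀ : Fin n} {a b : Fin r}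

/-- The summand of `e_0` of type `C` which acts in the pair of rows `a`, `b`. -/
def spTermEC (ε : Fin n → Fin 2) (κ : Fin n → 𝕂) (c₀ : Fin n) (a b : Fin r) :
    Module.End 𝕂 (ConfSpace (colPar r ε)) :=
  mon (colPar r ε) (fun M => q⁻¹ ^ a.val * chi (rowChar (· < a) κ) M) [] [(a, c₀), (b, c₀)]

/-- The summand of `-f_0` of type `C` which acts in the pair of rows `a`, `b`. -/
def spTermFC (ε : Fin n → Fin 2) (κ : Fin n → 𝕂) (c₀ : Fin n) (a b : Fin r) :
    Module.End 𝕂 (ConfSpace (colPar r ε)) :=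
  mon (colPar r ε) (fun M => q ^ (r - 1 - b.val) * chi (rowChar (b < ·) fun t => (κ t)⁻¹) M)
    [(a, c₀), (b, c₀)] []

theorem mon_rowChar_win₁ {S S₀ S₁ : Fin r → Prop} [DecidablePred S] [DecidablePred S₀]
    [DecidablePred S₁] {ρ : Type} [Fintype ρ] [DecidableEq ρ] {f : ρ → Fin r}
    (hf : Function.Injective f) (hκ : ∀ t, κ t ≠ 0) (hκ' : ∀ t, t ≠ c₀ → κ t = 1)
    (hS : ∀ s, S s ↔ S₀ s ∨ S₁ s) (hd : ∀ s, S₀ s → ¬ S₁ s) (h0 : ∀ y, ¬ S₀ (f y))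
    (h1 : ∀ s, S₁ s → s ∈ Set.range f) {c : 𝕂} {C A : List ρ} (hA : A.Nodup)
    {g : (ρ → ℤ) → 𝕂} (hg : ∀ m, g m = c * ∏ y, rowChar S₁ κ (win₁ f c₀ y) ^ m y) :
    mon (colPar r ε) (fun M => c * chi (rowChar S κ) M) (C.map (win₁ f c₀)) (A.map (win₁ f c₀)) =
      dg (colPar r ε) (chi (rowChar S₀ κ)) * lmon (colPar r ε) (win₁ f c₀) g C A := by
  have := mon_rowChar (ε := ε) (C := C) (ψ := fun _ => 1) (win₁_injective hf c₀) hκ hS hd h0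
    (fun s t hs ht => ?_) (by simp) hA (g := g) (c := c) fun m => by simp [hg]
  · rw [← this]
    simp only [mul_one]
  · obtain ⟨i, rfl⟩ := h1 s hs
    refine ⟨i, Prod.ext rfl ?_⟩
    by_contra h
    exact ht (hκ' t (Ne.symm h))

theorem colTermE_eq_first₁ {ρ : Type} [Fintype ρ] [DecidableEq ρ] {f : ρ → Fin r} {i j : ρ}
    (hf : Function.Injective f) (h0 : c₀.val = 0) (hij : i ≠ j) :
    colTermE ε (f i) (f j) c₀ = lmon (colPar r ε) (win₁ f c₀) (fun _ => 1) [i] [j] := by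
  rw [colTermE_eq_window hf hij]
  have : chi (colChar (· < c₀) (f i) (f j) 1) = fun _ => 1 := by
    funext M
    refine chi_eq_one fun z => .inl (if_neg ?_)
    change ¬ z.2 < c₀
    rw [Fin.lt_def]
    omega
  rw [this, dg, wshift_one, one_mul]

theorem commutesCol_of_win₁ {ρ : Type} [Fintype ρ] [DecidableEq ρ] {f : ρ → Fin r} {i j : ρ}
    (hf : Function.Injective f) (hij : i ≠ j) {T : Module.End 𝕂 (ConfSpace (colPar r ε))}
    (hT : ∀ (R : Fin n → Prop) [DecidablePred R] (s : ℤ),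
      FarScale (colPar r ε) (win₁ f c₀) (colChar R (f i) (f j) s) 1 T)
    (he : Commute T (lmon (colPar r ε) (win₁ f c₀) (fun _ => 1) [i] [j]))
    (hf' : Commute T (lmon (colPar r ε) (win₁ f c₀) (fun _ => 1) [j] [i])) :
    CommutesCol ε (f i) (f j) T := by
  refine commutesCol_of_window (x := win₁ f c₀) {c₀} (· < c₀) (c₀ < ·) (fun t ht s => ?_)
    (fun t _ => ?_) (by simp) (by simp)
    ((Finset.sum_singleton _ _).trans (colTermE_eq_window hf hij))
    ((Finset.sum_singleton _ _).trans (colTermF_eq_window hf hij))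
    (fun R _ s _ => hT R s) he hf'
  · exact win₁_ne _ (by simpa using ht) s
  · simp

theorem commute_of_qBracket_one {A : Type*} [Ring A] [Algebra 𝕂 A] {u v : A}
    (h : qBracket 1 u v = 0) : Commute u v := by
  rw [qBracket, one_smul, sub_eq_zero] at h
  exact h

variable (hε : ε c₀ = 1) (hκ0 : κ c₀ = (qpar 1)⁻¹ * (qpar 1)⁻¹) (hκ : ∀ t, t ≠ c₀ → κ t = 1)
  (h0 : c₀.val = 0)
include hε hκ0 hκ h0

omit h0 in
theorem commutesCol_spEC (hab : a.val + 1 = b.val) :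
    CommutesCol ε a b (spTermEC ε κ c₀ a b) := by
  have hab' : a ≠ b := fun h => by rw [h] at hab; omega
  have hle : a ≤ b := Fin.le_def.mpr (by omega)
  have hf := injective_pair hab'
  have hn : ∀ t, κ t ≠ 0 := by
    intro t
    by_cases h0 : t = c₀
    · rw [h0, hκ0]; exact mul_ne_zero (inv_ne_zero (qpar_ne_zero 1)) (inv_ne_zero (qpar_ne_zero 1))
    · rw [hκ t h0]; exact one_ne_zero
  have hx := win₁_injective hf c₀
  have e : spTermEC ε κ c₀ a b = dg (colPar r ε) (chi (rowChar (· < a) κ)) *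
      (q⁻¹ ^ a.val • lmon (colPar r ε) (win₁ ![a, b] c₀) (fun _ => 1) [] [0, 1]) := by
    rw [← lmon_smul]
    exact mon_rowChar_win₁ (S₀ := (· < a)) (S₁ := fun _ => False) (C := []) (A := [0, 1]) hf hn hκ
      (by simp) (by simp) (Fin.forall_fin_two.mpr ⟨lt_irrefl a, not_lt.mpr hle⟩) (by simp)
        (by decide) (by simp [rowChar])
  rw [e]
  refine (commutesCol_dg hab' (rowChar_ne_zero hn) fun t => ?_).mul (CommutesCol.smul ?_ _)
  · rw [rowChar, rowChar, if_neg (lt_irrefl a), if_neg (not_lt.mpr hle)]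
  have he := commute_of_qBracket_one (lower_colE_typeC (η := colPar r ε) hx fun _ => hε)
  have hf' := commute_of_qBracket_one (lower_colF_typeC (η := colPar r ε) hx fun _ => hε)
  refine commutesCol_of_win₁ (f := ![a, b]) (i := 0) (j := 1) (c₀ := c₀) hf (by decide)
    (fun R _ s => .lmon hx (colChar_ne_zero _ _ _ _) (by decide) ?_) he hf'
  by_cases hR : R c₀ <;> simp [win₁, colChar, hR, hab'.symm, zpow_ne_zero s q_ne_zero]

theorem isSpNode_EC : IsSpNode (r := r) ε (spTermEC ε κ c₀) := by
  have hn : ∀ t, κ t ≠ 0 := by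
    intro t
    by_cases h0 : t = c₀
    · rw [h0, hκ0]; exact mul_ne_zero (inv_ne_zero (qpar_ne_zero 1)) (inv_ne_zero (qpar_ne_zero 1))
    · rw [hκ t h0]; exact one_ne_zero
  have hq := q_ne_zero
  have hqs := fun s : ℤ => zpow_ne_zero s hq
  have hq1 := qpar_ne_zero 1
  have far : ∀ a b c d : Fin r, a.val + 1 = b.val → c.val + 1 = d.val →
      (b.val < c.val ∨ d.val < a.val) → CommutesCol ε a b (spTermEC ε κ c₀ c d) := by
    intro a b c d hab hcd h
    have hab' : a ≠ b := fun h => by rw [h] at hab; omega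
    have hac : a ≠ c := fun h' => by rw [h'] at hab h; omega
    have had : a ≠ d := fun h' => by rw [h'] at hab h; omega
    have hbc : b ≠ c := fun h' => by rw [h'] at hab h; omega
    have hbd : b ≠ d := fun h' => by rw [h'] at hab h; omega
    have hcd' : c ≠ d := fun h => by rw [h] at hcd; omega
    have hlt : (a < c ↔ b < c) := by rw [Fin.lt_def, Fin.lt_def]; omega
    refine commutesCol_mon_far hab' (rowChar_ne_zero hn) (fun t => ?_) _ (by simp [hcd']) ?_
    · simp [rowChar, hlt]
    · simp [hac.symm, had.symm, hbc.symm, hbd.symm]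
  refine ⟨fun a b hab => commutesCol_spEC hε hκ0 hκ hab, far, fun f hf => ?_⟩
  have hv1 : (f 1).val = (f 0).val + 1 := hf 1
  have hv2 : (f 2).val = (f 0).val + 2 := hf 2
  have hv3 : (f 3).val = (f 0).val + 3 := hf 3
  have hinj := injective_of_val hf
  have hx := win₁_injective hinj c₀
  have hne : ∀ i j, i ≠ j → f i ≠ f j := fun i j h => hinj.ne h
  have hp : ∀ y, colPar r ε (win₁ f c₀ y) = 1 := fun _ => hε
  have hnot : ∀ y, ¬ f y < f 0 := fun y => not_lt.mpr (Fin.le_def.mpr (by rw [hf y]; omega))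
  have e1 : spTermEC ε κ c₀ (f 0) (f 1) = dg (colPar r ε) (chi (rowChar (· < f 0) κ)) *
      (q⁻¹ ^ (f 0).val • lmon (colPar r ε) (win₁ f c₀) (fun _ => 1) [] [0, 1]) := by
    rw [← lmon_smul]
    exact mon_rowChar_win₁ (S₀ := (· < f 0)) (S₁ := fun _ => False) (C := []) (A := [0, 1]) hinj hn
      hκ
      (by simp) (by simp) hnot (by simp) (by decide) (by simp [rowChar])
  have e2 : spTermEC ε κ c₀ (f 2) (f 3) = dg (colPar r ε) (chi (rowChar (· < f 0) κ)) *
      (q⁻¹ ^ (f 0).val • lmon (colPar r ε) (win₁ f c₀)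
        (fun m => q⁻¹ * q⁻¹ * qpar 1 ^ (-(m 0 + m 0)) * qpar 1 ^ (-(m 1 + m 1))) [] [2, 3]) := by
    rw [← lmon_smul]
    refine mon_rowChar_win₁ (S₁ := fun s => s = f 0 ∨ s = f 1) (C := []) (A := [2, 3]) hinj hn hκ
      (fun s => ?_) (fun s h => ?_) hnot (fun s h => ?_) (by decide) fun m => ?_
    · rw [Fin.lt_def, Fin.lt_def, Fin.ext_iff, Fin.ext_iff]; omega
    · rw [Fin.lt_def] at h; rw [Fin.ext_iff, Fin.ext_iff]; omega
    · rcases h with rfl | rfl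
      · exact ⟨0, rfl⟩
      · exact ⟨1, rfl⟩
    · rw [Fin.prod_univ_four]
      simp only [rowChar, win₁, hinj.eq_iff]
      simp [hκ0, hv2, pow_succ, mul_zpow, zpow_add₀ hq1]
      ring
  have hs : q⁻¹ ^ (f 0).val ≠ 0 := pow_ne_zero _ (inv_ne_zero hq)
  have same : ∀ i j t, rowChar (· < f 0) κ (f i, t) = rowChar (· < f 0) κ (f j, t) :=
    fun i j t => by rw [rowChar, rowChar, if_neg (hnot i), if_neg (hnot j)]
  have hG : ∀ i j, i ≠ j →
      CommutesCol ε (f i) (f j) (dg (colPar r ε) (chi (rowChar (· < f 0) κ))) := fun i j h =>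
    commutesCol_dg (hne i j h) (rowChar_ne_zero hn) (same i j)
  have l1 := commutesCol_spEC (r := r) (a := f 0) (b := f 1) hε hκ0 hκ (by omega)
  have l2 := far (f 2) (f 3) (f 0) (f 1) (by omega) (by omega) (by omega)
  have l3 := far (f 0) (f 1) (f 2) (f 3) (by omega) (by omega) (by omega)
  have l4 := commutesCol_spEC (r := r) (a := f 2) (b := f 3) hε hκ0 hκ (by omega)
  rw [e1] at l1 l2
  rw [e2] at l3 l4
  have m1 := l1.of_dg_mul (hne _ _ (by decide)) (rowChar_ne_zero hn) (same _ _) hs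
  have m2 := l2.of_dg_mul (hne _ _ (by decide)) (rowChar_ne_zero hn) (same _ _) hs
  have m3 := l3.of_dg_mul (hne _ _ (by decide)) (rowChar_ne_zero hn) (same _ _) hs
  have m4 := l4.of_dg_mul (hne _ _ (by decide)) (rowChar_ne_zero hn) (same _ _) hs
  rw [e1, e2, ← mul_add, ← smul_add]
  refine Commute.mul_left (CommutesCol.spB (hG _ _ (by decide)) (hG _ _ (by decide))
    (hG _ _ (by decide))) (Commute.smul_left ?_ _)
  have first : ∀ i j, i ≠ j → ∑ t ∈ {c₀}, colTermE ε (f i) (f j) t = _ := fun i j h =>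
    (Finset.sum_singleton _ _).trans (colTermE_eq_first₁ hinj h0 h)
  refine commute_spB_of_window (x := win₁ f c₀) {c₀} (c₀ < ·)
    (fun t ht s => ?_) (fun t ht => ?_) (by simp) (first _ _ (by decide)) (first _ _ (by decide))
    (first _ _ (by decide))
    ((Finset.sum_singleton _ _).trans (colTermF_eq_window hinj (by decide)))
    (colK_eq_window₁ hinj (by decide) h0)
    (fun R _ s h => .lmon hx (colChar_ne_zero _ _ _ _) (by decide) ?_)
    (fun R _ s h => .lmon hx (colChar_ne_zero _ _ _ _) (by decide) ?_)
    (fun R _ h => .lmon hx (colChar_ne_zero _ _ _ _) (by decide) ?_)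
    (fun R _ h => .lmon hx (colChar_ne_zero _ _ _ _) (by decide) ?_)
    (fun R _ h => .lmon hx (colChar_ne_zero _ _ _ _) (by decide) ?_)
    (fun R _ h => .lmon hx (colChar_ne_zero _ _ _ _) (by decide) ?_)
    (fun R _ h => .lmon hx (colChar_ne_zero _ _ _ _) (by decide) ?_)
    (fun R _ h => ?_) m1.e m2.e m3.e m4.e
    (lower_colF_middle_typeC hx hp) (lower_colE_middle_typeC hx hp)
    (lower_bracket_eq_typeC hx hp)
  · exact win₁_ne _ (by simpa using ht) s
  · simp only [Finset.mem_singleton, Fin.ext_iff] at ht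
    simp only [Finset.mem_singleton, forall_eq, Fin.lt_def]
    omega
  iterate 7
    have hR0 := h c₀ (by simp)
    simp [win₁, colChar, hR0, hinj.eq_iff, hqs, hq]
  have hR0 := h c₀ (by simp)
  simp only [List.mem_cons, List.not_mem_nil, or_false, forall_eq_or_imp, forall_eq]
  refine ⟨.lmon hx (colChar_ne_zero _ _ _ _) (by decide) ?_,
    .lmon hx (colChar_ne_zero _ _ _ _) (by decide) ?_,
    .lmon hx (colChar_ne_zero _ _ _ _) (by decide) ?_,
    .lmon hx (colChar_ne_zero _ _ _ _) (by decide) ?_,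
    .lmon hx (colChar_ne_zero _ _ _ _) (by decide) ?_⟩ <;> simp [win₁, colChar, hR0]

omit h0 in
theorem commutesCol_spFC (hab : a.val + 1 = b.val) :
    CommutesCol ε a b (spTermFC ε κ c₀ a b) := by
  have hab' : a ≠ b := fun h => by rw [h] at hab; omega
  have hle : a ≤ b := Fin.le_def.mpr (by omega)
  have hf := injective_pair hab'
  have hn : ∀ t, κ t ≠ 0 := by
    intro t
    by_cases h0 : t = c₀
    · rw [h0, hκ0]; exact mul_ne_zero (inv_ne_zero (qpar_ne_zero 1)) (inv_ne_zero (qpar_ne_zero 1))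
    · rw [hκ t h0]; exact one_ne_zero
  have hn' : ∀ t, (κ t)⁻¹ ≠ 0 := fun t => inv_ne_zero (hn t)
  have hκ' : ∀ t, t ≠ c₀ → (κ t)⁻¹ = 1 := fun t h => by rw [hκ t h, inv_one]
  have hx := win₁_injective hf c₀
  have e : spTermFC ε κ c₀ a b = dg (colPar r ε) (chi (rowChar (b < ·) (fun t => (κ t)⁻¹))) *
      (q ^ (r - 1 - b.val) • lmon (colPar r ε) (win₁ ![a, b] c₀) (fun _ => 1) [0, 1] []) := by
    rw [← lmon_smul]
    exact mon_rowChar_win₁ (S₀ := (b < ·)) (S₁ := fun _ => False) (C := [0, 1]) (A := []) hf hn' hκ'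
      (by simp) (by simp) (Fin.forall_fin_two.mpr ⟨not_lt.mpr hle, lt_irrefl b⟩) (by simp)
        (by decide) (by simp [rowChar])
  rw [e]
  refine (commutesCol_dg hab' (rowChar_ne_zero hn') fun t => ?_).mul (CommutesCol.smul ?_ _)
  · rw [rowChar, rowChar, if_neg (not_lt.mpr hle), if_neg (lt_irrefl b)]
  have he := commute_of_qBracket_one (raise_colE_typeC (η := colPar r ε) hx fun _ => hε)
  have hf' := commute_of_qBracket_one (raise_colF_typeC (η := colPar r ε) hx fun _ => hε)
  refine commutesCol_of_win₁ (f := ![a, b]) (i := 0) (j := 1) (c₀ := c₀) hf (by decide)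
    (fun R _ s => .lmon hx (colChar_ne_zero _ _ _ _) (by decide) ?_) he hf'
  by_cases hR : R c₀ <;> simp [win₁, colChar, hR, hab'.symm, zpow_ne_zero s q_ne_zero]

theorem isSpNode_FC : IsSpNode (r := r) ε (spTermFC ε κ c₀) := by
  have hn : ∀ t, κ t ≠ 0 := by
    intro t
    by_cases h0 : t = c₀
    · rw [h0, hκ0]; exact mul_ne_zero (inv_ne_zero (qpar_ne_zero 1)) (inv_ne_zero (qpar_ne_zero 1))
    · rw [hκ t h0]; exact one_ne_zero
  have hn' : ∀ t, (κ t)⁻¹ ≠ 0 := fun t => inv_ne_zero (hn t)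
  have hκ' : ∀ t, t ≠ c₀ → (κ t)⁻¹ = 1 := fun t h => by rw [hκ t h, inv_one]
  have hq := q_ne_zero
  have hqs := fun s : ℤ => zpow_ne_zero s hq
  have hq1 := qpar_ne_zero 1
  have far : ∀ a b c d : Fin r, a.val + 1 = b.val → c.val + 1 = d.val →
      (b.val < c.val ∨ d.val < a.val) → CommutesCol ε a b (spTermFC ε κ c₀ c d) := by
    intro a b c d hab hcd h
    have hab' : a ≠ b := fun h => by rw [h] at hab; omega
    have hac : a ≠ c := fun h' => by rw [h'] at hab h; omega
    have had : a ≠ d := fun h' => by rw [h'] at hab h; omega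
    have hbc : b ≠ c := fun h' => by rw [h'] at hab h; omega
    have hbd : b ≠ d := fun h' => by rw [h'] at hab h; omega
    have hcd' : c ≠ d := fun h => by rw [h] at hcd; omega
    have hlt : (d < a ↔ d < b) := by rw [Fin.lt_def, Fin.lt_def]; omega
    refine commutesCol_mon_far hab' (rowChar_ne_zero hn') (fun t => ?_) _ (by simp [hcd']) ?_
    · simp [rowChar, hlt]
    · simp [hac.symm, had.symm, hbc.symm, hbd.symm]
  refine ⟨fun a b hab => commutesCol_spFC hε hκ0 hκ hab, far, fun f hf => ?_⟩
  have hv1 : (f 1).val = (f 0).val + 1 := hf 1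
  have hv2 : (f 2).val = (f 0).val + 2 := hf 2
  have hv3 : (f 3).val = (f 0).val + 3 := hf 3
  have hinj := injective_of_val hf
  have hx := win₁_injective hinj c₀
  have hne : ∀ i j, i ≠ j → f i ≠ f j := fun i j h => hinj.ne h
  have hp : ∀ y, colPar r ε (win₁ f c₀ y) = 1 := fun _ => hε
  have hnot : ∀ y, ¬ f 3 < f y := fun y => not_lt.mpr (Fin.le_def.mpr (by rw [hf y, hv3]; omega))
  have hpow : r - 1 - (f 1).val = r - 1 - (f 3).val + 2 := by omega
  have e1 : spTermFC ε κ c₀ (f 2) (f 3) =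
      dg (colPar r ε) (chi (rowChar (f 3 < ·) (fun t => (κ t)⁻¹))) *
      (q ^ (r - 1 - (f 3).val) • lmon (colPar r ε) (win₁ f c₀) (fun _ => 1) [2, 3] []) := by
    rw [← lmon_smul]
    exact mon_rowChar_win₁ (S₀ := (f 3 < ·)) (S₁ := fun _ => False) (C := [2, 3]) (A := []) hinj hn'
      hκ'
      (by simp) (by simp) hnot (by simp) (by decide) (by simp [rowChar])
  have e2 : spTermFC ε κ c₀ (f 0) (f 1) =
      dg (colPar r ε) (chi (rowChar (f 3 < ·) (fun t => (κ t)⁻¹))) *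
      (q ^ (r - 1 - (f 3).val) • lmon (colPar r ε) (win₁ f c₀)
        (fun m => q * q * qpar 1 ^ (m 2 + m 2) * qpar 1 ^ (m 3 + m 3)) [0, 1] []) := by
    rw [← lmon_smul]
    refine mon_rowChar_win₁ (S₁ := fun s => s = f 2 ∨ s = f 3) (C := [0, 1]) (A := []) hinj hn' hκ'
      (fun s => ?_) (fun s h => ?_) hnot (fun s h => ?_) (by decide) fun m => ?_
    · rw [Fin.lt_def, Fin.lt_def, Fin.ext_iff, Fin.ext_iff]; omega
    · rw [Fin.lt_def] at h; rw [Fin.ext_iff, Fin.ext_iff]; omega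
    · rcases h with rfl | rfl
      · exact ⟨2, rfl⟩
      · exact ⟨3, rfl⟩
    · rw [Fin.prod_univ_four]
      simp only [rowChar, win₁, hinj.eq_iff]
      simp [hκ0, hpow, pow_succ, mul_zpow, zpow_add₀ hq1]
      ring
  have hs : q ^ (r - 1 - (f 3).val) ≠ 0 := pow_ne_zero _ hq
  have same : ∀ i j t, rowChar (f 3 < ·) (fun t => (κ t)⁻¹) (f i, t) =
      rowChar (f 3 < ·) (fun t => (κ t)⁻¹) (f j, t) :=
    fun i j t => by rw [rowChar, rowChar, if_neg (hnot i), if_neg (hnot j)]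
  have hG : ∀ i j, i ≠ j →
      CommutesCol ε (f i) (f j) (dg (colPar r ε) (chi (rowChar (f 3 < ·) (fun t => (κ t)⁻¹)))) :=
        fun i j h =>
    commutesCol_dg (hne i j h) (rowChar_ne_zero hn') (same i j)
  have l1 := commutesCol_spFC (r := r) (a := f 2) (b := f 3) hε hκ0 hκ (by omega)
  have l2 := far (f 0) (f 1) (f 2) (f 3) (by omega) (by omega) (by omega)
  have l3 := far (f 2) (f 3) (f 0) (f 1) (by omega) (by omega) (by omega)
  have l4 := commutesCol_spFC (r := r) (a := f 0) (b := f 1) hε hκ0 hκ (by omega)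
  rw [e1] at l1 l2
  rw [e2] at l3 l4
  have m1 := l1.of_dg_mul (hne _ _ (by decide)) (rowChar_ne_zero hn') (same _ _) hs
  have m2 := l2.of_dg_mul (hne _ _ (by decide)) (rowChar_ne_zero hn') (same _ _) hs
  have m3 := l3.of_dg_mul (hne _ _ (by decide)) (rowChar_ne_zero hn') (same _ _) hs
  have m4 := l4.of_dg_mul (hne _ _ (by decide)) (rowChar_ne_zero hn') (same _ _) hs
  rw [add_comm, e1, e2, ← mul_add, ← smul_add]
  refine Commute.mul_left (CommutesCol.spB (hG _ _ (by decide)) (hG _ _ (by decide))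
    (hG _ _ (by decide))) (Commute.smul_left ?_ _)
  have first : ∀ i j, i ≠ j → ∑ t ∈ {c₀}, colTermE ε (f i) (f j) t = _ := fun i j h =>
    (Finset.sum_singleton _ _).trans (colTermE_eq_first₁ hinj h0 h)
  refine commute_spB_of_window (x := win₁ f c₀) {c₀} (c₀ < ·)
    (fun t ht s => ?_) (fun t ht => ?_) (by simp) (first _ _ (by decide)) (first _ _ (by decide))
    (first _ _ (by decide))
    ((Finset.sum_singleton _ _).trans (colTermF_eq_window hinj (by decide)))
    (colK_eq_window₁ hinj (by decide) h0)
    (fun R _ s h => .lmon hx (colChar_ne_zero _ _ _ _) (by decide) ?_)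
    (fun R _ s h => .lmon hx (colChar_ne_zero _ _ _ _) (by decide) ?_)
    (fun R _ h => .lmon hx (colChar_ne_zero _ _ _ _) (by decide) ?_)
    (fun R _ h => .lmon hx (colChar_ne_zero _ _ _ _) (by decide) ?_)
    (fun R _ h => .lmon hx (colChar_ne_zero _ _ _ _) (by decide) ?_)
    (fun R _ h => .lmon hx (colChar_ne_zero _ _ _ _) (by decide) ?_)
    (fun R _ h => .lmon hx (colChar_ne_zero _ _ _ _) (by decide) ?_)
    (fun R _ h => ?_) m2.e m1.e m4.e m3.e
    (raise_colF_middle_typeC hx hp) (raise_colE_middle_typeC hx hp)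
    (raise_bracket_eq_typeC hx hp)
  · exact win₁_ne _ (by simpa using ht) s
  · simp only [Finset.mem_singleton, Fin.ext_iff] at ht
    simp only [Finset.mem_singleton, forall_eq, Fin.lt_def]
    omega
  iterate 7
    have hR0 := h c₀ (by simp)
    simp [win₁, colChar, hR0, hinj.eq_iff, hqs, hq]
  have hR0 := h c₀ (by simp)
  simp only [List.mem_cons, List.not_mem_nil, or_false, forall_eq_or_imp, forall_eq]
  refine ⟨.lmon hx (colChar_ne_zero _ _ _ _) (by decide) ?_,
    .lmon hx (colChar_ne_zero _ _ _ _) (by decide) ?_,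
    .lmon hx (colChar_ne_zero _ _ _ _) (by decide) ?_,
    .lmon hx (colChar_ne_zero _ _ _ _) (by decide) ?_,
    .lmon hx (colChar_ne_zero _ _ _ _) (by decide) ?_⟩ <;> simp [win₁, colChar, hR0]

end typeC

/-! ### Tensor products of Fock spaces as spaces of configurations -/

/-- The operator `T` sends `v(m)` to `c(m) v(m + w)` for all configurations `m`. -/
def ShiftsBy {J V : Type} [AddCommGroup V] [Module 𝕂 V] (E : J → Fin 2) (v : (J → ℤ) → V)
    (T : Module.End 𝕂 V) (c : (J → ℤ) → 𝕂) (w : J → ℤ) : Prop :=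
  ∀ m, IsConf E m → T (v m) = c m • v (m + w)

section shiftsBy
variable {J V : Type} [AddCommGroup V] [Module 𝕂 V] {E : J → Fin 2} {v : (J → ℤ) → V}

theorem shiftsBy_one : ShiftsBy E v 1 (fun _ => 1) 0 := fun m _ => by
  rw [one_smul, add_zero, Module.End.one_apply]

theorem ShiftsBy.smul {T : Module.End 𝕂 V} {c : (J → ℤ) → 𝕂} {w : J → ℤ} (h : ShiftsBy E v T c w)
    (a : 𝕂) : ShiftsBy E v (a • T) (fun m => a * c m) w := fun m hm => by
  rw [LinearMap.smul_apply, h m hm, smul_smul]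

theorem shiftsBy_shiftOp {n : ℕ} (ε : Fin n → Fin 2) (c : (Fin n → ℤ) → 𝕂) (w : Fin n → ℤ) :
    ShiftsBy ε (ket ε) (shiftOp ε c w) c w := fun m hm => by
  rw [shiftOp_ket, if_pos (show IsState ε m from hm)]

end shiftsBy

section coordinates
variable {ι J σ : Type} [Fintype ι] {V : ι → Type} [∀ i, AddCommGroup (V i)]
  [∀ i, Module 𝕂 (V i)] {η : σ → Fin 2} {π : σ ≃ ι × J} {v : Π i, (J → ℤ) → V i}
  {φ : (⨂[𝕂] i, V i) ≃ₗ[𝕂] ConfSpace η} {E : ι → J → Fin 2}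

/-- The isomorphism `φ` sends the tensor product of the vectors `v_i(m_i)` to the configuration with
the entries `m_i`, distributed over the sites by `π`. -/
structure IsCoordinate (π : σ ≃ ι × J) (v : Π i, (J → ℤ) → V i) (E : ι → J → Fin 2)
    (φ : (⨂[𝕂] i, V i) ≃ₗ[𝕂] ConfSpace η) : Prop where
  par (i : ι) (j : J) : η (π.symm (i, j)) = E i j
  tprod (M : σ → ℤ) :
    φ (PiTensorProduct.tprod 𝕂 fun i => v i fun j => M (π.symm (i, j))) = cket η M

theorem IsCoordinate.conj_map (h : IsCoordinate π v E φ) {T : Π i, Module.End 𝕂 (V i)}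
    {c : ι → (J → ℤ) → 𝕂} {w : ι → J → ℤ} (hT : ∀ i, ShiftsBy (E i) (v i) (T i) (c i) (w i)) :
    φ.conj (PiTensorProduct.map T) =
      wshift η (fun M => ∏ i, c i fun j => M (π.symm (i, j))) fun z => w (π z).1 (π z).2 := by
  refine conf_ext fun M hM => ?_
  rw [wshift_cket _ _ hM, LinearEquiv.conj_apply_apply, ← h.tprod M, LinearEquiv.symm_apply_apply,
    PiTensorProduct.map_tprod]
  have : ∀ i, T i (v i fun j => M (π.symm (i, j))) = (c i fun j => M (π.symm (i, j))) •
      v i fun j => (M + fun z => w (π z).1 (π z).2) (π.symm (i, j)) := by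
    intro i
    rw [hT i _ fun j => by rw [← h.par]; exact hM _]
    refine congrArg _ (congrArg _ (funext fun j => ?_))
    simp only [Pi.add_apply, Equiv.apply_symm_apply]
  rw [funext this, MultilinearMap.map_smul_univ, map_smul, h.tprod]

/-- The operator acting on one tensor factor, with diagonal operators on some of the others. -/
theorem IsCoordinate.conj_map_single [Fintype J] [Fintype σ] [DecidableEq ι]
    (h : IsCoordinate π v E φ)
    {T : Π i, Module.End 𝕂 (V i)} {s : ι} {S : ι → Prop} [DecidablePred S] {c : (J → ℤ) → 𝕂}
    {w : J → ℤ} {a : 𝕂} {κ : J → 𝕂} (hs : ¬ S s) (hT : ShiftsBy (E s) (v s) (T s) c w)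
    (hS : ∀ i, S i → ShiftsBy (E i) (v i) (T i) (fun m => a * chi κ m) 0)
    (hS' : ∀ i, i ≠ s → ¬ S i → T i = 1) :
    φ.conj (PiTensorProduct.map T) =
      wshift η (fun M => a ^ (Finset.univ.filter S).card *
        chi (fun z => if S (π z).1 then κ (π z).2 else 1) M * c fun j => M (π.symm (s, j)))
        fun z => if (π z).1 = s then w (π z).2 else 0 := by
  have hT' : ∀ i, ShiftsBy (E i) (v i) (T i)
      (fun m => if i = s then c m else if S i then a * chi κ m else 1)
      (fun j => if i = s then w j else 0) := by
    intro i
    by_cases hi : i = s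
    · subst hi
      simpa using hT
    · by_cases hSi : S i
      · simp only [hi, hSi, if_true, if_false]
        exact hS i hSi
      · rw [hS' i hi hSi]
        simp only [hi, hSi, if_false]
        exact shiftsBy_one
  rw [h.conj_map hT']
  congr 1
  funext M
  have e1 : chi (fun z => if S (π z).1 then κ (π z).2 else 1) M =
      ∏ i, if S i then chi κ fun j => M (π.symm (i, j)) else 1 := by
    rw [chi, ← π.symm.prod_comp, Fintype.prod_prod_type]
    refine Finset.prod_congr rfl fun i _ => ?_
    by_cases hi : S i <;> simp [hi, chi]
  have e2 : ∀ i, (if i = s then c fun j => M (π.symm (i, j)) else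
      if S i then a * chi κ fun j => M (π.symm (i, j)) else 1) =
      (if i = s then c fun j => M (π.symm (i, j)) else 1) *
        ((if S i then a else 1) * (if S i then chi κ fun j => M (π.symm (i, j)) else 1)) := by
    intro i
    by_cases hi : i = s
    · subst hi
      simp [hs]
    · by_cases hi' : S i <;> simp [hi, hi']
  rw [e1, Finset.prod_congr rfl fun i _ => e2 i, Finset.prod_mul_distrib, Finset.prod_mul_distrib,
    Finset.prod_ite_eq' Finset.univ s, if_pos (Finset.mem_univ _), Finset.prod_ite,
    Finset.prod_const, Finset.prod_const_one]
  ring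

/-- The group-like operators. -/
theorem IsCoordinate.conj_map_diag [Fintype J] [Fintype σ] (h : IsCoordinate π v E φ)
    {T : Π i, Module.End 𝕂 (V i)} {a : 𝕂} {κ : J → 𝕂}
    (hT : ∀ i, ShiftsBy (E i) (v i) (T i) (fun m => a * chi κ m) 0) :
    φ.conj (PiTensorProduct.map T) = a ^ Fintype.card ι • dg η (chi fun z => κ (π z).2) := by
  rw [h.conj_map hT, dg, ← wshift_smul]
  congr 1
  funext M
  rw [Finset.prod_mul_distrib, Finset.prod_const, chi, ← π.symm.prod_comp, Fintype.prod_prod_type]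
  simp [chi]

end coordinates

section site
variable {N : ℕ} {J σ : Type} [Fintype J] [Fintype σ] {V : Fin N → Type} [∀ i, AddCommGroup (V i)]
  [∀ i, Module 𝕂 (V i)] {η : σ → Fin 2} {π : σ ≃ Fin N × J} {v : Π i, (J → ℤ) → V i}
  {φ : (⨂[𝕂] i, V i) ≃ₗ[𝕂] ConfSpace η} {E : Fin N → J → Fin 2} {k : Π i, Module.End 𝕂 (V i)}
  {a : 𝕂} {κ : J → 𝕂} {c : (J → ℤ) → 𝕂} {w : J → ℤ} {s : Fin N} {T : Module.End 𝕂 (V s)}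

/-- The operator `T` in the factor `s`, with group-like operators in the factors before it, as in
the iterated comultiplication of `e`. -/
theorem IsCoordinate.conj_siteE (h : IsCoordinate π v E φ) (hT : ShiftsBy (E s) (v s) T c w)
    (hk : ∀ i, ShiftsBy (E i) (v i) (k i) (fun m => a * chi κ m) 0) :
    φ.conj (site k (fun _ => 1) s T) =
      wshift η (fun M => a ^ s.val *
        chi (fun z => if (π z).1 < s then κ (π z).2 else 1) M * c fun j => M (π.symm (s, j)))
        fun z => if (π z).1 = s then w (π z).2 else 0 := by
  have := h.conj_map_single (S := (· < s)) (s := s) (a := a) (κ := κ) (c := c) (w := w)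
    (T := Function.update (fun t => if t < s then k t else 1) s T) (lt_irrefl s)
    (by rwa [Function.update_self])
    (fun i hi => by rw [Function.update_of_ne hi.ne, if_pos hi]; exact hk i)
    (fun i hi hi' => by rw [Function.update_of_ne hi, if_neg hi'])
  rw [site, this]
  have : (Finset.univ.filter (· < s)).card = s.val := by
    rw [← Fin.card_Iio s]
    congr 1
    ext
    simp
  rw [this]

/-- The operator `T` in the factor `s`, with group-like operators in the factors after it, as in the
iterated comultiplication of `f`. -/
theorem IsCoordinate.conj_siteF (h : IsCoordinate π v E φ) (hT : ShiftsBy (E s) (v s) T c w)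
    (hk : ∀ i, ShiftsBy (E i) (v i) (k i) (fun m => a * chi κ m) 0) :
    φ.conj (site (fun _ => 1) k s T) =
      wshift η (fun M => a ^ (N - 1 - s.val) *
        chi (fun z => if s < (π z).1 then κ (π z).2 else 1) M * c fun j => M (π.symm (s, j)))
        fun z => if (π z).1 = s then w (π z).2 else 0 := by
  have := h.conj_map_single (S := (s < ·)) (s := s) (a := a) (κ := κ) (c := c) (w := w)
    (T := Function.update (fun t => if t < s then 1 else k t) s T) (lt_irrefl s)
    (by rwa [Function.update_self])
    (fun i hi => by rw [Function.update_of_ne hi.ne', if_neg hi.not_gt]; exact hk i)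
    (fun i hi hi' => by
      rw [Function.update_of_ne hi, if_pos (lt_of_le_of_ne (not_lt.mp hi') hi)])
  rw [site, this]
  have : (Finset.univ.filter (s < ·)).card = N - 1 - s.val := by
    rw [← Fin.card_Ioi s]
    congr 1
    ext
    simp
  rw [this]

end site

/-! ### Matrices of occupation numbers -/

section isCoordinate
variable {ι J σ : Type} [Fintype ι] {V : ι → Type} [∀ i, AddCommGroup (V i)]
  [∀ i, Module 𝕂 (V i)] {η : σ → Fin 2} {π : σ ≃ ι × J} {v : Π i, (J → ℤ) → V i}
  {φ : (⨂[𝕂] i, V i) ≃ₗ[𝕂] ConfSpace η} {E : ι → J → Fin 2}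

omit [Fintype ι] in
/-- It suffices to check configurations, since both sides vanish otherwise. -/
theorem IsCoordinate.of_conf (par : ∀ i j, η (π.symm (i, j)) = E i j)
    (h0 : ∀ i m, ¬ IsConf (E i) m → v i m = 0)
    (h : ∀ M, IsConf η M →
      φ (PiTensorProduct.tprod 𝕂 fun i => v i fun j => M (π.symm (i, j))) = cket η M) :
    IsCoordinate π v E φ := by
  refine ⟨par, fun M => ?_⟩
  by_cases hM : IsConf η M
  · exact h M hM
  rw [cket_of_not hM]
  obtain ⟨i, hi⟩ : ∃ i, ¬ IsConf (E i) fun j => M (π.symm (i, j)) := by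
    by_contra hall
    simp only [not_exists, not_not] at hall
    refine hM fun z => ?_
    have := hall (π z).1 (π z).2
    simp only [← par, Prod.mk.eta, Equiv.symm_apply_apply] at this
    exact this
  rw [MultilinearMap.map_coord_zero _ i (h0 i _ hi), map_zero]

end isCoordinate

theorem ket_of {n : ℕ} {ε : Fin n → Fin 2} {m : Fin n → ℤ} (h : IsState ε m) :
    ket ε m = Fock.basis ε ⟨m, h⟩ := dif_pos h

variable {n : ℕ} (ε : Fin n → Fin 2) (r ℓ : ℕ)

/-- Families of columns as matrices of occupation numbers. -/
def colEquiv : (Π t : Fin n, State (fun _ : Fin r => ε t)) ≃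
    {M : Fin r × Fin n → ℤ // IsConf (colPar r ε) M} where
  toFun N := ⟨fun z => (N z.2).1 z.1, fun z => (N z.2).2 z.1⟩
  invFun M t := ⟨fun s => M.1 (s, t), fun s => M.2 (s, t)⟩
  left_inv _ := rfl
  right_inv _ := rfl

/-- The space `𝒲'_1 ⊗ ⋯ ⊗ 𝒲'_n` as the space of matrices of occupation numbers. -/
def colIso : (⨂[𝕂] t : Fin n, Fock (fun _ : Fin r => ε t)) ≃ₗ[𝕂] ConfSpace (colPar r ε) :=
  (colBasis ε r).equiv (confBasis _) (colEquiv ε r)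

/-- The space `𝒲^{⊗ℓ}` as the space of matrices of occupation numbers. -/
def rowIso : (⨂[𝕂] _ : Fin ℓ, Fock ε) ≃ₗ[𝕂] ConfSpace (colPar ℓ ε) :=
  (transposeIso ε ℓ).trans (colIso ε ℓ)

/-- The space `(𝒲 ⊗ 𝒲)^{⊗ℓ}` as the space of matrices of occupation numbers. -/
def rowIsoTwo : (⨂[𝕂] _ : Fin ℓ, Fock ε ⊗[𝕂] Fock ε) ≃ₗ[𝕂] ConfSpace (colPar (2 * ℓ) ε) :=
  (transposeIsoTwo ε ℓ).trans (colIso ε (2 * ℓ))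

/-- The sites of a `2ℓ × n` matrix, with the rows grouped in consecutive pairs. -/
def pairEquiv (ℓ n : ℕ) : Fin (2 * ℓ) × Fin n ≃ Fin ℓ × (Fin 2 × Fin n) where
  toFun z := (⟨z.1.val / 2, by omega⟩, ⟨z.1.val % 2, by omega⟩, z.2)
  invFun y := (⟨2 * y.1.val + y.2.1.val, by omega⟩, y.2.2)
  left_inv z := Prod.ext (Fin.ext (by simp only; omega)) rfl
  right_inv y := Prod.ext (Fin.ext (by simp only; omega))
    (Prod.ext (Fin.ext (by simp only; omega)) rfl)

/-- The vector `|m(0, ·)⟩ ⊗ |m(1, ·)⟩` of `𝒲 ⊗ 𝒲`. -/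
def ketTwo (m : Fin 2 × Fin n → ℤ) : Fock ε ⊗[𝕂] Fock ε :=
  ket ε (fun t => m (0, t)) ⊗ₜ ket ε fun t => m (1, t)

theorem isCoordinate_colIso : IsCoordinate (Equiv.prodComm _ _)
    (fun t => ket fun _ : Fin r => ε t) (fun t _ => ε t) (colIso ε r) := by
  refine .of_conf (fun _ _ => rfl) (fun t m hm => ket_of_not hm) fun M hM => ?_
  rw [cket_of hM]
  have : (PiTensorProduct.tprod 𝕂 fun t => ket (fun _ : Fin r => ε t) fun s => M (s, t)) =
      colBasis ε r fun t => ⟨fun s => M (s, t), fun s => hM (s, t)⟩ := by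
    rw [colBasis, Basis.piTensorProduct_apply]
    exact congrArg _ (funext fun t => ket_of fun s => hM (s, t))
  exact (congrArg (colIso ε r) this).trans ((colBasis ε r).equiv_apply _ _ _)

theorem isCoordinate_rowIso : IsCoordinate (Equiv.refl _) (fun _ => ket ε) (fun _ => ε)
    (rowIso ε ℓ) := by
  refine .of_conf (fun _ _ => rfl) (fun t m hm => ket_of_not hm) fun M hM => ?_
  rw [cket_of hM]
  have : (PiTensorProduct.tprod 𝕂 fun s => ket ε fun t => M (s, t)) =
      rowBasis ε ℓ fun s => ⟨fun t => M (s, t), fun t => hM (s, t)⟩ := by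
    rw [rowBasis, Basis.piTensorProduct_apply]
    exact congrArg _ (funext fun s => ket_of fun t => hM (s, t))
  refine (congrArg (rowIso ε ℓ) this).trans ?_
  rw [rowIso, LinearEquiv.trans_apply, transposeIso, Module.Basis.equiv_apply, colIso,
    Module.Basis.equiv_apply]
  rfl

theorem isCoordinate_rowIsoTwo : IsCoordinate (pairEquiv ℓ n) (fun _ => ketTwo ε)
    (fun _ y => ε y.2) (rowIsoTwo ε ℓ) := by
  refine .of_conf (fun _ _ => rfl) (fun p m hm => ?_) fun M hM => ?_
  · simp only [IsConf, Prod.forall, Fin.forall_fin_two, not_and_or] at hm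
    rcases hm with hm | hm
    · rw [ketTwo, ket_of_not hm, TensorProduct.zero_tmul]
    · rw [ketTwo, ket_of_not (m := fun t => m (1, t)) hm, TensorProduct.tmul_zero]
  · rw [cket_of hM]
    have : (PiTensorProduct.tprod 𝕂 fun p => ketTwo ε fun y => M ((pairEquiv ℓ n).symm (p, y))) =
        rowBasisTwo ε ℓ fun p => (⟨fun t => M ((pairEquiv ℓ n).symm (p, 0, t)), fun t => hM _⟩,
          ⟨fun t => M ((pairEquiv ℓ n).symm (p, 1, t)), fun t => hM _⟩) := by
      rw [rowBasisTwo, Basis.piTensorProduct_apply]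
      refine congrArg _ (funext fun p => ?_)
      rw [Module.Basis.tensorProduct_apply, ketTwo]
      exact congrArg₂ (· ⊗ₜ[𝕂] ·) (ket_of fun t => hM _) (ket_of fun t => hM _)
    rw [this, rowIsoTwo, LinearEquiv.trans_apply, transposeIsoTwo, Module.Basis.equiv_apply, colIso,
      Module.Basis.equiv_apply]
    refine congrArg _ ?_
    exact (colEquiv ε (2 * ℓ)).eq_symm_apply.mp ((transposeTwo ε ℓ).eq_symm_apply.mp rfl)

/-- The representation of `𝐔(𝔰𝔩_r)` on matrices of occupation numbers. -/
def colRep : Usl r →ₐ[𝕂] Module.End 𝕂 (ConfSpace (colPar r ε)) :=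
  ((colIso ε r).conjAlgEquiv 𝕂).toAlgHom.comp (slRep ε r)

theorem conj_slRepRow (b : Usl ℓ) : (rowIso ε ℓ).conj (slRepRow ε ℓ b) = colRep ε ℓ b := by
  refine LinearMap.ext fun x => ?_
  simp [rowIso, slRepRow, colRep, LinearEquiv.conjAlgEquiv, LinearEquiv.conj_apply_apply]

theorem conj_slRepRowTwo (b : Usl (2 * ℓ)) :
    (rowIsoTwo ε ℓ).conj (slRepRowTwo ε ℓ b) = colRep ε (2 * ℓ) b := by
  refine LinearMap.ext fun x => ?_
  simp [rowIsoTwo, slRepRowTwo, colRep, LinearEquiv.conjAlgEquiv, LinearEquiv.conj_apply_apply]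

section monomials
variable {J V : Type} [AddCommGroup V] [Module 𝕂 V] {E : J → Fin 2} {v : (J → ℤ) → V}

theorem ShiftsBy.congr {T : Module.End 𝕂 V} {c c' : (J → ℤ) → 𝕂} {w w' : J → ℤ}
    (h : ShiftsBy E v T c w) (h0 : ∀ m, ¬ IsConf E m → v m = 0) (hw : w = w')
    (hc : ∀ m, IsConf E m → IsConf E (m + w) → c m = c' m) : ShiftsBy E v T c' w' := fun m hm => by
  subst hw
  rw [h m hm]
  by_cases h1 : IsConf E (m + w)
  · rw [hc m hm h1]
  · rw [h0 _ h1, smul_zero, smul_zero]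

variable {n : ℕ} {ε : Fin n → Fin 2}

theorem ketTwo_of_not {m : Fin 2 × Fin n → ℤ} (hm : ¬ IsConf (fun y : Fin 2 × Fin n => ε y.2) m) :
    ketTwo ε m = 0 := by
  simp only [IsConf, Prod.forall, Fin.forall_fin_two, not_and_or] at hm
  rcases hm with hm | hm
  · rw [ketTwo, ket_of_not hm, TensorProduct.zero_tmul]
  · rw [ketTwo, ket_of_not (m := fun t => m (1, t)) hm, TensorProduct.tmul_zero]

theorem ShiftsBy.map_ketTwo {S T : Module.End 𝕂 (Fock ε)} {c d : (Fin n → ℤ) → 𝕂}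
    {w u : Fin n → ℤ} (hS : ShiftsBy ε (ket ε) S c w) (hT : ShiftsBy ε (ket ε) T d u) :
    ShiftsBy (fun y : Fin 2 × Fin n => ε y.2) (ketTwo ε) (TensorProduct.map S T)
      (fun m => (c fun t => m (0, t)) * d fun t => m (1, t))
      (fun y => if y.1 = 0 then w y.2 else u y.2) := fun m hm => by
  rw [ketTwo, TensorProduct.map_tmul, hS _ fun t => hm (0, t), hT _ fun t => hm (1, t),
    TensorProduct.smul_tmul_smul, ketTwo]
  rfl

theorem shiftsBy_move (a b : Fin n) :
    ShiftsBy ε (ket ε) (move ε a b) (monWt ε (fun _ => 1) [b]) (units [a] - units [b]) := by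
  refine (shiftsBy_shiftOp ε _ _).congr (fun _ => ket_of_not) (by simp [units]) fun m hm _ => ?_
  rcases two_cases (ε b) with h | h
  · simp [monWt, h, dn_zero]
  · simp [monWt, h, dn_of_le_one 1 ((hm b).2 h)]

end monomials

section site
variable {N : ℕ} {J σ : Type} [Fintype J] [Fintype σ] [DecidableEq J] [DecidableEq σ]
  {V : Fin N → Type} [∀ i, AddCommGroup (V i)]
  [∀ i, Module 𝕂 (V i)] {η : σ → Fin 2} {π : σ ≃ Fin N × J} {v : Π i, (J → ℤ) → V i}
  {φ : (⨂[𝕂] i, V i) ≃ₗ[𝕂] ConfSpace η} {E : Fin N → J → Fin 2} {k : Π i, Module.End 𝕂 (V i)}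
  {a : 𝕂} {κ : J → 𝕂} {g : (J → ℤ) → 𝕂} {C A : List J} {s : Fin N} {T : Module.End 𝕂 (V s)}

omit [Fintype J] [Fintype σ] in
theorem units_site (π : σ ≃ Fin N × J) (s : Fin N) (C A : List J) :
    (fun z => if (π z).1 = s then (units C - units A) (π z).2 else 0) =
      units (C.map fun j => π.symm (s, j)) - units (A.map fun j => π.symm (s, j)) := by
  have hx : Function.Injective fun j => π.symm (s, j) := fun i j h =>
    congrArg Prod.snd (π.symm.injective h)
  rw [← extend_units_sub hx]
  funext z
  by_cases hz : (π z).1 = s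
  · have : z = (fun j => π.symm (s, j)) (π z).2 := by
      rw [Equiv.eq_symm_apply, ← hz]
    rw [if_pos hz]
    conv_rhs => rw [this]
    rw [hx.extend_apply]
  · rw [if_neg hz, Function.extend_apply', Pi.zero_apply]
    rintro ⟨j, rfl⟩
    exact hz (by simp)

omit [Fintype J] [Fintype σ] [DecidableEq J] [DecidableEq σ] in
theorem IsCoordinate.monWt_site (h : IsCoordinate π v E φ) (g' : (σ → ℤ) → 𝕂) (M : σ → ℤ) :
    (g' M * monWt (E s) g A fun j => M (π.symm (s, j))) =
      monWt η (fun M => g' M * g fun j => M (π.symm (s, j))) (A.map fun j => π.symm (s, j)) M := by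
  simp only [monWt, List.map_map, Function.comp_def, h.par]
  ring

theorem IsCoordinate.conj_siteE_mon (h : IsCoordinate π v E φ)
    (hk : ∀ i, ShiftsBy (E i) (v i) (k i) (fun m => a * chi κ m) 0)
    (hT : ShiftsBy (E s) (v s) T (monWt (E s) g A) (units C - units A)) :
    φ.conj (site k (fun _ => 1) s T) =
      mon η (fun M => a ^ s.val * chi (fun z => if (π z).1 < s then κ (π z).2 else 1) M *
        g fun j => M (π.symm (s, j))) (C.map fun j => π.symm (s, j))
        (A.map fun j => π.symm (s, j)) := by
  rw [h.conj_siteE hT hk, units_site, mon]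
  exact congrArg (wshift η · _) (funext fun M => h.monWt_site
    (fun M => a ^ s.val * chi (fun z => if (π z).1 < s then κ (π z).2 else 1) M) M)

theorem IsCoordinate.conj_siteF_mon (h : IsCoordinate π v E φ)
    (hk : ∀ i, ShiftsBy (E i) (v i) (k i) (fun m => a * chi κ m) 0)
    (hT : ShiftsBy (E s) (v s) T (monWt (E s) g A) (units C - units A)) :
    φ.conj (site (fun _ => 1) k s T) =
      mon η (fun M => a ^ (N - 1 - s.val) * chi (fun z => if s < (π z).1 then κ (π z).2 else 1) M *
        g fun j => M (π.symm (s, j))) (C.map fun j => π.symm (s, j))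
        (A.map fun j => π.symm (s, j)) := by
  rw [h.conj_siteF hT hk, units_site, mon]
  exact congrArg (wshift η · _) (funext fun M => h.monWt_site
    (fun M => a ^ (N - 1 - s.val) * chi (fun z => if s < (π z).1 then κ (π z).2 else 1) M) M)

end site

/-! ### The representation of `𝐔(𝔰𝔩_r)` -/

section colRep
variable {n r : ℕ} {ε : Fin n → Fin 2}

theorem lo_ne_hi (i : Fin (r - 1)) : lo i ≠ hi i := fun h => by
  simp [lo, hi, Fin.ext_iff] at h

theorem shiftsBy_kCol (p : Fin 2) {a b : Fin r} (hab : a ≠ b) (s : ℤ) :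
    ShiftsBy (fun _ => p) (ket fun _ => p) (kCol p a b s)
      (fun m => 1 * chi (fun x => if x = a then q ^ s else if x = b then q ^ (-s) else 1) m) 0 := by
  refine (shiftsBy_shiftOp _ _ _).congr (fun _ => ket_of_not) rfl fun m _ _ => ?_
  rw [chi, Fintype.prod_eq_mul a b hab fun x hx => by simp [hx.1, hx.2]]
  simp only [if_true, hab.symm, if_false, one_mul, ← zpow_mul, ← zpow_add₀ q_ne_zero]
  congr 1
  ring

theorem slRep_ι (x : SlGen r) : slRep ε r (Usl.mk r (FreeAlgebra.ι 𝕂 x)) =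
    slWords ε r (FreeAlgebra.ι 𝕂 x) := by
  rw [slRep, Usl.mk, RingQuot.liftAlgHom_mkAlgHom_apply]

theorem colRep_ι (x : SlGen r) : colRep ε r (Usl.mk r (FreeAlgebra.ι 𝕂 x)) =
    (colIso ε r).conj (slWords ε r (FreeAlgebra.ι 𝕂 x)) := by
  rw [← slRep_ι]
  rfl

open SlGen

theorem colRep_E (i : Fin (r - 1)) : colRep ε r (Usl.mk r (E i)) = colE ε (lo i) (hi i) := by
  have h : slWords ε r (FreeAlgebra.ι 𝕂 (.e i)) =
      tensE (fun t => kCol (ε t) (lo i) (hi i) 1) fun _ => move _ (lo i) (hi i) := by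
    rw [slWords, FreeAlgebra.lift_ι_apply]
  rw [E, colRep_ι, h, tensE, map_sum, colE]
  refine Finset.sum_congr rfl fun t _ => ?_
  rw [(isCoordinate_colIso ε r).conj_siteE_mon (fun t => shiftsBy_kCol (ε t) (lo_ne_hi i) 1)
    (shiftsBy_move _ _), colTermE]
  simp only [one_pow, one_mul, mul_one]
  rfl

theorem colRep_F (i : Fin (r - 1)) : colRep ε r (Usl.mk r (F i)) = colF ε (lo i) (hi i) := by
  have h : slWords ε r (FreeAlgebra.ι 𝕂 (.f i)) =
      tensF (fun t => kCol (ε t) (lo i) (hi i) (-1)) fun _ => move _ (hi i) (lo i) := by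
    rw [slWords, FreeAlgebra.lift_ι_apply]
  rw [F, colRep_ι, h, tensF, map_sum, colF]
  refine Finset.sum_congr rfl fun t _ => ?_
  rw [(isCoordinate_colIso ε r).conj_siteF_mon (fun t => shiftsBy_kCol (ε t) (lo_ne_hi i) (-1))
    (shiftsBy_move _ _), colTermF]
  simp only [one_pow, one_mul, mul_one]
  rfl

theorem colRep_K (i : Fin (r - 1)) : colRep ε r (Usl.mk r (K i)) = colK ε (lo i) (hi i) 1 := by
  have h : slWords ε r (FreeAlgebra.ι 𝕂 (.k i)) =
      PiTensorProduct.map fun t => kCol (ε t) (lo i) (hi i) 1 := by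
    rw [slWords, FreeAlgebra.lift_ι_apply]
  rw [K, colRep_ι, h,
    (isCoordinate_colIso ε r).conj_map_diag fun t => shiftsBy_kCol (ε t) (lo_ne_hi i) 1, one_pow,
    one_smul, colK]
  refine congrArg (fun f => dg _ (chi f)) (funext fun z => ?_)
  simp [colChar]

theorem colRep_K' (i : Fin (r - 1)) : colRep ε r (Usl.mk r (K' i)) = colK ε (lo i) (hi i) (-1) := by
  have h : slWords ε r (FreeAlgebra.ι 𝕂 (.kInv i)) =
      PiTensorProduct.map fun t => kCol (ε t) (lo i) (hi i) (-1) := by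
    rw [slWords, FreeAlgebra.lift_ι_apply]
  rw [K', colRep_ι, h,
    (isCoordinate_colIso ε r).conj_map_diag fun t => shiftsBy_kCol (ε t) (lo_ne_hi i) (-1), one_pow,
    one_smul, colK]
  refine congrArg (fun f => dg _ (chi f)) (funext fun z => ?_)
  simp [colChar]

end colRep

/-! ### The operators of `𝒰_X(ε)` on rows -/

section node
variable {n : ℕ} {ε : Fin n → Fin 2}

/-- The values `q_t^{(μ)_t}` which determine the action of `k_μ`. -/
def wtChar (ε : Fin n → Fin 2) (μ : Fin n → ℤ) (t : Fin n) : 𝕂 := qPar ε t ^ μ t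

theorem wtChar_neg (μ : Fin n → ℤ) : wtChar ε (-μ) = fun t => (wtChar ε μ t)⁻¹ := by
  funext t
  rw [wtChar, wtChar, Pi.neg_apply, zpow_neg]

theorem wtChar_ne_zero (μ : Fin n → ℤ) (t : Fin n) : wtChar ε μ t ≠ 0 :=
  zpow_ne_zero _ (qpar_ne_zero (ε t))

variable [NeZero n] {X : CDType} {i : Fin n}

theorem val_sub_one_add_one (hi : i ≠ 0) : (i - 1).val + 1 = i.val := by
  have h0 : i.val ≠ 0 := fun h => hi (Fin.ext (by simpa using h))
  have hn : 1 < n := by omega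
  rw [Fin.val_sub_one_of_ne_zero hi]
  omega

theorem sub_one_ne (hi : i ≠ 0) : i - 1 ≠ i := fun h => by
  have := val_sub_one_add_one hi
  rw [h] at this
  omega

theorem wtChar_alpha (hi : i ≠ 0) :
    wtChar ε (alpha X i) (i - 1) = qpar (ε (i - 1)) ∧
      wtChar ε (alpha X i) i = (qpar (ε i))⁻¹ ∧
      ∀ t, t ≠ i - 1 → t ≠ i → wtChar ε (alpha X i) t = 1 := by
  have h := sub_one_ne hi
  have h1 : ∀ t, qPar ε t = qpar (ε t) := fun _ => rfl
  refine ⟨?_, ?_, fun t ht ht' => ?_⟩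
  · simp [wtChar, alpha, hi, delta, Pi.single_apply, h, h1]
  · simp [wtChar, alpha, hi, delta, Pi.single_apply, h.symm, h1]
  · simp [wtChar, alpha, hi, delta, Pi.single_apply, ht, ht']

theorem sum_alpha (hi : i ≠ 0) : ∑ t, alpha X i t = 0 := by
  simp [alpha, hi, delta]

theorem sum_alpha_zero : ∑ t, alpha X (0 : Fin n) t = -2 := by
  cases X
  · simp [alpha, delta, ← Finset.mul_sum]
  · simp [alpha, delta]

theorem qHalf_sum_alpha_zero : qHalf ^ ∑ t, alpha X (0 : Fin n) t = q⁻¹ := by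
  rw [sum_alpha_zero, q]
  rfl

theorem qHalf_sum_neg_alpha_zero : qHalf ^ ∑ t, (-alpha X (0 : Fin n)) t = q := by
  have : ∑ t, (-alpha X (0 : Fin n)) t = 2 := by
    simp only [Pi.neg_apply, Finset.sum_neg_distrib, sum_alpha_zero, neg_neg]
  rw [this, q]
  rfl

end node

section shifts
variable {n : ℕ} {ε : Fin n → Fin 2}

theorem shiftsBy_oscK (μ : Fin n → ℤ) : ShiftsBy ε (ket ε) (oscK ε μ)
    (fun m => qHalf ^ (∑ t, μ t) * chi (wtChar ε μ) m) 0 := by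
  refine (shiftsBy_shiftOp _ _ _).congr (fun _ => ket_of_not) rfl fun m _ _ => ?_
  simp only [qForm, chi, wtChar, ← zpow_mul, mul_comm]

theorem shiftsBy_oscTwoK (μ : Fin n → ℤ) : ShiftsBy (fun y : Fin 2 × Fin n => ε y.2) (ketTwo ε)
    (oscTwoK ε μ) (fun m => (qHalf ^ (∑ t, μ t)) ^ 2 * chi (fun y => wtChar ε μ y.2) m) 0 := by
  refine ((shiftsBy_oscK μ).map_ketTwo (shiftsBy_oscK μ)).congr (fun _ => ketTwo_of_not) ?_
    fun m _ _ => ?_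
  · funext y
    simp
  · rw [chi, chi, chi, Fintype.prod_prod_type, Fin.prod_univ_two]
    ring

theorem units_append {σ : Type} [DecidableEq σ] (L L' : List σ) :
    units (L ++ L') = units L + units L' := by
  simp [units]

/-- The tensor product of two normally ordered monomials. -/
theorem ShiftsBy.map_mon {S T : Module.End 𝕂 (Fock ε)} {g g' : (Fin n → ℤ) → 𝕂}
    {C A C' A' : List (Fin n)} (hS : ShiftsBy ε (ket ε) S (monWt ε g A) (units C - units A))
    (hT : ShiftsBy ε (ket ε) T (monWt ε g' A') (units C' - units A')) :
    ShiftsBy (fun y : Fin 2 × Fin n => ε y.2) (ketTwo ε) (TensorProduct.map S T)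
      (monWt (fun y => ε y.2) (fun m => (g fun t => m (0, t)) * g' fun t => m (1, t))
        (A.map (Prod.mk 0) ++ A'.map (Prod.mk 1)))
      (units (C.map (Prod.mk 0) ++ C'.map (Prod.mk 1)) -
        units (A.map (Prod.mk 0) ++ A'.map (Prod.mk 1))) := by
  refine (hS.map_ketTwo hT).congr (fun _ => ketTwo_of_not) ?_ fun m _ _ => ?_
  · have e0 : ∀ (L : List (Fin n)) (a b : Fin 2) (t : Fin n),
        units (L.map (Prod.mk a)) (b, t) = if b = a then units L t else 0 := by
      intro L a b t
      rw [units_map (Prod.mk_right_injective a)]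
      split_ifs with h
      · rw [h, (Prod.mk_right_injective a).extend_apply]
      · rw [Function.extend_apply' _ _ _ (by simp [Ne.symm h]), Pi.zero_apply]
    funext y
    obtain ⟨a, t⟩ := y
    rcases two_cases a with rfl | rfl <;> simp [units_append, e0]
  · simp only [monWt, List.map_append, List.prod_append, List.map_map, Function.comp_def]
    ring

theorem shiftsBy_one_mon : ShiftsBy ε (ket ε) 1 (monWt ε (fun _ => 1) []) (units [] - units []) :=
  shiftsBy_one.congr (fun _ => ket_of_not) (by simp) fun m _ _ => by simp [monWt]

theorem shiftsBy_oscK_mon (μ : Fin n → ℤ) : ShiftsBy ε (ket ε) (oscK ε μ)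
    (monWt ε (fun m => qHalf ^ (∑ t, μ t) * chi (wtChar ε μ) m) []) (units [] - units []) :=
  (shiftsBy_oscK μ).congr (fun _ => ket_of_not) (by simp) fun m _ _ => by simp [monWt]

theorem shiftsBy_raise (g : (Fin n → ℤ) → 𝕂) {w : Fin n → ℤ} (C : List (Fin n)) (hw : w = units C) :
    ShiftsBy ε (ket ε) (shiftOp ε g w) (monWt ε g []) (units C - units []) :=
  (shiftsBy_shiftOp ε _ _).congr (fun _ => ket_of_not) (by simp [hw, units])
    fun m _ _ => by simp [monWt]

theorem shiftsBy_lower {g g' : (Fin n → ℤ) → 𝕂} {b : Fin n} (h : ∀ m, g' m = g m * qInt (m b)) :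
    ShiftsBy ε (ket ε) (shiftOp ε g' (-delta b)) (monWt ε g [b]) (units [] - units [b]) := by
  refine (shiftsBy_shiftOp ε _ _).congr (fun _ => ket_of_not) (by simp [units, delta])
    fun m hm _ => ?_
  rcases two_cases (ε b) with h' | h'
  · simp [monWt, h, h', dn_zero]
  · simp [monWt, h, h', dn_of_le_one 1 ((hm b).2 h')]

end shifts

section rows
variable {n ℓ : ℕ} {ε : Fin n → Fin 2} {T : Module.End 𝕂 (Fock ε)} {g : (Fin n → ℤ) → 𝕂}
  {C A : List (Fin n)} {μ : Fin n → ℤ}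

theorem conj_site_row_E (s : Fin ℓ)
    (hT : ShiftsBy ε (ket ε) T (monWt ε g A) (units C - units A)) :
    (rowIso ε ℓ).conj (site (fun _ => oscK ε μ) (fun _ => 1) s T) =
      mon (colPar ℓ ε) (fun M => (qHalf ^ ∑ t, μ t) ^ s.val * chi (rowChar (· < s) (wtChar ε μ)) M *
        g fun t => M (s, t)) (C.map (Prod.mk s)) (A.map (Prod.mk s)) :=
  (isCoordinate_rowIso ε ℓ).conj_siteE_mon (fun _ => shiftsBy_oscK μ) hT

theorem conj_site_row_F (s : Fin ℓ)
    (hT : ShiftsBy ε (ket ε) T (monWt ε g A) (units C - units A)) :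
    (rowIso ε ℓ).conj (site (fun _ => 1) (fun _ => oscK ε μ) s T) =
      mon (colPar ℓ ε) (fun M => (qHalf ^ ∑ t, μ t) ^ (ℓ - 1 - s.val) *
        chi (rowChar (s < ·) (wtChar ε μ)) M * g fun t => M (s, t))
        (C.map (Prod.mk s)) (A.map (Prod.mk s)) :=
  (isCoordinate_rowIso ε ℓ).conj_siteF_mon (fun _ => shiftsBy_oscK μ) hT

theorem tensF_neg {N : ℕ} {M : Fin N → Type} [∀ t, AddCommGroup (M t)] [∀ t, Module 𝕂 (M t)]
    (k f : Π t, Module.End 𝕂 (M t)) : tensF k (fun t => -f t) = -tensF k f := by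
  rw [tensF, tensF, ← Finset.sum_neg_distrib]
  refine Finset.sum_congr rfl fun s _ => ?_
  rw [← zero_sub, site_sub, site_zero, zero_sub]

end rows

section rowOperators
variable {n ℓ : ℕ} [NeZero n] {ε : Fin n → Fin 2} {X : CDType} {i : Fin n}

/-- The iterated comultiplication of `e_i`, as a sum over the rows. -/
theorem conj_rowE (hi : i ≠ 0) :
    (rowIso ε ℓ).conj (tensE (fun _ => oscK ε (alpha X i)) fun _ => oscE X ε i) =
      ∑ s, rowTermE ε (wtChar ε (alpha X i)) (i - 1) i s := by
  have hT : oscE X ε i = move ε (i - 1) i := if_neg hi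
  rw [hT, tensE, map_sum]
  refine Finset.sum_congr rfl fun s _ => ?_
  rw [conj_site_row_E s (shiftsBy_move _ _), sum_alpha hi, rowTermE]
  simp only [zpow_zero, one_pow, one_mul, mul_one]
  rfl

theorem conj_rowF (hi : i ≠ 0) :
    (rowIso ε ℓ).conj (tensF (fun _ => oscK ε (-alpha X i)) fun _ => oscF X ε i) =
      ∑ s, rowTermF ε (wtChar ε (alpha X i)) (i - 1) i s := by
  have h : ∑ t, (-alpha X i) t = 0 := by
    simp only [Pi.neg_apply, Finset.sum_neg_distrib, sum_alpha hi, neg_zero]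
  have hT : oscF X ε i = move ε i (i - 1) := if_neg hi
  rw [hT, tensF, map_sum]
  refine Finset.sum_congr rfl fun s _ => ?_
  rw [conj_site_row_F s (shiftsBy_move _ _), h, rowTermF, wtChar_neg]
  simp only [zpow_zero, one_pow, one_mul, mul_one]
  rfl

omit [NeZero n] in
theorem conj_rowK (μ : Fin n → ℤ) :
    (rowIso ε ℓ).conj (PiTensorProduct.map fun _ => oscK ε μ) =
      (qHalf ^ ∑ t, μ t) ^ ℓ • dg (colPar ℓ ε) (chi fun z => wtChar ε μ z.2) := by
  rw [(isCoordinate_rowIso ε ℓ).conj_map_diag fun _ => shiftsBy_oscK μ, Fintype.card_fin]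
  rfl

theorem conj_soED (h : ε 0 = 1) (h2 : 1 < n) :
    (rowIso ε ℓ).conj (tensE (fun _ => oscK ε (alpha .D 0)) fun _ => oscE .D ε 0) =
      ∑ s, soTermED ε (wtChar ε (alpha .D 0)) 0 1 s := by
  have h01 : (0 : Fin n) ≠ 1 := fun h => by
    have := congrArg Fin.val h
    rw [Fin.val_zero, Fin.val_one', Nat.mod_eq_of_lt h2] at this
    omega
  have hT : ShiftsBy ε (ket ε) (oscE .D ε 0) (monWt ε (fun _ => 1) [0, 1])
      (units [] - units [0, 1]) := by
    rw [oscE, if_pos rfl]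
    refine (shiftsBy_shiftOp ε _ _).congr (fun _ => ket_of_not)
      (by simp [units, delta, sub_eq_add_neg, add_comm])
      fun m hm hm' => ?_
    -- At parity `1`, a unit can only be removed from a full site, so the factor `[m_1]` is `1`.
    have h1 : m 0 = 1 := by
      have h1 := (hm 0).2 h
      have h2 := (hm' 0).1
      simp [delta, h01] at h2
      omega
    have h2 : dn (ε 1) (m 1) = qInt (m 1) := by
      rcases two_cases (ε 1) with h' | h'
      · rw [h', dn_zero]
      · exact dn_of_le_one _ ((hm 1).2 h')
    simp [monWt, h1, h2, dn_of_le_one, qInt_one]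
  rw [tensE, map_sum]
  refine Finset.sum_congr rfl fun s _ => ?_
  rw [conj_site_row_E s hT, qHalf_sum_alpha_zero, soTermED]
  simp only [mul_one]
  rfl

theorem conj_soFD :
    (rowIso ε ℓ).conj (tensF (fun _ => oscK ε (-alpha .D 0)) fun _ => oscF .D ε 0) =
      -∑ s, soTermFD ε (wtChar ε (alpha .D 0)) 0 1 s := by
  have hT : oscF .D ε 0 = -shiftOp ε (fun _ => 1) (delta 0 + delta 1) := by rw [oscF, if_pos rfl]
  rw [hT, tensF_neg, map_neg, tensF, map_sum]
  refine congrArg _ (Finset.sum_congr rfl fun s _ => ?_)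
  rw [conj_site_row_F s (shiftsBy_raise _ [0, 1] (by simp [units, delta])),
    qHalf_sum_neg_alpha_zero, soTermFD, wtChar_neg]
  simp only [mul_one]
  rfl

theorem conj_soEC :
    (rowIso ε ℓ).conj (tensE (fun _ => oscK ε (alpha .C 0)) fun _ => oscE .C ε 0) =
      (qInt 2 ^ 2)⁻¹ • ∑ s, soTermEC ε (wtChar ε (alpha .C 0)) 0 s := by
  have hT : ShiftsBy ε (ket ε) (oscE .C ε 0)
      (fun m => (qInt 2 ^ 2)⁻¹ * (qInt (m 0) * qInt (m 0 - 1)))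
      (units [] - units [0, 0]) := by
    rw [oscE, if_pos rfl]
    refine (shiftsBy_shiftOp ε _ _).congr (fun _ => ket_of_not) ?_ fun m hm hm' => ?_
    · simp [units, delta, two_smul]
    · ring
  rw [tensE, map_sum, Finset.smul_sum]
  refine Finset.sum_congr rfl fun s _ => ?_
  rw [(isCoordinate_rowIso ε ℓ).conj_siteE hT (fun _ => shiftsBy_oscK _), qHalf_sum_alpha_zero,
    units_site, soTermEC, ← wshift_smul]
  refine congrArg (wshift (colPar ℓ ε) · _) (funext fun M => ?_)
  rw [mul_left_comm]
  rfl

theorem conj_soFC :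
    (rowIso ε ℓ).conj (tensF (fun _ => oscK ε (-alpha .C 0)) fun _ => oscF .C ε 0) =
      -∑ s, soTermFC ε (wtChar ε (alpha .C 0)) 0 s := by
  have hT : oscF .C ε 0 = -shiftOp ε (fun _ => 1) (2 • delta 0) := by rw [oscF, if_pos rfl]
  rw [hT, tensF_neg, map_neg, tensF, map_sum]
  refine congrArg _ (Finset.sum_congr rfl fun s _ => ?_)
  rw [conj_site_row_F s (shiftsBy_raise _ [0, 0] (by simp [units, delta, two_smul])),
    qHalf_sum_neg_alpha_zero, soTermFC, wtChar_neg, mon]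
  exact congrArg (wshift (colPar ℓ ε) · _) (funext fun M => by simp [monWt])

end rowOperators

/-! ### The operators of `𝒰_X(ε)` on pairs of rows -/

section pairs
variable {n ℓ : ℕ} {ε : Fin n → Fin 2} {μ : Fin n → ℤ}

/-- Every row belongs to exactly one pair. -/
theorem sum_evenRow_add_oddRow {M : Type*} [AddCommMonoid M] (f : Fin (2 * ℓ) → M) :
    ∑ p, (f (evenRow p) + f (oddRow p)) = ∑ s, f s := by
  let e : Fin ℓ × Fin 2 ≃ Fin (2 * ℓ) :=
    { toFun := fun y => ⟨2 * y.1.val + y.2.val, by omega⟩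
      invFun := fun s => (⟨s.val / 2, by omega⟩, ⟨s.val % 2, by omega⟩)
      left_inv := fun y => Prod.ext (Fin.ext (by simp only; omega)) (Fin.ext (by simp only; omega))
      right_inv := fun s => Fin.ext (by simp only; omega) }
  rw [← e.sum_comp, Fintype.sum_prod_type]
  refine Finset.sum_congr rfl fun p _ => ?_
  rw [Fin.sum_univ_two]
  rfl

variable {T : Module.End 𝕂 (Fock ε ⊗[𝕂] Fock ε)} {g : (Fin 2 × Fin n → ℤ) → 𝕂}
  {C A : List (Fin 2 × Fin n)}

/-- The site of the entry `y` in the pair of rows `p`. -/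
def pairSite (p : Fin ℓ) (y : Fin 2 × Fin n) : Fin (2 * ℓ) × Fin n := (pairEquiv ℓ n).symm (p, y)

theorem conj_site_pair_E (p : Fin ℓ)
    (hT : ShiftsBy (fun y : Fin 2 × Fin n => ε y.2) (ketTwo ε) T
      (monWt (fun y : Fin 2 × Fin n => ε y.2) g A) (units C - units A)) :
    (rowIsoTwo ε ℓ).conj (site (fun _ => oscTwoK ε μ) (fun _ => 1) p T) =
      mon (colPar (2 * ℓ) ε) (fun M => (qHalf ^ ∑ t, μ t) ^ (evenRow p).val *
        chi (rowChar (· < evenRow p) (wtChar ε μ)) M * g fun y => M (pairSite p y))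
        (C.map (pairSite p)) (A.map (pairSite p)) := by
  refine ((isCoordinate_rowIsoTwo ε ℓ).conj_siteE_mon (fun _ => shiftsBy_oscTwoK μ) hT).trans ?_
  have : (fun z => if ((pairEquiv ℓ n) z).1 < p then wtChar ε μ ((pairEquiv ℓ n) z).2.2 else 1) =
      rowChar (· < evenRow p) (wtChar ε μ) := by
    funext z
    have : ((pairEquiv ℓ n) z).1 < p ↔ z.1 < evenRow p := by
      simp only [pairEquiv, evenRow, Equiv.coe_fn_mk, Fin.lt_def]
      omega
    simp only [this]
    rfl
  rw [this, ← pow_mul]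
  rfl

theorem conj_site_pair_F (p : Fin ℓ)
    (hT : ShiftsBy (fun y : Fin 2 × Fin n => ε y.2) (ketTwo ε) T
      (monWt (fun y : Fin 2 × Fin n => ε y.2) g A) (units C - units A)) :
    (rowIsoTwo ε ℓ).conj (site (fun _ => 1) (fun _ => oscTwoK ε μ) p T) =
      mon (colPar (2 * ℓ) ε) (fun M => (qHalf ^ ∑ t, μ t) ^ (2 * ℓ - 1 - (oddRow p).val) *
        chi (rowChar (oddRow p < ·) (wtChar ε μ)) M * g fun y => M (pairSite p y))
        (C.map (pairSite p)) (A.map (pairSite p)) := by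
  refine ((isCoordinate_rowIsoTwo ε ℓ).conj_siteF_mon (fun _ => shiftsBy_oscTwoK μ) hT).trans ?_
  have : (fun z => if p < ((pairEquiv ℓ n) z).1 then wtChar ε μ ((pairEquiv ℓ n) z).2.2 else 1) =
      rowChar (oddRow p < ·) (wtChar ε μ) := by
    funext z
    have : p < ((pairEquiv ℓ n) z).1 ↔ oddRow p < z.1 := by
      simp only [pairEquiv, oddRow, Equiv.coe_fn_mk, Fin.lt_def]
      omega
    simp only [this]
    rfl
  have e : 2 * (ℓ - 1 - p.val) = 2 * ℓ - 1 - (oddRow p).val := by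
    simp only [oddRow]
    omega
  rw [this, ← pow_mul, e]
  rfl

theorem mon_congr {σ : Type} [DecidableEq σ] {η : σ → Fin 2} {g g' : (σ → ℤ) → 𝕂} {C A : List σ}
    (h : ∀ M, g M = g' M) : mon η g C A = mon η g' C A := by
  rw [funext h]

theorem mon_neg {σ : Type} [DecidableEq σ] {η : σ → Fin 2} {g : (σ → ℤ) → 𝕂} {C A : List σ} :
    mon η (fun M => -g M) C A = -mon η g C A := by
  rw [mon, mon, ← neg_one_smul 𝕂, ← wshift_smul]
  refine congrArg (wshift η · _) (funext fun M => ?_)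
  simp only [monWt]
  ring

theorem ShiftsBy.smul_mon {J V : Type} [AddCommGroup V] [Module 𝕂 V] {E : J → Fin 2}
    {v : (J → ℤ) → V} {T : Module.End 𝕂 V} {g : (J → ℤ) → 𝕂} {A : List J} {w : J → ℤ}
    (h : ShiftsBy E v T (monWt E g A) w) (a : 𝕂) :
    ShiftsBy E v (a • T) (monWt E (fun m => a * g m) A) w := fun m hm => by
  rw [h.smul a m hm]
  simp only [monWt, mul_assoc]

theorem pairSite_zero (p : Fin ℓ) (t : Fin n) : pairSite p (0, t) = (evenRow p, t) := rfl

theorem pairSite_one (p : Fin ℓ) (t : Fin n) : pairSite p (1, t) = (oddRow p, t) := rfl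

theorem rowChar_mul_single {r : ℕ} {κ : Fin n → 𝕂} {S : Fin r → Prop} [DecidablePred S]
    {S' : Fin r → Prop} [DecidablePred S'] {b : Fin r} (h : ∀ s, S' s ↔ S s ∨ s = b) (hb : ¬ S b)
    (M : Fin r × Fin n → ℤ) :
    chi (rowChar S κ) M * chi κ (fun t => M (b, t)) = chi (rowChar S' κ) M := by
  have : chi κ (fun t => M (b, t)) = chi (rowChar (· = b) κ) M := by
    rw [chi, chi, Fintype.prod_prod_type, Fintype.prod_eq_single b]
    · simp [rowChar]
    · intro s hs
      simp [rowChar, hs]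
  rw [this, ← chi_mul]
  congr 1
  funext z
  by_cases hz : z.1 = b
  · simp [rowChar, h, hz, hb]
  · simp [rowChar, h, hz]

end pairs

section pairOperators
variable {n ℓ : ℕ} [NeZero n] {ε : Fin n → Fin 2} {X : CDType} {i : Fin n}

theorem conj_pairE (hi : i ≠ 0) :
    (rowIsoTwo ε ℓ).conj (tensE (fun _ => oscTwoK ε (alpha X i)) fun _ => oscTwoE X ε i) =
      ∑ s, rowTermE ε (wtChar ε (alpha X i)) (i - 1) i s := by
  have hT : oscTwoE X ε i = TensorProduct.map (move ε (i - 1) i) 1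
    + TensorProduct.map (oscK ε (alpha X i)) (move ε (i - 1) i) := if_neg hi
  rw [hT, tensE, map_sum, ← sum_evenRow_add_oddRow]
  refine Finset.sum_congr rfl fun p _ => ?_
  rw [site_add, map_add,
    conj_site_pair_E p ((shiftsBy_move (i - 1) i).map_mon shiftsBy_one_mon),
    conj_site_pair_E p ((shiftsBy_oscK_mon (alpha X i)).map_mon (shiftsBy_move (i - 1) i)),
    rowTermE, rowTermE]
  refine congrArg₂ (· + ·) ?_ ?_
  · simp only [sum_alpha hi, zpow_zero, one_pow, one_mul, mul_one]
    rfl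
  · refine mon_congr fun M => ?_
    rw [sum_alpha hi, zpow_zero, one_pow, one_mul, one_mul, mul_one]
    refine rowChar_mul_single (S := (· < evenRow p)) (S' := (· < oddRow p)) (b := evenRow p)
      (fun s => ?_) ?_ M
    · simp only [evenRow, oddRow, Fin.lt_def, Fin.ext_iff]
      omega
    · exact lt_irrefl _

theorem conj_pairF (hi : i ≠ 0) :
    (rowIsoTwo ε ℓ).conj (tensF (fun _ => oscTwoK ε (-alpha X i)) fun _ => oscTwoF X ε i) =
      ∑ s, rowTermF ε (wtChar ε (alpha X i)) (i - 1) i s := by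
  have hT : oscTwoF X ε i = TensorProduct.map (move ε i (i - 1)) (oscK ε (-alpha X i))
    + TensorProduct.map 1 (move ε i (i - 1)) := if_neg hi
  have h : ∑ t, (-alpha X i) t = 0 := by
    simp only [Pi.neg_apply, Finset.sum_neg_distrib, sum_alpha hi, neg_zero]
  rw [hT, tensF, map_sum, ← sum_evenRow_add_oddRow]
  refine Finset.sum_congr rfl fun p _ => ?_
  rw [site_add, map_add,
    conj_site_pair_F p ((shiftsBy_move i (i - 1)).map_mon (shiftsBy_oscK_mon (-alpha X i))),
    conj_site_pair_F p (shiftsBy_one_mon.map_mon (shiftsBy_move i (i - 1))),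
    rowTermF, rowTermF, ← wtChar_neg]
  refine congrArg₂ (· + ·) ?_ ?_
  · refine mon_congr fun M => ?_
    rw [h, zpow_zero, one_pow, one_mul, one_mul, one_mul]
    refine rowChar_mul_single (S := (oddRow p < ·)) (S' := (evenRow p < ·)) (b := oddRow p)
      (fun s => ?_) ?_ M
    · simp only [evenRow, oddRow, Fin.lt_def, Fin.ext_iff]
      omega
    · simp only [evenRow, oddRow, Fin.lt_def]
      omega
  · simp only [h, zpow_zero, one_pow, one_mul, mul_one]
    rfl

omit [NeZero n] in
theorem conj_pairK (μ : Fin n → ℤ) :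
    (rowIsoTwo ε ℓ).conj (PiTensorProduct.map fun _ => oscTwoK ε μ) =
      ((qHalf ^ ∑ t, μ t) ^ 2) ^ ℓ • dg (colPar (2 * ℓ) ε) (chi fun z => wtChar ε μ z.2) := by
  rw [(isCoordinate_rowIsoTwo ε ℓ).conj_map_diag fun _ => shiftsBy_oscTwoK μ, Fintype.card_fin]
  rfl

theorem conj_spEC :
    (rowIsoTwo ε ℓ).conj (tensE (fun _ => oscTwoK ε (alpha .C 0)) fun _ => oscTwoE .C ε 0) =
      ∑ p, spTermEC ε (wtChar ε (alpha .C 0)) 0 (evenRow p) (oddRow p) := by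
  have hT : oscTwoE .C ε 0 = TensorProduct.map (shiftOp ε (fun m => qInt (m 0)) (-delta 0))
        (shiftOp ε (fun m => qInt (m 0)) (-delta 0)) := if_pos rfl
  have h1 := shiftsBy_lower (ε := ε) (g := fun _ => 1) (b := 0) fun m => (one_mul (qInt (m 0))).symm
  rw [hT, tensE, map_sum]
  refine Finset.sum_congr rfl fun p _ => ?_
  rw [conj_site_pair_E p (h1.map_mon h1), qHalf_sum_alpha_zero, spTermEC]
  simp only [mul_one]
  rfl

theorem conj_spFC :
    (rowIsoTwo ε ℓ).conj (tensF (fun _ => oscTwoK ε (-alpha .C 0)) fun _ => oscTwoF .C ε 0) =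
      -∑ p, spTermFC ε (wtChar ε (alpha .C 0)) 0 (evenRow p) (oddRow p) := by
  have hT : oscTwoF .C ε 0 = (-1 : 𝕂) • TensorProduct.map (shiftOp ε (fun _ => 1) (delta 0))
        (shiftOp ε (fun _ => 1) (delta 0)) := by
    refine Eq.trans (if_pos rfl) ?_
    exact (neg_one_smul 𝕂 _).symm
  have h1 := shiftsBy_raise (ε := ε) (fun _ => 1) [0] (w := delta 0) (by simp [units, delta])
  rw [hT, tensF, map_sum, ← Finset.sum_neg_distrib]
  refine Finset.sum_congr rfl fun p _ => ?_
  rw [conj_site_pair_F p ((h1.map_mon h1).smul_mon (-1)), qHalf_sum_neg_alpha_zero, spTermFC,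
    wtChar_neg, ← mon_neg]
  exact mon_congr fun M => by ring

theorem zero_ne_one_of_lt (hn : 1 < n) : (0 : Fin n) ≠ 1 := fun h => by
  have := congrArg Fin.val h
  rw [Fin.val_zero, Fin.val_one', Nat.mod_eq_of_lt hn] at this
  omega

theorem qPar_eq {n : ℕ} (ε : Fin n → Fin 2) (t : Fin n) : qPar ε t = qpar (ε t) := rfl

theorem wtChar_alpha_C :
    wtChar ε (alpha .C 0) 0 = (qpar (ε 0))⁻¹ * (qpar (ε 0))⁻¹ ∧
      ∀ t, t ≠ 0 → wtChar ε (alpha .C 0) t = 1 := by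
  have h1 : ∀ t, qPar ε t = qpar (ε t) := fun _ => rfl
  refine ⟨?_, fun t ht => ?_⟩
  · simp [wtChar, alpha, delta, h1, pow_two]
  · simp [wtChar, alpha, delta, Pi.single_apply, ht]

theorem wtChar_alpha_D (hn : 1 < n) :
    wtChar ε (alpha .D 0) 0 = (qpar (ε 0))⁻¹ ∧ wtChar ε (alpha .D 0) 1 = (qpar (ε 1))⁻¹ ∧
      ∀ t, t ≠ 0 → t ≠ 1 → wtChar ε (alpha .D 0) t = 1 := by
  have h := zero_ne_one_of_lt hn
  have h1 : ∀ t, qPar ε t = qpar (ε t) := fun _ => rfl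
  refine ⟨?_, ?_, fun t ht ht' => ?_⟩
  · simp [wtChar, alpha, delta, Pi.single_apply, h, h1]
  · simp [wtChar, alpha, delta, Pi.single_apply, h.symm, h1]
  · simp [wtChar, alpha, delta, Pi.single_apply, ht, ht']

omit [NeZero n] in
theorem chi_pairChar {r : ℕ} {κ : Fin n → 𝕂} {z₁ z₂ : Fin r × Fin n} (h : z₁ ≠ z₂)
    (M : Fin r × Fin n → ℤ) :
    chi (pairChar κ z₁ z₂) M = κ z₁.2 ^ M z₁ * κ z₂.2 ^ M z₂ :=
  prod_pairChar (x := id) Function.injective_id h M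

theorem conj_spED (hn : 1 < n) :
    (rowIsoTwo ε ℓ).conj (tensE (fun _ => oscTwoK ε (alpha .D 0)) fun _ => oscTwoE .D ε 0) =
      ∑ p, spTermED ε (wtChar ε (alpha .D 0)) 0 1 (evenRow p) (oddRow p) := by
  have hT : oscTwoE .D ε 0 = TensorProduct.map (shiftOp ε (fun m => qInt (m 1)) (-delta 1))
          (shiftOp ε (fun m => qInt (m 0)) (-delta 0)) + (-q⁻¹) • TensorProduct.map
          (shiftOp ε (fun m => qPar ε 1 ^ (-m 1) * qInt (m 0)) (-delta 0))
          (shiftOp ε (fun m => qPar ε 0 ^ (-m 0) * qInt (m 1)) (-delta 1)) := by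
    refine Eq.trans (if_pos rfl) ((sub_eq_add_neg _ _).trans ?_)
    exact congrArg _ (neg_smul _ _).symm
  have h1 := fun b : Fin n => shiftsBy_lower (ε := ε) (g := fun _ => 1) (b := b)
    fun m => (one_mul (qInt (m b))).symm
  have h2 := fun a b : Fin n => shiftsBy_lower (ε := ε) (g := fun m => qPar ε a ^ (-m a)) (b := b)
    fun m => rfl
  rw [hT, tensE, map_sum]
  refine Finset.sum_congr rfl fun p _ => ?_
  rw [site_add, map_add, conj_site_pair_E p ((h1 1).map_mon (h1 0)),
    conj_site_pair_E p (((h2 1 0).map_mon (h2 0 1)).smul_mon (-q⁻¹)), qHalf_sum_alpha_zero,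
      spTermED]
  refine congrArg₂ (· + ·) ?_ ?_
  · simp only [mul_one]
    rfl
  · refine mon_congr fun M => ?_
    rw [chi_mul, chi_pairChar fun h => zero_ne_one_of_lt hn (congrArg Prod.snd h),
      (wtChar_alpha_D hn).1, (wtChar_alpha_D hn).2.1, inv_zpow', inv_zpow']
    simp only [pairSite_zero, pairSite_one, qPar_eq]
    ring

theorem conj_spFD (hn : 1 < n) :
    (rowIsoTwo ε ℓ).conj (tensF (fun _ => oscTwoK ε (-alpha .D 0)) fun _ => oscTwoF .D ε 0) =
      ∑ p, spTermFD ε (wtChar ε (alpha .D 0)) 0 1 (evenRow p) (oddRow p) := by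
  have hT : oscTwoF .D ε 0 = (-q) • TensorProduct.map
          (shiftOp ε (fun m => qPar ε 0 ^ m 0) (delta 1))
          (shiftOp ε (fun m => qPar ε 1 ^ m 1) (delta 0)) +
        TensorProduct.map (shiftOp ε (fun _ => 1) (delta 0))
          (shiftOp ε (fun _ => 1) (delta 1)) := by
    refine Eq.trans (if_pos rfl) ?_
    exact congrArg (· + _) (neg_smul _ _).symm
  have h1 := fun (g : (Fin n → ℤ) → 𝕂) (b : Fin n) => shiftsBy_raise (ε := ε) g [b] (w := delta b)
    (by simp [units, delta])
  rw [hT, tensF, map_sum]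
  refine Finset.sum_congr rfl fun p _ => ?_
  rw [site_add, map_add, conj_site_pair_F p (((h1 _ 1).map_mon (h1 _ 0)).smul_mon (-q)),
    conj_site_pair_F p ((h1 _ 0).map_mon (h1 _ 1)), qHalf_sum_neg_alpha_zero, spTermFD, wtChar_neg]
  refine congrArg₂ (· + ·) ?_ ?_
  · refine mon_congr fun M => ?_
    rw [chi_mul, chi_pairChar fun h => zero_ne_one_of_lt hn (congrArg Prod.snd h),
      (wtChar_alpha_D hn).1, (wtChar_alpha_D hn).2.1, inv_inv, inv_inv]
    simp only [pairSite_zero, pairSite_one, qPar_eq]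
    ring
  · simp only [mul_one]
    rfl

end pairOperators

/-! ### Reduction to generators -/

section reduction
variable {G A B : Type*} [Ring A] [Algebra 𝕂 A] [Ring B] [Algebra 𝕂 B]

/-- The commutation of two algebras of operators can be tested on generators of both. -/
theorem commute_adjoin_iff (act : FreeAlgebra 𝕂 G →ₐ[𝕂] A) (ρ : B →ₐ[𝕂] A) (S : Set B) :
    (∀ y, ∀ b ∈ Algebra.adjoin 𝕂 S, Commute (act y) (ρ b)) ↔
      ∀ g, ∀ b ∈ S, Commute (act (FreeAlgebra.ι 𝕂 g)) (ρ b) := by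
  refine ⟨fun h g b hb => h _ b (Algebra.subset_adjoin hb), fun h y b hb => ?_⟩
  have key : ∀ g, Commute (act (FreeAlgebra.ι 𝕂 g)) (ρ b) := by
    intro g
    induction hb using Algebra.adjoin_induction with
    | mem b hb => exact h g b hb
    | algebraMap c => rw [AlgHom.commutes]; exact (Algebra.commutes c _).symm
    | add b b' _ _ hb hb' => rw [map_add]; exact hb.add_right hb'
    | mul b b' _ _ hb hb' => rw [map_mul]; exact hb.mul_right hb'
  induction y using FreeAlgebra.induction with
  | grade0 c => rw [AlgHom.commutes]; exact Algebra.commutes c _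
  | grade1 g => exact key g
  | mul y y' hy hy' => rw [map_mul]; exact hy.mul_left hy'
  | add y y' hy hy' => rw [map_add]; exact hy.add_left hy'

theorem conj_commute_iff {V W : Type*} [AddCommGroup V] [Module 𝕂 V] [AddCommGroup W] [Module 𝕂 W]
    (φ : V ≃ₗ[𝕂] W) (S T : Module.End 𝕂 V) : Commute (φ.conj S) (φ.conj T) ↔ Commute S T := by
  have h : ∀ A B : Module.End 𝕂 V, φ.conj (A * B) = φ.conj A * φ.conj B := fun A B =>
    LinearEquiv.conj_comp φ B A
  rw [Commute, SemiconjBy, Commute, SemiconjBy, ← φ.conj.injective.eq_iff, h, h]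

end reduction

/-! ### The operator `T_{w_•}` -/

section lusztig
variable {r : ℕ}
open SlGen

theorem cartan_of_far {i j : Fin (r - 1)} (h : i.val + 1 < j.val ∨ j.val + 1 < i.val) :
    cartan i j = 0 := by
  rw [cartan, if_neg (fun h' => by rw [h'] at h; omega), if_neg (by omega)]

theorem cartan_of_adj {i j : Fin (r - 1)} (h : i.val + 1 = j.val ∨ j.val + 1 = i.val) :
    cartan i j = -1 := by
  rw [cartan, if_neg (fun h' => by rw [h'] at h; omega), if_pos h]

theorem lusztigT_E_of_adj {i j : Fin (r - 1)} (h : i.val + 1 = j.val ∨ j.val + 1 = i.val) :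
    lusztigT i (E j) = qBracket q⁻¹ (E i) (E j) := by
  refine (FreeAlgebra.lift_ι_apply _ (SlGen.e j)).trans ?_
  exact (if_neg fun h' => by rw [h'] at h; omega).trans (if_pos (cartan_of_adj h))

theorem lusztigT_E_of_far {i j : Fin (r - 1)} (h : i.val + 1 < j.val ∨ j.val + 1 < i.val) :
    lusztigT i (E j) = E j := by
  refine (FreeAlgebra.lift_ι_apply _ (SlGen.e j)).trans ?_
  refine (if_neg fun h' => ?_).trans (if_neg fun h' => ?_)
  · rw [h'] at h
    omega
  · rw [cartan_of_far h] at h'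
    omega

theorem map_qBracket {A B : Type*} [Ring A] [Algebra 𝕂 A] [Ring B] [Algebra 𝕂 B] (f : A →ₐ[𝕂] B)
    (c : 𝕂) (u v : A) : f (qBracket c u v) = qBracket c (f u) (f v) := by
  simp only [qBracket, map_sub, map_mul, map_smul]

theorem qBracket_left_comm {A : Type*} [Ring A] [Algebra 𝕂 A] {u w : A} (h : Commute u w) (c : 𝕂)
    (v : A) : qBracket c u (qBracket c w v) = qBracket c w (qBracket c u v) := by
  have h1 : ∀ x, u * (w * x) = w * (u * x) := fun x => by
    rw [← mul_assoc, h.eq, mul_assoc]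
  simp only [qBracket, mul_sub, sub_mul, mul_smul_comm, smul_mul_assoc, mul_assoc, h1, h.eq]
  module

/-- Only the two neighbours `i`, `k` of the node `j` contribute to `T_{w_•}(e_j)`. -/
theorem foldr_lusztigT_E {i j k : Fin (r - 1)} (hi : i.val + 1 = j.val) (hk : j.val + 1 = k.val)
    (L : List (Fin (r - 1))) (hL : L.Pairwise (· < ·)) (hj : ∀ l ∈ L, l.val % 2 = i.val % 2) :
    L.foldr (fun i T => (lusztigT i).comp T) (AlgHom.id 𝕂 _) (E j) =
      if k ∈ L then
        if i ∈ L then qBracket q⁻¹ (E k) (qBracket q⁻¹ (E i) (E j)) else qBracket q⁻¹ (E k) (E j)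
      else if i ∈ L then qBracket q⁻¹ (E i) (E j) else E j := by
  induction L with
  | nil => simp
  | cons l L ih =>
    rw [List.pairwise_cons] at hL
    have ih := ih hL.2 fun l' hl' => hj l' (List.mem_cons_of_mem _ hl')
    have hl := hj l List.mem_cons_self
    have hlL : l ∉ L := fun h => lt_irrefl _ (hL.1 l h)
    rw [List.foldr_cons, AlgHom.comp_apply, ih]
    by_cases h1 : l = i
    · have hki : k ≠ i := fun h => by rw [h] at hk; omega
      have h2 : lusztigT i (E k) = E k := lusztigT_E_of_far (by omega)
      have h3 : lusztigT i (E j) = qBracket q⁻¹ (E i) (E j) := lusztigT_E_of_adj (by omega)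
      subst h1
      by_cases hkL : k ∈ L <;> simp [hlL, hkL, hki, map_qBracket, h2, h3]
    by_cases h1' : l = k
    · have hiL : i ∉ L := fun h => by
        have := hL.1 i h
        rw [h1', Fin.lt_def] at this
        omega
      have h3 : lusztigT k (E j) = qBracket q⁻¹ (E k) (E j) := lusztigT_E_of_adj (by omega)
      subst h1'
      simp [hlL, hiL, Ne.symm h1, h3]
    · have far : ∀ m : Fin (r - 1), m = i ∨ m = j ∨ m = k → lusztigT l (E m) = E m := by
        rw [Fin.ext_iff] at h1 h1'
        rintro m (rfl | rfl | rfl) <;> exact lusztigT_E_of_far (by omega)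
      simp only [List.mem_cons, Ne.symm h1, Ne.symm h1', false_or]
      split_ifs <;> simp only [map_qBracket, far _ (.inl rfl), far _ (.inr (.inl rfl)),
        far _ (.inr (.inr rfl))]

/-- The automorphism `T_{w_•}` is the product of the `T_l` for the nodes `l` with an even value. -/
theorem lusztigTBlack_E {i j k : Fin (r - 1)} (hi : i.val + 1 = j.val) (hk : j.val + 1 = k.val)
    (hj : j.val % 2 = 1) :
    lusztigTBlack r (E j) = qBracket q⁻¹ (E k) (qBracket q⁻¹ (E i) (E j)) := by
  have h0 : i.val % 2 = 0 := by omega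
  rw [lusztigTBlack, foldr_lusztigT_E hi hk _ ((List.pairwise_lt_finRange _).filter _)]
  · rw [if_pos, if_pos]
    · simp [h0]
    · simp
      omega
  · intro l hl
    rw [List.mem_filter] at hl
    rw [h0]
    simpa using hl.2

end lusztig

section colRels
variable {n r : ℕ} (ε : Fin n → Fin 2)

/-- The operators `colE`, `colF`, `colK` satisfy the relations of `𝐔(𝔰𝔩_r)`. -/
theorem col_rels : SlRels (fun i : Fin (r - 1) => colE ε (lo i) (hi i))
    (fun i => colF ε (lo i) (hi i)) (fun i => colK ε (lo i) (hi i) 1)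
    (fun i => colK ε (lo i) (hi i) (-1)) := by
  have rel : ∀ {x y}, SlRel r x y → colRep ε r (Usl.mk r x) = colRep ε r (Usl.mk r y) :=
    fun h => congrArg _ (RingQuot.mkAlgHom_rel 𝕂 h)
  constructor
  · intro i; simpa only [map_mul, map_one, colRep_K, colRep_K'] using rel (.k_inv i)
  · intro i; simpa only [map_mul, map_one, colRep_K, colRep_K'] using rel (.inv_k i)
  · intro i j; simpa only [map_mul, colRep_K] using rel (.k_k i j)
  · intro i j; simpa only [map_mul, map_smul, colRep_K, colRep_K', colRep_E] using rel (.k_e i j)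
  · intro i j; simpa only [map_mul, map_smul, colRep_K, colRep_K', colRep_F] using rel (.k_f i j)
  · intro i j
    have := rel (.e_f i j)
    split_ifs at this ⊢
    · simpa only [map_mul, map_sub, map_smul, colRep_K, colRep_K', colRep_E, colRep_F] using this
    · simpa only [map_mul, map_sub, map_zero, colRep_E, colRep_F] using this
  · intro i j h; simpa only [map_mul, colRep_E] using rel (.e_e i j h)
  · intro i j h; simpa only [map_mul, colRep_F] using rel (.f_f i j h)
  · intro i j h
    simpa only [map_mul, map_add, map_sub, map_smul, map_zero, colRep_E] using rel (.e_serre i j h)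
  · intro i j h
    simpa only [map_mul, map_add, map_sub, map_smul, map_zero, colRep_F] using rel (.f_serre i j h)

end colRels

section iff
variable {n ℓ : ℕ} [NeZero n] (X : CDType) (ε : Fin n → Fin 2)
open SlGen

/-- The operators of the generators of `𝒰_X(ε)` on `𝒲^{⊗ℓ}`, as matrices of occupation numbers. -/
def rowGen (ℓ : ℕ) (g : UGen n) : Module.End 𝕂 (ConfSpace (colPar ℓ ε)) :=
  (rowIso ε ℓ).conj (tensorPowerAct X (oscE X ε) (oscF X ε) (oscK ε) ℓ (FreeAlgebra.ι 𝕂 g))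

/-- The operators of the generators of `𝒰_X(ε)` on `(𝒲 ⊗ 𝒲)^{⊗ℓ}`, as matrices of occupation
numbers. -/
def pairGen (ℓ : ℕ) (g : UGen n) : Module.End 𝕂 (ConfSpace (colPar (2 * ℓ) ε)) :=
  (rowIsoTwo ε ℓ).conj
    (tensorPowerAct X (oscTwoE X ε) (oscTwoF X ε) (oscTwoK ε) ℓ (FreeAlgebra.ι 𝕂 g))

/-- The commutation with `𝐔^ı(𝔰𝔬_ℓ)` in terms of generators and matrices of occupation numbers. -/
theorem soActionCommutes_iff (ς κ : Fin (ℓ - 1) → 𝕂) : SoActionCommutes X ε ℓ ς κ ↔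
    ∀ g i, Commute (rowGen X ε ℓ g) (colF ε (lo i) (hi i) +
      ς i • (colE ε (lo i) (hi i) * colK ε (lo i) (hi i) (-1)) +
      κ i • colK ε (lo i) (hi i) (-1)) := by
  have h1 : SoActionCommutes X ε ℓ ς κ ↔ ∀ y, ∀ b ∈ iQuantumSo ℓ ς κ,
      Commute (tensorPowerAct X (oscE X ε) (oscF X ε) (oscK ε) ℓ y) (slRepRow ε ℓ b) :=
    ⟨fun h y => h _ _ ⟨y, rfl, rfl⟩, fun h u T ⟨y, _, hT⟩ => hT ▸ h y⟩
  rw [h1, iQuantumSo, commute_adjoin_iff, forall_congr' fun g => ?_]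
  rw [Set.forall_mem_range]
  refine forall_congr' fun i => ?_
  rw [← conj_commute_iff (rowIso ε ℓ), conj_slRepRow]
  simp only [map_add, map_smul, map_mul, colRep_E, colRep_F, colRep_K']
  rfl

/-- The commutation with `𝐔^ı(𝔰𝔭_{2ℓ})` in terms of generators and matrices of occupation
numbers. -/
theorem spActionCommutes_iff (ς : Fin (2 * ℓ - 1) → 𝕂) : SpActionCommutes X ε ℓ ς ↔
    ∀ g, (∀ i : Fin (2 * ℓ - 1), i.val % 2 = 1 → Commute (pairGen X ε ℓ g)
        (colF ε (lo i) (hi i) + ς i • (colRep ε (2 * ℓ) (Usl.mk _ (lusztigTBlack _ (E i))) *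
          colK ε (lo i) (hi i) (-1)))) ∧
      ∀ j : Fin (2 * ℓ - 1), j.val % 2 = 0 →
        Commute (pairGen X ε ℓ g) (colE ε (lo j) (hi j)) ∧
        Commute (pairGen X ε ℓ g) (colF ε (lo j) (hi j)) ∧
        Commute (pairGen X ε ℓ g) (colK ε (lo j) (hi j) 1) ∧
        Commute (pairGen X ε ℓ g) (colK ε (lo j) (hi j) (-1)) := by
  let act : FreeAlgebra 𝕂 (UGen n) →ₐ[𝕂] Module.End 𝕂 (ConfSpace (colPar (2 * ℓ) ε)) :=
    ((rowIsoTwo ε ℓ).conjAlgEquiv 𝕂).toAlgHom.comp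
      (tensorPowerAct X (oscTwoE X ε) (oscTwoF X ε) (oscTwoK ε) ℓ)
  have h2 : ∀ T b, Commute T (slRepRowTwo ε ℓ b) ↔
      Commute ((rowIsoTwo ε ℓ).conj T) (colRep ε (2 * ℓ) b) := fun T b => by
    rw [← conj_slRepRowTwo]
    exact (conj_commute_iff (rowIsoTwo ε ℓ) _ _).symm
  have h1 : SpActionCommutes X ε ℓ ς ↔ ∀ y, ∀ b ∈ iQuantumSp ℓ ς,
      Commute (act y) (colRep ε (2 * ℓ) b) :=
    ⟨fun h y b hb => (h2 _ b).1 (h _ _ ⟨y, rfl, rfl⟩ b hb),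
      fun h u T ⟨y, _, hT⟩ b hb => (h2 T b).2 (hT ▸ h y b hb)⟩
  rw [h1, iQuantumSp, commute_adjoin_iff]
  refine forall_congr' fun g => ?_
  have hB : ∀ i, colRep ε (2 * ℓ) (Usl.mk _ (F i + ς i • (lusztigTBlack _ (E i) * K' i))) =
      colF ε (lo i) (hi i) + ς i • (colRep ε (2 * ℓ) (Usl.mk _ (lusztigTBlack _ (E i))) *
          colK ε (lo i) (hi i) (-1)) := fun i => by
    simp only [map_add, map_smul, map_mul, colRep_F, colRep_K']
  constructor
  · intro h
    refine ⟨fun i hi => hB i ▸ h _ (.inl ⟨i, hi, rfl⟩), fun j hj => ⟨?_, ?_, ?_, ?_⟩⟩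
    · exact colRep_E (ε := ε) j ▸ h _ (.inr ⟨j, hj, .inl rfl⟩)
    · exact colRep_F (ε := ε) j ▸ h _ (.inr ⟨j, hj, .inr (.inl rfl)⟩)
    · exact colRep_K (ε := ε) j ▸ h _ (.inr ⟨j, hj, .inr (.inr (.inl rfl))⟩)
    · exact colRep_K' (ε := ε) j ▸ h _ (.inr ⟨j, hj, .inr (.inr (.inr rfl))⟩)
  · rintro ⟨h, h'⟩ b hb
    obtain ⟨i, hi, rfl⟩ | ⟨j, hj, rfl | rfl | rfl | rfl⟩ := hb
    · exact (hB i).symm ▸ h i hi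
    · exact (colRep_E (ε := ε) j).symm ▸ (h' j hj).1
    · exact (colRep_F (ε := ε) j).symm ▸ (h' j hj).2.1
    · exact (colRep_K (ε := ε) j).symm ▸ (h' j hj).2.2.1
    · exact (colRep_K' (ε := ε) j).symm ▸ (h' j hj).2.2.2

end iff

/-! ### The commuting actions -/

section generators
variable {n ℓ : ℕ} [NeZero n] {X : CDType} {ε : Fin n → Fin 2}

theorem rowGen_e (i : Fin n) : rowGen X ε ℓ (.e i) =
    (rowIso ε ℓ).conj (tensE (fun _ => oscK ε (alpha X i)) fun _ => oscE X ε i) := by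
  rw [rowGen, tensorPowerAct, FreeAlgebra.lift_ι_apply]

theorem rowGen_f (i : Fin n) : rowGen X ε ℓ (.f i) =
    (rowIso ε ℓ).conj (tensF (fun _ => oscK ε (-alpha X i)) fun _ => oscF X ε i) := by
  rw [rowGen, tensorPowerAct, FreeAlgebra.lift_ι_apply]

theorem rowGen_k (μ : Fin n → ℤ) : rowGen X ε ℓ (.k μ) =
    (qHalf ^ ∑ t, μ t) ^ ℓ • dg (colPar ℓ ε) (chi fun z => wtChar ε μ z.2) := by
  rw [rowGen, tensorPowerAct, FreeAlgebra.lift_ι_apply]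
  exact conj_rowK μ

theorem pairGen_e (i : Fin n) : pairGen X ε ℓ (.e i) =
    (rowIsoTwo ε ℓ).conj (tensE (fun _ => oscTwoK ε (alpha X i)) fun _ => oscTwoE X ε i) := by
  rw [pairGen, tensorPowerAct, FreeAlgebra.lift_ι_apply]

theorem pairGen_f (i : Fin n) : pairGen X ε ℓ (.f i) =
    (rowIsoTwo ε ℓ).conj (tensF (fun _ => oscTwoK ε (-alpha X i)) fun _ => oscTwoF X ε i) := by
  rw [pairGen, tensorPowerAct, FreeAlgebra.lift_ι_apply]

theorem pairGen_k (μ : Fin n → ℤ) : pairGen X ε ℓ (.k μ) =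
    ((qHalf ^ ∑ t, μ t) ^ 2) ^ ℓ • dg (colPar (2 * ℓ) ε) (chi fun z => wtChar ε μ z.2) := by
  rw [pairGen, tensorPowerAct, FreeAlgebra.lift_ι_apply]
  exact conj_pairK μ

omit [NeZero n] in
theorem CommutesCol.neg {r : ℕ} {a b : Fin r} {T : Module.End 𝕂 (ConfSpace (colPar r ε))}
    (h : CommutesCol ε a b T) : CommutesCol ε a b (-T) :=
  ⟨h.e.neg_left, h.f.neg_left, fun s => (h.k s).neg_left⟩

omit [NeZero n] in
theorem commutesCol_k {r : ℕ} {a b : Fin r} (hab : a ≠ b) (μ : Fin n → ℤ) :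
    CommutesCol ε a b (dg (colPar r ε) (chi fun z => wtChar ε μ z.2)) :=
  commutesCol_dg hab (fun z => wtChar_ne_zero μ z.2) fun _ => rfl

theorem commute_rowGen_soB (hn : 1 < n) (h : (X = .D ∧ ε 0 = 1) ∨ (X = .C ∧ ε 0 = 0))
    {a b : Fin ℓ} (hab : a.val + 1 = b.val) (g : UGen n) :
    Commute (rowGen X ε ℓ g) (soB ε a b) := by
  have hab' : a ≠ b := fun h => by rw [h] at hab; omega
  have h0 : (0 : Fin n).val = 0 := Fin.val_zero n
  have h1 : (1 : Fin n).val = 1 := by rw [Fin.val_one', Nat.mod_eq_of_lt hn]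
  have hD := wtChar_alpha_D (ε := ε) hn
  have hC := wtChar_alpha_C (ε := ε)
  cases g with
  | e i =>
    rw [rowGen_e]
    by_cases hi : i = 0
    · subst hi
      obtain ⟨rfl, hε⟩ | ⟨rfl, hε⟩ := h
      · rw [conj_soED hε hn]
        exact commute_soED_soB hε hD.1 hD.2.1 hD.2.2 h0 h1 hab
      · rw [conj_soEC]
        rw [hε, qpar_zero] at hC
        exact (commute_soEC_soB hε hC.1 hC.2 h0 hab).smul_left _
    · obtain ⟨h1, h2, h3⟩ := wtChar_alpha (ε := ε) (X := X) hi
      rw [conj_rowE hi]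
      exact (commutesCol_rowE h1 h2 h3 (val_sub_one_add_one hi) hab).soB
  | f i =>
    rw [rowGen_f]
    by_cases hi : i = 0
    · subst hi
      obtain ⟨rfl, hε⟩ | ⟨rfl, hε⟩ := h
      · rw [conj_soFD]
        exact (commute_soFD_soB hε hD.1 hD.2.1 hD.2.2 h0 h1 hab).neg_left
      · rw [conj_soFC]
        rw [hε, qpar_zero] at hC
        exact (commute_soFC_soB hε hC.1 hC.2 h0 hab).neg_left
    · obtain ⟨h1, h2, h3⟩ := wtChar_alpha (ε := ε) (X := X) hi
      rw [conj_rowF hi]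
      exact (commutesCol_rowF h1 h2 h3 (val_sub_one_add_one hi) hab).soB
  | k μ =>
    rw [rowGen_k]
    exact ((commutesCol_k hab' μ).smul _).soB

/-- Commutation with the operators which generate `𝐔^ı(𝔰𝔭_{2ℓ})` for `ς_i = -q`. -/
structure CommutesSp (ε : Fin n → Fin 2) (T : Module.End 𝕂 (ConfSpace (colPar (2 * ℓ) ε))) :
    Prop where
  levi (p : Fin ℓ) : CommutesCol ε (evenRow p) (oddRow p) T
  spB (p p' : Fin ℓ) (hp : p.val + 1 = p'.val) :
    Commute T (spB ε (evenRow p) (oddRow p) (evenRow p') (oddRow p'))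

omit [NeZero n] in
theorem IsSpNode.commutesSp
    {T : Fin (2 * ℓ) → Fin (2 * ℓ) → Module.End 𝕂 (ConfSpace (colPar (2 * ℓ) ε))}
    (h : IsSpNode ε T) : CommutesSp ε (∑ p, T (evenRow p) (oddRow p)) :=
  ⟨h.commutesCol, fun _ _ hp => h.commute_spB hp⟩

omit [NeZero n] in
theorem CommutesSp.neg {T : Module.End 𝕂 (ConfSpace (colPar (2 * ℓ) ε))} (h : CommutesSp ε T) :
    CommutesSp ε (-T) :=
  ⟨fun p => (h.levi p).neg, fun p p' hp => (h.spB p p' hp).neg_left⟩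

omit [NeZero n] in
theorem CommutesSp.of_commutesCol {T : Module.End 𝕂 (ConfSpace (colPar (2 * ℓ) ε))}
    (h : ∀ a b : Fin (2 * ℓ), a.val + 1 = b.val → CommutesCol ε a b T) : CommutesSp ε T :=
  ⟨fun p => h _ _ rfl, fun p p' hp => (h _ _ rfl).spB
    (h _ _ (by simp only [evenRow, oddRow]; omega)) (h _ _ rfl)⟩

theorem commutesSp_pairGen (hn : 1 < n) (h : (X = .D ∧ ε 0 = 0) ∨ (X = .C ∧ ε 0 = 1))
    (g : UGen n) : CommutesSp ε (pairGen X ε ℓ g) := by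
  have h0 : (0 : Fin n).val = 0 := Fin.val_zero n
  have h1 : (1 : Fin n).val = 1 := by rw [Fin.val_one', Nat.mod_eq_of_lt hn]
  have hD := wtChar_alpha_D (ε := ε) hn
  have hC := wtChar_alpha_C (ε := ε)
  cases g with
  | e i =>
    rw [pairGen_e]
    by_cases hi : i = 0
    · subst hi
      obtain ⟨rfl, hε⟩ | ⟨rfl, hε⟩ := h
      · rw [conj_spED hn]
        rw [hε, qpar_zero] at hD
        exact (isSpNode_ED hε hD.1 hD.2.1 hD.2.2 h0 h1).commutesSp
      · rw [conj_spEC]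
        rw [hε] at hC
        exact (isSpNode_EC hε hC.1 hC.2 h0).commutesSp
    · obtain ⟨h1, h2, h3⟩ := wtChar_alpha (ε := ε) (X := X) hi
      rw [conj_pairE hi]
      exact .of_commutesCol fun a b => commutesCol_rowE h1 h2 h3 (val_sub_one_add_one hi)
  | f i =>
    rw [pairGen_f]
    by_cases hi : i = 0
    · subst hi
      obtain ⟨rfl, hε⟩ | ⟨rfl, hε⟩ := h
      · rw [conj_spFD hn]
        rw [hε, qpar_zero] at hD
        exact (isSpNode_FD hε hD.1 hD.2.1 hD.2.2 h0 h1).commutesSp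
      · rw [conj_spFC]
        rw [hε] at hC
        exact (isSpNode_FC hε hC.1 hC.2 h0).commutesSp.neg
    · obtain ⟨h1, h2, h3⟩ := wtChar_alpha (ε := ε) (X := X) hi
      rw [conj_pairF hi]
      exact .of_commutesCol fun a b => commutesCol_rowF h1 h2 h3 (val_sub_one_add_one hi)
  | k μ =>
    rw [pairGen_k]
    exact .of_commutesCol fun a b hab => (commutesCol_k (fun h => by rw [h] at hab; omega) μ).smul _

end generators

section nodes
variable {n ℓ : ℕ} {ε : Fin n → Fin 2}

theorem colRep_lusztigTBlack_E {r : ℕ} {i₀ i i₂ : Fin (r - 1)} (h₀ : i₀.val + 1 = i.val)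
    (h₂ : i.val + 1 = i₂.val) (hodd : i.val % 2 = 1) :
    colRep ε r (Usl.mk _ (lusztigTBlack _ (SlGen.E i))) =
      qBracket q⁻¹ (colE ε (lo i₀) (hi i₀))
        (qBracket q⁻¹ (colE ε (lo i₂) (hi i₂)) (colE ε (lo i) (hi i))) := by
  rw [lusztigTBlack_E h₀ h₂ hodd, map_qBracket, map_qBracket, map_qBracket, map_qBracket, colRep_E,
    colRep_E, colRep_E]
  exact qBracket_left_comm ((col_rels ε).e_e i₀ i₂ (cartan_of_far (by omega))).symm _ _

/-- The nodes with an odd value, that is the even nodes in the numbering from `1`, lie between two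
pairs of rows. -/
theorem exists_pair_of_odd {i : Fin (2 * ℓ - 1)} (hodd : i.val % 2 = 1) :
    ∃ (p p' : Fin ℓ) (i₀ i₂ : Fin (2 * ℓ - 1)), p.val + 1 = p'.val ∧ i₀.val + 1 = i.val ∧
      i.val + 1 = i₂.val ∧ lo i₀ = evenRow p ∧ hi i₀ = oddRow p ∧ lo i = oddRow p ∧
      hi i = evenRow p' ∧ lo i₂ = evenRow p' ∧ hi i₂ = oddRow p' := by
  have h := i.isLt
  refine ⟨⟨i.val / 2, by omega⟩, ⟨i.val / 2 + 1, by omega⟩, ⟨i.val - 1, by omega⟩,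
    ⟨i.val + 1, by omega⟩, rfl, ?_, rfl, ?_, ?_, ?_, ?_, ?_, ?_⟩ <;>
  · simp only [lo, hi, evenRow, oddRow, Fin.ext_iff]
    omega

theorem exists_pair_of_even {j : Fin (2 * ℓ - 1)} (hj : j.val % 2 = 0) :
    ∃ p : Fin ℓ, lo j = evenRow p ∧ hi j = oddRow p := by
  have h := j.isLt
  refine ⟨⟨j.val / 2, by omega⟩, ?_, ?_⟩
  · simp only [lo, evenRow, Fin.ext_iff]
    omega
  · simp only [hi, oddRow, Fin.ext_iff]
    omega

end nodes

section sufficiency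
variable {n ℓ : ℕ} [NeZero n] {X : CDType} {ε : Fin n → Fin 2}

theorem soActionCommutes_of_eq (hn : 1 < n) (h : (X = .D ∧ ε 0 = 1) ∨ (X = .C ∧ ε 0 = 0))
    {ς κ : Fin (ℓ - 1) → 𝕂} (hς : ∀ i, ς i = -q⁻¹ ∧ κ i = 0) : SoActionCommutes X ε ℓ ς κ := by
  rw [soActionCommutes_iff]
  intro g i
  have := commute_rowGen_soB hn h (a := lo i) (b := hi i) rfl g
  rwa [soB, sub_eq_add_neg, ← neg_smul, ← (hς i).1, ← add_zero (_ + _),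
    ← zero_smul 𝕂 (colK ε (lo i) (hi i) (-1)), ← (hς i).2] at this

theorem spActionCommutes_of_eq (hn : 1 < n) (h : (X = .D ∧ ε 0 = 0) ∨ (X = .C ∧ ε 0 = 1))
    {ς : Fin (2 * ℓ - 1) → 𝕂} (hς : ∀ i, i.val % 2 = 1 → ς i = -q) : SpActionCommutes X ε ℓ ς := by
  rw [spActionCommutes_iff]
  intro g
  have hg := commutesSp_pairGen (ℓ := ℓ) hn h g
  refine ⟨fun i hi => ?_, fun j hj => ?_⟩
  · obtain ⟨p, p', i₀, i₂, hp, h₀, h₂, h3, h4, h5, h6, h7, h8⟩ := exists_pair_of_odd hi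
    rw [colRep_lusztigTBlack_E h₀ h₂ hi, h3, h4, h5, h6, h7, h8, hς i hi, neg_smul,
      ← sub_eq_add_neg]
    exact hg.spB p p' hp
  · obtain ⟨p, h1, h2⟩ := exists_pair_of_even hj
    rw [h1, h2]
    exact ⟨(hg.levi p).e, (hg.levi p).f, (hg.levi p).k 1, (hg.levi p).k (-1)⟩

end sufficiency

/-! ### Uniqueness of the parameters -/

section coef
variable {σ : Type} {η : σ → Fin 2}

open Classical in
/-- The coefficient of `|M⟩`, put to zero if `M` is not a configuration. -/
def coef (η : σ → Fin 2) (M : σ → ℤ) : ConfSpace η →ₗ[𝕂] 𝕂 :=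
  if h : IsConf η M then (confBasis η).coord ⟨M, h⟩ else 0

theorem coef_of_not {M : σ → ℤ} (h : ¬ IsConf η M) : coef η M = 0 := dif_neg h

open Classical in
theorem coef_cket {M : σ → ℤ} (hM : IsConf η M) (N : σ → ℤ) :
    coef η M (cket η N) = if N = M then 1 else 0 := by
  rw [coef, dif_pos hM]
  by_cases hN : IsConf η N
  · rw [cket_of hN, Module.Basis.coord_apply, Module.Basis.repr_self, Finsupp.single_apply]
    simp only [Subtype.mk.injEq]
  · rw [cket_of_not hN, map_zero, if_neg]
    rintro rfl
    exact hN hM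

theorem coef_wshift {M : σ → ℤ} (hM : IsConf η M) (c : (σ → ℤ) → 𝕂) (v : σ → ℤ)
    (x : ConfSpace η) : coef η M (wshift η c v x) = c (M - v) * coef η (M - v) x := by
  classical
  have : (coef η M).comp (wshift η c v) = c (M - v) • coef η (M - v) := by
    refine conf_ext fun N hN => ?_
    rw [LinearMap.comp_apply, wshift_cket _ _ hN, map_smul, coef_cket hM, LinearMap.smul_apply]
    by_cases h : IsConf η (M - v)
    · rw [coef_cket h]
      simp only [eq_sub_iff_add_eq]
      split_ifs with h1
      · rw [← h1, add_sub_cancel_right]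
      · rw [smul_zero, smul_zero]
    · rw [coef_of_not h, LinearMap.zero_apply, if_neg, smul_zero, smul_zero]
      rintro h1
      rw [← h1, add_sub_cancel_right] at h
      exact h hN
  exact LinearMap.congr_fun this x

theorem isConf_zero : IsConf η 0 := fun _ => ⟨le_rfl, fun _ => zero_le_one⟩

theorem mon_cket_zero [DecidableEq σ] (g : (σ → ℤ) → 𝕂) (C : List σ) :
    mon η g C [] (cket η 0) = g 0 • cket η (units C) := by
  rw [mon, wshift_cket _ _ isConf_zero, zero_add]
  simp [monWt, units]

theorem mon_cket_zero_of_ne_nil [DecidableEq σ] (g : (σ → ℤ) → 𝕂) (C : List σ) {A : List σ}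
    (hA : A ≠ []) : mon η g C A (cket η 0) = 0 := by
  rw [mon, wshift_cket _ _ isConf_zero]
  obtain ⟨z, A, rfl⟩ := List.exists_cons_of_ne_nil hA
  have : dn (η z) 0 = 0 := by rw [dn_of_le_one _ zero_le_one, qInt_zero]
  simp [monWt, this]

theorem chi_zero [Fintype σ] (φ : σ → 𝕂) : chi φ 0 = 1 := chi_eq_one fun _ => .inr rfl

end coef

section vacuum
variable {r n : ℕ} {ε : Fin n → Fin 2} {a b : Fin r}

theorem colE_vacuum : colE ε a b (cket _ 0) = 0 := by
  rw [colE, LinearMap.sum_apply]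
  exact Finset.sum_eq_zero fun t _ => mon_cket_zero_of_ne_nil _ _ (by simp)

theorem colF_vacuum : colF ε a b (cket _ 0) = 0 := by
  rw [colF, LinearMap.sum_apply]
  exact Finset.sum_eq_zero fun t _ => mon_cket_zero_of_ne_nil _ _ (by simp)

theorem colK_vacuum (s : ℤ) : colK ε a b s (cket _ 0) = cket _ 0 := by
  rw [colK, dg, wshift_cket _ _ isConf_zero, chi_zero, one_smul, add_zero]

/-- If the row `a` of `M` has no entries outside of the column `c`, then only the column `c`
contributes to the coefficient of `|M⟩`. -/
theorem coef_colE (hab : a ≠ b) {c : Fin n} {M R : Fin r × Fin n → ℤ}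
    (hM : IsConf (colPar r ε) M) (hR : M - (units [(a, c)] - units [(b, c)]) = R)
    (h0 : ∀ t, t ≠ c → M (a, t) = 0) (hd : dn (ε c) (R (b, c)) ≠ 0) :
    ∃ u : 𝕂, u ≠ 0 ∧ ∀ y, coef _ M (colE ε a b y) = u * coef _ R y := by
  refine ⟨monWt (colPar r ε) (chi (colChar (· < c) a b 1)) [(b, c)] R, ?_, fun y => ?_⟩
  · refine mul_ne_zero (Finset.prod_ne_zero_iff.mpr fun z _ =>
      zpow_ne_zero _ (colChar_ne_zero _ _ _ _ z)) ?_
    simpa [colPar] using hd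
  · rw [colE, LinearMap.sum_apply, map_sum, Finset.sum_eq_single c]
    · rw [colTermE, mon, coef_wshift hM, hR]
    · intro t _ ht
      -- Undoing a move in another column `t` makes the entry in the row `a` negative.
      rw [colTermE, mon, coef_wshift hM, coef_of_not, LinearMap.zero_apply, mul_zero]
      intro h
      have := (h (a, t)).1
      simp [units_apply, h0 t ht, hab.symm] at this
    · simp

theorem coef_colK {M : Fin r × Fin n → ℤ} (hM : IsConf (colPar r ε) M) (s : ℤ)
    (y : ConfSpace (colPar r ε)) :
    coef _ M (colK ε a b s y) = chi (colChar (fun _ => True) a b s) M * coef _ M y := by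
  rw [colK, dg, coef_wshift hM, sub_zero]

theorem chi_colChar_ne_zero (S : Fin n → Prop) [DecidablePred S] (s : ℤ) (M : Fin r × Fin n → ℤ) :
    chi (colChar S a b s) M ≠ 0 :=
  Finset.prod_ne_zero_iff.mpr fun z _ => zpow_ne_zero _ (colChar_ne_zero _ _ _ _ z)

end vacuum

section so
variable {r n : ℕ} {ε : Fin n → Fin 2} {a b : Fin r}

/-- The parameters are determined by the commutator with one operator `T`, evaluated on the
vacuum: `M` arises from the configuration `R` of `T|0⟩` by moving one unit from row `b` to row
`a`. -/
theorem so_parameters {T : Module.End 𝕂 (ConfSpace (colPar r ε))} (hab : a ≠ b) {x κ : 𝕂}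
    (hT : Commute T (x • (colE ε a b * colK ε a b (-1)) + κ • colK ε a b (-1))) {c : Fin n}
    {M R : Fin r × Fin n → ℤ} (hM : IsConf (colPar r ε) M) (hRc : IsConf (colPar r ε) R)
    (hR : M - (units [(a, c)] - units [(b, c)]) = R)
    (h0 : ∀ t, t ≠ c → M (a, t) = 0) (hd : dn (ε c) (R (b, c)) ≠ 0)
    (hy : coef _ R (T (cket _ 0)) ≠ 0) (hy' : coef _ M (T (cket _ 0)) = 0)
    (hchi : chi (colChar (fun _ => True) a b (-1)) R ≠ 1) : x = 0 ∧ κ = 0 := by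
  have h := LinearMap.congr_fun hT.eq (cket _ 0)
  obtain ⟨u, hu, hu'⟩ := coef_colE hab hM hR h0 hd
  simp only [Module.End.mul_apply, LinearMap.add_apply, LinearMap.smul_apply, colK_vacuum,
    colE_vacuum, smul_zero, zero_add, map_smul] at h
  have hx : x = 0 := by
    have h1 := congrArg (coef _ M) h
    simp only [map_add, map_smul, smul_eq_mul, hu', coef_colK hM, coef_colK hRc, hy', mul_zero,
      add_zero] at h1
    have h2 := chi_colChar_ne_zero (a := a) (b := b) (fun _ : Fin n => True) (-1) R
    simpa [hu, hy, h2] using h1.symm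
  refine ⟨hx, ?_⟩
  have h1 := congrArg (coef _ R) h
  simp only [map_add, map_smul, smul_eq_mul, coef_colK hRc, hx, zero_mul, zero_add] at h1
  by_contra hκ
  have h2 := mul_left_cancel₀ hκ h1
  exact hchi (mul_right_cancel₀ hy (by rw [one_mul]; exact h2.symm))

end so

section sp
variable {r : ℕ} {V : Type*} [AddCommGroup V] [Module 𝕂 V] {e f k k' : Fin (r - 1) → Module.End 𝕂 V}
  {i j l : Fin (r - 1)} {y z : V}

theorem SlRels.k'_apply (h : SlRels e f k k') {c : 𝕂} (hc : c ≠ 0) (hz : k i z = c • z) :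
    k' i z = c⁻¹ • z := by
  have := LinearMap.congr_fun (h.inv_k i) z
  rw [Module.End.mul_apply, hz, map_smul, Module.End.one_apply] at this
  rw [← this, smul_smul, inv_mul_cancel₀ hc, one_smul, this]

theorem SlRels.k_e_apply (h : SlRels e f k k') {c : 𝕂} (hc : c ≠ 0) (hz : k i z = c • z) :
    k i (e j z) = (q ^ cartan i j * c) • e j z := by
  have := LinearMap.congr_fun (h.k_e i j) z
  simp only [Module.End.mul_apply, h.k'_apply hc hz, map_smul, LinearMap.smul_apply] at this
  rw [mul_comm, mul_smul, ← this, smul_smul, mul_inv_cancel₀ hc, one_smul]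

theorem SlRels.f_e_apply (h : SlRels e f k k') (hij : i ≠ j) (hz : f j z = 0) :
    f j (e i z) = 0 := by
  have := LinearMap.congr_fun (h.e_f i j) z
  rw [if_neg hij] at this
  simpa [hz] using this

theorem q_ne_inv : q ≠ q⁻¹ := sub_ne_zero.mp q_sub_inv_ne_zero

/-- A vector of weight `-1` which is killed by `f` and `e` vanishes. -/
theorem SlRels.eq_zero (h : SlRels e f k k') (hk : k i z = q⁻¹ • z) (hf : f i z = 0)
    (he : e i z = 0) : z = 0 := by
  have h0 := q_ne_zero
  have h1 := LinearMap.congr_fun (h.e_f i i) z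
  have h2 := h.k'_apply (inv_ne_zero h0) hk
  rw [if_pos rfl] at h1
  simp only [LinearMap.sub_apply, Module.End.mul_apply, LinearMap.smul_apply, hf, he, map_zero,
    sub_zero, hk, h2, ← sub_smul, smul_smul] at h1
  refine (smul_eq_zero.mp h1.symm).resolve_left (mul_ne_zero (inv_ne_zero q_sub_inv_ne_zero) ?_)
  rw [_root_.inv_inv]
  exact sub_ne_zero.mpr q_ne_inv.symm

/-- On a vector which is invariant under the nodes `i` and `l`, the operator
`[e_i, [e_l, e_j]]` is injective modulo the kernel of `e_j`. -/
theorem SlRels.apply_eq_zero (h : SlRels e f k k') (hi : i.val + 1 = j.val) (hl : j.val + 1 = l.val)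
    (hei : e i y = 0) (hel : e l y = 0) (hfi : f i y = 0) (hfl : f l y = 0) (hki : k i y = y)
    (hkl : k l y = y) (hT : qBracket q⁻¹ (e i) (qBracket q⁻¹ (e l) (e j)) y = 0) : e j y = 0 := by
  have hij : j ≠ i := fun h => by rw [h] at hi; omega
  have hjl : j ≠ l := fun h => by rw [h] at hl; omega
  have hil : l ≠ i := fun h => by rw [h] at hl; omega
  have key : ∀ m, (m = i ∨ m = l) → k m y = y → k m (e j y) = q⁻¹ • e j y := by
    intro m hm hk
    rw [h.k_e_apply one_ne_zero (by rw [one_smul, hk]),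
      cartan_of_adj (by rcases hm with rfl | rfl <;> omega), mul_one, zpow_neg_one]
  -- The vector `e_i e_l e_j y` vanishes; the rank one argument for `i`, then for `l`, strips off
  -- the factors `e_i` and `e_l`.
  have hz' : e l (e j y) = 0 := by
    refine h.eq_zero (i := i) ?_ (h.f_e_apply hil (h.f_e_apply hij hfi)) ?_
    · rw [h.k_e_apply (inv_ne_zero q_ne_zero) (key i (.inl rfl) hki),
        cartan_of_far (by omega), zpow_zero, one_mul]
    · simpa [qBracket, hei, hel] using hT
  exact h.eq_zero (key l (.inr rfl) hkl) (h.f_e_apply hjl hfl) hz'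

/-- With the next two lemmas: `k_j⁻¹` preserves the vectors which are invariant under the node
`i`. -/
theorem SlRels.e_k'_apply (h : SlRels e f k k') (hz : e i y = 0) : e i (k' j y) = 0 := by
  have h1 := LinearMap.congr_fun (h.k_e j i) y
  have h2 := congrArg (k' j) h1
  have h3 := LinearMap.congr_fun (h.inv_k j) (e i (k' j y))
  simp only [Module.End.mul_apply, LinearMap.smul_apply, hz, smul_zero, map_zero,
    Module.End.one_apply] at h2 h3
  rw [← h3, h2]

theorem SlRels.f_k'_apply (h : SlRels e f k k') (hz : f i y = 0) : f i (k' j y) = 0 := by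
  have h1 := LinearMap.congr_fun (h.k_f j i) y
  have h2 := congrArg (k' j) h1
  have h3 := LinearMap.congr_fun (h.inv_k j) (f i (k' j y))
  simp only [Module.End.mul_apply, LinearMap.smul_apply, hz, smul_zero, map_zero,
    Module.End.one_apply] at h2 h3
  rw [← h3, h2]

theorem SlRels.k_k'_apply (h : SlRels e f k k') (hz : k i y = y) : k i (k' j y) = k' j y := by
  have h1 := congrArg (k' j) (LinearMap.congr_fun (h.k_k i j) (k' j y))
  have h2 := LinearMap.congr_fun (h.k_inv j) y
  have h3 := LinearMap.congr_fun (h.inv_k j) (k i (k' j y))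
  simp only [Module.End.mul_apply, Module.End.one_apply] at h1 h2 h3
  rw [h2, hz, h3] at h1
  exact h1.symm

end sp

/-! ### The vector `f_0|0⟩` -/

section units
variable {σ : Type} [DecidableEq σ] {η : σ → Fin 2}

theorem mem_of_units_eq {L L' : List σ} (h : units L = units L') {z : σ} (hz : z ∈ L) : z ∈ L' := by
  have := congrFun h z
  rw [units_apply, units_apply, Nat.cast_inj] at this
  exact List.count_pos_iff.mp (this ▸ List.count_pos_iff.mpr hz)

theorem isConf_units {L : List σ} (h : L.Nodup) : IsConf η (units L) := fun z => by
  rw [units_apply]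
  exact ⟨Nat.cast_nonneg _, fun _ => by exact_mod_cast List.nodup_iff_count_le_one.mp h z⟩

theorem coef_sum_cket {ρ : Type} [Fintype ρ] {M : σ → ℤ} (hM : IsConf η M) {L : ρ → List σ}
    (w : ρ → 𝕂) {s₀ : ρ} (h₀ : units (L s₀) = M) (h : ∀ s, units (L s) = M → s = s₀) :
    coef η M (∑ s, w s • cket η (units (L s))) = w s₀ := by
  classical
  simp only [map_sum, map_smul, coef_cket hM, smul_eq_mul]
  rw [Finset.sum_eq_single s₀ (fun s _ hs => by rw [if_neg (fun h' => hs (h s h')), mul_zero])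
    (by simp), if_pos h₀, mul_one]

theorem coef_sum_cket_eq_zero {ρ : Type} [Fintype ρ] {M : σ → ℤ} (hM : IsConf η M)
    {L : ρ → List σ} (w : ρ → 𝕂) (h : ∀ s, units (L s) ≠ M) :
    coef η M (∑ s, w s • cket η (units (L s))) = 0 := by
  classical
  simp only [map_sum, map_smul, coef_cket hM, smul_eq_mul]
  exact Finset.sum_eq_zero fun s _ => by rw [if_neg (h s), mul_zero]

end units

section
variable {n ℓ : ℕ} [NeZero n] {X : CDType} {ε : Fin n → Fin 2}

theorem rowGen_FD_vacuum : rowGen .D ε ℓ (.f 0) (cket _ 0) =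
    -∑ s : Fin ℓ, q ^ (ℓ - 1 - s.val) • cket _ (units [(s, 0), (s, 1)]) := by
  rw [rowGen_f, conj_soFD, LinearMap.neg_apply, LinearMap.sum_apply]
  congr 1
  refine Finset.sum_congr rfl fun s _ => ?_
  rw [soTermFD, mon_cket_zero, chi_zero, mul_one]

theorem rowGen_FC_vacuum : rowGen .C ε ℓ (.f 0) (cket _ 0) =
    -∑ s : Fin ℓ, q ^ (ℓ - 1 - s.val) • cket _ (units [(s, 0), (s, 0)]) := by
  rw [rowGen_f, conj_soFC, LinearMap.neg_apply, LinearMap.sum_apply]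
  congr 1
  refine Finset.sum_congr rfl fun s _ => ?_
  rw [soTermFC, wshift_cket _ _ isConf_zero, chi_zero, mul_one, zero_add]
  simp [units]

theorem pairGen_FC_vacuum : pairGen .C ε ℓ (.f 0) (cket _ 0) =
    -∑ p : Fin ℓ, q ^ (2 * ℓ - 1 - (oddRow p).val) •
      cket _ (units [(evenRow p, 0), (oddRow p, 0)]) := by
  rw [pairGen_f, conj_spFC, LinearMap.neg_apply, LinearMap.sum_apply]
  congr 1
  refine Finset.sum_congr rfl fun s _ => ?_
  rw [spTermFC, mon_cket_zero, chi_zero, mul_one]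

theorem pairGen_FD_vacuum (hn : 1 < n) : pairGen .D ε ℓ (.f 0) (cket _ 0) =
    ∑ p : Fin ℓ, (-q * q ^ (2 * ℓ - 1 - (oddRow p).val)) •
      cket _ (units [(evenRow p, 1), (oddRow p, 0)]) +
    ∑ p : Fin ℓ, q ^ (2 * ℓ - 1 - (oddRow p).val) •
      cket _ (units [(evenRow p, 0), (oddRow p, 1)]) := by
  rw [pairGen_f, conj_spFD hn, LinearMap.sum_apply, ← Finset.sum_add_distrib]
  refine Finset.sum_congr rfl fun s _ => ?_
  rw [spTermFD, LinearMap.add_apply, mon_cket_zero, mon_cket_zero, chi_zero, chi_zero, mul_one,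
    mul_one]

omit [NeZero n] in
theorem chi_colChar_units {r : ℕ} (a b : Fin r) (hab : a ≠ b) (L : List (Fin r × Fin n))
    (h : ∀ z ∈ L, z.1 = b) :
    chi (colChar (fun _ => True) a b (-1)) (units L) = q ^ L.length := by
  have := chi_units (colChar_ne_zero (fun _ : Fin n => True) a b (-1)) L []
  simp only [List.map_nil, List.prod_nil, div_one] at this
  rw [show units L = units L - units [] by simp [units], this,
    List.map_congr_left (g := fun _ => q) fun z hz => ?_, List.map_const', List.prod_replicate]
  simp [colChar, h z hz, hab.symm]

theorem q_sq_ne_one : q ^ 2 ≠ 1 := fun h => q_ne_inv <| by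
  rw [← mul_eq_one_iff_eq_inv₀ q_ne_zero, ← sq, h]

theorem qInt_two_ne_zero : qInt 2 ≠ 0 := by
  rw [qInt_two]
  intro h
  have h1 : qHalf ^ 4 = -1 := by
    calc qHalf ^ 4 = q * (q + q⁻¹ - q⁻¹) := by rw [q]; ring
      _ = -1 := by rw [h, zero_sub, mul_neg, mul_inv_cancel₀ q_ne_zero]
  have h2 : (algebraMap (Polynomial ℂ) (RatFunc ℂ)) (Polynomial.X ^ 4) =
      algebraMap (Polynomial ℂ) (RatFunc ℂ) (-1) := by
    rw [map_pow, map_neg, map_one, RatFunc.algebraMap_X]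
    exact h1
  have h3 := congrArg Polynomial.natDegree (RatFunc.algebraMap_injective ℂ h2)
  simp at h3

/-- An application of `so_parameters` to `T = f_0`: one unit of a doubly occupied row `b` in
`f_0|0⟩` is moved to row `a`, which leads to a configuration that does not occur in `f_0|0⟩`. -/
theorem so_necessity {T : Module.End 𝕂 (ConfSpace (colPar ℓ ε))} {a b : Fin ℓ} (hab : a ≠ b)
    (hn : 1 < n) (h : (X = .D ∧ ε 0 = 1) ∨ (X = .C ∧ ε 0 = 0)) (hT : T = rowGen X ε ℓ (.f 0))
    {x κ : 𝕂}
    (hc : Commute T (x • (colE ε a b * colK ε a b (-1)) + κ • colK ε a b (-1))) :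
    x = 0 ∧ κ = 0 := by
  have h01 := zero_ne_one_of_lt hn
  have hw : ∀ m : ℕ, -(q ^ m) ≠ 0 := fun m => neg_ne_zero.mpr (pow_ne_zero _ q_ne_zero)
  obtain ⟨rfl, hε⟩ | ⟨rfl, hε⟩ := h
  · have hM : IsConf (colPar ℓ ε) (units [(a, 0), (b, 1)]) := isConf_units (by simp [hab])
    have hR : IsConf (colPar ℓ ε) (units [(b, 0), (b, 1)]) := isConf_units (by simp [h01])
    refine so_parameters hab hc (c := 0) hM hR ?_ (fun t ht => ?_) ?_ ?_ ?_ ?_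
    · simp only [units, List.map_cons, List.map_nil, List.sum_cons, List.sum_nil]
      abel
    · simp [units_apply, ht.symm, hab.symm]
    · rw [hε]
      simp [units_apply, h01.symm, dn_one_one]
    · rw [hT, rowGen_FD_vacuum, map_neg, coef_sum_cket hR _ (s₀ := b) rfl]
      · exact hw _
      · intro s hs
        have := mem_of_units_eq hs (z := (s, 0)) (by simp)
        simpa [h01] using this
    · rw [hT, rowGen_FD_vacuum, map_neg, coef_sum_cket_eq_zero hM, neg_zero]
      intro s hs
      have h1 := mem_of_units_eq hs (z := (s, 0)) (by simp)
      have h2 := mem_of_units_eq hs (z := (s, 1)) (by simp)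
      simp [h01, h01.symm] at h1 h2
      exact hab (h1.symm.trans h2)
    · rw [chi_colChar_units a b hab _ (by simp)]
      exact q_sq_ne_one
  · have hM : IsConf (colPar ℓ ε) (units [(a, 0), (b, 0)]) := isConf_units (by simp [hab])
    have hR : IsConf (colPar ℓ ε) (units [(b, 0), (b, 0)]) := fun z => by
      rw [units_apply]
      refine ⟨Nat.cast_nonneg _, fun hz => ?_⟩
      have : (b, 0) ≠ z := by
        rintro rfl
        rw [colPar, hε] at hz
        exact absurd hz (by decide)
      simp [this]
    refine so_parameters hab hc (c := 0) hM hR ?_ (fun t ht => ?_) ?_ ?_ ?_ ?_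
    · simp only [units, List.map_cons, List.map_nil, List.sum_cons, List.sum_nil]
      abel
    · simp [units_apply, ht.symm, hab.symm]
    · rw [hε, dn_zero]
      simpa [units_apply] using qInt_two_ne_zero
    · rw [hT, rowGen_FC_vacuum, map_neg, coef_sum_cket hR _ (s₀ := b) rfl]
      · exact hw _
      · intro s hs
        have := mem_of_units_eq hs (z := (s, 0)) (by simp)
        simpa using this
    · rw [hT, rowGen_FC_vacuum, map_neg, coef_sum_cket_eq_zero hM, neg_zero]
      intro s hs
      have h1 := mem_of_units_eq hs.symm (z := (a, 0)) (by simp)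
      have h2 := mem_of_units_eq hs.symm (z := (b, 0)) (by simp)
      simp at h1 h2
      exact hab (h1.trans h2.symm)
    · rw [chi_colChar_units a b hab _ (by simp)]
      exact q_sq_ne_one

/-- Necessity for `𝐔^ı(𝔰𝔬_ℓ)`: the distinguished element `soB` commutes as well, hence so does the
difference. -/
theorem eq_of_soActionCommutes (hn : 1 < n) (h : (X = .D ∧ ε 0 = 1) ∨ (X = .C ∧ ε 0 = 0))
    {ς κ : Fin (ℓ - 1) → 𝕂} (hς : SoActionCommutes X ε ℓ ς κ) (i : Fin (ℓ - 1)) :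
    ς i = -q⁻¹ ∧ κ i = 0 := by
  have h1 := (soActionCommutes_iff X ε ς κ).1 hς (.f 0) i
  have h2 := commute_rowGen_soB hn h (a := lo i) (b := hi i) rfl (.f 0)
  have h3 := h1.sub_right h2
  rw [soB, show ∀ A B C : Module.End 𝕂 (ConfSpace (colPar ℓ ε)),
    A + ς i • B + C - (A - q⁻¹ • B) = (ς i + q⁻¹) • B + C from fun A B C => by
      rw [add_smul]; abel] at h3
  have := so_necessity (fun h => by simp [lo, hi, Fin.ext_iff] at h) hn h rfl h3
  exact ⟨eq_neg_of_add_eq_zero_left this.1, this.2⟩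

theorem evenRow_ne_oddRow (p p' : Fin ℓ) : evenRow p ≠ oddRow p' := fun h => by
  simp only [evenRow, oddRow, Fin.ext_iff] at h
  omega

theorem evenRow_injective : Function.Injective (evenRow (ℓ := ℓ)) := fun p p' h => by
  simp only [evenRow, Fin.ext_iff] at h ⊢
  omega

theorem oddRow_injective : Function.Injective (oddRow (ℓ := ℓ)) := fun p p' h => by
  simp only [oddRow, Fin.ext_iff] at h ⊢
  omega

/-- The raising operator which moves one unit from the pair of rows `p'` to the previous pair does
not kill `f_0|0⟩`. -/
theorem colE_pairGen_vacuum_ne_zero (hn : 1 < n) (h : (X = .D ∧ ε 0 = 0) ∨ (X = .C ∧ ε 0 = 1))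
    {p p' : Fin ℓ} (hp : p ≠ p') :
    colE ε (oddRow p) (evenRow p')
      (colK ε (oddRow p) (evenRow p') (-1) (pairGen X ε ℓ (.f 0) (cket _ 0))) ≠ 0 := by
  have h01 := zero_ne_one_of_lt hn
  have hw : ∀ m : ℕ, q ^ m ≠ 0 := fun m => pow_ne_zero _ q_ne_zero
  have hab : oddRow p ≠ evenRow p' := (evenRow_ne_oddRow p' p).symm
  have had : oddRow p ≠ oddRow p' := oddRow_injective.ne hp
  have hbd : evenRow p' ≠ oddRow p' := evenRow_ne_oddRow p' p'
  -- The column of the second unit in `f_0|0⟩` depends on the type.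
  suffices key : ∃ c : Fin n, dn (ε 0) (units [(evenRow p', 0), (oddRow p', c)]
      ((evenRow p', 0) : Fin (2 * ℓ) × Fin n)) ≠ 0 ∧
      coef (colPar _ ε) (units [(evenRow p', 0), (oddRow p', c)])
        (pairGen X ε ℓ (.f 0) (cket _ 0)) ≠ 0 by
    obtain ⟨c, hd, hc⟩ := key
    have hM : IsConf (colPar (2 * ℓ) ε) (units [(oddRow p, 0), (oddRow p', c)]) :=
      isConf_units (by simp [had])
    have hR : IsConf (colPar (2 * ℓ) ε) (units [(evenRow p', 0), (oddRow p', c)]) :=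
      isConf_units (by simp [hbd])
    obtain ⟨u, hu, hu'⟩ := coef_colE hab (c := 0) hM
      (R := units [(evenRow p', 0), (oddRow p', c)])
      (by simp only [units, List.map_cons, List.map_nil, List.sum_cons, List.sum_nil]; abel)
      (fun t ht => by simp [units_apply, ht.symm, had.symm]) hd
    intro h0
    have := hu' (colK ε (oddRow p) (evenRow p') (-1) (pairGen X ε ℓ (.f 0) (cket _ 0)))
    rw [h0, map_zero, coef_colK hR] at this
    exact mul_ne_zero hu (mul_ne_zero (chi_colChar_ne_zero _ _ _) hc) this.symm
  obtain ⟨rfl, hε⟩ | ⟨rfl, hε⟩ := h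
  · have hR : IsConf (colPar (2 * ℓ) ε) (units [(evenRow p', 0), (oddRow p', 1)]) :=
      isConf_units (by simp [hbd])
    refine ⟨1, ?_, ?_⟩
    · rw [hε, dn_zero]
      simp [units_apply, hbd.symm, qInt_one]
    · rw [pairGen_FD_vacuum hn, map_add, coef_sum_cket_eq_zero hR, zero_add,
        coef_sum_cket hR _ (s₀ := p') rfl]
      · exact hw _
      · intro s hs
        have := mem_of_units_eq hs (z := (evenRow s, 0)) (by simp)
        simpa [h01, evenRow_injective.eq_iff] using this
      · intro s hs
        have := mem_of_units_eq hs (z := (oddRow s, 0)) (by simp)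
        simp [h01, (evenRow_ne_oddRow _ _).symm] at this
  · have hR : IsConf (colPar (2 * ℓ) ε) (units [(evenRow p', 0), (oddRow p', 0)]) :=
      isConf_units (by simp [hbd])
    refine ⟨0, ?_, ?_⟩
    · rw [hε]
      simp [units_apply, hbd.symm, dn_one_one]
    · rw [pairGen_FC_vacuum, map_neg, coef_sum_cket hR _ (s₀ := p') rfl]
      · exact neg_ne_zero.mpr (hw _)
      · intro s hs
        have := mem_of_units_eq hs (z := (evenRow s, 0)) (by simp)
        simpa [evenRow_ne_oddRow, evenRow_injective.eq_iff] using this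

omit [NeZero n] in
/-- The vacuum is invariant under `𝐔(𝔰𝔩_r)`, hence so is its image under a commuting operator. -/
theorem CommutesCol.invariant {r : ℕ} {a b : Fin r} {T : Module.End 𝕂 (ConfSpace (colPar r ε))}
    (h : CommutesCol ε a b T) : colE ε a b (T (cket _ 0)) = 0 ∧ colF ε a b (T (cket _ 0)) = 0 ∧
      colK ε a b 1 (T (cket _ 0)) = T (cket _ 0) := by
  refine ⟨?_, ?_, ?_⟩
  · rw [← Module.End.mul_apply, ← h.e.eq, Module.End.mul_apply, colE_vacuum, map_zero]
  · rw [← Module.End.mul_apply, ← h.f.eq, Module.End.mul_apply, colF_vacuum, map_zero]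
  · rw [← Module.End.mul_apply, ← (h.k 1).eq, Module.End.mul_apply, colK_vacuum]

/-- Necessity for `𝐔^ı(𝔰𝔭_{2ℓ})`: the distinguished element `spB` commutes as well, hence so does
the difference, a multiple of `T_{w_•}(e_i) k_i⁻¹`. -/
theorem eq_of_spActionCommutes (hn : 1 < n) (h : (X = .D ∧ ε 0 = 0) ∨ (X = .C ∧ ε 0 = 1))
    {ς : Fin (2 * ℓ - 1) → 𝕂} (hς : SpActionCommutes X ε ℓ ς) {i : Fin (2 * ℓ - 1)}
    (hodd : i.val % 2 = 1) : ς i = -q := by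
  have h1 := ((spActionCommutes_iff X ε ς).1 hς (.f 0)).1 i hodd
  have hg := commutesSp_pairGen (ℓ := ℓ) hn h (.f 0)
  obtain ⟨p, p', i₀, i₂, hp, h₀, h₂, e1, e2, e3, e4, e5, e6⟩ := exists_pair_of_odd hodd
  have h2 := hg.spB p p' hp
  have H := col_rels (r := 2 * ℓ) ε
  have inv₀ := (hg.levi p).invariant
  have inv₂ := (hg.levi p').invariant
  have hne := colE_pairGen_vacuum_ne_zero hn h (fun h => by rw [h] at hp; omega : p ≠ p')
  rw [colRep_lusztigTBlack_E h₀ h₂ hodd] at h1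
  simp only [e1, e2, e3, e4, e5, e6] at h1
  have h3 := h1.sub_right h2
  rw [spB, show ∀ A B : Module.End 𝕂 (ConfSpace (colPar (2 * ℓ) ε)),
    A + ς i • B - (A - q • B) = (ς i + q) • B from fun A B => by rw [add_smul]; abel] at h3
  rw [← e1, ← e2] at inv₀
  rw [← e5, ← e6] at inv₂
  -- All raising operators kill the vacuum, so that only the product with `f_0` on the right
  -- remains.
  by_contra hx
  have h4 := LinearMap.congr_fun h3.eq (cket _ 0)
  simp only [Module.End.mul_apply, LinearMap.smul_apply, colK_vacuum, qBracket,
    LinearMap.sub_apply, colE_vacuum, map_zero, smul_zero, sub_zero] at h4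
  have h5 := (smul_eq_zero.mp h4.symm).resolve_left fun h => hx (eq_neg_of_add_eq_zero_left h)
  refine hne ?_
  have := H.apply_eq_zero (i := i₀) (j := i) (l := i₂) h₀ h₂
    (y := colK ε (lo i) (hi i) (-1) (pairGen X ε ℓ (.f 0) (cket _ 0)))
    (H.e_k'_apply inv₀.1) (H.e_k'_apply inv₂.1) (H.f_k'_apply inv₀.2.1) (H.f_k'_apply inv₂.2.1)
    (H.k_k'_apply inv₀.2.2) (H.k_k'_apply inv₂.2.2)
    (by simpa only [e1, e2, e3, e4, e5, e6, qBracket, LinearMap.sub_apply, Module.End.mul_apply,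
      LinearMap.smul_apply] using h5)
  simpa only [e3, e4] using this

end

end FockDuality

end

theorem proposition4p3 {n : ℕ} [NeZero n] (hn : 4 ≤ n) (X : CDType) (ε : Fin n → Fin 2) :
    (((X = .D ∧ ε 0 = 1) ∨ (X = .C ∧ ε 0 = 0)) →
      ∀ (ℓ : ℕ), 2 ≤ ℓ → ∀ ς κ : Fin (ℓ - 1) → 𝕂,
        (SoActionCommutes X ε ℓ ς κ ↔ ∀ i, ς i = -q⁻¹ ∧ κ i = 0)) ∧
    (((X = .D ∧ ε 0 = 0) ∨ (X = .C ∧ ε 0 = 1)) →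
      ∀ (ℓ : ℕ), 1 ≤ ℓ → ∀ ς : Fin (2 * ℓ - 1) → 𝕂,
        (SpActionCommutes X ε ℓ ς ↔ ∀ i, i.val % 2 = 1 → ς i = -q)) := by
  have hn' : 1 < n := by omega
  exact ⟨fun h _ _ _ _ => ⟨eq_of_soActionCommutes hn' h, soActionCommutes_of_eq hn' h⟩,
    fun h _ _ _ => ⟨fun hς _ => eq_of_spActionCommutes hn' h hς, spActionCommutes_of_eq hn' h⟩⟩
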